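/- Let $(M,g)$ be a smooth time-oriented $4$-dimensional Lorentzian manifold of signature $(-,+,+,+)$. A *future horizon* is a closed achronal topological hypersurface $\mathcal H\subset M$ such that through every point of $\mathcal H$ there is a future-directed, future-inextendible null geodesic whose part to the future of that point lies in $\mathcal H$; these are the generators. Let $N(x)$ be the number of generators through $x$ (the number of their directions at $x$), $\mathcal H_{\rm end}$ the set of past endpoints of generators, the *crease set* the set of $x\in\mathcal H_{\rm end}$ with $N(x)>1$, and the *big wavefront* $\mathcal W\supseteq\mathcal H$ the union of the generators, extended as null geodesics as far as possible to the past. A point $p\in\mathcal H$ is an *$A_3$ point* if there is a *canonical chart* at $p$: smooth coordinates $(w,x,y,z)$ on a neighbourhood of $p$, vanishing at $p$, in which $\mathcal W$ is the set of the points $(w,\,4a^3-2qa,\,q,\,3a^4-qa^2)$ with $w,a,q\in\mathbb R$. Let $p$ be an $A_3$ point of $\mathcal H$ with canonical coordinates $(w,x,y,z)$. **(I)** In a neighbourhood of $p$ the following hold. 1. $\mathcal H$ is the part $q\le 2a^2$ of $\mathcal W$. It is a graph $z=Z(x,y)$, where $Z$ is continuous, smooth except at $x=0$, $y\ge 0$,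 not differentiable at $x=0$, $y>0$, and $C^1$ on the complement of $\{x=0,y>0\}$, with $dZ=a\,dx+a^2\,dy$; $dZ$ (on that complement) is not differentiable at $(0,0)$. So $\mathcal H$ is $C^1$ but not twice differentiable at the points $x=y=z=0$. 2. The $A_3$ points are exactly the points $(w,0,0,0)$ (the *$A_3$ line*). The crease set is the surface $\{(w,0,y,y^2/4):y>0\}$, on which $N=2$; with the $A_3$ line as boundary it is a smoothly immersed surface with parameters $(w,y)$, $y\ge0$. 3. At every point of the $A_3$ line: exactly one generator enters $\mathcal H$, i.e. the point lies in $\mathcal H_{\rm end}$ and $N=1$; the inverse metric satisfies $g^{zz}=g^{xz}=0$ and $g^{yz}=\tfrac12 g^{xx}>0$; $-(dz)^a$ is null and future-directed and the tangent vectors of generators are its positive multiples; $\partial/\partial w$ (the tangent of the line) and $\partial/\partial x$ are spacelike. The tangent planes of the crease converge, as the point is approached, to the plane spanned by $\partial/\partial w$ and $\partial/\partial y$, equivalently by $\partial/\partial w$ and $(dz)^a$; this plane is null and tangent to $\mathcal H$, i.e. contained in the kernel of $dz$. **(II)** Let $\tau$ be a smooth time function ($-(d\tau)^a$ is timelike and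 future-directed) with $\tau(p)=0$. 1. If $\partial_w\tau(p)\neq0$, there is a canonical chart at $p$ in which $\tau=w$. 2. Suppose $\partial_w\tau(p)=0$ (an *$A_3$ perestroika*: the surface $\tau=0$ is tangent to the $A_3$ line at $p$). Then $\partial_y\tau(p)<0$, and for every $K>0$ all crease points sufficiently close to $p$ with $|w|\le Ky$ have $\tau<0$. 3. Suppose moreover that $b=\tfrac12\partial_w^2\tau(p)\ne0$. Then in arbitrarily small neighbourhoods $U$ of $p$, and for $|t|<\delta$ with some $\delta=\delta(U)>0$, the cross-sections $\{\tau=t\}\cap\mathcal H\cap U$ have one of the following forms, where curves of crease are graphs $y=Y(t,w)$, $x=0$, $z=y^2/4$, with a smooth function $Y$ defined for $|t|<\delta$ and $w$ in an interval $(-\varepsilon,\varepsilon)$. * ($b<0$: a finite crease shrinks.) For $t<0$ there are exactly two $A_3$ points, at $w=w_\pm(t)$ with $w_-(t)<0<w_+(t)$, and the crease is a single curve over $w_-(t)<w<w_+(t)$ with these two points as endpoints. As $t\to0^-$, $w_+$ decreases and $w_-$ increases strictly, $w_\pm(t)\sim\pm\sqrt{t/b}$, and the crease shrinks to $p$. At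 $t=0$ the only $A_3$ point is $p$ and there is no crease; for $t>0$ there are neither $A_3$ points nor creases. Thus creases are absent for $t\ge0$. * ($b>0$: an $A_3$ pair nucleates and eats up a crease.) For $t<0$ there is no $A_3$ point and the crease is a single curve over $(-\varepsilon,\varepsilon)$. At $t=0$ the only $A_3$ point is $p$, and the crease is the rest of such a curve, over $(-\varepsilon,0)\cup(0,\varepsilon)$. For $t>0$ there are exactly two $A_3$ points, at $w=w_-(t)<0<w_+(t)$, which move apart strictly monotonically with $w_\pm(t)\sim\pm\sqrt{t/b}$ as $t\to0^+$; the crease consists of two curves, over $(-\varepsilon,w_-(t))$ and $(w_+(t),\varepsilon)$, each ending at one of the $A_3$ points. Thus for $t\ge0$ creases are absent between the $A_3$ points. -/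

import Mathlib

open Set Filter Topology
open scoped Manifold ContDiff

noncomputable section

namespace Caustic

/-- The model space `ℝ⁴`; the coordinates `0, 1, 2, 3` of a canonical chart are called `w, x, y, z`. -/
abbrev R4 : Type := EuclideanSpace ℝ (Fin 4)

/-- The `i`-th coordinate vector of `ℝ⁴`. -/
def stdVec (i : Fin 4) : R4 := EuclideanSpace.single i (1 : ℝ)

section Geometry

variable {M : Type*} [TopologicalSpace M] [ChartedSpace R4 M]

/-- The tangent vector at `e⁻¹(u)` with components `c` in the chart `e`. -/
def coordTangent (e : OpenPartialHomeomorph M R4) (u c : R4) : TangentSpace (𝓡 4) (e.symm u) :=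
  mfderiv (𝓡 4) (𝓡 4) e.symm u c

/-- The components `g_{ij}` of a field of bilinear forms in the chart `e`, as functions of the
coordinates. -/
def coordMatrix (g : ∀ x : M, LinearMap.BilinForm ℝ (TangentSpace (𝓡 4) x))
    (e : OpenPartialHomeomorph M R4) (u : R4) : Matrix (Fin 4) (Fin 4) ℝ :=
  Matrix.of fun i j => g (e.symm u) (coordTangent e u (stdVec i)) (coordTangent e u (stdVec j))

/-- The velocity vector of a curve. -/
def velocity (γ : ℝ → M) (t : ℝ) : TangentSpace (𝓡 4) (γ t) :=
  mfderiv 𝓘(ℝ, ℝ) (𝓡 4) γ t (1 : ℝ)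

variable (M) in
/-- A smooth Lorentzian metric of signature `(-,+,+,+)` on the 4-manifold `M`, together with
a time orientation, given by a smooth timelike vector field (declared to be future-directed).
Smoothness is smoothness of the components in all charts of the maximal smooth atlas. -/
structure Spacetime [IsManifold (𝓡 4) ∞ M] where
  metric : ∀ x : M, LinearMap.BilinForm ℝ (TangentSpace (𝓡 4) x)
  symm : ∀ x v u, metric x v u = metric x u v
  lorentzian : ∀ x, ∃ b : Module.Basis (Fin 4) ℝ (TangentSpace (𝓡 4) x),
    ∀ i j, metric x (b i) (b j) = if i = j then (if i = 0 then -1 else 1) else 0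
  smooth_metric : ∀ e ∈ IsManifold.maximalAtlas (𝓡 4) ∞ M, ∀ i j,
    ContDiffOn ℝ ∞ (fun u => coordMatrix metric e u i j) e.target
  future : ∀ x : M, TangentSpace (𝓡 4) x
  future_timelike : ∀ x, metric x (future x) (future x) < 0
  smooth_future : ∀ e ∈ IsManifold.maximalAtlas (𝓡 4) ∞ M,
    ContDiffOn ℝ ∞
      (fun u => (mfderiv (𝓡 4) (𝓡 4) e (e.symm u) (future (e.symm u)) : R4)) e.target

namespace Spacetime

variable [IsManifold (𝓡 4) ∞ M] (S : Spacetime M)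

/-- `v` is a future-directed timelike vector. -/
def IsFutureTimelike {x : M} (v : TangentSpace (𝓡 4) x) : Prop :=
  S.metric x v v < 0 ∧ S.metric x (S.future x) v < 0

/-- `v` is a future-directed (in particular nonzero) null vector. -/
def IsFutureNull {x : M} (v : TangentSpace (𝓡 4) x) : Prop :=
  S.metric x v v = 0 ∧ S.metric x (S.future x) v < 0

/-- The components `g_{ij}` of the metric in the chart `e`. -/
def gDown (e : OpenPartialHomeomorph M R4) (u : R4) : Matrix (Fin 4) (Fin 4) ℝ :=
  coordMatrix S.metric e u

/-- The components `g^{ij}` of the inverse metric in the chart `e`. -/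
def gUp (e : OpenPartialHomeomorph M R4) (u : R4) : Matrix (Fin 4) (Fin 4) ℝ :=
  (S.gDown e u)⁻¹

/-- The Christoffel symbols `Γ^k_{ij}` of the Levi-Civita connection in the chart `e`. -/
def christoffel (e : OpenPartialHomeomorph M R4) (u : R4) (k i j : Fin 4) : ℝ :=
  (1 / 2) * ∑ l, S.gUp e u k l *
    (fderiv ℝ (fun v => S.gDown e v j l) u (stdVec i)
      + fderiv ℝ (fun v => S.gDown e v i l) u (stdVec j)
      - fderiv ℝ (fun v => S.gDown e v i j) u (stdVec l))

/-- `γ` is an affinely parametrized geodesic on the open set `J` of parameters: it satisfies the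
geodesic equation in every chart. -/
def IsGeodesicOn (γ : ℝ → M) (J : Set ℝ) : Prop :=
  ContMDiffOn 𝓘(ℝ, ℝ) (𝓡 4) 2 γ J ∧
  ∀ e ∈ IsManifold.maximalAtlas (𝓡 4) ∞ M, ∀ t ∈ J, γ t ∈ e.source → ∀ k : Fin 4,
    deriv (deriv fun s => e (γ s) k) t
      + ∑ i, ∑ j, S.christoffel e (e (γ t)) k i j
          * deriv (fun s => e (γ s) i) t * deriv (fun s => e (γ s) j) t = 0

/-- The curve `γ`, defined on the parameters `J`, has no future endpoint in `M`. -/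
def IsFutureInextendible (γ : ℝ → M) (J : Set ℝ) : Prop :=
  ¬ ∃ q : M, ∀ V ∈ 𝓝 q, ∃ t₀ ∈ J, ∀ t ∈ J, t₀ ≤ t → γ t ∈ V

/-- `γ`, defined on an open interval `J ∋ t₀`, is a future-directed, future-inextendible null
geodesic whose part from the parameter value `t₀` on lies in `H`. Thus `γ` restricted to
`J ∩ [t₀, ∞)` is (a final part of) a generator of `H`, and `γ` is an extension of it to the past
as a null geodesic. -/
structure IsGenerator (H : Set M) (γ : ℝ → M) (J : Set ℝ) (t₀ : ℝ) : Prop where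
  isOpen : IsOpen J
  ordConnected : J.OrdConnected
  mem : t₀ ∈ J
  geodesic : S.IsGeodesicOn γ J
  null : ∀ t ∈ J, S.IsFutureNull (velocity γ t)
  inextendible : IsFutureInextendible γ J
  subset : ∀ t ∈ J, t₀ ≤ t → γ t ∈ H

/-- `x ≪ y`: there is a future-directed timelike curve from `x` to `y`. -/
def Chronological (x y : M) : Prop :=
  ∃ γ : ℝ → M, γ 0 = x ∧ γ 1 = y ∧ ∀ t ∈ Icc (0 : ℝ) 1,
    ContMDiffAt 𝓘(ℝ, ℝ) (𝓡 4) 1 γ t ∧ S.IsFutureTimelike (velocity γ t)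

/-- No two points of `H` are joined by a timelike curve. -/
def IsAchronal (H : Set M) : Prop :=
  ∀ x ∈ H, ∀ y ∈ H, ¬ S.Chronological x y

/-- `H` is an embedded topological hypersurface: near each of its points there is a homeomorphism
of an open set of `M` onto an open set of `ℝ⁴` that takes `H` to a hyperplane. -/
def IsTopologicalHypersurface (H : Set M) : Prop :=
  ∀ x ∈ H, ∃ φ : OpenPartialHomeomorph M R4, x ∈ φ.source ∧
    ∀ y ∈ φ.source, (y ∈ H ↔ φ y 0 = 0)

/-- A future horizon: an achronal, closed, future null geodesically ruled topological
hypersurface. -/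
structure IsFutureHorizon (H : Set M) : Prop where
  achronal : S.IsAchronal H
  isClosed : IsClosed H
  hypersurface : IsTopologicalHypersurface H
  ruled : ∀ x ∈ H, ∃ γ J t₀, S.IsGenerator H γ J t₀ ∧ γ t₀ = x

/-- The future-directed vectors at `x` that are tangent to a generator of `H` through `x`. -/
def generatorVectors (H : Set M) (x : M) : Set (TangentSpace (𝓡 4) x) :=
  {v | ∃ γ J t₀, S.IsGenerator H γ J t₀ ∧
    (⟨γ t₀, velocity γ t₀⟩ : TangentBundle (𝓡 4) M) = ⟨x, v⟩}

/-- `N(x)`, the number of generators of `H` through `x`, i.e. the number of different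
future directions of generators at `x`. -/
def numGenerators (H : Set M) (x : M) : ℕ∞ :=
  Set.encard {r : Module.Ray ℝ (TangentSpace (𝓡 4) x) |
    ∃ (v : TangentSpace (𝓡 4) x) (hv : v ≠ 0),
      v ∈ S.generatorVectors H x ∧ r = rayOfNeZero ℝ v hv}

/-- The set of past endpoints of generators of `H`. -/
def endpoints (H : Set M) : Set M :=
  {x | ∃ γ J t₀, S.IsGenerator H γ J t₀ ∧ γ t₀ = x ∧
    ¬ ∃ t ∈ J, t < t₀ ∧ ∀ s ∈ Icc t t₀, γ s ∈ H}

/-- The crease set: the endpoints through which there is more than one generator. -/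
def creaseSet (H : Set M) : Set M :=
  {x | x ∈ S.endpoints H ∧ 1 < S.numGenerators H x}

/-- The big wavefront: the union of the generators of `H`, extended (as null geodesics) as far as
possible to the past. -/
def bigWavefront (H : Set M) : Set M :=
  {x | ∃ γ J t₀, S.IsGenerator H γ J t₀ ∧ ∃ t ∈ J, γ t = x}

/-- `e` is a canonical chart at the `A₃` point `p` of `H`: it is a smooth chart, centred at `p`, in
which the big wavefront is the product of a line with the swallowtail
`(a, q) ↦ (4a³ - 2qa, q, 3a⁴ - qa²)`. -/
structure IsA3Chart (H : Set M) (p : M) (e : OpenPartialHomeomorph M R4) : Prop where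
  mem_atlas : e ∈ IsManifold.maximalAtlas (𝓡 4) ∞ M
  mem_horizon : p ∈ H
  mem_source : p ∈ e.source
  map_zero : e p = 0
  wavefront : ∀ v ∈ e.target, e.symm v ∈ S.bigWavefront H ↔
    ∃ a q : ℝ, v 1 = 4 * a ^ 3 - 2 * q * a ∧ v 2 = q ∧ v 3 = 3 * a ^ 4 - q * a ^ 2

/-- The set of `A₃` points of `H`. -/
def a3Set (H : Set M) : Set M :=
  {p | ∃ e, S.IsA3Chart H p e}

/-- `τ` is a smooth time function: minus its gradient is timelike and future-directed. -/
def IsTimeFunction (τ : M → ℝ) : Prop :=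
  ContMDiff (𝓡 4) 𝓘(ℝ, ℝ) ∞ τ ∧
  ∀ x, ∃ n : TangentSpace (𝓡 4) x,
    (∀ v, S.metric x n v = mfderiv (𝓡 4) 𝓘(ℝ, ℝ) τ x v) ∧ S.IsFutureTimelike (-n)

/-- The components, in the chart `e`, of the vector `(dz)^a`. -/
def dzUp (e : OpenPartialHomeomorph M R4) (u : R4) : R4 :=
  WithLp.toLp 2 fun i => S.gUp e u i 3

/-- A linear subspace of the tangent space (given by its components) is null: the metric
is degenerate on it. -/
def IsNullSubspace (e : OpenPartialHomeomorph M R4) (u : R4) (P : Submodule ℝ R4) : Prop :=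
  ∃ c ∈ P, c ≠ 0 ∧
    ∀ d ∈ P, S.metric (e.symm u) (coordTangent e u c) (coordTangent e u d) = 0

end Spacetime

end Geometry

/-- The points of the crease (`y > 0`) and of the `A₃` line (`y = 0`) in canonical coordinates,
parametrized by `(w, y)`. -/
def creaseParam (s : ℝ × ℝ) : R4 := !₂[s.1, 0, s.2, s.2 ^ 2 / 4]

/-- The point `(w, 0, 0, 0)`. -/
def linePoint (w : ℝ) : R4 := !₂[w, 0, 0, 0]

/-- The tangent plane of the surface parametrized by `creaseParam`. -/
def creasePlane (s : ℝ × ℝ) : Submodule ℝ R4 :=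
  LinearMap.range (fderiv ℝ creaseParam s : ℝ × ℝ →ₗ[ℝ] R4)

/-- The domain of the `(x, y)` plane that is left when the crease is removed. -/
def offCrease : Set (ℝ × ℝ) := {s | ¬ (s.1 = 0 ∧ 0 < s.2)}

/-- `Z` is the function whose graph is the part `q ≤ 2a²` of the swallowtail; it is smooth
except at `x = 0, y ≥ 0`, with `dZ = a dx + a² dy`; it is `C¹` off the crease `x = 0, y > 0`, in
particular at the origin, where it is not twice differentiable; and it is continuous but not
differentiable at the crease. -/
structure IsSwallowtailGraph (Z : ℝ × ℝ → ℝ) : Prop where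
  graph : ∀ x y z : ℝ, z = Z (x, y) ↔
    ∃ a : ℝ, y ≤ 2 * a ^ 2 ∧ x = 4 * a ^ 3 - 2 * y * a ∧ z = 3 * a ^ 4 - y * a ^ 2
  continuous : Continuous Z
  smooth : ContDiffOn ℝ ∞ Z {s | ¬ (s.1 = 0 ∧ 0 ≤ s.2)}
  hasFDerivAt : ∀ a y : ℝ, (y < 2 * a ^ 2 ∨ a = 0 ∧ y = 0) →
    HasFDerivAt Z (a • ContinuousLinearMap.fst ℝ ℝ ℝ + a ^ 2 • ContinuousLinearMap.snd ℝ ℝ ℝ)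
      (4 * a ^ 3 - 2 * y * a, y)
  continuousOn_fderiv : (∀ s ∈ offCrease, DifferentiableAt ℝ Z s) ∧
    ContinuousOn (fderiv ℝ Z) offCrease
  not_twice_differentiable : ¬ DifferentiableWithinAt ℝ (fderiv ℝ Z) offCrease (0, 0)
  not_differentiable_crease : ∀ y : ℝ, 0 < y → ¬ DifferentiableAt ℝ Z (0, y)

section Conclusions

variable {M : Type*} [TopologicalSpace M] [ChartedSpace R4 M] [IsManifold (𝓡 4) ∞ M]

/-- The geometry at the point `u = (w, 0, 0, 0)` of the `A₃` line. -/
structure A3LineGeometry (S : Spacetime M) (H : Set M) (e : OpenPartialHomeomorph M R4)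
    (u : R4) : Prop where
  -- exactly one generator enters the horizon here, with tangent `-(dz)^a`
  endpoint : e.symm u ∈ S.endpoints H
  one_generator : S.numGenerators H (e.symm u) = 1
  generator_vectors : S.generatorVectors H (e.symm u) =
    {v | ∃ c : ℝ, 0 < c ∧ v = coordTangent e u (-(c • S.dzUp e u))}
  future_null : S.IsFutureNull (coordTangent e u (-S.dzUp e u))
  -- the inverse metric
  gzz : S.gUp e u 3 3 = 0
  gxz : S.gUp e u 1 3 = 0
  gyz : S.gUp e u 2 3 = (1 / 2) * S.gUp e u 1 1
  gyz_pos : 0 < S.gUp e u 2 3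
  -- the tangent `∂/∂w` of the line, and `∂/∂x`, are spacelike
  line_spacelike : 0 < S.gDown e u 0 0
  x_spacelike : 0 < S.gDown e u 1 1
  -- the limit of the tangent planes of the crease, as the point is approached, is the plane
  -- spanned by `∂/∂w` and `∂/∂y`, or by `∂/∂w` and `(dz)^a`; it is null and tangent to the horizon
  plane_tendsto :
    Tendsto (fun s => (creasePlane s).starProjection) (𝓝[{s | 0 < s.2}] (u 0, 0))
      (𝓝 (creasePlane (u 0, 0)).starProjection)
  plane_eq : creasePlane (u 0, 0) = Submodule.span ℝ {stdVec 0, stdVec 2}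
  plane_eq' : creasePlane (u 0, 0) = Submodule.span ℝ {stdVec 0, S.dzUp e u}
  plane_null : S.IsNullSubspace e u (creasePlane (u 0, 0))
  plane_tangent : ∀ c ∈ creasePlane (u 0, 0), c 3 = 0

/-- The structure of the horizon in a neighbourhood (a ball of radius `r` in the canonical
coordinates) of an `A₃` point. -/
structure A3LocalStructure (S : Spacetime M) (H : Set M) (e : OpenPartialHomeomorph M R4)
    (r : ℝ) : Prop where
  ball_subset : Metric.ball 0 r ⊆ e.target
  -- the horizon is the part `q ≤ 2a²` of the big wavefront
  horizon : ∀ v ∈ Metric.ball (0 : R4) r, e.symm v ∈ H ↔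
    ∃ a q : ℝ, q ≤ 2 * a ^ 2 ∧
      v 1 = 4 * a ^ 3 - 2 * q * a ∧ v 2 = q ∧ v 3 = 3 * a ^ 4 - q * a ^ 2
  -- it is a graph, `C¹` but not `C²` at the `A₃` line
  graph : ∃ Z : ℝ × ℝ → ℝ, IsSwallowtailGraph Z ∧
    ∀ v ∈ Metric.ball (0 : R4) r, e.symm v ∈ H ↔ v 3 = Z (v 1, v 2)
  -- the `A₃` points form the line `x = y = z = 0`
  a3 : ∀ v ∈ Metric.ball (0 : R4) r, e.symm v ∈ S.a3Set H ↔ ∃ w, v = linePoint w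
  -- the crease is a surface ending at this line, with exactly two generators at each point
  crease : ∀ v ∈ Metric.ball (0 : R4) r, e.symm v ∈ S.creaseSet H ↔
    ∃ w y : ℝ, 0 < y ∧ v = creaseParam (w, y)
  two_generators : ∀ v ∈ Metric.ball (0 : R4) r, e.symm v ∈ S.creaseSet H →
    S.numGenerators H (e.symm v) = 2
  crease_immersed : ContDiff ℝ ∞ creaseParam ∧ ∀ s, Module.finrank ℝ (creasePlane s) = 2
  line : ∀ w : ℝ, linePoint w ∈ Metric.ball (0 : R4) r → A3LineGeometry S H e (linePoint w)

/-- In the part `U` of the chart `e`, the `A₃` points of the surface `τ = t` are those with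
`w ∈ A`, and the crease of the horizon cross-section at `τ = t` is
the graph `y = Y t w`, `w ∈ C`. -/
def SliceIs (S : Spacetime M) (H : Set M) (e : OpenPartialHomeomorph M R4) (τ : M → ℝ)
    (U : Set R4) (Y : ℝ → ℝ → ℝ) (t : ℝ) (A C : Set ℝ) : Prop :=
  {v ∈ U | e.symm v ∈ S.a3Set H ∧ τ (e.symm v) = t} = linePoint '' A ∧
  {v ∈ U | e.symm v ∈ S.creaseSet H ∧ τ (e.symm v) = t} = (fun w => creaseParam (w, Y t w)) '' C

/-- The first type of perestroika, in the part `U` of the chart `e`: for `t < 0` the cross-section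
`τ = t` has one section of crease, a curve joining its two endpoints, which are the only
two `A₃` points, at `w = wm t` and `w = wp t`; as `t → 0` it shrinks to the point
`p`, its extent being proportional to `√(-t)`; for `t > 0` there are no creases and `A₃` points. -/
structure CreaseShrinks (S : Spacetime M) (H : Set M) (e : OpenPartialHomeomorph M R4)
    (τ : M → ℝ) (b : ℝ) (U : Set R4) (ε δ : ℝ) (Y : ℝ → ℝ → ℝ) (wm wp : ℝ → ℝ) : Prop where
  before : ∀ t ∈ Ioo (-δ) 0, wm t ∈ Ioo (-ε) 0 ∧ wp t ∈ Ioo 0 ε ∧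
    (∀ w ∈ Ioo (wm t) (wp t), 0 < Y t w) ∧ Y t (wm t) = 0 ∧ Y t (wp t) = 0 ∧
    SliceIs S H e τ U Y t {wm t, wp t} (Ioo (wm t) (wp t))
  instant : SliceIs S H e τ U Y 0 {0} ∅
  after : ∀ t ∈ Ioo 0 δ, SliceIs S H e τ U Y t ∅ ∅
  shrinking : StrictMonoOn wm (Ioo (-δ) 0) ∧ StrictAntiOn wp (Ioo (-δ) 0)
  to_point : ∀ V ∈ 𝓝 (0 : R4), ∀ᶠ t in 𝓝[<] (0 : ℝ),
    {v ∈ U | e.symm v ∈ S.creaseSet H ∧ τ (e.symm v) = t} ⊆ V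
  rate_left : Tendsto (fun t => wm t / √(-t)) (𝓝[<] 0) (𝓝 (-(1 / √(-b))))
  rate_right : Tendsto (fun t => wp t / √(-t)) (𝓝[<] 0) (𝓝 (1 / √(-b)))

/-- The second type of perestroika, in the part `U` of the chart `e`: for `t < 0` the cross-section
`τ = t` has one section of crease, which crosses `U`, and no `A₃` point; at
`t = 0` an `A₃` point appears on it; for `t > 0` there are exactly two `A₃` points, at `w = wm t` and
`w = wp t`, which move apart with separation proportional to `√t`; the crease consists of two curves,
each ending at one of the `A₃` points, and there is no crease between these points. -/
structure A3Nucleation (S : Spacetime M) (H : Set M) (e : OpenPartialHomeomorph M R4)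
    (τ : M → ℝ) (b : ℝ) (U : Set R4) (ε δ : ℝ) (Y : ℝ → ℝ → ℝ) (wm wp : ℝ → ℝ) : Prop where
  before : ∀ t ∈ Ioo (-δ) 0, (∀ w ∈ Ioo (-ε) ε, 0 < Y t w) ∧
    SliceIs S H e τ U Y t ∅ (Ioo (-ε) ε)
  instant : (∀ w ∈ Ioo (-ε) ε, w ≠ 0 → 0 < Y 0 w) ∧ Y 0 0 = 0 ∧
    SliceIs S H e τ U Y 0 {0} (Ioo (-ε) 0 ∪ Ioo 0 ε)
  after : ∀ t ∈ Ioo 0 δ, wm t ∈ Ioo (-ε) 0 ∧ wp t ∈ Ioo 0 ε ∧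
    (∀ w ∈ Ioo (-ε) (wm t) ∪ Ioo (wp t) ε, 0 < Y t w) ∧ Y t (wm t) = 0 ∧ Y t (wp t) = 0 ∧
    SliceIs S H e τ U Y t {wm t, wp t} (Ioo (-ε) (wm t) ∪ Ioo (wp t) ε)
  separating : StrictAntiOn wm (Ioo 0 δ) ∧ StrictMonoOn wp (Ioo 0 δ)
  rate_left : Tendsto (fun t => wm t / √t) (𝓝[>] 0) (𝓝 (-(1 / √b)))
  rate_right : Tendsto (fun t => wp t / √t) (𝓝[>] 0) (𝓝 (1 / √b))

/-- The possible behaviours at an `A₃` perestroika at the centre of the canonical chart `e`,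
for the time function `τ` with `τ = b w² + O(w³)` on the `A₃` line, `b ≠ 0`: in arbitrarily small
neighbourhoods `U` of the `A₃` point the crease shrinks (if `b < 0`) or is eaten up by a nucleated
pair of `A₃` points (if `b > 0`). -/
def PerestroikaDichotomy (S : Spacetime M) (H : Set M) (e : OpenPartialHomeomorph M R4)
    (τ : M → ℝ) (b : ℝ) : Prop :=
  ∀ ρ > 0, ∃ U : Set R4, IsOpen U ∧ (0 : R4) ∈ U ∧ U ⊆ e.target ∩ Metric.ball 0 ρ ∧
    ∃ (ε δ : ℝ) (Y : ℝ → ℝ → ℝ) (wm wp : ℝ → ℝ), 0 < ε ∧ 0 < δ ∧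
      ContDiffOn ℝ ∞ (fun s : ℝ × ℝ => Y s.1 s.2) (Ioo (-δ) δ ×ˢ Ioo (-ε) ε) ∧
      ((b < 0 ∧ CreaseShrinks S H e τ b U ε δ Y wm wp) ∨
        (0 < b ∧ A3Nucleation S H e τ b U ε δ Y wm wp))

end Conclusions

end Caustic

end

open Caustic

noncomputable section
namespace Caustic

/-! ### The generating function of the swallowtail -/

/-! Everything rests on the quartics `x a + y a² - a⁴` in the variable `a`. Their critical values
form the swallowtail, and the critical points with `y ≤ 2 a²` are exactly the global maxima. So the
upper sheet is the graph of `maxGen`, a supremum of functions affine in `(x, y)`. It is therefore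
convex, and the envelope argument gives `dZ = a dx + a² dy` wherever the maximizer is unique.
Uniqueness fails only over `x = 0, y > 0`, where the two maximizers `±a` produce a kink.

The horizon is this upper sheet (`exists_horizon_graph`). Near `p` it is the zero set of a
continuous function taking both signs, and achronality forces opposite signs at the two ends of a
short timelike segment through `p`. The horizon is contained in the wavefront, so if a generic point
of the upper sheet were missing from it, one could pass from above to below without meeting the
horizon. Closedness supplies the remaining points of the sheet. Nothing else can belong to the
horizon, because a timelike line through any of its points near `p` crosses the sheet.

The velocity of a generator is null and tangent to the sheet, and tangent hyperplanes of an achronal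
set contain no timelike vectors. Hence the velocity is a multiple of the raised conormal `dz - a dx
- a² dy`, and these conormals are null. Expanding this null condition along `a ↦ (w, 4a³, 0, 3a⁴)`,
whose points are only `O(a³)` away from the `A₃` line, gives the relations for the inverse metric on
the line (`HorizonGraph.gUp_line`).

At a crease point the two raised conormals have negative product. If the future were below the
sheet, generators would leave the sheet at once, so it is above (`HorizonGraph.futureCoord_pos`);
the same inequality prevents continuation of a generator to the past through the crease. On the `A₃`
line, continuation to the past by a parameter `s` would make `y` of order `s`, while `a = O(s)` and
`y ≤ 2 a²` (`OrientedGraph.not_extendible_line`). Both crease directions do occur: they are limits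
of generators from the regular points of either side, and the limit geodesic, glued to a generator
at a later regular point, is again a generator. So `N = 2` on the crease and `N = 1` on the rest of
the sheet. The number of generators distinguishes `A₃` points from the crease. They are
distinguished from smooth points because a smooth function vanishing on the sheet has zero
derivative at an `A₃` point.

For a time function stationary along the line, the future null vector `-(dz)^a` has only `w` and `y`
components there, so `∂τ/∂y < 0`. The implicit function theorem solves `τ = t` on the crease
surface, extended to negative `y`, as `y = Y(t, w)`, with `Y > 0` exactly where `τ > t` on the line.
The perestroikas thus reduce to the sublevel and superlevel sets of a function of the single
variable `w` with a nondegenerate critical point. -/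

/-- The family of quartics whose critical values form the swallowtail. -/
def genFun (s : ℝ × ℝ) (a : ℝ) : ℝ := s.1 * a + s.2 * a ^ 2 - a ^ 4

lemma exists_genFun_max (s : ℝ × ℝ) : ∃ a, ∀ b, genFun s b ≤ genFun s a := by
  have hc : Continuous (genFun s) := by unfold genFun; fun_prop
  -- For `|b| > R` the term `b⁴` outweighs the other two, so the value there is at most `0`, the
  -- value at `b = 0`. A maximum over `[-R, R]` is therefore global.
  set R : ℝ := |s.1| + |s.2| + 1 with hR
  have hR1 : 1 ≤ R := by have := abs_nonneg s.1; have := abs_nonneg s.2; linarith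
  obtain ⟨a, -, ha⟩ := (isCompact_Icc : IsCompact (Icc (-R) R)).exists_isMaxOn
    ⟨0, by constructor <;> linarith⟩ hc.continuousOn
  refine ⟨a, fun b => ?_⟩
  by_cases hb : b ∈ Icc (-R) R
  · exact ha hb
  · have h0 : genFun s 0 ≤ genFun s a := ha (show (0 : ℝ) ∈ Icc (-R) R by constructor <;> linarith)
    have hbR : R < |b| := by
      by_contra h
      exact hb (abs_le.mp (not_lt.mp h))
    have h1 : genFun s 0 = 0 := by simp [genFun]
    have hb2 : b ^ 2 = |b| ^ 2 := (sq_abs b).symm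
    have hb4 : b ^ 4 = |b| ^ 4 := by rw [show (4 : ℕ) = 2 * 2 from rfl, pow_mul, pow_mul, hb2]
    have h2 : s.1 * b ≤ |s.1| * |b| := by rw [← abs_mul]; exact le_abs_self _
    have h3 : s.2 * b ^ 2 ≤ |s.2| * |b| ^ 2 := by
      rw [hb2]; exact mul_le_mul_of_nonneg_right (le_abs_self _) (by positivity)
    have hb1 : 1 ≤ |b| := by linarith
    have h5 : |b| ≤ |b| ^ 3 := by nlinarith [sq_nonneg (|b| - 1), mul_self_nonneg |b|]
    have h6 : |b| ^ 2 ≤ |b| ^ 3 := by nlinarith [sq_nonneg |b|]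
    have h7 : |s.1| * |b| ≤ |s.1| * |b| ^ 3 := mul_le_mul_of_nonneg_left h5 (abs_nonneg _)
    have h8 : |s.2| * |b| ^ 2 ≤ |s.2| * |b| ^ 3 := mul_le_mul_of_nonneg_left h6 (abs_nonneg _)
    have h9 : (|s.1| + |s.2|) * |b| ^ 3 ≤ |b| * |b| ^ 3 :=
      mul_le_mul_of_nonneg_right (by linarith) (by positivity)
    have : genFun s b ≤ 0 := by
      unfold genFun; rw [hb4]; nlinarith
    linarith

/-- A maximizer of the generating function. -/
def argmaxGen (s : ℝ × ℝ) : ℝ := (exists_genFun_max s).choose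

/-- The maximum of the generating function. -/
def maxGen (s : ℝ × ℝ) : ℝ := genFun s (argmaxGen s)

lemma genFun_le_maxGen (s : ℝ × ℝ) (b : ℝ) : genFun s b ≤ maxGen s :=
  (exists_genFun_max s).choose_spec b

lemma argmaxGen_critical (s : ℝ × ℝ) :
    s.1 = 4 * argmaxGen s ^ 3 - 2 * s.2 * argmaxGen s := by
  have h : IsLocalMax (genFun s) (argmaxGen s) :=
    Filter.Eventually.of_forall fun b => genFun_le_maxGen s b
  have hd : HasDerivAt (genFun s) (s.1 * 1 + s.2 * (2 * argmaxGen s ^ 1 * 1)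
      - 4 * argmaxGen s ^ 3 * 1) (argmaxGen s) := by
    unfold genFun
    exact (((hasDerivAt_id _).const_mul _).add (((hasDerivAt_id _).pow 2).const_mul _)).sub
      ((hasDerivAt_id _).pow 4)
  have := h.hasDerivAt_eq_zero hd
  linarith

/-- Comparison of the maximizer `a` with its mirror image `-a`: the gain is `2 x a = 4 a² (2 a² -
y)`, which must be nonnegative. For `a = 0` the critical equation gives `x = 0`, and if `y > 0` the
value `y²/4` at `√(y/2)` would be larger. -/
lemma le_two_argmaxGen_sq (s : ℝ × ℝ) : s.2 ≤ 2 * argmaxGen s ^ 2 := by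
  have hx := argmaxGen_critical s
  set a := argmaxGen s with ha
  have key : ∀ b, genFun s b ≤ genFun s a := fun b => genFun_le_maxGen s b
  by_cases h0 : a = 0
  · rw [h0] at hx key ⊢
    by_contra hy
    have hy' : 0 < s.2 := by simpa using hy
    have h1 := key (Real.sqrt (s.2 / 2))
    have h2 : Real.sqrt (s.2 / 2) ^ 2 = s.2 / 2 := Real.sq_sqrt (by positivity)
    have h4 : Real.sqrt (s.2 / 2) ^ 4 = (s.2 / 2) ^ 2 := by
      rw [show Real.sqrt (s.2 / 2) ^ 4 = (Real.sqrt (s.2 / 2) ^ 2) ^ 2 by ring, h2]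
    have hx0 : s.1 = 0 := by simpa using hx
    simp only [genFun, h4, h2, hx0] at h1
    nlinarith
  · have h1 := key (-a)
    simp only [genFun] at h1
    have h2 : 0 ≤ 4 * a ^ 2 * (2 * a ^ 2 - s.2) := by
      have : 0 ≤ 2 * (s.1 * a) := by nlinarith
      rw [hx] at this; nlinarith
    have h3 : 0 < 4 * a ^ 2 := by positivity
    have := nonneg_of_mul_nonneg_right h2 h3
    linarith

lemma genFun_critical (a y : ℝ) : genFun (4 * a ^ 3 - 2 * y * a, y) a = 3 * a ^ 4 - y * a ^ 2 := by
  simp only [genFun]; ring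

/-- Criticality of `a` splits off a double root at `b = a`. The other factor is nonnegative for `y ≤
2 a²`, so every such critical point is a global maximum. It also measures how stable the maximizer
is. -/
lemma genFun_sub_of_critical (a y b : ℝ) :
    genFun (4 * a ^ 3 - 2 * y * a, y) a - genFun (4 * a ^ 3 - 2 * y * a, y) b
      = (b - a) ^ 2 * ((b + a) ^ 2 + (2 * a ^ 2 - y)) := by
  simp only [genFun]; ring

lemma maxGen_critical {a y : ℝ} (h : y ≤ 2 * a ^ 2) :
    maxGen (4 * a ^ 3 - 2 * y * a, y) = 3 * a ^ 4 - y * a ^ 2 := by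
  rw [← genFun_critical]
  apply le_antisymm
  · have h1 := genFun_sub_of_critical a y (argmaxGen (4 * a ^ 3 - 2 * y * a, y))
    set A := argmaxGen (4 * a ^ 3 - 2 * y * a, y) with hA
    have : 0 ≤ (A - a) ^ 2 * ((A + a) ^ 2 + (2 * a ^ 2 - y)) :=
      mul_nonneg (sq_nonneg _) (add_nonneg (sq_nonneg _) (by linarith))
    have h2 : maxGen (4 * a ^ 3 - 2 * y * a, y) = genFun (4 * a ^ 3 - 2 * y * a, y) A := rfl
    linarith
  · exact genFun_le_maxGen _ _

lemma maxGen_eq_argmaxGen (s : ℝ × ℝ) :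
    maxGen s = 3 * argmaxGen s ^ 4 - s.2 * argmaxGen s ^ 2 := by
  have h := argmaxGen_critical s
  unfold maxGen genFun
  rw [h]; ring

lemma eq_maxGen_iff (x y z : ℝ) : z = maxGen (x, y) ↔
    ∃ a : ℝ, y ≤ 2 * a ^ 2 ∧ x = 4 * a ^ 3 - 2 * y * a ∧ z = 3 * a ^ 4 - y * a ^ 2 := by
  constructor
  · rintro rfl
    exact ⟨argmaxGen (x, y), le_two_argmaxGen_sq (x, y), argmaxGen_critical (x, y),
      maxGen_eq_argmaxGen (x, y)⟩
  · rintro ⟨a, hy, rfl, rfl⟩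
    exact (maxGen_critical hy).symm

lemma maxGen_nonneg (s : ℝ × ℝ) : 0 ≤ maxGen s := by
  have := genFun_le_maxGen s 0
  simpa [genFun] using this

lemma maxGen_zero_nonpos {y : ℝ} (hy : y ≤ 0) : maxGen (0, y) = 0 := by
  have := maxGen_critical (a := 0) (y := y) (by simpa using hy)
  simpa using this

lemma maxGen_zero_nonneg {y : ℝ} (hy : 0 ≤ y) : maxGen (0, y) = y ^ 2 / 4 := by
  have h2 : Real.sqrt (y / 2) ^ 2 = y / 2 := Real.sq_sqrt (by positivity)
  refine ((eq_maxGen_iff 0 y (y ^ 2 / 4)).mpr ⟨Real.sqrt (y / 2), by rw [h2]; linarith, ?_, ?_⟩).symm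
  · rw [show Real.sqrt (y / 2) ^ 3 = Real.sqrt (y / 2) ^ 2 * Real.sqrt (y / 2) by ring, h2]; ring
  · rw [show Real.sqrt (y / 2) ^ 4 = (Real.sqrt (y / 2) ^ 2) ^ 2 by ring, h2]; ring

/-- Any value of the parameter gives a lower bound for the increment of `maxGen`. -/
lemma genFun_add_le_maxGen (s s' : ℝ × ℝ) (a : ℝ) :
    genFun s a + (a * (s'.1 - s.1) + a ^ 2 * (s'.2 - s.2)) ≤ maxGen s' := by
  have := genFun_le_maxGen s' a
  simp only [genFun] at this ⊢; linarith

/-- The maximizer belonging to `s'` is used as a competitor at `s`. Together with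
`genFun_add_le_maxGen` this encloses the increment of `maxGen` between two linear forms, which merge
where the maximizer is continuous. -/
lemma maxGen_le_add (s s' : ℝ × ℝ) :
    maxGen s' ≤ maxGen s + (argmaxGen s' * (s'.1 - s.1) + argmaxGen s' ^ 2 * (s'.2 - s.2)) := by
  have := genFun_le_maxGen s (argmaxGen s')
  have h2 : maxGen s' = genFun s' (argmaxGen s') := rfl
  rw [h2]; simp only [genFun] at this ⊢; linarith

/-- For fixed `a` the generating function is affine in the parameters, and a maximum of affine
functions is convex. Convexity gives continuity, and later connectedness of the region above the
sheet. -/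
lemma convexOn_maxGen : ConvexOn ℝ univ maxGen := by
  refine ⟨convex_univ, fun s _ t _ α β hα hβ _ => ?_⟩
  set A := argmaxGen (α • s + β • t)
  have h1 := mul_le_mul_of_nonneg_left (genFun_le_maxGen s A) hα
  have h2 := mul_le_mul_of_nonneg_left (genFun_le_maxGen t A) hβ
  have h3 : maxGen (α • s + β • t) = genFun (α • s + β • t) A := rfl
  rw [h3]
  simp only [genFun, smul_eq_mul, Prod.fst_add, Prod.snd_add, Prod.smul_fst, Prod.smul_snd]
    at h1 h2 ⊢
  have : (α + β) * A ^ 4 = A ^ 4 := by rw [‹α + β = 1›, one_mul]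
  linarith

lemma continuous_maxGen : Continuous maxGen := by
  rw [← continuousOn_univ]
  exact convexOn_maxGen.continuousOn isOpen_univ

lemma maxGen_zero : maxGen (0, 0) = 0 := maxGen_zero_nonpos le_rfl

/-! ### Stability of the maximizer and the derivative of the maximum -/

/-- The maximizer depends continuously on the parameters in a quantitative sense. -/
lemma argmaxGen_dist (a y : ℝ) (s' : ℝ × ℝ) :
    |argmaxGen s' - a| * ((argmaxGen s' + a) ^ 2 + (2 * a ^ 2 - y))
      ≤ |s'.1 - (4 * a ^ 3 - 2 * y * a)| + |argmaxGen s' + a| * |s'.2 - y| := by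
  set A := argmaxGen s'
  have h1 : genFun s' a ≤ genFun s' A := genFun_le_maxGen s' a
  have h2 := genFun_sub_of_critical a y A
  -- The loss at the base point is given exactly by `genFun_sub_of_critical`; subtracting the
  -- optimality of `A` at `s'` cancels the quartic terms and leaves expressions linear in the change
  -- of the parameters.
  have h3 : (A - a) ^ 2 * ((A + a) ^ 2 + (2 * a ^ 2 - y)) ≤
      (A - a) * (s'.1 - (4 * a ^ 3 - 2 * y * a)) + (A - a) * (A + a) * (s'.2 - y) := by
    rw [← h2]
    simp only [genFun] at h1 ⊢
    nlinarith
  have h4 : (A - a) * (s'.1 - (4 * a ^ 3 - 2 * y * a)) + (A - a) * (A + a) * (s'.2 - y)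
      ≤ |A - a| * (|s'.1 - (4 * a ^ 3 - 2 * y * a)| + |A + a| * |s'.2 - y|) := by
    have e1 := le_abs_self ((A - a) * (s'.1 - (4 * a ^ 3 - 2 * y * a)))
    have e2 := le_abs_self ((A - a) * (A + a) * (s'.2 - y))
    simp only [abs_mul] at e1 e2
    nlinarith
  rcases eq_or_ne A a with h | h
  · rw [h]; simp only [sub_self, abs_zero, zero_mul]; positivity
  · have hp : 0 < |A - a| := abs_pos.mpr (sub_ne_zero.mpr h)
    rw [← sq_abs] at h3
    have h5 : |A - a| * (|A - a| * ((A + a) ^ 2 + (2 * a ^ 2 - y))) ≤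
      |A - a| * (|s'.1 - (4 * a ^ 3 - 2 * y * a)| + |A + a| * |s'.2 - y|) := by
      nlinarith
    exact le_of_mul_le_mul_left h5 hp

/-- On the sheet of the sign of `a`, the maximizer is Lipschitz at the points of the crease. -/
lemma argmaxGen_dist_of_sign {a y : ℝ} (ha : a ≠ 0) (hy : y ≤ 2 * a ^ 2) (s' : ℝ × ℝ)
    (hs : 0 ≤ argmaxGen s' * a) :
    |argmaxGen s' - a| ≤ |s'.1 - (4 * a ^ 3 - 2 * y * a)| / a ^ 2 + |s'.2 - y| / |a| := by
  have h := argmaxGen_dist a y s'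
  set A := argmaxGen s'
  have ha' : 0 < |a| := abs_pos.mpr ha
  -- Equal signs exclude cancellation in `A + a`, so `(A + a)²` stays away from zero even when `2 a²
  -- - y = 0`.
  have ht : |a| ≤ |A + a| := by
    apply sq_le_sq.mp; nlinarith [sq_nonneg A]
  have ht0 : 0 < |A + a| := lt_of_lt_of_le ha' ht
  have h1 : |A - a| * |A + a| ^ 2 ≤ |s'.1 - (4 * a ^ 3 - 2 * y * a)| + |A + a| * |s'.2 - y| := by
    rw [sq_abs]
    refine le_trans ?_ h
    exact mul_le_mul_of_nonneg_left (by linarith) (abs_nonneg _)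
  have h2 : |A - a| ≤ |s'.1 - (4 * a ^ 3 - 2 * y * a)| / |A + a| ^ 2 + |s'.2 - y| / |A + a| := by
    have : |s'.1 - (4 * a ^ 3 - 2 * y * a)| / |A + a| ^ 2 + |s'.2 - y| / |A + a|
      = (|s'.1 - (4 * a ^ 3 - 2 * y * a)| + |A + a| * |s'.2 - y|) / |A + a| ^ 2 := by
      field_simp
    rw [this, le_div_iff₀ (by positivity)]; exact h1
  refine h2.trans (add_le_add ?_ ?_)
  · rw [← sq_abs a]; gcongr
  · gcongr

/-- For `y < 2 a²` the second factor in `argmaxGen_dist` is bounded below, which gives a Lipschitz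
bound at the point. At the origin the estimate degenerates to `|A|³ ≤ |x| + |A| |y|`, which still
forces `A → 0`. -/
lemma tendsto_argmaxGen {a y : ℝ} (h : y < 2 * a ^ 2 ∨ a = 0 ∧ y = 0) :
    Tendsto argmaxGen (𝓝 (4 * a ^ 3 - 2 * y * a, y)) (𝓝 a) := by
  have hx : Tendsto (fun s : ℝ × ℝ => |s.1 - (4 * a ^ 3 - 2 * y * a)|)
      (𝓝 (4 * a ^ 3 - 2 * y * a, y)) (𝓝 0) := by
    have : Continuous fun s : ℝ × ℝ => |s.1 - (4 * a ^ 3 - 2 * y * a)| := by fun_prop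
    have h := this.tendsto (4 * a ^ 3 - 2 * y * a, y)
    rwa [sub_self, abs_zero] at h
  have hyy : Tendsto (fun s : ℝ × ℝ => |s.2 - y|) (𝓝 (4 * a ^ 3 - 2 * y * a, y)) (𝓝 0) := by
    have : Continuous fun s : ℝ × ℝ => |s.2 - y| := by fun_prop
    simpa using this.tendsto (4 * a ^ 3 - 2 * y * a, y)
  rcases h with h | ⟨rfl, rfl⟩
  -- Chosen so that `m (t² + 1) ≤ t² + (2 a² - y)` for every `t`; the factor `t² + 1` also absorbs
  -- the `|t|` that multiplies the change of `y`.
  · set m : ℝ := min (2 * a ^ 2 - y) 1 with hm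
    have hm0 : 0 < m := lt_min (by linarith) one_pos
    rw [tendsto_iff_dist_tendsto_zero]
    refine squeeze_zero (fun _ => dist_nonneg) (fun s => ?_)
      (by simpa using (hx.add hyy).div_const m)
    have h1 := argmaxGen_dist a y s
    set A := argmaxGen s
    rw [Real.dist_eq, le_div_iff₀ hm0]
    set t := A + a
    have e1 : m * (t ^ 2 + 1) ≤ t ^ 2 + (2 * a ^ 2 - y) := by
      have := min_le_left (2 * a ^ 2 - y) 1
      have := min_le_right (2 * a ^ 2 - y) 1
      nlinarith [sq_nonneg t]
    have e2 : |t| ≤ t ^ 2 + 1 := by rw [← sq_abs]; nlinarith [sq_nonneg (|t| - 1), abs_nonneg t]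
    have e3 : |A - a| * (m * (t ^ 2 + 1)) ≤ (|s.1 - (4 * a ^ 3 - 2 * y * a)| + |s.2 - y|) * (t ^ 2 + 1) := by
      calc |A - a| * (m * (t ^ 2 + 1)) ≤ |A - a| * (t ^ 2 + (2 * a ^ 2 - y)) :=
            mul_le_mul_of_nonneg_left e1 (abs_nonneg _)
        _ ≤ _ := h1
        _ ≤ _ := by
          have := mul_le_mul_of_nonneg_right e2 (abs_nonneg (s.2 - y))
          have := mul_nonneg (abs_nonneg (s.1 - (4 * a ^ 3 - 2 * y * a))) (sq_nonneg t)
          nlinarith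
    have e4 : 0 < t ^ 2 + 1 := by positivity
    have e5 : (|A - a| * m) * (t ^ 2 + 1) ≤ (|s.1 - (4 * a ^ 3 - 2 * y * a)| + |s.2 - y|) * (t ^ 2 + 1) := by
      linarith
    exact le_of_mul_le_mul_right e5 e4
  · rw [Metric.tendsto_nhds]
    intro ε hε
    -- If `|A| ≥ ε`, these thresholds give `|x| + |A| |y| < ε³/2 + |A| ε²/2 ≤ |A|³`, against
    -- `argmaxGen_dist`.
    filter_upwards [hx.eventually (gt_mem_nhds (show (0 : ℝ) < ε ^ 3 / 2 by positivity)),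
      hyy.eventually (gt_mem_nhds (show (0 : ℝ) < ε ^ 2 / 2 by positivity))] with s h1 h2
    have h3 := argmaxGen_dist 0 0 s
    simp only [sub_zero, add_zero] at h3 h2
    rw [Real.dist_eq, sub_zero]
    by_contra h4
    rw [not_lt] at h4
    set A := |argmaxGen s| with hA
    have h5 : argmaxGen s ^ 2 = A ^ 2 := (sq_abs _).symm
    rw [h5] at h3
    simp only [ne_eq, OfNat.ofNat_ne_zero, not_false_eq_true, zero_pow, mul_zero, add_zero,
      sub_zero] at h3 h1
    have e1 : ε ^ 2 ≤ A ^ 2 := by gcongr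
    have e2 : ε ^ 3 ≤ A ^ 3 := by gcongr
    have hA0 : 0 < A := by linarith
    have e3 := mul_lt_mul_of_pos_left h2 hA0
    have e4 : A * ε ^ 2 ≤ A * A ^ 2 := mul_le_mul_of_nonneg_left e1 hA0.le
    nlinarith

/-- Envelope theorem: the increment lies between the linear forms with coefficients `(a, a²)` and
`(A, A²)`, where `A` is the maximizer at the nearby point, and `A → a`. -/
lemma maxGen_hasFDerivAt {a y : ℝ} (h : y < 2 * a ^ 2 ∨ a = 0 ∧ y = 0) :
    HasFDerivAt maxGen (a • ContinuousLinearMap.fst ℝ ℝ ℝ + a ^ 2 • ContinuousLinearMap.snd ℝ ℝ ℝ)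
      (4 * a ^ 3 - 2 * y * a, y) := by
  have hle : y ≤ 2 * a ^ 2 := by
    rcases h with h | ⟨rfl, rfl⟩
    · exact h.le
    · simp
  have ht := tendsto_argmaxGen h
  rw [hasFDerivAt_iff_isLittleO]
  set s : ℝ × ℝ := (4 * a ^ 3 - 2 * y * a, y) with hs
  have hz : maxGen s = genFun s a := by rw [hs, maxGen_critical hle, genFun_critical]
  have hlim : Tendsto (fun s' => |argmaxGen s' - a| + |argmaxGen s' ^ 2 - a ^ 2|) (𝓝 s) (𝓝 0) := by
    have h1 := (ht.sub_const a).abs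
    have h2 := ((ht.pow 2).sub_const (a ^ 2)).abs
    simpa using h1.add h2
  rw [Asymptotics.isLittleO_iff]
  intro c hc
  filter_upwards [hlim.eventually (gt_mem_nhds hc)] with s' hs'
  have l := genFun_add_le_maxGen s s' a
  have u := maxGen_le_add s s'
  set A := argmaxGen s'
  have n1 : |s'.1 - s.1| ≤ ‖s' - s‖ := by
    simpa using norm_fst_le (s' - s)
  have n2 : |s'.2 - s.2| ≤ ‖s' - s‖ := by
    simpa using norm_snd_le (s' - s)
  simp only [add_apply, smul_apply,
    ContinuousLinearMap.coe_fst', ContinuousLinearMap.coe_snd', smul_eq_mul, Prod.fst_sub,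
    Prod.snd_sub, Real.norm_eq_abs]
  have e0 : 0 ≤ maxGen s' - maxGen s - (a * (s'.1 - s.1) + a ^ 2 * (s'.2 - s.2)) := by
    rw [hz]; linarith
  rw [abs_of_nonneg e0]
  have e1 : maxGen s' - maxGen s - (a * (s'.1 - s.1) + a ^ 2 * (s'.2 - s.2)) ≤
      (A - a) * (s'.1 - s.1) + (A ^ 2 - a ^ 2) * (s'.2 - s.2) := by linarith
  have e2 : (A - a) * (s'.1 - s.1) ≤ |A - a| * ‖s' - s‖ :=
    (le_abs_self _).trans (by rw [abs_mul]; gcongr)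
  have e3 : (A ^ 2 - a ^ 2) * (s'.2 - s.2) ≤ |A ^ 2 - a ^ 2| * ‖s' - s‖ :=
    (le_abs_self _).trans (by rw [abs_mul]; gcongr)
  have e4 : (|A - a| + |A ^ 2 - a ^ 2|) * ‖s' - s‖ ≤ c * ‖s' - s‖ := by gcongr
  linarith

/-- Off the crease the maximizer satisfies the strict inequality, or is degenerate at the origin. -/
lemma argmaxGen_of_offCrease {s : ℝ × ℝ} (hs : s ∈ offCrease) :
    s.2 < 2 * argmaxGen s ^ 2 ∨ argmaxGen s = 0 ∧ s.2 = 0 := by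
  have h1 := argmaxGen_critical s
  have h2 := le_two_argmaxGen_sq s
  rcases h2.lt_or_eq with h | h
  · exact Or.inl h
  · right
    have hx : s.1 = 0 := by rw [h1, h]; ring
    have hy : s.2 = 0 := by
      by_contra hne
      exact hs ⟨hx, lt_of_le_of_ne (by rw [h]; positivity) (Ne.symm hne)⟩
    refine ⟨?_, hy⟩
    have : argmaxGen s ^ 2 = 0 := by linarith
    exact pow_eq_zero_iff (two_ne_zero) |>.mp this

lemma eq_critical (s : ℝ × ℝ) :
    s = (4 * argmaxGen s ^ 3 - 2 * s.2 * argmaxGen s, s.2) :=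
  Prod.ext (argmaxGen_critical s) rfl

lemma maxGen_hasFDerivAt_offCrease {s : ℝ × ℝ} (hs : s ∈ offCrease) :
    HasFDerivAt maxGen (argmaxGen s • ContinuousLinearMap.fst ℝ ℝ ℝ
      + argmaxGen s ^ 2 • ContinuousLinearMap.snd ℝ ℝ ℝ) s := by
  have := maxGen_hasFDerivAt (argmaxGen_of_offCrease hs)
  rwa [← eq_critical s] at this

lemma continuousAt_argmaxGen {s : ℝ × ℝ} (hs : s ∈ offCrease) : ContinuousAt argmaxGen s := by
  have := tendsto_argmaxGen (argmaxGen_of_offCrease hs)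
  rwa [← eq_critical s] at this

/-- The derivative of `(a, y) ↦ (4a³ - 2ya, y)`, where it is invertible. -/
def critEquiv (a y : ℝ) (h : 12 * a ^ 2 - 2 * y ≠ 0) : (ℝ × ℝ) ≃L[ℝ] (ℝ × ℝ) :=
  ContinuousLinearEquiv.equivOfInverse
    (((12 * a ^ 2 - 2 * y) • ContinuousLinearMap.fst ℝ ℝ ℝ
      - (2 * a) • ContinuousLinearMap.snd ℝ ℝ ℝ).prod (ContinuousLinearMap.snd ℝ ℝ ℝ))
    (((12 * a ^ 2 - 2 * y)⁻¹ • (ContinuousLinearMap.fst ℝ ℝ ℝ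
      + (2 * a) • ContinuousLinearMap.snd ℝ ℝ ℝ)).prod (ContinuousLinearMap.snd ℝ ℝ ℝ))
    (fun s => by
      ext
      · simp; field_simp; ring
      · simp)
    (fun s => by
      ext
      · simp; field_simp; ring
      · simp)

/-- The inverse function theorem for `(a, y) ↦ (4a³ - 2ya, y)`, whose Jacobian `12a² - 2y` is
positive for `y < 2a²`. The excluded half-line `x = 0, y ≥ 0` is where this strict inequality fails
for the maximizer. Near `s` the maximum is the critical value at the smoothly inverted parameter. -/
lemma maxGen_contDiffAt {s : ℝ × ℝ} (hs : ¬ (s.1 = 0 ∧ 0 ≤ s.2)) : ContDiffAt ℝ ∞ maxGen s := by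
  have hoff : s ∈ offCrease := fun h => hs ⟨h.1, h.2.le⟩
  have hlt : s.2 < 2 * argmaxGen s ^ 2 := by
    rcases argmaxGen_of_offCrease hoff with h | ⟨h, h'⟩
    · exact h
    · exact absurd ⟨by rw [argmaxGen_critical s, h]; ring, h'.ge⟩ hs
  set a := argmaxGen s with ha
  set Ψ : ℝ × ℝ → ℝ × ℝ := fun r => (4 * r.1 ^ 3 - 2 * r.2 * r.1, r.2) with hΨ
  have hΨc : ContDiff ℝ ∞ Ψ := by rw [hΨ]; fun_prop
  have hne : 12 * a ^ 2 - 2 * s.2 ≠ 0 := by nlinarith [sq_nonneg a]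
  have hd : HasFDerivAt Ψ (critEquiv a s.2 hne : (ℝ × ℝ) →L[ℝ] (ℝ × ℝ)) (a, s.2) := by
    have h1 : HasFDerivAt (fun r : ℝ × ℝ => r.1) (ContinuousLinearMap.fst ℝ ℝ ℝ) (a, s.2) :=
      hasFDerivAt_fst
    have h2 : HasFDerivAt (fun r : ℝ × ℝ => r.2) (ContinuousLinearMap.snd ℝ ℝ ℝ) (a, s.2) :=
      hasFDerivAt_snd
    have h3 := (((h1.pow 3).const_mul 4).sub ((h2.const_mul 2).mul h1)).prodMk h2
    refine h3.congr_fderiv ?_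
    ext <;> simp [critEquiv] <;> ring
  have hΨs : Ψ (a, s.2) = s := (eq_critical s).symm
  set g := (hΨc.contDiffAt (x := (a, s.2))).localInverse hd (by simp) with hg
  have hgc : ContDiffAt ℝ ∞ g s := by
    have := (hΨc.contDiffAt (x := (a, s.2))).to_localInverse hd (by simp)
    rwa [hΨs] at this
  have hgs : g s = (a, s.2) := by
    have := (hΨc.contDiffAt (x := (a, s.2))).localInverse_apply_image hd (by simp)
    rwa [hΨs] at this
  have hinv : ∀ᶠ s' in 𝓝 s, Ψ (g s') = s' := by
    have := (hΨc.contDiffAt (x := (a, s.2))).hasStrictFDerivAt' hd (by simp)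
    have h2 := this.eventually_right_inverse
    rw [hΨs] at h2
    exact h2
  -- The strict inequality is open, so the critical point selected by the local inverse remains the
  -- global maximum.
  have hlt' : ∀ᶠ s' in 𝓝 s, (g s').2 < 2 * (g s').1 ^ 2 := by
    have hc := hgc.continuousAt
    have h1 : Tendsto (fun s' => (g s').2) (𝓝 s) (𝓝 (g s).2) := (continuous_snd.tendsto _).comp hc
    have h2 : Tendsto (fun s' => 2 * (g s').1 ^ 2) (𝓝 s) (𝓝 (2 * (g s).1 ^ 2)) :=
      (((continuous_fst.tendsto _).comp hc).pow 2).const_mul 2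
    exact h1.eventually_lt h2 (by rw [hgs]; exact hlt)
  have heq : maxGen =ᶠ[𝓝 s] fun s' => 3 * (g s').1 ^ 4 - (g s').2 * (g s').1 ^ 2 := by
    filter_upwards [hinv, hlt'] with s' h1 h2
    rw [← maxGen_critical h2.le]
    congr 1
    exact h1.symm
  refine ContDiffAt.congr_of_eventuallyEq ?_ heq
  have h1 : ContDiffAt ℝ ∞ (fun s' => (g s').1) s := contDiffAt_fst.comp s hgc
  have h2 : ContDiffAt ℝ ∞ (fun s' => (g s').2) s := contDiffAt_snd.comp s hgc
  exact (contDiffAt_const.mul (h1.pow 4)).sub (h2.mul (h1.pow 2))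

/-! ### Regularity and singularities of the upper sheet -/

theorem isSwallowtailGraph_maxGen : IsSwallowtailGraph maxGen where
  graph := eq_maxGen_iff
  continuous := continuous_maxGen
  smooth := fun s hs => (maxGen_contDiffAt hs).contDiffWithinAt
  hasFDerivAt := fun a y h => maxGen_hasFDerivAt h
  continuousOn_fderiv := by
    refine ⟨fun s hs => (maxGen_hasFDerivAt_offCrease hs).differentiableAt, fun s hs => ?_⟩
    have h1 : ContinuousAt (fun s => argmaxGen s • ContinuousLinearMap.fst ℝ ℝ ℝ
      + argmaxGen s ^ 2 • ContinuousLinearMap.snd ℝ ℝ ℝ) s :=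
      ((continuousAt_argmaxGen hs).smul continuousAt_const).add
        (((continuousAt_argmaxGen hs).pow 2).smul continuousAt_const)
    exact h1.continuousWithinAt.congr (fun t ht => (maxGen_hasFDerivAt_offCrease ht).fderiv)
      (maxGen_hasFDerivAt_offCrease hs).fderiv
  not_twice_differentiable := by
    -- On the curve `a ↦ (4a³, 0)` the derivative of `maxGen` has norm at least `a`, while the
    -- distance to the origin is `4a³`, so the difference quotients of the derivative are unbounded.
    rintro ⟨D, hD⟩
    have hval : ∀ a : ℝ, fderiv ℝ maxGen (4 * a ^ 3, 0) =
        a • ContinuousLinearMap.fst ℝ ℝ ℝ + a ^ 2 • ContinuousLinearMap.snd ℝ ℝ ℝ := by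
      intro a
      have := (maxGen_hasFDerivAt (a := a) (y := 0) (by
        rcases eq_or_ne a 0 with h | h
        · exact Or.inr ⟨h, rfl⟩
        · left; positivity)).fderiv
      simpa using this
    have hO := hD.isBigO_sub
    have ht : Tendsto (fun a : ℝ => ((4 * a ^ 3, 0) : ℝ × ℝ)) (𝓝[>] 0) (𝓝[offCrease] (0, 0)) := by
      rw [tendsto_nhdsWithin_iff]
      constructor
      · have : Continuous fun a : ℝ => ((4 * a ^ 3, 0) : ℝ × ℝ) := by fun_prop
        have h := this.tendsto 0
        simp only [ne_eq, OfNat.ofNat_ne_zero, not_false_eq_true, zero_pow, mul_zero] at h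
        exact h.mono_left nhdsWithin_le_nhds
      · exact Eventually.of_forall fun a h => lt_irrefl _ h.2
    obtain ⟨C, hC⟩ := (hO.comp_tendsto ht).bound
    have h0 : fderiv ℝ maxGen (0, 0) = 0 := by simpa using hval 0
    have hlim : Tendsto (fun a : ℝ => C * (4 * a ^ 2)) (𝓝[>] 0) (𝓝 0) := by
      have : Continuous fun a : ℝ => C * (4 * a ^ 2) := by fun_prop
      have h := this.tendsto 0
      simp only [ne_eq, OfNat.ofNat_ne_zero, not_false_eq_true, zero_pow, mul_zero] at h
      exact h.mono_left nhdsWithin_le_nhds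
    obtain ⟨a, h1, h2, ha⟩ := (hC.and ((hlim.eventually (gt_mem_nhds one_pos)).and
      self_mem_nhdsWithin)).exists
    have ha : 0 < a := ha
    simp only [Function.comp, hval, h0, sub_zero] at h1
    have e1 : a ≤ ‖a • ContinuousLinearMap.fst ℝ ℝ ℝ + a ^ 2 • ContinuousLinearMap.snd ℝ ℝ ℝ‖ := by
      have := (a • ContinuousLinearMap.fst ℝ ℝ ℝ
        + a ^ 2 • ContinuousLinearMap.snd ℝ ℝ ℝ).le_opNorm (1, 0)
      simpa [abs_of_pos ha] using this
    have e2 : ‖((4 * a ^ 3, 0) : ℝ × ℝ) - (0, 0)‖ = 4 * a ^ 3 := by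
      simp [Prod.norm_def, abs_of_pos ha]
      positivity
    rw [e2] at h1
    have e3 : C * (4 * a ^ 3) < 1 * a := by
      calc C * (4 * a ^ 3) = (C * (4 * a ^ 2)) * a := by ring
        _ < 1 * a := by gcongr
    linarith
  not_differentiable_crease := by
    intro y hy hd
    have h2 : Real.sqrt (y / 2) ^ 2 = y / 2 := Real.sq_sqrt (by positivity)
    set a := Real.sqrt (y / 2) with ha
    have ha0 : 0 < a := Real.sqrt_pos.mpr (by positivity)
    have hline : HasDerivAt (fun x : ℝ => maxGen (x, y)) (fderiv ℝ maxGen (0, y) (1, 0)) 0 := by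
      have h3 : HasDerivAt (fun x : ℝ => ((x, y) : ℝ × ℝ)) (1, 0) 0 :=
        (hasDerivAt_id _).prodMk (hasDerivAt_const _ _)
      exact hd.hasFDerivAt.comp_hasDerivAt (0 : ℝ) h3
    -- Each of the maximizers `±a` over the crease gives a lower bound; together they form a kink.
    -- So `x = 0` is a minimum, where a derivative would have to vanish, contrary to the growth `a
    -- |x|`.
    have hbound : ∀ x : ℝ, maxGen (0, y) + a * |x| ≤ maxGen (x, y) := by
      intro x
      have h4 : a ^ 4 = (y / 2) ^ 2 := by rw [← h2]; ring
      have p1 := genFun_le_maxGen (x, y) a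
      have p2 := genFun_le_maxGen (x, y) (-a)
      rw [maxGen_zero_nonneg hy.le]
      simp only [genFun, neg_sq, show (-a) ^ 4 = a ^ 4 by ring, h4, h2] at p1 p2
      rcases abs_cases x with ⟨h, _⟩ | ⟨h, _⟩ <;> rw [h] <;> nlinarith
    set d := fderiv ℝ maxGen (0, y) (1, 0)
    have hmin : IsLocalMin (fun x : ℝ => maxGen (x, y)) 0 :=
      Eventually.of_forall fun x => by
        have := hbound x
        have := mul_nonneg ha0.le (abs_nonneg x)
        show maxGen (0, y) ≤ maxGen (x, y)
        linarith
    have hd0 : d = 0 := hmin.hasDerivAt_eq_zero hline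
    rw [hd0, hasDerivAt_iff_isLittleO, Asymptotics.isLittleO_iff] at hline
    have h5 := hline (show (0 : ℝ) < a / 2 by positivity)
    obtain ⟨x, hx, hxpos⟩ := ((h5.filter_mono (nhdsWithin_le_nhds (s := Ioi 0))).and
      self_mem_nhdsWithin).exists
    have hxpos : 0 < x := hxpos
    have := hbound x
    simp only [sub_zero, smul_zero, Real.norm_eq_abs] at hx
    have h6 := le_abs_self (maxGen (x, y) - maxGen (0, y))
    rw [abs_of_pos hxpos] at this hx
    nlinarith

/-! ### The complement of the swallowtail -/

/-- The swallowtail, as a set of points `(x, y, z)`. -/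
def swallowtail (x y z : ℝ) : Prop :=
  ∃ a q : ℝ, x = 4 * a ^ 3 - 2 * q * a ∧ y = q ∧ z = 3 * a ^ 4 - q * a ^ 2

lemma swallowtail_iff {x y z : ℝ} : swallowtail x y z ↔
    ∃ a : ℝ, x = 4 * a ^ 3 - 2 * y * a ∧ z = 3 * a ^ 4 - y * a ^ 2 := by
  constructor
  · rintro ⟨a, q, h1, rfl, h3⟩; exact ⟨a, h1, h3⟩
  · rintro ⟨a, h1, h3⟩; exact ⟨a, y, h1, rfl, h3⟩

lemma swallowtail.le_maxGen {x y z : ℝ} (h : swallowtail x y z) : z ≤ maxGen (x, y) := by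
  obtain ⟨a, rfl, rfl⟩ := swallowtail_iff.mp h
  rw [← genFun_critical]
  exact genFun_le_maxGen _ _

/-- Completing the square: `z + y²/12 = (6a² - y)²/12`. The side below the parabolic cylinder is
thus a convex region free of the wavefront. -/
lemma swallowtail.neg_sq_le {x y z : ℝ} (h : swallowtail x y z) : -(y ^ 2 / 12) ≤ z := by
  obtain ⟨a, rfl, rfl⟩ := swallowtail_iff.mp h
  nlinarith [sq_nonneg (6 * a ^ 2 - y)]

/-- There is a gap below the upper sheet of the swallowtail. -/
lemma swallowtail.gap {x y s : ℝ} (h : swallowtail x y (maxGen (x, y) - s)) :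
    s = 0 ∨ x ^ 2 ≤ s * y := by
  obtain ⟨b, hx, hz⟩ := swallowtail_iff.mp h
  rcases le_or_gt y (2 * b ^ 2) with hb | hb
  · left
    have := maxGen_critical hb
    rw [← hx] at this
    linarith
  · right
    -- The competitor `-b` has the value `z + 4b²(y - 2b²)`, so `s` is at least `4b²(y - 2b²)`,
    -- whereas `x² = 4b²(y - 2b²)²`.
    have h1 := genFun_le_maxGen (x, y) (-b)
    have hs : 4 * b ^ 2 * (y - 2 * b ^ 2) ≤ s := by
      simp only [genFun] at h1
      rw [hx] at h1 hz
      nlinarith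
    have hy : 0 < y - 2 * b ^ 2 := by linarith
    have e1 : x ^ 2 = 4 * b ^ 2 * (y - 2 * b ^ 2) * (y - 2 * b ^ 2) := by rw [hx]; ring
    have h0 : 0 ≤ 4 * b ^ 2 * (y - 2 * b ^ 2) := by positivity
    have hyy : y - 2 * b ^ 2 ≤ y := by nlinarith [sq_nonneg b]
    rw [e1]
    calc _ ≤ 4 * b ^ 2 * (y - 2 * b ^ 2) * y := mul_le_mul_of_nonneg_left hyy h0
      _ ≤ s * y := mul_le_mul_of_nonneg_right hs (by nlinarith [sq_nonneg b])

end Caustic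
end

noncomputable section
namespace Caustic

/-! ### Lorentzian linear algebra -/

/-- A symmetric bilinear form of signature `(-,+,+,+)`. -/
structure IsLorentz {V : Type*} [AddCommGroup V] [Module ℝ V] (B : LinearMap.BilinForm ℝ V) :
    Prop where
  symm : ∀ v u, B v u = B u v
  basis : ∃ b : Module.Basis (Fin 4) ℝ V,
    ∀ i j, B (b i) (b j) = if i = j then (if i = 0 then -1 else 1) else 0

namespace IsLorentz

variable {V : Type*} [AddCommGroup V] [Module ℝ V] {B : LinearMap.BilinForm ℝ V}

/-- Cauchy–Schwarz for the spatial parts in an orthonormal basis: orthogonality identifies their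
product with the product of the time components, and the spatial part of `T` is shorter than its
time component. -/
lemma pos_of_orthogonal (hB : IsLorentz B) {T c : V} (hT : B T T < 0) (h : B T c = 0) (hc : c ≠ 0) :
    0 < B c c := by
  obtain ⟨b, hb⟩ := hB.basis
  have key : ∀ v w : V, B v w = - (b.repr v 0 * b.repr w 0) + b.repr v 1 * b.repr w 1
      + b.repr v 2 * b.repr w 2 + b.repr v 3 * b.repr w 3 := by
    intro v w
    conv_lhs => rw [← b.sum_repr v, ← b.sum_repr w]
    simp only [Fin.sum_univ_four, map_add, LinearMap.add_apply, map_smul, LinearMap.smul_apply,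
      smul_eq_mul, hb]
    simp
    ring
  rw [key] at hT h ⊢
  set t0 := b.repr T 0
  set t1 := b.repr T 1
  set t2 := b.repr T 2
  set t3 := b.repr T 3
  have hne : ¬ (b.repr c 0 = 0 ∧ b.repr c 1 = 0 ∧ b.repr c 2 = 0 ∧ b.repr c 3 = 0) := by
    rintro ⟨h0, h1, h2, h3⟩
    apply hc
    rw [← b.sum_repr c, Fin.sum_univ_four, h0, h1, h2, h3]
    simp
  set c0 := b.repr c 0
  set c1 := b.repr c 1
  set c2 := b.repr c 2
  set c3 := b.repr c 3
  have hcs : (t1 * c1 + t2 * c2 + t3 * c3) ^ 2 ≤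
      (t1 ^ 2 + t2 ^ 2 + t3 ^ 2) * (c1 ^ 2 + c2 ^ 2 + c3 ^ 2) := by
    nlinarith [sq_nonneg (t1 * c2 - t2 * c1), sq_nonneg (t1 * c3 - t3 * c1),
      sq_nonneg (t2 * c3 - t3 * c2)]
  have h0 : t1 * c1 + t2 * c2 + t3 * c3 = t0 * c0 := by linarith
  rw [h0] at hcs
  have ht : t1 ^ 2 + t2 ^ 2 + t3 ^ 2 < t0 ^ 2 := by nlinarith
  have ht0 : 0 < t0 ^ 2 := lt_of_le_of_lt (by positivity) ht
  by_cases hs : c1 ^ 2 + c2 ^ 2 + c3 ^ 2 = 0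
  · exfalso
    have e1 : c1 = 0 := by nlinarith [sq_nonneg c1, sq_nonneg c2, sq_nonneg c3]
    have e2 : c2 = 0 := by nlinarith [sq_nonneg c1, sq_nonneg c2, sq_nonneg c3]
    have e3 : c3 = 0 := by nlinarith [sq_nonneg c1, sq_nonneg c2, sq_nonneg c3]
    have e0 : t0 * c0 = 0 := by rw [← h0, e1, e2, e3]; ring
    have : t0 ≠ 0 := fun h => by rw [h] at ht0; simp at ht0
    exact hne ⟨(mul_eq_zero.mp e0).resolve_left this, e1, e2, e3⟩
  · have hs' : 0 < c1 ^ 2 + c2 ^ 2 + c3 ^ 2 := lt_of_le_of_ne (by positivity) (Ne.symm hs)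
    have : t0 ^ 2 * c0 ^ 2 < t0 ^ 2 * (c1 ^ 2 + c2 ^ 2 + c3 ^ 2) := by nlinarith
    have := lt_of_mul_lt_mul_left this ht0.le
    nlinarith

lemma exists_timelike (hB : IsLorentz B) : ∃ T, B T T < 0 := by
  obtain ⟨b, hb⟩ := hB.basis
  exact ⟨b 0, by rw [hb]; simp⟩

lemma eq_zero_of_forall (hB : IsLorentz B) {k : V} (h : ∀ d, B k d = 0) : k = 0 := by
  obtain ⟨T, hT⟩ := hB.exists_timelike
  by_contra hk
  have := hB.pos_of_orthogonal hT (by rw [hB.symm]; exact h T) hk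
  rw [h k] at this
  exact lt_irrefl _ this

/-- A nonzero causal vector is not orthogonal to a timelike vector. -/
lemma ne_zero_of_causal (hB : IsLorentz B) {T k : V} (hT : B T T < 0) (hk : k ≠ 0)
    (hkk : B k k ≤ 0) : B T k ≠ 0 := fun h =>
  absurd (hB.pos_of_orthogonal hT h hk) (not_lt.mpr hkk)

/-- Orthogonal null vectors are proportional. -/
lemma eq_smul_of_null (hB : IsLorentz B) {k l : V} (hk : B k k = 0) (hl : B l l = 0)
    (hkl : B k l = 0) (hl0 : l ≠ 0) : ∃ μ : ℝ, k = μ • l := by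
  obtain ⟨T, hT⟩ := hB.exists_timelike
  have hTl := hB.ne_zero_of_causal hT hl0 hl.le
  -- With this coefficient the difference is orthogonal to `T`. Its square vanishes, so it cannot be
  -- nonzero.
  refine ⟨B T k / B T l, ?_⟩
  rw [← sub_eq_zero]
  by_contra hne
  have := hB.pos_of_orthogonal hT (c := k - (B T k / B T l) • l) (by
    simp only [map_sub, map_smul, smul_eq_mul]; field_simp; ring) hne
  simp only [map_sub, map_smul, LinearMap.sub_apply, LinearMap.smul_apply, smul_eq_mul,
    hB.symm l k, hk, hl, hkl] at this
  simp at this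

/-- If a form is nonnegative on the hyperplane `ν = 0` then a null vector in this hyperplane is
orthogonal to it. -/
lemma orthogonal_of_nonneg {ν : V →ₗ[ℝ] ℝ} (hs : ∀ v u, B v u = B u v)
    (hpos : ∀ c, ν c = 0 → 0 ≤ B c c) {k : V} (hk : B k k = 0) (hνk : ν k = 0) {c : V}
    (hc : ν c = 0) : B k c = 0 := by
  by_contra hne
  -- On the line `s k + c` the form equals `2 s B(k, c) + B(c, c)`; this `s` makes it `-1`.
  have h := hpos ((-(B c c + 1) / (2 * B k c)) • k + c) (by simp [hνk, hc])
  simp only [map_add, map_smul, LinearMap.add_apply, LinearMap.smul_apply, smul_eq_mul, hk,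
    hs c k] at h
  have e : -(B c c + 1) / (2 * B k c) * B k c = -(B c c + 1) / 2 := by field_simp
  nlinarith

/-- Non-proportional null vectors of the same time orientation have negative product. -/
lemma neg_of_future_null (hB : IsLorentz B) {T k l : V} (hT : B T T < 0) (hk : B k k = 0)
    (hl : B l l = 0) (hTk : B T k < 0) (hTl : B T l < 0) (hne : ∀ μ : ℝ, k ≠ μ • l) :
    B k l < 0 := by
  -- This combination is orthogonal to `T`, hence spacelike, and its square is `-2 B(T,k) B(T,l)
  -- B(k,l)`.
  have h0 : B T l • k - B T k • l ≠ 0 := by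
    intro h
    apply hne (B T k / B T l)
    rw [sub_eq_zero] at h
    rw [div_eq_inv_mul, mul_smul, ← h, smul_smul, inv_mul_cancel₀ hTl.ne, one_smul]
  have := hB.pos_of_orthogonal hT (c := B T l • k - B T k • l) (by
    simp only [map_sub, map_smul, smul_eq_mul]; ring) h0
  simp only [map_sub, map_smul, LinearMap.sub_apply, LinearMap.smul_apply, smul_eq_mul,
    hB.symm l k, hk, hl] at this
  have hp : 0 < B T k * B T l := mul_pos_of_neg_of_neg hTk hTl
  nlinarith

/-- Timelike and causal vectors of the same time orientation have negative product. -/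
lemma neg_of_future_causal (hB : IsLorentz B) {T n k : V} (hT : B T T < 0) (hn : B n n < 0)
    (hTn : B T n < 0) (hkk : B k k ≤ 0) (hTk : B T k < 0) : B n k < 0 := by
  have hk0 : k ≠ 0 := by rintro rfl; simp at hTk
  by_contra hnk
  rw [not_lt] at hnk
  have hden : 0 < B n k - B T k := by linarith
  -- With this weight the convex combination of `T` and `n` is orthogonal to `k`. It is still
  -- timelike because `T` and `n` have the same time orientation, and a timelike vector is not
  -- orthogonal to a nonzero causal one.
  set s : ℝ := -(B T k) / (B n k - B T k) with hs
  have hs0 : 0 < s := div_pos (by linarith) hden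
  have hs1 : s ≤ 1 := by rw [hs, div_le_one hden]; linarith
  have hm : B ((1 - s) • T + s • n) ((1 - s) • T + s • n) < 0 := by
    simp only [map_add, map_smul, LinearMap.add_apply, LinearMap.smul_apply, smul_eq_mul,
      hB.symm n T]
    have h1 : 0 ≤ 1 - s := by linarith
    have a1 : (1 - s) * ((1 - s) * B T T) ≤ 0 := by
      have := mul_nonneg h1 (mul_nonneg h1 (neg_nonneg.mpr hT.le)); nlinarith
    have a2 : s * (s * B n n) < 0 := by
      have := mul_pos hs0 (mul_pos hs0 (neg_pos.mpr hn)); nlinarith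
    have a3 : (1 - s) * (s * B T n) ≤ 0 := by
      have := mul_nonneg h1 (mul_nonneg hs0.le (neg_nonneg.mpr hTn.le)); nlinarith
    nlinarith
  refine hB.ne_zero_of_causal hm hk0 hkk ?_
  simp only [map_add, map_smul, LinearMap.add_apply, LinearMap.smul_apply, smul_eq_mul]
  rw [hs]; field_simp; ring

end IsLorentz

/-! ### The metric in coordinates -/

set_option linter.unusedSectionVars false

variable {M : Type*} [TopologicalSpace M] [ChartedSpace R4 M] [IsManifold (𝓡 4) ∞ M]

lemma mdifferentiable_of_mem_maximalAtlas {e : OpenPartialHomeomorph M R4}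
    (he : e ∈ IsManifold.maximalAtlas (𝓡 4) ∞ M) : e.MDifferentiable (𝓡 4) (𝓡 4) :=
  ⟨(contMDiffOn_of_mem_maximalAtlas he).mdifferentiableOn (by simp),
    (contMDiffOn_symm_of_mem_maximalAtlas he).mdifferentiableOn (by simp)⟩

section Chart

variable (S : Spacetime M) {e : OpenPartialHomeomorph M R4}

/-- The differential of the chart `e`, as a linear map to the model space. -/
def chartD (e : OpenPartialHomeomorph M R4) (x : M) : TangentSpace (𝓡 4) x →ₗ[ℝ] R4 where
  toFun v := mfderiv (𝓡 4) (𝓡 4) e x v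
  map_add' v w := (mfderiv (𝓡 4) (𝓡 4) e x).map_add v w
  map_smul' c v := (mfderiv (𝓡 4) (𝓡 4) e x).map_smul c v

/-- The differential of the inverse of the chart `e`, as a linear map from the model space. -/
def coordD (e : OpenPartialHomeomorph M R4) (u : R4) : R4 →ₗ[ℝ] TangentSpace (𝓡 4) (e.symm u) where
  toFun c := coordTangent e u c
  map_add' v w := (mfderiv (𝓡 4) (𝓡 4) e.symm u).map_add v w
  map_smul' c v := (mfderiv (𝓡 4) (𝓡 4) e.symm u).map_smul c v

lemma chartD_coordTangent (he : e ∈ IsManifold.maximalAtlas (𝓡 4) ∞ M) {u : R4}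
    (hu : u ∈ e.target) (c : R4) : chartD e (e.symm u) (coordTangent e u c) = c := by
  have := (mdifferentiable_of_mem_maximalAtlas he).comp_symm_deriv hu
  exact DFunLike.congr_fun this c

lemma coordTangent_chartD (he : e ∈ IsManifold.maximalAtlas (𝓡 4) ∞ M) {u : R4}
    (hu : u ∈ e.target) (v : TangentSpace (𝓡 4) (e.symm u)) :
    coordTangent e u (chartD e (e.symm u) v) = v := by
  have := (mdifferentiable_of_mem_maximalAtlas he).symm_comp_deriv (e.map_target hu)
  rw [e.right_inv hu] at this
  exact DFunLike.congr_fun this v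

/-- The metric as a bilinear form on the components in the chart `e`. -/
def gForm (e : OpenPartialHomeomorph M R4) (u : R4) : LinearMap.BilinForm ℝ R4 :=
  (S.metric (e.symm u)).compl₁₂ (coordD e u) (coordD e u)

lemma gForm_apply (u c d : R4) :
    gForm S e u c d = S.metric (e.symm u) (coordTangent e u c) (coordTangent e u d) := rfl

/-- The components of the time orientation. -/
def futureCoord (e : OpenPartialHomeomorph M R4) (u : R4) : R4 :=
  chartD e (e.symm u) (S.future (e.symm u))

lemma coordTangent_futureCoord (he : e ∈ IsManifold.maximalAtlas (𝓡 4) ∞ M) {u : R4}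
    (hu : u ∈ e.target) : coordTangent e u (futureCoord S e u) = S.future (e.symm u) :=
  coordTangent_chartD he hu _

lemma gForm_symm (u c d : R4) : gForm S e u c d = gForm S e u d c := S.symm _ _ _

lemma isLorentz_gForm (he : e ∈ IsManifold.maximalAtlas (𝓡 4) ∞ M) {u : R4}
    (hu : u ∈ e.target) : IsLorentz (gForm S e u) := by
  refine ⟨gForm_symm S u, ?_⟩
  obtain ⟨b, hb⟩ := S.lorentzian (e.symm u)
  let L : TangentSpace (𝓡 4) (e.symm u) ≃ₗ[ℝ] R4 :=
    { chartD e (e.symm u) with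
      invFun := fun c => coordTangent e u c
      left_inv := fun v => coordTangent_chartD he hu v
      right_inv := fun c => chartD_coordTangent he hu c }
  refine ⟨b.map L, fun i j => ?_⟩
  rw [gForm_apply, Module.Basis.map_apply, Module.Basis.map_apply]
  have : ∀ i, coordTangent e u (L (b i)) = b i := fun i => coordTangent_chartD he hu _
  rw [this, this, hb]

lemma metric_eq_gForm (he : e ∈ IsManifold.maximalAtlas (𝓡 4) ∞ M) {x : M} (hx : x ∈ e.source)
    (v w : TangentSpace (𝓡 4) x) :
    S.metric x v w = gForm S e (e x) (chartD e x v) (chartD e x w) := by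
  obtain ⟨u, hu, rfl⟩ : ∃ u ∈ e.target, x = e.symm u := ⟨e x, e.map_source hx, (e.left_inv hx).symm⟩
  rw [e.right_inv hu, gForm_apply, coordTangent_chartD he hu, coordTangent_chartD he hu]

lemma futureCoord_eq {x : M} (hx : x ∈ e.source) :
    futureCoord S e (e x) = chartD e x (S.future x) := by
  unfold futureCoord; rw [e.left_inv hx]

lemma isFutureNull_iff (he : e ∈ IsManifold.maximalAtlas (𝓡 4) ∞ M) {x : M} (hx : x ∈ e.source)
    (v : TangentSpace (𝓡 4) x) : S.IsFutureNull v ↔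
      gForm S e (e x) (chartD e x v) (chartD e x v) = 0 ∧
      gForm S e (e x) (futureCoord S e (e x)) (chartD e x v) < 0 := by
  rw [Spacetime.IsFutureNull, metric_eq_gForm S he hx, metric_eq_gForm S he hx,
    futureCoord_eq S hx]

lemma isFutureTimelike_iff (he : e ∈ IsManifold.maximalAtlas (𝓡 4) ∞ M) {x : M}
    (hx : x ∈ e.source) (v : TangentSpace (𝓡 4) x) : S.IsFutureTimelike v ↔
      gForm S e (e x) (chartD e x v) (chartD e x v) < 0 ∧
      gForm S e (e x) (futureCoord S e (e x)) (chartD e x v) < 0 := by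
  rw [Spacetime.IsFutureTimelike, metric_eq_gForm S he hx, metric_eq_gForm S he hx,
    futureCoord_eq S hx]

lemma futureCoord_timelike (he : e ∈ IsManifold.maximalAtlas (𝓡 4) ∞ M) {u : R4}
    (hu : u ∈ e.target) : gForm S e u (futureCoord S e u) (futureCoord S e u) < 0 := by
  rw [gForm_apply, coordTangent_futureCoord S he hu]
  exact S.future_timelike _

/-- The velocity of a curve in coordinates. -/
lemma hasDerivAt_chart (he : e ∈ IsManifold.maximalAtlas (𝓡 4) ∞ M) {γ : ℝ → M} {t : ℝ}
    (hγ : MDifferentiableAt 𝓘(ℝ, ℝ) (𝓡 4) γ t) (ht : γ t ∈ e.source) :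
    HasDerivAt (fun s => e (γ s)) (chartD e (γ t) (velocity γ t)) t := by
  have hE := (mdifferentiable_of_mem_maximalAtlas he).mdifferentiableAt ht
  have hd : DifferentiableAt ℝ (fun s => e (γ s)) t := (hE.comp t hγ).differentiableAt
  have h1 := mfderiv_comp t hE hγ
  have h2 : deriv (fun s => e (γ s)) t = chartD e (γ t) (velocity γ t) := by
    rw [← fderiv_apply_one_eq_deriv, ← mfderiv_eq_fderiv]
    exact DFunLike.congr_fun h1 (1 : ℝ)
  rw [← h2]
  exact hd.hasDerivAt

lemma sum_smul_stdVec (c : R4) : c = ∑ i, c i • stdVec i := by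
  ext j
  simp [stdVec, Fin.sum_univ_four]
  fin_cases j <;> simp

lemma gForm_eq_sum (u c d : R4) :
    gForm S e u c d = ∑ i, ∑ j, S.gDown e u i j * c i * d j := by
  conv_lhs => rw [sum_smul_stdVec c, sum_smul_stdVec d]
  rw [map_sum, Finset.sum_comm]
  refine Finset.sum_congr rfl fun j _ => ?_
  rw [map_sum, LinearMap.sum_apply]
  refine Finset.sum_congr rfl fun i _ => ?_
  rw [show S.gDown e u i j = gForm S e u (stdVec i) (stdVec j) from rfl]
  simp only [map_smul, LinearMap.smul_apply, smul_eq_mul]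
  ring

lemma contDiffOn_gDown (he : e ∈ IsManifold.maximalAtlas (𝓡 4) ∞ M) (i j : Fin 4) :
    ContDiffOn ℝ ∞ (fun u => S.gDown e u i j) e.target := S.smooth_metric e he i j

lemma continuousOn_futureCoord (he : e ∈ IsManifold.maximalAtlas (𝓡 4) ∞ M) :
    ContinuousOn (futureCoord S e) e.target := (S.smooth_future e he).continuousOn

lemma tendsto_gForm (he : e ∈ IsManifold.maximalAtlas (𝓡 4) ∞ M) {ι : Type*} {l : Filter ι}
    {u c d : ι → R4} {u₀ c₀ d₀ : R4} (hu₀ : u₀ ∈ e.target) (hu : Tendsto u l (𝓝 u₀))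
    (hc : Tendsto c l (𝓝 c₀)) (hd : Tendsto d l (𝓝 d₀)) :
    Tendsto (fun i => gForm S e (u i) (c i) (d i)) l (𝓝 (gForm S e u₀ c₀ d₀)) := by
  simp only [gForm_eq_sum]
  refine tendsto_finsetSum _ fun i _ => tendsto_finsetSum _ fun j _ => ?_
  have h1 : Tendsto (fun k => S.gDown e (u k) i j) l (𝓝 (S.gDown e u₀ i j)) :=
    (((contDiffOn_gDown S he i j).continuousOn.continuousAt
      (e.open_target.mem_nhds hu₀)).tendsto).comp hu
  have h2 : Tendsto (fun k => c k i) l (𝓝 (c₀ i)) :=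
    ((EuclideanSpace.proj (𝕜 := ℝ) i).continuous.tendsto c₀).comp hc
  have h3 : Tendsto (fun k => d k j) l (𝓝 (d₀ j)) :=
    ((EuclideanSpace.proj (𝕜 := ℝ) j).continuous.tendsto d₀).comp hd
  exact (h1.mul h2).mul h3

/-! ### Raising indices -/

/-- A kernel vector of the Gram matrix would be orthogonal to every vector, which nondegeneracy
excludes. -/
lemma gDown_det_ne_zero (he : e ∈ IsManifold.maximalAtlas (𝓡 4) ∞ M) {u : R4}
    (hu : u ∈ e.target) : (S.gDown e u).det ≠ 0 := by
  intro h
  obtain ⟨v, hv0, hv⟩ := Matrix.exists_mulVec_eq_zero_iff.mpr h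
  apply hv0
  have : (WithLp.toLp 2 v : R4) = 0 := by
    refine (isLorentz_gForm S he hu).eq_zero_of_forall fun d => ?_
    rw [gForm_symm, gForm_eq_sum]
    refine Finset.sum_eq_zero fun i _ => ?_
    have h1 := congrFun hv i
    simp only [Matrix.mulVec, dotProduct, Pi.zero_apply] at h1
    calc _ = d i * ∑ j, S.gDown e u i j * v j := by
            rw [Finset.mul_sum]; exact Finset.sum_congr rfl fun j _ => by ring
      _ = 0 := by rw [h1, mul_zero]
  ext i
  simpa using congrArg (fun w : R4 => w i) this

/-- The vector obtained from a covector by raising the index. -/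
def sharp (e : OpenPartialHomeomorph M R4) (u ν : R4) : R4 :=
  WithLp.toLp 2 ((S.gUp e u).mulVec ν)

lemma sharp_apply (u ν : R4) (i : Fin 4) : sharp S e u ν i = ∑ j, S.gUp e u i j * ν j := rfl

/-- The pairing of a covector and a vector. -/
def pair (ν c : R4) : ℝ := ∑ i, ν i * c i

lemma gDown_symm (u : R4) (i j : Fin 4) : S.gDown e u i j = S.gDown e u j i := S.symm _ _ _

lemma gDown_mulVec_sharp (he : e ∈ IsManifold.maximalAtlas (𝓡 4) ∞ M) {u : R4}
    (hu : u ∈ e.target) (ν : R4) (i : Fin 4) : ∑ j, S.gDown e u i j * sharp S e u ν j = ν i := by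
  have h : (S.gDown e u) * (S.gUp e u) = 1 :=
    Matrix.mul_nonsing_inv _ (isUnit_iff_ne_zero.mpr (gDown_det_ne_zero S he hu))
  have h2 : (S.gDown e u).mulVec ((S.gUp e u).mulVec ν) = ν := by
    rw [Matrix.mulVec_mulVec, h, Matrix.one_mulVec]
  exact congrFun h2 i

lemma gForm_sharp (he : e ∈ IsManifold.maximalAtlas (𝓡 4) ∞ M) {u : R4}
    (hu : u ∈ e.target) (ν d : R4) : gForm S e u (sharp S e u ν) d = pair ν d := by
  rw [gForm_symm, gForm_eq_sum, pair]
  refine Finset.sum_congr rfl fun i _ => ?_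
  rw [← gDown_mulVec_sharp S he hu ν i, Finset.sum_mul]
  exact Finset.sum_congr rfl fun j _ => by ring

lemma eq_sharp_of_forall (he : e ∈ IsManifold.maximalAtlas (𝓡 4) ∞ M) {u : R4}
    (hu : u ∈ e.target) {k ν : R4} {μ : ℝ} (h : ∀ d, gForm S e u k d = μ * pair ν d) :
    k = μ • sharp S e u ν := by
  rw [← sub_eq_zero]
  refine (isLorentz_gForm S he hu).eq_zero_of_forall fun d => ?_
  simp only [map_sub, map_smul, LinearMap.sub_apply, LinearMap.smul_apply, smul_eq_mul,
    gForm_sharp S he hu, h, sub_self]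

/-- Cramer's rule: the adjugate is polynomial in the smooth components `g_{ij}`, and the determinant
does not vanish. -/
lemma contDiffOn_gUp (he : e ∈ IsManifold.maximalAtlas (𝓡 4) ∞ M) (i j : Fin 4) :
    ContDiffOn ℝ ∞ (fun u => S.gUp e u i j) e.target := by
  have hdet : ContDiffOn ℝ ∞ (fun u => (S.gDown e u).det) e.target := by
    simp only [Matrix.det_apply]
    refine ContDiffOn.sum fun σ _ => ?_
    exact (contDiffOn_prod fun k _ => contDiffOn_gDown S he _ _).const_smul _
  have hadj : ContDiffOn ℝ ∞ (fun u => (S.gDown e u).adjugate i j) e.target := by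
    simp only [Matrix.adjugate_apply, Matrix.det_apply]
    refine ContDiffOn.sum fun σ _ => ?_
    refine (contDiffOn_prod fun k _ => ?_).const_smul _
    by_cases hk : σ k = j
    · rw [hk]; simp only [Matrix.updateRow_self]; exact contDiffOn_const
    · simp only [Matrix.updateRow_ne hk]; exact contDiffOn_gDown S he _ _
  have : ∀ u ∈ e.target, S.gUp e u i j = ((S.gDown e u).det)⁻¹ * (S.gDown e u).adjugate i j := by
    intro u _
    rw [Spacetime.gUp, Matrix.inv_def, Ring.inverse_eq_inv', Matrix.smul_apply, smul_eq_mul]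
  exact ((hdet.inv fun u hu => gDown_det_ne_zero S he hu).mul hadj).congr this

lemma tendsto_sharp (he : e ∈ IsManifold.maximalAtlas (𝓡 4) ∞ M) {ι : Type*} {l : Filter ι}
    {u ν : ι → R4} {u₀ ν₀ : R4} (hu₀ : u₀ ∈ e.target) (hu : Tendsto u l (𝓝 u₀))
    (hν : Tendsto ν l (𝓝 ν₀)) :
    Tendsto (fun i => sharp S e (u i) (ν i)) l (𝓝 (sharp S e u₀ ν₀)) := by
  have h : Tendsto (fun i => (S.gUp e (u i)).mulVec (ν i)) l (𝓝 ((S.gUp e u₀).mulVec ν₀)) := by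
    rw [tendsto_pi_nhds]
    intro k
    simp only [Matrix.mulVec, dotProduct]
    refine tendsto_finsetSum _ fun j _ => ?_
    have h1 : Tendsto (fun i => S.gUp e (u i) k j) l (𝓝 (S.gUp e u₀ k j)) :=
      (((contDiffOn_gUp S he k j).continuousOn.continuousAt
        (e.open_target.mem_nhds hu₀)).tendsto).comp hu
    have h2 : Tendsto (fun i => ν i j) l (𝓝 (ν₀ j)) :=
      ((EuclideanSpace.proj (𝕜 := ℝ) j).continuous.tendsto ν₀).comp hν
    exact h1.mul h2
  exact ((PiLp.continuous_toLp 2 _).tendsto _).comp h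

lemma dzUp_eq_sharp (u : R4) : S.dzUp e u = sharp S e u (stdVec 3) := by
  ext i
  simp [Spacetime.dzUp, sharp_apply, stdVec]

lemma gUp_eq_sharp (u : R4) (i j : Fin 4) : S.gUp e u i j = sharp S e u (stdVec j) i := by
  simp [sharp_apply, stdVec]

lemma gUp_symm (u : R4) (i j : Fin 4) : S.gUp e u i j = S.gUp e u j i := by
  have h : (S.gDown e u).transpose = S.gDown e u := by
    ext i j; exact gDown_symm S u j i
  have : (S.gUp e u).transpose = S.gUp e u := by
    rw [Spacetime.gUp, Matrix.transpose_nonsing_inv, h]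
  exact congrFun (congrFun this j) i

end Chart

end Caustic
end

noncomputable section
namespace Caustic

set_option linter.unusedSectionVars false

/-! ### Points of the model space -/

/-- The point with given coordinates. -/
def pt (w x y z : ℝ) : R4 := !₂[w, x, y, z]

@[simp] lemma pt_zero (w x y z : ℝ) : pt w x y z 0 = w := rfl
@[simp] lemma pt_one (w x y z : ℝ) : pt w x y z 1 = x := rfl
@[simp] lemma pt_two (w x y z : ℝ) : pt w x y z 2 = y := rfl
@[simp] lemma pt_three (w x y z : ℝ) : pt w x y z 3 = z := rfl

lemma R4.ext_iff {u v : R4} : u = v ↔ u 0 = v 0 ∧ u 1 = v 1 ∧ u 2 = v 2 ∧ u 3 = v 3 := by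
  constructor
  · rintro rfl; exact ⟨rfl, rfl, rfl, rfl⟩
  · rintro ⟨h0, h1, h2, h3⟩
    ext i
    fin_cases i <;> assumption

lemma R4.ext {u v : R4} (h0 : u 0 = v 0) (h1 : u 1 = v 1) (h2 : u 2 = v 2) (h3 : u 3 = v 3) :
    u = v := R4.ext_iff.mpr ⟨h0, h1, h2, h3⟩

lemma pt_eta (u : R4) : pt (u 0) (u 1) (u 2) (u 3) = u := R4.ext rfl rfl rfl rfl

lemma creaseParam_eq (s : ℝ × ℝ) : creaseParam s = pt s.1 0 s.2 (s.2 ^ 2 / 4) := rfl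

lemma linePoint_eq (w : ℝ) : linePoint w = pt w 0 0 0 := rfl

lemma pt_zero_eq : pt 0 0 0 0 = 0 := R4.ext rfl rfl rfl rfl

@[simp] lemma stdVec_apply (i j : Fin 4) : stdVec i j = if j = i then 1 else 0 := by
  simp [stdVec]

lemma pt_eq_sum (w x y z : ℝ) :
    pt w x y z = w • stdVec 0 + x • stdVec 1 + y • stdVec 2 + z • stdVec 3 := by
  apply R4.ext <;> simp

lemma continuous_coord (i : Fin 4) : Continuous fun u : R4 => u i :=
  (EuclideanSpace.proj (𝕜 := ℝ) i).continuous

lemma continuous_pt {α : Type*} [TopologicalSpace α] {f g h k : α → ℝ} (hf : Continuous f)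
    (hg : Continuous g) (hh : Continuous h) (hk : Continuous k) :
    Continuous fun t => pt (f t) (g t) (h t) (k t) := by
  simp only [pt_eq_sum]; fun_prop

lemma contDiffAt_pt {E : Type*} [NormedAddCommGroup E] [NormedSpace ℝ E] {n : WithTop ℕ∞}
    {f g h k : E → ℝ} {x : E} (hf : ContDiffAt ℝ n f x) (hg : ContDiffAt ℝ n g x)
    (hh : ContDiffAt ℝ n h x) (hk : ContDiffAt ℝ n k x) :
    ContDiffAt ℝ n (fun t => pt (f t) (g t) (h t) (k t)) x := by
  simp only [pt_eq_sum]; fun_prop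

lemma hasDerivWithinAt_pt {f g h k : ℝ → ℝ} {f' g' h' k' t : ℝ} {s : Set ℝ}
    (hf : HasDerivWithinAt f f' s t) (hg : HasDerivWithinAt g g' s t)
    (hh : HasDerivWithinAt h h' s t) (hk : HasDerivWithinAt k k' s t) :
    HasDerivWithinAt (fun t => pt (f t) (g t) (h t) (k t)) (pt f' g' h' k') s t := by
  simp only [pt_eq_sum]
  exact (((hf.smul_const _).add (hg.smul_const _)).add (hh.smul_const _)).add (hk.smul_const _)

lemma hasDerivWithinAt_coord {f : ℝ → R4} {f' : R4} {s : Set ℝ} {t : ℝ}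
    (h : HasDerivWithinAt f f' s t) (i : Fin 4) : HasDerivWithinAt (fun r => f r i) (f' i) s t :=
  (EuclideanSpace.proj (𝕜 := ℝ) i).hasFDerivAt.comp_hasDerivWithinAt t h

lemma hasDerivAt_coord {f : ℝ → R4} {f' : R4} {t : ℝ}
    (h : HasDerivAt f f' t) (i : Fin 4) : HasDerivAt (fun r => f r i) (f' i) t :=
  (EuclideanSpace.proj (𝕜 := ℝ) i).hasFDerivAt.comp_hasDerivAt t h

lemma abs_coord_le (u : R4) (i : Fin 4) : |u i| ≤ ‖u‖ := by
  simpa using PiLp.norm_apply_le u i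

/-- A cube with centre at the origin. -/
def cube (R : ℝ) : Set R4 := {u | ∀ i, |u i| < R}

lemma ball_subset_cube (R : ℝ) : Metric.ball (0 : R4) R ⊆ cube R := fun u hu i =>
  (abs_coord_le u i).trans_lt (by simpa using hu)

lemma cube_subset_ball {R : ℝ} (hR : 0 < R) : cube R ⊆ Metric.ball (0 : R4) (2 * R) := by
  intro u hu
  rw [mem_ball_zero_iff, EuclideanSpace.norm_eq, Real.sqrt_lt' (by positivity)]
  have : ∀ i, ‖u i‖ ^ 2 < R ^ 2 := fun i => by
    rw [Real.norm_eq_abs]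
    exact pow_lt_pow_left₀ (hu i) (abs_nonneg _) two_ne_zero
  rw [Fin.sum_univ_four]
  nlinarith [this 0, this 1, this 2, this 3]

lemma isOpen_cube (R : ℝ) : IsOpen (cube R) := by
  have : cube R = ⋂ i, {u : R4 | |u i| < R} := by ext; simp [cube]
  rw [this]
  exact isOpen_iInter_of_finite fun i => isOpen_lt (continuous_coord i).abs continuous_const

lemma convex_cube (R : ℝ) : Convex ℝ (cube R) := by
  have : cube R = ⋂ i : Fin 4, {u : R4 | |u i| < R} := by ext; simp [cube]
  rw [this]
  refine convex_iInter fun i => ?_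
  have h : {u : R4 | |u i| < R} = (EuclideanSpace.proj (𝕜 := ℝ) i : R4 →L[ℝ] ℝ).toLinearMap ⁻¹' Metric.ball 0 R := by
    ext u; simp
  rw [h]
  exact (convex_ball _ _).linear_preimage _

lemma pt_mem_cube {R w x y z : ℝ} (hw : |w| < R) (hx : |x| < R) (hy : |y| < R) (hz : |z| < R) :
    pt w x y z ∈ cube R := by
  intro i; fin_cases i <;> assumption

/-! ### Local consequences of achronality -/

variable {M : Type*} [TopologicalSpace M] [ChartedSpace R4 M] [IsManifold (𝓡 4) ∞ M]
variable {S : Spacetime M} {e : OpenPartialHomeomorph M R4} {H : Set M}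

lemma chartD_velocity (he : e ∈ IsManifold.maximalAtlas (𝓡 4) ∞ M) {c : ℝ → R4} {c' : R4} {t : ℝ}
    (hc : HasDerivAt c c' t) (ht : c t ∈ e.target) :
    chartD e (e.symm (c t)) (velocity (fun s => e.symm (c s)) t) = c' := by
  have h1 : MDifferentiableAt 𝓘(ℝ, ℝ) (𝓡 4) (fun s => e.symm (c s)) t :=
    ((mdifferentiable_of_mem_maximalAtlas he).mdifferentiableAt_symm ht).comp t
      hc.differentiableAt.mdifferentiableAt
  have h2 := hasDerivAt_chart he h1 (e.map_target ht)
  refine h2.unique (hc.congr_of_eventuallyEq ?_)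
  filter_upwards [hc.continuousAt.eventually_mem (e.open_target.mem_nhds ht)] with s hs
  exact e.right_inv hs

lemma chronological_segment (he : e ∈ IsManifold.maximalAtlas (𝓡 4) ∞ M) {v d : R4}
    (hsub : ∀ s ∈ Icc (0 : ℝ) 1, v + s • d ∈ e.target)
    (ht : ∀ s ∈ Icc (0 : ℝ) 1, gForm S e (v + s • d) d d < 0)
    (hf : ∀ s ∈ Icc (0 : ℝ) 1, gForm S e (v + s • d) (futureCoord S e (v + s • d)) d < 0) :
    S.Chronological (e.symm v) (e.symm (v + d)) := by
  refine ⟨fun s => e.symm (v + s • d), by simp, by simp, fun s hs => ⟨?_, ?_⟩⟩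
  · have h1 : ContMDiffAt (𝓡 4) (𝓡 4) 1 e.symm (v + s • d) :=
      ((contMDiffOn_symm_of_mem_maximalAtlas he).contMDiffAt
        (e.open_target.mem_nhds (hsub s hs))).of_le (by simp)
    have h2 : ContDiff ℝ 1 (fun s : ℝ => v + s • d) := by fun_prop
    exact h1.comp s h2.contMDiff.contMDiffAt
  · have hd : HasDerivAt (fun s : ℝ => v + s • d) d s := by
      simpa using ((hasDerivAt_id s).smul_const d).const_add v
    rw [isFutureTimelike_iff S he (e.map_target (hsub s hs)), chartD_velocity he hd (hsub s hs),
      e.right_inv (hsub s hs)]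
    exact ⟨ht s hs, hf s hs⟩

/-- Near a point, coordinate segments whose direction is close to a timelike vector do not join
points of an achronal set. -/
lemma achronal_local (he : e ∈ IsManifold.maximalAtlas (𝓡 4) ∞ M) (hH : S.IsAchronal H) {u₀ c₀ : R4}
    (hu₀ : u₀ ∈ e.target) (hc₀ : gForm S e u₀ c₀ c₀ < 0) :
    ∃ ρ > 0, Metric.ball u₀ ρ ⊆ e.target ∧ ∀ v ∈ Metric.ball u₀ ρ, ∀ c ∈ Metric.ball c₀ ρ,
      ∀ s : ℝ, 0 < s → v + s • c ∈ Metric.ball u₀ ρ → e.symm v ∈ H → e.symm (v + s • c) ∉ H := by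
  have hL := isLorentz_gForm S he hu₀
  have hne : gForm S e u₀ (futureCoord S e u₀) c₀ ≠ 0 :=
    hL.ne_zero_of_causal (futureCoord_timelike S he hu₀) (by rintro rfl; simp at hc₀) hc₀.le
  have h1 : Tendsto (fun r : R4 × R4 => gForm S e r.1 r.2 r.2) (𝓝 (u₀, c₀))
      (𝓝 (gForm S e u₀ c₀ c₀)) :=
    tendsto_gForm S he hu₀ continuousAt_fst continuousAt_snd continuousAt_snd
  have h2 : Tendsto (fun r : R4 × R4 => gForm S e r.1 (futureCoord S e r.1) r.2) (𝓝 (u₀, c₀))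
      (𝓝 (gForm S e u₀ (futureCoord S e u₀) c₀)) :=
    tendsto_gForm S he hu₀ continuousAt_fst
      (((continuousOn_futureCoord S he).continuousAt (e.open_target.mem_nhds hu₀)).tendsto.comp
        continuousAt_fst) continuousAt_snd
  have ev1 := h1.eventually (gt_mem_nhds hc₀)
  have ev3 : ∀ᶠ r : R4 × R4 in 𝓝 (u₀, c₀), r.1 ∈ e.target :=
    continuousAt_fst.eventually_mem (e.open_target.mem_nhds hu₀)
  have segment_mem : ∀ {ρ : ℝ} {v d : R4} (_ : v ∈ Metric.ball u₀ ρ)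
      (_ : v + d ∈ Metric.ball u₀ ρ), ∀ s ∈ Icc (0 : ℝ) 1, v + s • d ∈ Metric.ball u₀ ρ := by
    intro ρ v d hv hd s hs
    have := (convex_ball u₀ ρ).add_smul_sub_mem hv hd hs
    simpa using this
  -- A timelike direction is future- or past-directed and keeps its type nearby. In the
  -- past-directed case the segment is traversed backwards, so achronality applies in both cases.
  rcases lt_or_gt_of_ne hne with hneg | hpos
  · obtain ⟨ρ, hρ, hb⟩ := Metric.eventually_nhds_iff_ball.mp
      (ev1.and ((h2.eventually (gt_mem_nhds hneg)).and ev3))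
    rw [← ball_prod_same] at hb
    refine ⟨ρ, hρ, fun v hv => (hb (v, c₀) ⟨hv, Metric.mem_ball_self hρ⟩).2.2, ?_⟩
    intro v hv c hc s hs hv' hvH hvH'
    have key := fun r hr => hb (v + r • (s • c), c) ⟨segment_mem hv hv' r hr, hc⟩
    refine hH _ hvH _ hvH' (chronological_segment he (fun r hr => (key r hr).2.2)
      (fun r hr => ?_) (fun r hr => ?_))
    · have h3 := (key r hr).1
      simp only [map_smul, LinearMap.smul_apply, smul_eq_mul] at h3 ⊢
      exact mul_neg_of_pos_of_neg hs (mul_neg_of_pos_of_neg hs h3)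
    · have h3 := (key r hr).2.1
      simp only [map_smul, smul_eq_mul] at h3 ⊢
      exact mul_neg_of_pos_of_neg hs h3
  · obtain ⟨ρ, hρ, hb⟩ := Metric.eventually_nhds_iff_ball.mp
      (ev1.and ((h2.eventually (lt_mem_nhds hpos)).and ev3))
    rw [← ball_prod_same] at hb
    refine ⟨ρ, hρ, fun v hv => (hb (v, c₀) ⟨hv, Metric.mem_ball_self hρ⟩).2.2, ?_⟩
    intro v hv c hc s hs hv' hvH hvH'
    have hback : v + s • c + -(s • c) = v := by simp
    have key := fun r hr => hb (v + s • c + r • (-(s • c)), c)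
      ⟨segment_mem hv' (hback.symm ▸ hv) r hr, hc⟩
    have hchr : S.Chronological (e.symm (v + s • c)) (e.symm (v + s • c + -(s • c))) := by
      refine chronological_segment he (fun r hr => (key r hr).2.2)
        (fun r hr => ?_) (fun r hr => ?_)
      · have h3 := (key r hr).1
        simp only [map_smul, map_neg, LinearMap.neg_apply, LinearMap.smul_apply, smul_eq_mul]
          at h3 ⊢
        have := mul_neg_of_pos_of_neg hs (mul_neg_of_pos_of_neg hs h3)
        linarith
      · have h3 := (key r hr).2.1
        simp only [map_smul, map_neg, smul_eq_mul] at h3 ⊢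
        exact neg_neg_of_pos (mul_pos hs h3)
    rw [hback] at hchr
    exact hH _ hvH' _ hvH hchr

/-- One-sided tangent vectors of an achronal set are not timelike. -/
lemma tangent_nonneg (he : e ∈ IsManifold.maximalAtlas (𝓡 4) ∞ M) (hH : S.IsAchronal H) {f : ℝ → R4}
    {c : R4} {t : ℝ} (hu : f t ∈ e.target) (hf : HasDerivWithinAt f c (Ioi t) t)
    (hmem : e.symm (f t) ∈ H)
    (hev : ∀ᶠ s in 𝓝[>] t, e.symm (f s) ∈ H) : 0 ≤ gForm S e (f t) c c := by
  by_contra hneg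
  obtain ⟨ρ, hρ, -, hb⟩ := achronal_local he hH hu (not_le.mp hneg)
  have h1 := (hasDerivWithinAt_iff_tendsto_slope' (by simp)).mp hf
  have h2 := h1.eventually_mem (Metric.ball_mem_nhds c hρ)
  have h3 : ∀ᶠ s in 𝓝[>] t, f s ∈ Metric.ball (f t) ρ :=
    hf.continuousWithinAt.eventually_mem (Metric.ball_mem_nhds _ hρ)
  obtain ⟨s, hs, hs2, hs3, hst⟩ := (hev.and (h2.and (h3.and self_mem_nhdsWithin))).exists
  have hst : 0 < s - t := sub_pos.mpr hst
  -- The chord from `f t` to `f s` is a positive multiple of the slope, which is eventually close to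
  -- the timelike vector `c`.
  have e1 : f t + (s - t) • slope f t s = f s := by
    rw [sub_smul_slope, vsub_eq_sub]; abel
  exact hb (f t) (Metric.mem_ball_self hρ) _ hs2 _ hst (by rwa [e1]) hmem (by rwa [e1])

/-! ### Local separation by a hypersurface -/

/-- `ψ` is the defining coordinate of the hypersurface chart, transported to `e`. Moving from the
given point along this coordinate in either direction shows both signs arbitrarily close to it. -/
lemma exists_separating (hH : Spacetime.IsTopologicalHypersurface H) {u₀ : R4} (hu₀ : u₀ ∈ e.target)
    (hmem : e.symm u₀ ∈ H) : ∃ (Ω : Set R4) (ψ : R4 → ℝ), IsOpen Ω ∧ u₀ ∈ Ω ∧ Ω ⊆ e.target ∧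
      ContinuousOn ψ Ω ∧ (∀ u ∈ Ω, e.symm u ∈ H ↔ ψ u = 0) ∧
      (∃ᶠ u in 𝓝 u₀, 0 < ψ u) ∧ ∃ᶠ u in 𝓝 u₀, ψ u < 0 := by
  obtain ⟨φ, hx, hφ⟩ := hH _ hmem
  set x := e.symm u₀ with hxdef
  have hfreq : ∀ σ : ℝ, σ ≠ 0 → ∃ᶠ u in 𝓝 u₀, ∃ r > 0, φ (e.symm u) 0 = r * σ := by
    intro σ hσ
    have hφx : φ x 0 = 0 := (hφ x hx).mp hmem
    have ht : Tendsto (fun r : ℝ => e (φ.symm (φ x + (r * σ) • stdVec 0))) (𝓝[>] 0) (𝓝 u₀) := by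
      have h1 : Tendsto (fun r : ℝ => φ x + (r * σ) • stdVec 0) (𝓝[>] 0) (𝓝 (φ x)) := by
        have : Continuous fun r : ℝ => φ x + (r * σ) • stdVec 0 := by fun_prop
        have := this.tendsto 0
        simp only [zero_mul, zero_smul, add_zero] at this
        exact this.mono_left nhdsWithin_le_nhds
      have h2 := (φ.continuousAt_symm (φ.map_source hx)).tendsto.comp h1
      rw [φ.left_inv hx] at h2
      have h3 := (e.continuousAt (e.map_target hu₀)).tendsto
      rw [e.right_inv hu₀] at h3
      exact h3.comp h2
    refine ht.frequently (Eventually.frequently ?_)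
    have h1 : Tendsto (fun r : ℝ => φ x + (r * σ) • stdVec 0) (𝓝[>] 0) (𝓝 (φ x)) := by
      have : Continuous fun r : ℝ => φ x + (r * σ) • stdVec 0 := by fun_prop
      have := this.tendsto 0
      simp only [zero_mul, zero_smul, add_zero] at this
      exact this.mono_left nhdsWithin_le_nhds
    have h2 := (φ.continuousAt_symm (φ.map_source hx)).tendsto.comp h1
    rw [φ.left_inv hx] at h2
    filter_upwards [h1.eventually_mem (φ.open_target.mem_nhds (φ.map_source hx)),
      h2.eventually_mem (e.open_source.mem_nhds (e.map_target hu₀)), self_mem_nhdsWithin]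
      with r hr1 hr2 hr3
    refine ⟨r, hr3, ?_⟩
    rw [e.left_inv (show φ.symm (φ x + (r * σ) • stdVec 0) ∈ e.source from hr2), φ.right_inv hr1]
    simp [hφx]
  refine ⟨e.target ∩ e.symm ⁻¹' φ.source, fun u => φ (e.symm u) 0,
    e.symm.isOpen_inter_preimage φ.open_source, ⟨hu₀, hx⟩, inter_subset_left, ?_, ?_, ?_, ?_⟩
  · exact (continuous_coord 0).comp_continuousOn
      (φ.continuousOn.comp (e.continuousOn_symm.mono inter_subset_left) fun u hu => hu.2)
  · intro u hu; exact hφ _ hu.2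
  · refine (hfreq 1 one_ne_zero).mono ?_
    rintro u ⟨r, hr, h⟩; simp only [h]; simpa using hr
  · refine (hfreq (-1) (by norm_num)).mono ?_
    rintro u ⟨r, hr, h⟩; simp only [h]; simpa using hr

/-- A parallel segment through a nearby point with `ψ < 0` still has positive ends. By the
intermediate value theorem it contains two zeros of `ψ`, that is, two points of the set on one
timelike segment. -/
lemma ne_sign_of_achronal {Ω : Set R4} {ψ : R4 → ℝ} {u₀ T : R4} {ρ k : ℝ}
    (hψ : ContinuousOn ψ Ω) (hΩ : Metric.ball u₀ ρ ⊆ Ω)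
    (hach : ∀ v ∈ Metric.ball u₀ ρ, ∀ s : ℝ, 0 < s → v + s • T ∈ Metric.ball u₀ ρ →
      ψ v = 0 → ψ (v + s • T) ≠ 0)
    (hfreq : ∃ᶠ u in 𝓝 u₀, ψ u < 0) (hk : 0 < k) (hp : u₀ + k • T ∈ Metric.ball u₀ ρ)
    (hm : u₀ - k • T ∈ Metric.ball u₀ ρ) (h1 : 0 < ψ (u₀ + k • T)) (h2 : 0 < ψ (u₀ - k • T)) :
    False := by
  have hopen : IsOpen (Metric.ball u₀ ρ) := Metric.isOpen_ball
  have hc : ContinuousOn ψ (Metric.ball u₀ ρ) := hψ.mono hΩ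
  have hadd : Tendsto (fun s : R4 => s + k • T) (𝓝 u₀) (𝓝 (u₀ + k • T)) :=
    (continuous_id.add continuous_const).tendsto _
  have hsub : Tendsto (fun s : R4 => s - k • T) (𝓝 u₀) (𝓝 (u₀ - k • T)) :=
    (continuous_id.sub continuous_const).tendsto _
  have e1 := hadd.eventually ((hc.continuousAt (hopen.mem_nhds hp)).eventually (lt_mem_nhds h1))
  have e2 := hsub.eventually ((hc.continuousAt (hopen.mem_nhds hm)).eventually (lt_mem_nhds h2))
  have e3 := hadd.eventually_mem (hopen.mem_nhds hp)
  have e4 := hsub.eventually_mem (hopen.mem_nhds hm)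
  obtain ⟨s, hs, s1, s2, s3, s4⟩ := (hfreq.and_eventually (e1.and (e2.and (e3.and e4)))).exists
  have hseg : ∀ t ∈ Icc (-k) k, s + t • T ∈ Metric.ball u₀ ρ := by
    intro t ht
    have := (convex_ball u₀ ρ).add_smul_sub_mem s4 s3 (t := (t + k) / (2 * k))
      ⟨div_nonneg (by linarith [ht.1]) (by linarith), by
        rw [div_le_one (by linarith)]; linarith [ht.2]⟩
    convert this using 1
    have h2k : (t + k) / (2 * k) * (2 * k) = t + k := by field_simp
    have : (s + k • T - (s - k • T)) = (2 * k) • T := by module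
    rw [this, smul_smul, h2k]; module
  have hcont : ContinuousOn (fun t : ℝ => ψ (s + t • T)) (Icc (-k) k) :=
    hc.comp (by fun_prop) hseg
  have z1 : (0 : ℝ) ∈ (fun t : ℝ => ψ (s + t • T)) '' Icc 0 k := by
    refine intermediate_value_Icc hk.le (hcont.mono (Icc_subset_Icc (by linarith) le_rfl)) ⟨?_, ?_⟩
    · simpa using hs.le
    · exact s1.le
  have z2 : (0 : ℝ) ∈ (fun t : ℝ => ψ (s + t • T)) '' Icc (-k) 0 := by
    refine intermediate_value_Icc' (by linarith)
      (hcont.mono (Icc_subset_Icc le_rfl (by linarith))) ⟨?_, ?_⟩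
    · simpa using hs.le
    · simpa [sub_eq_add_neg] using s2.le
  obtain ⟨t1, ht1, z1⟩ := z1
  obtain ⟨t2, ht2, z2⟩ := z2
  simp only at z1 z2
  have hne : t1 ≠ t2 := by
    rintro rfl
    have : t1 = 0 := le_antisymm ht2.2 ht1.1
    subst this
    simp only [zero_smul, add_zero] at z1
    linarith
  have hlt : 0 < t1 - t2 := sub_pos.mpr (lt_of_le_of_ne (ht2.2.trans ht1.1) (Ne.symm hne))
  have e5 : s + t2 • T + (t1 - t2) • T = s + t1 • T := by module
  exact hach _ (hseg t2 ⟨ht2.1, by linarith [ht2.2]⟩) _ hlt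
    (by rw [e5]; exact hseg t1 ⟨by linarith [ht1.1], ht1.2⟩) z2 (by rw [e5]; exact z1)

lemma pos_iff_of_isPreconnected {Ω C : Set R4} {ψ : R4 → ℝ} (hψ : ContinuousOn ψ Ω) (hC : C ⊆ Ω)
    (hpre : IsPreconnected C) (hne : ∀ u ∈ C, ψ u ≠ 0) {a b : R4} (ha : a ∈ C) (hb : b ∈ C) :
    0 < ψ a ↔ 0 < ψ b := by
  have key : ∀ a ∈ C, ∀ b ∈ C, 0 < ψ a → 0 < ψ b := by
    intro a ha b hb h
    by_contra hn
    obtain ⟨c, hc, h0⟩ := hpre.intermediate_value hb ha (hψ.mono hC) ⟨not_lt.mp hn, h.le⟩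
    exact hne c hc h0
  exact ⟨key a ha b hb, key b hb a ha⟩

end Caustic
end

noncomputable section
namespace Caustic

set_option linter.unusedSectionVars false

/-! ### The horizon is the upper sheet of the swallowtail -/

variable {M : Type*} [TopologicalSpace M] [ChartedSpace R4 M] [IsManifold (𝓡 4) ∞ M]
variable {S : Spacetime M} {e : OpenPartialHomeomorph M R4} {H : Set M} {p : M}

lemma horizon_subset_bigWavefront (hH : S.IsFutureHorizon H) : H ⊆ S.bigWavefront H := by
  intro x hx
  obtain ⟨γ, J, t₀, hg, rfl⟩ := hH.ruled x hx
  exact ⟨γ, J, t₀, hg, t₀, hg.mem, rfl⟩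

lemma swallowtail_of_mem_horizon (hH : S.IsFutureHorizon H) (he : S.IsA3Chart H p e) {v : R4}
    (hv : v ∈ e.target) (hvH : e.symm v ∈ H) : swallowtail (v 1) (v 2) (v 3) :=
  (he.wavefront v hv).mp (horizon_subset_bigWavefront hH hvH)

lemma zero_mem_target (he : S.IsA3Chart H p e) : (0 : R4) ∈ e.target := by
  rw [← he.map_zero]; exact e.map_source he.mem_source

lemma symm_zero (he : S.IsA3Chart H p e) : e.symm 0 = p := by
  rw [← he.map_zero]; exact e.left_inv he.mem_source

/-- There are timelike vectors at the origin of the chart that are transverse to `z = 0`. -/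
lemma exists_timelike_transverse (he : S.IsA3Chart H p e) :
    ∃ T : R4, gForm S e 0 T T < 0 ∧ 0 < T 3 := by
  have h0 := zero_mem_target he
  obtain ⟨T, hT⟩ := (isLorentz_gForm S he.mem_atlas h0).exists_timelike
  rcases lt_trichotomy (T 3) 0 with h | h | h
  · exact ⟨-T, by simpa using hT, by simpa using h⟩
  · have ht : Tendsto (fun s : ℝ => gForm S e 0 (T + s • stdVec 3) (T + s • stdVec 3)) (𝓝[>] 0)
        (𝓝 (gForm S e 0 T T)) := by
      have h1 : Tendsto (fun s : ℝ => T + s • stdVec 3) (𝓝[>] 0) (𝓝 T) := by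
        have : Continuous fun s : ℝ => T + s • stdVec 3 := by fun_prop
        have := this.tendsto 0
        simp only [zero_smul, add_zero] at this
        exact this.mono_left nhdsWithin_le_nhds
      exact tendsto_gForm S he.mem_atlas h0 tendsto_const_nhds h1 h1
    obtain ⟨s, hs, hs0⟩ := ((ht.eventually (gt_mem_nhds hT)).and self_mem_nhdsWithin).exists
    exact ⟨_, hs, by simpa [h] using hs0⟩
  · exact ⟨T, hT, h⟩

/-- The strict epigraph of a convex function over a cube. Convexity serves to make the region above
the wavefront connected. -/
lemma convex_above (R : ℝ) : Convex ℝ {u : R4 | u ∈ cube R ∧ maxGen (u 1, u 2) < u 3} := by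
  intro u hu v hv α β hα hβ hαβ
  refine ⟨convex_cube R hu.1 hv.1 hα hβ hαβ, ?_⟩
  have h1 := convexOn_maxGen.2 (mem_univ (u 1, u 2)) (mem_univ (v 1, v 2)) hα hβ hαβ
  have h2 : α • (u 1, u 2) + β • (v 1, v 2) = ((α • u + β • v) 1, (α • u + β • v) 2) := by simp
  rw [h2] at h1
  refine lt_of_le_of_lt h1 ?_
  have h3 : (α • u + β • v) 3 = α * u 3 + β * v 3 := by simp
  rw [h3]
  simp only [smul_eq_mul]
  rcases hα.eq_or_lt with h | h
  · have : β = 1 := by linarith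
    rw [← h, this]; linarith [hv.2]
  · have a1 := mul_lt_mul_of_pos_left hu.2 h
    have a2 := mul_le_mul_of_nonneg_left hv.2.le hβ
    linarith

/-- The region below the graph of a concave function of `y`. By `swallowtail.neg_sq_le` it contains
no points of the wavefront. -/
lemma convex_below (R : ℝ) : Convex ℝ {u : R4 | u ∈ cube R ∧ u 3 < -(u 2 ^ 2 / 12)} := by
  intro u hu v hv α β hα hβ hαβ
  refine ⟨convex_cube R hu.1 hv.1 hα hβ hαβ, ?_⟩
  have h3 : (α • u + β • v) 3 = α * u 3 + β * v 3 := by simp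
  have h2 : (α • u + β • v) 2 = α * u 2 + β * v 2 := by simp
  rw [h3, h2]
  have hβ' : β = 1 - α := by linarith
  have key : (α * u 2 + β * v 2) ^ 2 ≤ α * u 2 ^ 2 + β * v 2 ^ 2 := by
    have : α * u 2 ^ 2 + β * v 2 ^ 2 - (α * u 2 + β * v 2) ^ 2 = α * β * (u 2 - v 2) ^ 2 := by
      rw [hβ']; ring
    nlinarith [mul_nonneg (mul_nonneg hα hβ) (sq_nonneg (u 2 - v 2))]
  have hu2 := hu.2
  have hv2 := hv.2
  rcases hα.eq_or_lt with h | h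
  · have : β = 1 := by linarith
    rw [← h, this]; linarith
  · have a1 := mul_lt_mul_of_pos_left hu2 h
    have a2 := mul_le_mul_of_nonneg_left hv2.le hβ
    linarith

/-- `maxGen` and its derivative vanish at the origin, so its value along the line is `o(k)`, while
the height grows linearly. -/
lemma eventually_maxGen_line (T : R4) (hT : 0 < T 3) :
    ∀ᶠ k in 𝓝[>] (0 : ℝ), maxGen (k * T 1, k * T 2) < k * T 3 := by
  have h0 : HasFDerivAt maxGen (0 : ℝ × ℝ →L[ℝ] ℝ) ((0 : ℝ) * T 1, (0 : ℝ) * T 2) := by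
    have := maxGen_hasFDerivAt (a := 0) (y := 0) (Or.inr ⟨rfl, rfl⟩)
    simpa using this
  have h1 : HasDerivAt (fun k : ℝ => (k * T 1, k * T 2)) (T 1, T 2) 0 := by
    have := ((hasDerivAt_id (0 : ℝ)).mul_const (T 1)).prodMk ((hasDerivAt_id (0 : ℝ)).mul_const (T 2))
    simpa using this
  have h2 : HasDerivAt (fun k : ℝ => maxGen (k * T 1, k * T 2)) 0 0 := by
    exact (h0.comp_hasDerivAt (0 : ℝ) h1).congr_deriv rfl
  have h3 := (hasDerivAt_iff_tendsto_slope.mp h2).mono_left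
    (nhdsWithin_mono (0 : ℝ) (fun x (hx : x ∈ Ioi 0) => ne_of_gt hx))
  filter_upwards [h3.eventually (gt_mem_nhds hT), self_mem_nhdsWithin] with k hk hk0
  have hk0 : 0 < k := hk0
  rw [slope_def_field, div_lt_iff₀ (by simpa using hk0)] at hk
  simp only [zero_mul, maxGen_zero, sub_zero] at hk
  linarith

/-- The upper sheet of the swallowtail is contained in the horizon. -/
lemma exists_graph_subset_horizon (hH : S.IsFutureHorizon H) (he : S.IsA3Chart H p e) {T : R4}
    (hT : gForm S e 0 T T < 0) (hT3 : 0 < T 3) :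
    ∃ r > 0, cube r ⊆ e.target ∧
      ∀ w x y : ℝ, |w| < r → |x| < r → |y| < r → e.symm (pt w x y (maxGen (x, y))) ∈ H := by
  have h0 := zero_mem_target he
  have h0H : e.symm 0 ∈ H := by rw [symm_zero he]; exact he.mem_horizon
  obtain ⟨Ω, ψ, hΩo, h0Ω, hΩt, hψ, hψH, hfp, hfn⟩ := exists_separating hH.hypersurface h0 h0H
  obtain ⟨ρ₀, hρ₀, -, hach⟩ := achronal_local he.mem_atlas hH.achronal h0 hT
  obtain ⟨ρ₁, hρ₁, hball⟩ := Metric.isOpen_iff.mp hΩo 0 h0Ω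
  set ρ := min ρ₀ ρ₁ with hρdef
  have hρ : 0 < ρ := lt_min hρ₀ hρ₁
  have hbΩ : Metric.ball (0 : R4) ρ ⊆ Ω := (Metric.ball_subset_ball (min_le_right _ _)).trans hball
  set R := min (ρ / 2) 1 with hRdef
  have hR : 0 < R := lt_min (by positivity) one_pos
  have hR1 : R ≤ 1 := min_le_right _ _
  have hcb : cube R ⊆ Metric.ball (0 : R4) ρ := (cube_subset_ball hR).trans
    (Metric.ball_subset_ball (by have := min_le_left (ρ / 2) 1; linarith))
  have hcΩ : cube R ⊆ Ω := hcb.trans hbΩ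
  -- points of the cube off the swallowtail
  have hoff : ∀ u ∈ cube R, ¬ swallowtail (u 1) (u 2) (u 3) → ψ u ≠ 0 := fun u hu hs h =>
    hs (swallowtail_of_mem_horizon hH he (hΩt (hcΩ hu)) ((hψH u (hcΩ hu)).mpr h))
  -- a scale at which the timelike line through the origin is on both sides
  obtain ⟨k, hk1, hk2, hk3, hk4, hk0⟩ : ∃ k : ℝ, maxGen (k * T 1, k * T 2) < k * T 3 ∧
      k * T 2 ^ 2 < T 3 ∧ k • T ∈ cube R ∧ -(k • T) ∈ cube R ∧ 0 < k := by
    have c1 : Tendsto (fun k : ℝ => k * T 2 ^ 2) (𝓝[>] 0) (𝓝 0) := by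
      have : Continuous fun k : ℝ => k * T 2 ^ 2 := by fun_prop
      have := this.tendsto 0
      rw [zero_mul] at this
      exact this.mono_left nhdsWithin_le_nhds
    have c2 : Tendsto (fun k : ℝ => k • T) (𝓝[>] 0) (𝓝 0) := by
      have : Continuous fun k : ℝ => k • T := by fun_prop
      have := this.tendsto 0
      rw [zero_smul] at this
      exact this.mono_left nhdsWithin_le_nhds
    have c3 : Tendsto (fun k : ℝ => -(k • T)) (𝓝[>] 0) (𝓝 0) := by simpa using c2.neg
    have hn : cube R ∈ 𝓝 (0 : R4) := (isOpen_cube R).mem_nhds (fun i => by simpa using hR)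
    exact ((eventually_maxGen_line T hT3).and ((c1.eventually (gt_mem_nhds hT3)).and
      ((c2.eventually_mem hn).and ((c3.eventually_mem hn).and self_mem_nhdsWithin)))).exists
  -- `k T` lies above the upper sheet and `-k T` below the parabolic cylinder, so neither is in the
  -- horizon. Equal signs are excluded by `ne_sign_of_achronal`, applied to `-ψ` if both are
  -- negative.
  have hopp : ¬ (0 < ψ (k • T) ↔ 0 < ψ (-(k • T))) := by
    have hachψ : ∀ v ∈ Metric.ball (0 : R4) ρ, ∀ s : ℝ, 0 < s → v + s • T ∈ Metric.ball (0 : R4) ρ →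
        ψ v = 0 → ψ (v + s • T) ≠ 0 := by
      intro v hv s hs hv' h1 h2
      have m := Metric.ball_subset_ball (x := (0 : R4)) (min_le_left ρ₀ ρ₁)
      exact hach v (m hv) T (Metric.mem_ball_self hρ₀) s hs (m hv') ((hψH v (hbΩ hv)).mpr h1)
        ((hψH _ (hbΩ hv')).mpr h2)
    have n1 : ψ (k • T) ≠ 0 := by
      refine hoff _ hk3 fun hs => ?_
      have := hs.le_maxGen
      simp only [PiLp.smul_apply, smul_eq_mul] at this
      linarith
    have n2 : ψ (-(k • T)) ≠ 0 := by
      refine hoff _ hk4 fun hs => ?_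
      have := hs.neg_sq_le
      simp only [PiLp.smul_apply, PiLp.neg_apply, smul_eq_mul, neg_sq] at this
      have := mul_lt_mul_of_pos_left hk2 hk0
      nlinarith
    intro hiff
    rcases lt_or_gt_of_ne n1 with h | h
    · have h' : ψ (-(k • T)) < 0 := by
        rcases lt_or_gt_of_ne n2 with h' | h'
        · exact h'
        · exact absurd (hiff.mpr h') (not_lt.mpr h.le)
      refine ne_sign_of_achronal (Ω := Ω) (ψ := fun u => -ψ u) (u₀ := 0) (T := T) (ρ := ρ) (k := k)
        hψ.neg hbΩ (fun v hv s hs hv' h1 h2 => hachψ v hv s hs hv' (by simpa using h1) (by simpa using h2))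
        (hfp.mono fun u hu => by simpa using hu) hk0 (by simpa using hcb hk3)
        (by simpa using hcb hk4) (by simpa using h) (by simpa using h')
    · have h' := hiff.mp h
      exact ne_sign_of_achronal (Ω := Ω) (ψ := ψ) (u₀ := 0) (T := T) (ρ := ρ) (k := k)
        hψ hbΩ hachψ hfn hk0 (by simpa using hcb hk3)
        (by simpa using hcb hk4) (by simpa using h) (by simpa using h')
  -- a scale at which the graph stays in the cube
  obtain ⟨r, hr0, hrR, hrZ⟩ : ∃ r > 0, r ≤ R ∧ ∀ x y : ℝ, |x| < r → |y| < r → maxGen (x, y) < R / 2 := by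
    have hc := continuous_maxGen.tendsto (0, 0)
    rw [maxGen_zero] at hc
    obtain ⟨r, hr, hb⟩ := Metric.eventually_nhds_iff_ball.mp
      (hc.eventually (gt_mem_nhds (show (0 : ℝ) < R / 2 by positivity)))
    refine ⟨min r R, lt_min hr hR, min_le_right _ _, fun x y hx hy => hb (x, y) ?_⟩
    rw [← ball_prod_same]
    constructor
    · simpa using hx.trans_le (min_le_left _ _)
    · simpa using hy.trans_le (min_le_left _ _)
  -- the generic points of the upper sheet
  have hgen : ∀ w x y : ℝ, |w| < r → |x| < r → |y| < r → x ≠ 0 →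
      e.symm (pt w x y (maxGen (x, y))) ∈ H := by
    intro w x y hw hx hy hx0
    -- If the point were missing, a chain of connected sets avoiding the horizon would lead from `k
    -- T` to `-k T`: the region above, a vertical segment through the missing point, a path just
    -- under the sheet to negative `y`, a vertical descent, and the region below. This contradicts
    -- `hopp`.
    by_contra hnot
    apply hopp
    have hZ0 := maxGen_nonneg
    -- By `swallowtail.gap`, a sheet at depth `s'` under the upper one requires `x² ≤ s' y`. The
    -- choice `s |y| < x²` keeps a layer of thickness `s` free, also for all smaller values of `y`.
    obtain ⟨s, hs0, hsR, hsx⟩ : ∃ s > 0, s < R / 4 ∧ s * |y| < x ^ 2 := by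
      have hx2 : 0 < x ^ 2 := by positivity
      have hd : 0 < |y| + 1 := by positivity
      refine ⟨min (R / 8) (x ^ 2 / (|y| + 1)), by positivity,
        (min_le_left _ _).trans_lt (by linarith), ?_⟩
      calc min (R / 8) (x ^ 2 / (|y| + 1)) * |y| ≤ x ^ 2 / (|y| + 1) * |y| := by
            gcongr; exact min_le_right _ _
        _ < x ^ 2 / (|y| + 1) * (|y| + 1) := by gcongr; linarith
        _ = x ^ 2 := by field_simp
    have hgap : ∀ y' s', y' ≤ y → |y'| < r → 0 < s' → s' ≤ s →
        ¬ swallowtail x y' (maxGen (x, y') - s') := by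
      intro y' s' hy' _ hs' hss hsw
      rcases hsw.gap with h | h
      · exact hs'.ne' h
      · have h1 : s' * y' ≤ s' * |y| :=
          mul_le_mul_of_nonneg_left (hy'.trans (le_abs_self y)) hs'.le
        have h2 : s' * |y| ≤ s * |y| := mul_le_mul_of_nonneg_right hss (abs_nonneg y)
        linarith
    -- At negative `y` the condition `x² ≤ s y` is impossible for `s > 0`, so nothing lies below the
    -- upper sheet and the descent is unobstructed.
    set ye := min y (-(r / 2)) with hye
    have hye_le : ye ≤ y := min_le_left _ _
    have hye_neg : ye < 0 := (min_le_right _ _).trans_lt (by linarith)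
    have hyabs := abs_lt.mp hy
    have hye_abs : |ye| < r := abs_lt.mpr ⟨lt_min hyabs.1 (by linarith), by linarith⟩
    have inR : ∀ {t : ℝ}, |t| < r → |t| < R := fun h => h.trans_le hrR
    -- the upper region
    have s1 : 0 < ψ (k • T) ↔ 0 < ψ (pt w x y (maxGen (x, y) + s)) := by
      refine pos_iff_of_isPreconnected hψ (fun u hu => hcΩ hu.1) (convex_above R).isPreconnected
        (fun u hu => hoff u hu.1 fun hsw => not_lt.mpr hsw.le_maxGen hu.2) ⟨hk3, ?_⟩ ⟨?_, ?_⟩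
      · simpa using hk1
      · refine pt_mem_cube (inR hw) (inR hx) (inR hy) (abs_lt.mpr ⟨?_, ?_⟩)
        · linarith [hZ0 (x, y)]
        · linarith [hrZ x y hx hy]
      · simpa using hs0
    -- through the point
    have s2 : 0 < ψ (pt w x y (maxGen (x, y) + s)) ↔ 0 < ψ (pt w x y (maxGen (x, y) + -s)) := by
      have hcub : ∀ t ∈ Icc (-s) s, pt w x y (maxGen (x, y) + t) ∈ cube R := by
        intro t ht
        refine pt_mem_cube (inR hw) (inR hx) (inR hy) (abs_lt.mpr ⟨?_, ?_⟩)
        · linarith [hZ0 (x, y), ht.1]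
        · linarith [hrZ x y hx hy, ht.2]
      refine pos_iff_of_isPreconnected hψ
        (C := (fun t : ℝ => pt w x y (maxGen (x, y) + t)) '' Icc (-s) s) ?_
        (isPreconnected_Icc.image _ (continuous_pt continuous_const continuous_const
          continuous_const (by fun_prop)).continuousOn) ?_
        ⟨s, ⟨by linarith, le_rfl⟩, rfl⟩ ⟨-s, ⟨le_rfl, by linarith⟩, rfl⟩
      · rintro _ ⟨t, ht, rfl⟩; exact hcΩ (hcub t ht)
      · rintro _ ⟨t, ht, rfl⟩
        rcases lt_trichotomy t 0 with h | h | h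
        · refine hoff _ (hcub t ht) ?_
          have := hgap y (-t) le_rfl hy (by linarith) (by linarith [ht.1])
          simpa using this
        · subst h
          intro h0
          apply hnot
          have := (hψH _ (hcΩ (hcub 0 ht))).mpr h0
          simpa using this
        · refine hoff _ (hcub t ht) fun hsw => ?_
          have := hsw.le_maxGen
          simp only [pt_one, pt_two, pt_three] at this
          linarith
    -- along the upper sheet
    have s3 : 0 < ψ (pt w x y (maxGen (x, y) + -s)) ↔ 0 < ψ (pt w x ye (maxGen (x, ye) + -s)) := by
      have hab : ∀ t ∈ Icc ye y, |t| < r := fun t ht =>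
        abs_lt.mpr ⟨by linarith [(abs_lt.mp hye_abs).1, ht.1], by linarith [hyabs.2, ht.2]⟩
      have hcub : ∀ t ∈ Icc ye y, pt w x t (maxGen (x, t) + -s) ∈ cube R := by
        intro t ht
        refine pt_mem_cube (inR hw) (inR hx) (inR (hab t ht)) (abs_lt.mpr ⟨?_, ?_⟩)
        · linarith [hZ0 (x, t)]
        · linarith [hrZ x t hx (hab t ht)]
      refine pos_iff_of_isPreconnected hψ
        (C := (fun t : ℝ => pt w x t (maxGen (x, t) + -s)) '' Icc ye y) ?_
        (isPreconnected_Icc.image _ (continuous_pt continuous_const continuous_const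
          continuous_id ((continuous_maxGen.comp (by fun_prop)).add continuous_const)).continuousOn) ?_
        ⟨y, ⟨hye_le, le_rfl⟩, rfl⟩ ⟨ye, ⟨le_rfl, hye_le⟩, rfl⟩
      · rintro _ ⟨t, ht, rfl⟩; exact hcΩ (hcub t ht)
      · rintro _ ⟨t, ht, rfl⟩
        refine hoff _ (hcub t ht) ?_
        have := hgap t s ht.2 (hab t ht) hs0 le_rfl
        simpa [sub_eq_add_neg] using this
    -- down
    have s4 : 0 < ψ (pt w x ye (maxGen (x, ye) + -s)) ↔ 0 < ψ (pt w x ye (-(R / 2))) := by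
      have hcub : ∀ t ∈ Icc (-(R / 2)) (maxGen (x, ye) + -s), pt w x ye t ∈ cube R := by
        intro t ht
        refine pt_mem_cube (inR hw) (inR hx) (inR hye_abs) (abs_lt.mpr ⟨?_, ?_⟩)
        · linarith [ht.1]
        · linarith [ht.2, hrZ x ye hx hye_abs]
      refine pos_iff_of_isPreconnected hψ
        (C := (fun t : ℝ => pt w x ye t) '' Icc (-(R / 2)) (maxGen (x, ye) + -s)) ?_
        (isPreconnected_Icc.image _ (continuous_pt continuous_const continuous_const
          continuous_const continuous_id).continuousOn) ?_
        ⟨_, ⟨by linarith [hZ0 (x, ye)], le_rfl⟩, rfl⟩ ⟨_, ⟨le_rfl, by linarith [hZ0 (x, ye)]⟩, rfl⟩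
      · rintro _ ⟨t, ht, rfl⟩; exact hcΩ (hcub t ht)
      · rintro _ ⟨t, ht, rfl⟩
        refine hoff _ (hcub t ht) fun hsw => ?_
        simp only [pt_one, pt_two, pt_three] at hsw
        have h1 : swallowtail x ye (maxGen (x, ye) - (maxGen (x, ye) - t)) := by simpa using hsw
        have hpos : 0 < maxGen (x, ye) - t := by linarith [ht.2]
        rcases h1.gap with h | h
        · linarith
        · have : (maxGen (x, ye) - t) * ye < 0 := mul_neg_of_pos_of_neg hpos hye_neg
          nlinarith [sq_nonneg x]
    -- the lower region
    have s5 : 0 < ψ (pt w x ye (-(R / 2))) ↔ 0 < ψ (-(k • T)) := by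
      refine pos_iff_of_isPreconnected hψ (fun u hu => hcΩ hu.1) (convex_below R).isPreconnected
        (fun u hu => hoff u hu.1 fun hsw => not_lt.mpr hsw.neg_sq_le hu.2) ⟨?_, ?_⟩ ⟨hk4, ?_⟩
      · exact pt_mem_cube (inR hw) (inR hx) (inR hye_abs) (by rw [abs_neg, abs_of_pos] <;> linarith)
      · simp only [pt_two, pt_three]
        have h1 : ye ^ 2 < R ^ 2 := sq_lt_sq' (by linarith [(abs_lt.mp (inR hye_abs)).1])
          (by linarith)
        nlinarith
      · simp only [PiLp.smul_apply, PiLp.neg_apply, smul_eq_mul, neg_sq]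
        have := mul_lt_mul_of_pos_left hk2 hk0
        nlinarith
    exact s1.trans (s2.trans (s3.trans (s4.trans s5)))
  -- the remaining points, by closedness
  refine ⟨r, hr0, fun u hu => hΩt (hcΩ fun i => (hu i).trans_le hrR), fun w x y hw hx hy => ?_⟩
  by_cases hx0 : x = 0
  · subst hx0
    have hcub : ∀ x' : ℝ, |x'| < r → pt w x' y (maxGen (x', y)) ∈ e.target := by
      intro x' hx'
      refine hΩt (hcΩ (pt_mem_cube (hw.trans_le hrR) (hx'.trans_le hrR) (hy.trans_le hrR) ?_))
      rw [abs_of_nonneg (maxGen_nonneg _)]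
      linarith [hrZ x' y hx' hy]
    have hc : Tendsto (fun x' : ℝ => e.symm (pt w x' y (maxGen (x', y)))) (𝓝[>] 0)
        (𝓝 (e.symm (pt w 0 y (maxGen (0, y))))) := by
      refine ((e.continuousAt_symm (hcub 0 hx)).tendsto).comp ?_
      have : Continuous fun x' : ℝ => pt w x' y (maxGen (x', y)) :=
        continuous_pt continuous_const continuous_id continuous_const
          (continuous_maxGen.comp (by fun_prop))
      exact (this.tendsto 0).mono_left nhdsWithin_le_nhds
    refine hH.isClosed.mem_of_tendsto hc ?_
    filter_upwards [Ioo_mem_nhdsGT hr0] with x' hx'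
    exact hgen w x' y hw (by rw [abs_of_pos hx'.1]; exact hx'.2) hy hx'.1.ne'
  · exact hgen w x y hw hx hy hx0

/-- Near an `A₃` point the horizon is the upper sheet of the swallowtail. -/
theorem exists_horizon_graph (hH : S.IsFutureHorizon H) (he : S.IsA3Chart H p e) :
    ∃ r > 0, Metric.ball 0 r ⊆ e.target ∧
      ∀ v ∈ Metric.ball (0 : R4) r, e.symm v ∈ H ↔ v 3 = maxGen (v 1, v 2) := by
  obtain ⟨T, hT, hT3⟩ := exists_timelike_transverse he
  obtain ⟨r, hr, hrt, hgraph⟩ := exists_graph_subset_horizon hH he hT hT3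
  have h0 := zero_mem_target he
  obtain ⟨ρ, hρ, -, hach⟩ := achronal_local he.mem_atlas hH.achronal h0 hT
  set R := min (r / 2) (ρ / 4) with hRdef
  have hR : 0 < R := lt_min (by positivity) (by positivity)
  have hRr : 2 * R ≤ r := by have := min_le_left (r / 2) (ρ / 4); linarith
  have hRρ : 4 * R ≤ ρ := by have := min_le_right (r / 2) (ρ / 4); linarith
  obtain ⟨k, hk1, hk3, hk0⟩ : ∃ k : ℝ, maxGen (k * T 1, k * T 2) < k * T 3 ∧
      k • T ∈ cube R ∧ 0 < k := by
    have c2 : Tendsto (fun k : ℝ => k • T) (𝓝[>] 0) (𝓝 0) := by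
      have : Continuous fun k : ℝ => k • T := by fun_prop
      have := this.tendsto 0
      rw [zero_smul] at this
      exact this.mono_left nhdsWithin_le_nhds
    have hn : cube R ∈ 𝓝 (0 : R4) := (isOpen_cube R).mem_nhds (fun i => by simpa using hR)
    exact ((eventually_maxGen_line T hT3).and ((c2.eventually_mem hn).and self_mem_nhdsWithin)).exists
  set F : R4 → ℝ := fun u => u 3 - maxGen (u 1, u 2) with hF
  have hFc : Continuous F := (continuous_coord 3).sub
    (continuous_maxGen.comp ((continuous_coord 1).prodMk (continuous_coord 2)))
  have hev : ∀ᶠ v in 𝓝 (0 : R4), 0 < F (v + k • T) ∧ F (v + (-k) • T) < 0 := by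
    have c1 : Continuous fun v : R4 => F (v + k • T) := hFc.comp (by fun_prop)
    have c2 : Continuous fun v : R4 => F (v + (-k) • T) := hFc.comp (by fun_prop)
    refine (c1.tendsto 0 |>.eventually (lt_mem_nhds ?_)).and
      (c2.tendsto 0 |>.eventually (gt_mem_nhds ?_))
    · simp only [hF, zero_add, PiLp.smul_apply, smul_eq_mul]; linarith
    · simp only [hF, zero_add, PiLp.smul_apply, smul_eq_mul]
      have := maxGen_nonneg (-k * T 1, -k * T 2)
      have := mul_pos hk0 hT3
      linarith
  obtain ⟨r₂, hr₂, hb⟩ := Metric.eventually_nhds_iff_ball.mp hev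
  refine ⟨min r₂ R, lt_min hr₂ hR, ?_, ?_⟩
  · refine (Metric.ball_subset_ball (min_le_right _ _)).trans ((ball_subset_cube R).trans ?_)
    exact fun u hu => hrt fun i => (hu i).trans_le (by linarith)
  intro v hv
  have hvR : v ∈ cube R := ball_subset_cube R (Metric.ball_subset_ball (min_le_right _ _) hv)
  have hvr : ∀ i, |v i| < r := fun i => (hvR i).trans_le (by linarith)
  constructor
  · intro hvH
    obtain ⟨hp, hm⟩ := hb v (Metric.ball_subset_ball (min_le_left _ _) hv)
    have hc : Continuous fun t : ℝ => F (v + t • T) := hFc.comp (by fun_prop)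
    -- The timelike line through the point `v` of the horizon crosses the upper sheet, and the
    -- crossing point is in the horizon too. By achronality it coincides with `v`.
    obtain ⟨t, ht, hFt⟩ := intermediate_value_Icc (show -k ≤ k by linarith) hc.continuousOn
      ⟨hm.le, hp.le⟩
    simp only at hFt
    have hcoord : ∀ i, |(v + t • T) i| < 2 * R := by
      intro i
      have e1 : |t * T i| ≤ |k * T i| := by
        rw [abs_mul, abs_mul]
        refine mul_le_mul_of_nonneg_right ?_ (abs_nonneg _)
        rw [abs_of_pos hk0]; exact abs_le.mpr ht
      have e2 := hk3 i
      simp only [PiLp.smul_apply, smul_eq_mul] at e2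
      have e3 := abs_add_le (v i) (t * T i)
      have e4 := hvR i
      simp only [PiLp.add_apply, PiLp.smul_apply, smul_eq_mul]
      linarith
    have hmem : e.symm (v + t • T) ∈ H := by
      have h3 : (v + t • T) 3 = maxGen ((v + t • T) 1, (v + t • T) 2) := by
        simp only [hF] at hFt; linarith
      have := hgraph _ _ _ ((hcoord 0).trans_le hRr) ((hcoord 1).trans_le hRr) ((hcoord 2).trans_le hRr)
      rwa [← h3, pt_eta] at this
    have b1 : v ∈ Metric.ball (0 : R4) ρ :=
      Metric.ball_subset_ball (by linarith) (cube_subset_ball hR hvR)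
    have b2 : v + t • T ∈ Metric.ball (0 : R4) ρ :=
      Metric.ball_subset_ball (by linarith)
        (cube_subset_ball (R := 2 * R) (by linarith) hcoord)
    have ht0 : t = 0 := by
      rcases lt_trichotomy t 0 with h | h | h
      · exfalso
        have e1 : v + t • T + (-t) • T = v := by module
        exact hach _ b2 T (Metric.mem_ball_self hρ) (-t) (by linarith) (by rwa [e1]) hmem
          (by rwa [e1])
      · exact h
      · exact absurd hmem (hach _ b1 T (Metric.mem_ball_self hρ) t h b2 hvH)
    rw [ht0] at hFt
    simp only [hF, zero_smul, add_zero] at hFt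
    linarith
  · intro h3
    have := hgraph _ _ _ (hvr 0) (hvr 1) (hvr 2)
    rwa [← h3, pt_eta] at this

end Caustic
end

noncomputable section
namespace Caustic

set_option linter.unusedSectionVars false

/-! ### Conormals and one-sided tangents of the upper sheet -/

/-- The conormal `dz - a dx - a² dy` of the swallowtail. -/
def conormal (a : ℝ) : R4 := pt 0 (-a) (-a ^ 2) 1

/-- The parametrization of the big wavefront in canonical coordinates. -/
def sheet (w a q : ℝ) : R4 := pt w (4 * a ^ 3 - 2 * q * a) q (3 * a ^ 4 - q * a ^ 2)

/-- The points of the upper sheet. -/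
def OnGraph (v : R4) : Prop := v 3 = maxGen (v 1, v 2)

lemma pair_eq (ν c : R4) : pair ν c = ν 0 * c 0 + ν 1 * c 1 + ν 2 * c 2 + ν 3 * c 3 := by
  simp [pair, Fin.sum_univ_four]

lemma pair_conormal (a : ℝ) (c : R4) : pair (conormal a) c = c 3 - a * c 1 - a ^ 2 * c 2 := by
  rw [pair_eq]; simp [conormal]; ring

lemma pair_add (ν c d : R4) : pair ν (c + d) = pair ν c + pair ν d := by
  simp only [pair_eq, PiLp.add_apply]; ring

lemma pair_smul (ν c : R4) (μ : ℝ) : pair ν (μ • c) = μ * pair ν c := by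
  simp only [pair_eq, PiLp.smul_apply, smul_eq_mul]; ring

lemma pair_neg (ν c : R4) : pair ν (-c) = -pair ν c := by
  simp only [pair_eq, PiLp.neg_apply]; ring

/-- The pairing as a linear form. -/
def pairLin (ν : R4) : R4 →ₗ[ℝ] ℝ where
  toFun := pair ν
  map_add' := pair_add ν
  map_smul' μ c := pair_smul ν c μ

lemma conormal_zero : conormal 0 = stdVec 3 := by
  apply R4.ext <;> simp [conormal]

lemma pair_stdVec (i : Fin 4) (c : R4) : pair (stdVec i) c = c i := by
  simp [pair]

lemma continuous_conormal : Continuous conormal :=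
  continuous_pt continuous_const (by fun_prop) (by fun_prop) continuous_const

lemma tendsto_pair {ι : Type*} {l : Filter ι} {ν c : ι → R4} {ν₀ c₀ : R4}
    (hν : Tendsto ν l (𝓝 ν₀)) (hc : Tendsto c l (𝓝 c₀)) :
    Tendsto (fun i => pair (ν i) (c i)) l (𝓝 (pair ν₀ c₀)) := by
  simp only [pair]
  exact tendsto_finsetSum _ fun i _ =>
    (((continuous_coord i).tendsto ν₀).comp hν).mul (((continuous_coord i).tendsto c₀).comp hc)

lemma onGraph_sheet {w a q : ℝ} (h : q ≤ 2 * a ^ 2) : OnGraph (sheet w a q) := by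
  simp only [OnGraph, sheet, pt_one, pt_two, pt_three, maxGen_critical h]

lemma OnGraph.eq_sheet {v : R4} (h : OnGraph v) : v = sheet (v 0) (argmaxGen (v 1, v 2)) (v 2) := by
  apply R4.ext
  · rfl
  · exact argmaxGen_critical (v 1, v 2)
  · rfl
  · exact h.trans (maxGen_eq_argmaxGen (v 1, v 2))

/-- At the base point itself the right-hand side of `argmaxGen_dist` vanishes, so the maximizer is
unique off the crease. -/
lemma argmaxGen_critical_eq {a y : ℝ} (h : y < 2 * a ^ 2 ∨ a = 0 ∧ y = 0) :
    argmaxGen (4 * a ^ 3 - 2 * y * a, y) = a := by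
  have h1 := argmaxGen_dist a y (4 * a ^ 3 - 2 * y * a, y)
  set A := argmaxGen (4 * a ^ 3 - 2 * y * a, y)
  simp only [sub_self, abs_zero, mul_zero, add_zero] at h1
  rcases h with h | ⟨rfl, rfl⟩
  · have h2 : 0 < (A + a) ^ 2 + (2 * a ^ 2 - y) := by nlinarith [sq_nonneg (A + a)]
    have h3 : |A - a| ≤ 0 := by
      by_contra hn
      exact absurd h1 (not_le.mpr (mul_pos (not_le.mp hn) h2))
    exact sub_eq_zero.mp (abs_nonpos_iff.mp h3)
  · simp only [sub_zero, add_zero, ne_eq, OfNat.ofNat_ne_zero, not_false_eq_true, zero_pow,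
      mul_zero] at h1
    by_contra hne
    have h2 : 0 < |A| := abs_pos.mpr hne
    have h3 : 0 < A ^ 2 := by positivity
    exact absurd h1 (not_le.mpr (mul_pos h2 h3))

lemma tendsto_slope_Ioi {f : ℝ → ℝ} {f' t : ℝ}
    (h : HasDerivWithinAt f f' (Ioi t) t) :
    Tendsto (fun s => (f s - f t) / (s - t)) (𝓝[>] t) (𝓝 f') := by
  have := (hasDerivWithinAt_iff_tendsto_slope' (by simp)).mp h
  simpa [slope_fun_def_field] using this

/-- The affine function attached to `a` has the height of the base point there and lies below
`maxGen` everywhere. Curves in the graph therefore start on the nonnegative side of this supporting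
hyperplane. -/
lemma pair_conormal_nonneg {w a q : ℝ} {c : ℝ → R4} {k : R4} {t : ℝ}
    (hct : c t = sheet w a q) (hc : HasDerivWithinAt c k (Ioi t) t)
    (hev : ∀ᶠ s in 𝓝[>] t, OnGraph (c s)) : 0 ≤ pair (conormal a) k := by
  have h1 := (tendsto_slope_Ioi (hasDerivWithinAt_coord hc 1))
  have h2 := (tendsto_slope_Ioi (hasDerivWithinAt_coord hc 2))
  have h3 := (tendsto_slope_Ioi (hasDerivWithinAt_coord hc 3))
  rw [pair_conormal]
  refine ge_of_tendsto ((h3.sub (h1.const_mul a)).sub (h2.const_mul (a ^ 2))) ?_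
  filter_upwards [hev, self_mem_nhdsWithin] with s hs hst
  have hst : 0 < s - t := sub_pos.mpr hst
  have e1 := genFun_add_le_maxGen (4 * a ^ 3 - 2 * q * a, q) (c s 1, c s 2) a
  rw [genFun_critical, ← hs] at e1
  rw [hct]
  simp only [sheet, pt_one, pt_two, pt_three]
  have : (c s 3 - (3 * a ^ 4 - q * a ^ 2)) / (s - t) - a * ((c s 1 - (4 * a ^ 3 - 2 * q * a)) / (s - t))
      - a ^ 2 * ((c s 2 - q) / (s - t)) =
      (c s 3 - (3 * a ^ 4 - q * a ^ 2) - a * (c s 1 - (4 * a ^ 3 - 2 * q * a)) - a ^ 2 * (c s 2 - q))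
        / (s - t) := by ring
  rw [this]
  exact div_nonneg (by linarith) hst.le

/-- The upper bound `maxGen_le_add` has the maximizers along the curve as coefficients, and it
passes to the limit along any filter on which they converge to `a`. The freedom in `l` is needed at
the crease, where the maximizer may jump between `a` and `-a`. -/
lemma pair_conormal_nonpos {w a q : ℝ} (hq : q ≤ 2 * a ^ 2) {c : ℝ → R4} {k : R4} {t : ℝ}
    {l : Filter ℝ} [l.NeBot] (hl : l ≤ 𝓝[>] t)
    (hct : c t = sheet w a q) (hc : HasDerivWithinAt c k (Ioi t) t)
    (hev : ∀ᶠ s in 𝓝[>] t, OnGraph (c s))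
    (hA : Tendsto (fun s => argmaxGen (c s 1, c s 2)) l (𝓝 a)) : pair (conormal a) k ≤ 0 := by
  have h1 := (tendsto_slope_Ioi (hasDerivWithinAt_coord hc 1)).mono_left hl
  have h2 := (tendsto_slope_Ioi (hasDerivWithinAt_coord hc 2)).mono_left hl
  have h3 := (tendsto_slope_Ioi (hasDerivWithinAt_coord hc 3)).mono_left hl
  rw [pair_conormal]
  refine le_of_tendsto ((h3.sub (hA.mul h1)).sub ((hA.pow 2).mul h2)) ?_
  filter_upwards [hl hev, hl self_mem_nhdsWithin] with s hs hst
  have hs : OnGraph (c s) := hs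
  have hst : 0 < s - t := sub_pos.mpr hst
  have e1 := maxGen_le_add (4 * a ^ 3 - 2 * q * a, q) (c s 1, c s 2)
  rw [← hs, maxGen_critical hq] at e1
  rw [hct]
  simp only [sheet, pt_one, pt_two, pt_three] at e1 ⊢
  set A := argmaxGen (c s 1, c s 2)
  have : (c s 3 - (3 * a ^ 4 - q * a ^ 2)) / (s - t) - A * ((c s 1 - (4 * a ^ 3 - 2 * q * a)) / (s - t))
      - A ^ 2 * ((c s 2 - q) / (s - t)) =
      (c s 3 - (3 * a ^ 4 - q * a ^ 2) - A * (c s 1 - (4 * a ^ 3 - 2 * q * a)) - A ^ 2 * (c s 2 - q))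
        / (s - t) := by ring
  rw [this]
  exact div_nonpos_of_nonpos_of_nonneg (by linarith) hst.le

lemma tendsto_xy {c : ℝ → R4} {k : R4} {t : ℝ}
    (hc : HasDerivWithinAt c k (Ioi t) t) :
    Tendsto (fun s => (c s 1, c s 2)) (𝓝[>] t) (𝓝 (c t 1, c t 2)) := by
  have h1 := ((continuous_coord 1).tendsto _).comp hc.continuousWithinAt.tendsto
  have h2 := ((continuous_coord 2).tendsto _).comp hc.continuousWithinAt.tendsto
  exact h1.prodMk_nhds h2

/-- At the points where the upper sheet is differentiable, its one-sided tangents are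
annihilated by the conormal. -/
lemma pair_conormal_eq_zero {w a q : ℝ} (h : q < 2 * a ^ 2 ∨ a = 0 ∧ q = 0) {c : ℝ → R4} {k : R4}
    {t : ℝ} (hct : c t = sheet w a q) (hc : HasDerivWithinAt c k (Ioi t) t)
    (hev : ∀ᶠ s in 𝓝[>] t, OnGraph (c s)) : pair (conormal a) k = 0 := by
  have hq : q ≤ 2 * a ^ 2 := by
    rcases h with h | ⟨rfl, rfl⟩
    · exact h.le
    · simp
  refine le_antisymm (pair_conormal_nonpos hq le_rfl hct hc hev ?_)
    (pair_conormal_nonneg hct hc hev)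
  have := (tendsto_xy hc)
  rw [hct] at this
  exact (tendsto_argmaxGen h).comp this

lemma sheet_crease_neg (w a : ℝ) : sheet w (-a) (2 * a ^ 2) = sheet w a (2 * a ^ 2) := by
  apply R4.ext <;> simp only [sheet, pt_zero, pt_one, pt_two, pt_three] <;> ring

/-- At the crease, one-sided tangents are annihilated by one of the two conormals. -/
lemma pair_conormal_crease {w a : ℝ} (ha : a ≠ 0) {c : ℝ → R4} {k : R4}
    {t : ℝ} (hct : c t = sheet w a (2 * a ^ 2)) (hc : HasDerivWithinAt c k (Ioi t) t)
    (hev : ∀ᶠ s in 𝓝[>] t, OnGraph (c s)) :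
    pair (conormal a) k = 0 ∨ pair (conormal (-a)) k = 0 := by
  have key : ∀ b : ℝ, b ≠ 0 → c t = sheet w b (2 * b ^ 2) →
      (∃ᶠ s in 𝓝[>] t, 0 ≤ argmaxGen (c s 1, c s 2) * b) → pair (conormal b) k = 0 := by
    intro b hb hctb hfr
    -- Restriction to the parameters at which the maximizer has the sign of `b`; there
    -- `argmaxGen_dist_of_sign` makes it converge to `b`. One of the two signs occurs arbitrarily
    -- close to `t`.
    set l : Filter ℝ := 𝓝[>] t ⊓ 𝓟 {s | 0 ≤ argmaxGen (c s 1, c s 2) * b} with hl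
    have : l.NeBot := frequently_mem_iff_neBot.mp hfr
    refine le_antisymm (pair_conormal_nonpos le_rfl (l := l) inf_le_left hctb hc hev ?_)
      (pair_conormal_nonneg hctb hc hev)
    have hxy := (tendsto_xy hc).mono_left (inf_le_left : l ≤ 𝓝[>] t)
    rw [hctb] at hxy
    simp only [sheet, pt_one, pt_two] at hxy
    have hx := ((continuous_fst.tendsto _).comp hxy).sub_const (4 * b ^ 3 - 2 * (2 * b ^ 2) * b)
    have hy := ((continuous_snd.tendsto _).comp hxy).sub_const (2 * b ^ 2)
    simp only [Function.comp_def, sub_self] at hx hy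
    rw [tendsto_iff_dist_tendsto_zero]
    refine squeeze_zero' (Eventually.of_forall fun _ => dist_nonneg) ?_
      (by simpa using (hx.abs.div_const (b ^ 2)).add (hy.abs.div_const |b|))
    have hmem : ∀ᶠ s in l, 0 ≤ argmaxGen (c s 1, c s 2) * b :=
      mem_inf_of_right (mem_principal_self _)
    filter_upwards [hmem] with s hs
    rw [Real.dist_eq]
    exact argmaxGen_dist_of_sign hb le_rfl (c s 1, c s 2) hs
  by_cases hfr : ∃ᶠ s in 𝓝[>] t, 0 ≤ argmaxGen (c s 1, c s 2) * a
  · exact Or.inl (key a ha hct hfr)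
  · right
    refine key (-a) (neg_ne_zero.mpr ha) (by rw [neg_sq, sheet_crease_neg, hct]) ?_
    refine (Eventually.frequently ?_)
    filter_upwards [not_frequently.mp hfr] with s hs
    have := not_le.mp hs
    linarith

/-! ### Generators in coordinates -/

variable {M : Type*} [TopologicalSpace M] [ChartedSpace R4 M] [IsManifold (𝓡 4) ∞ M]
variable {S : Spacetime M} {H : Set M} {e : OpenPartialHomeomorph M R4} {p : M} {r : ℝ}

variable (S H e) in
/-- The components of the tangent vectors of generators at a point. -/
def genVecs (u : R4) : Set R4 :=
  {k | ∃ γ J t₀, S.IsGenerator H γ J t₀ ∧ γ t₀ = e.symm u ∧ chartD e (γ t₀) (velocity γ t₀) = k}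

lemma chartD_injective (he : e ∈ IsManifold.maximalAtlas (𝓡 4) ∞ M) {x : M} (hx : x ∈ e.source) :
    Function.Injective (chartD e x) := by
  obtain ⟨u, hu, rfl⟩ : ∃ u ∈ e.target, x = e.symm u := ⟨e x, e.map_source hx, (e.left_inv hx).symm⟩
  intro v w h
  rw [← coordTangent_chartD he hu v, h, coordTangent_chartD he hu w]

/-- Tangent vectors at two points that are equal but given differently are compared by their
components in a chart. -/
lemma totalSpace_eq (he : e ∈ IsManifold.maximalAtlas (𝓡 4) ∞ M) {x y : M} (hx : x ∈ e.source)
    (hxy : x = y) {v : TangentSpace (𝓡 4) x} {w : TangentSpace (𝓡 4) y}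
    (h : chartD e x v = chartD e y w) : (⟨x, v⟩ : TangentBundle (𝓡 4) M) = ⟨y, w⟩ := by
  subst hxy
  rw [chartD_injective he hx h]

lemma mem_generatorVectors_iff (he : e ∈ IsManifold.maximalAtlas (𝓡 4) ∞ M) {u : R4}
    (hu : u ∈ e.target) (v : TangentSpace (𝓡 4) (e.symm u)) :
    v ∈ S.generatorVectors H (e.symm u) ↔ chartD e (e.symm u) v ∈ genVecs S H e u := by
  constructor
  · rintro ⟨γ, J, t₀, hg, h⟩
    refine ⟨γ, J, t₀, hg, congrArg Bundle.TotalSpace.proj h, ?_⟩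
    exact congrArg (fun q : TangentBundle (𝓡 4) M => chartD e q.1 q.2) h
  · rintro ⟨γ, J, t₀, hg, h, h'⟩
    exact ⟨γ, J, t₀, hg, totalSpace_eq he (h ▸ e.map_target hu) h h'⟩

lemma IsGenerator_mdifferentiableAt {γ : ℝ → M} {J : Set ℝ} {t₀ t : ℝ} (hg : S.IsGenerator H γ J t₀)
    (ht : t ∈ J) : MDifferentiableAt 𝓘(ℝ, ℝ) (𝓡 4) γ t :=
  (hg.geodesic.1.contMDiffAt (hg.isOpen.mem_nhds ht)).mdifferentiableAt (by simp)

/-- A generator may be started later. -/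
lemma IsGenerator_later {γ : ℝ → M} {J : Set ℝ} {t₀ t : ℝ} (hg : S.IsGenerator H γ J t₀) (ht : t ∈ J)
    (hsub : ∀ s ∈ J, t ≤ s → γ s ∈ H) : S.IsGenerator H γ J t :=
  ⟨hg.isOpen, hg.ordConnected, ht, hg.geodesic, hg.null, hg.inextendible, hsub⟩

lemma hasDerivAt_generator (he : e ∈ IsManifold.maximalAtlas (𝓡 4) ∞ M) {γ : ℝ → M} {J : Set ℝ}
    {t₀ t : ℝ} (hg : S.IsGenerator H γ J t₀) (ht : t ∈ J) (hs : γ t ∈ e.source) :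
    HasDerivAt (fun s => e (γ s)) (chartD e (γ t) (velocity γ t)) t :=
  hasDerivAt_chart he (IsGenerator_mdifferentiableAt hg ht) hs

/-! ### Null conormals and the time orientation of the upper sheet -/

variable (S H e r) in
/-- In the ball of radius `r` in the chart `e`, the horizon is the upper sheet of the
swallowtail. -/
structure HorizonGraph : Prop where
  horizon : S.IsFutureHorizon H
  atlas : e ∈ IsManifold.maximalAtlas (𝓡 4) ∞ M
  pos : 0 < r
  target : Metric.ball 0 r ⊆ e.target
  graph : ∀ v ∈ Metric.ball (0 : R4) r, e.symm v ∈ H ↔ OnGraph v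

namespace HorizonGraph

lemma mono (hG : HorizonGraph S H e r) {r' : ℝ} (h0 : 0 < r') (h : r' ≤ r) :
    HorizonGraph S H e r' :=
  ⟨hG.horizon, hG.atlas, h0, (Metric.ball_subset_ball h).trans hG.target,
    fun v hv => hG.graph v (Metric.ball_subset_ball h hv)⟩

variable (hG : HorizonGraph S H e r) {u : R4} (hu : u ∈ Metric.ball (0 : R4) r)
include hG hu

lemma genVecs_null {k : R4} (hk : k ∈ genVecs S H e u) :
    gForm S e u k k = 0 ∧ gForm S e u (futureCoord S e u) k < 0 := by
  obtain ⟨γ, J, t₀, hg, hγ, rfl⟩ := hk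
  have hs : γ t₀ ∈ e.source := by rw [hγ]; exact e.map_target (hG.target hu)
  have h := (isFutureNull_iff S hG.atlas hs _).mp (hg.null t₀ hg.mem)
  have : e (γ t₀) = u := by rw [hγ]; exact e.right_inv (hG.target hu)
  rwa [this] at h

lemma genVecs_ne_zero {k : R4} (hk : k ∈ genVecs S H e u) : k ≠ 0 := by
  rintro rfl
  simpa using (hG.genVecs_null hu hk).2

lemma genVecs_nonempty (hg : OnGraph u) : (genVecs S H e u).Nonempty := by
  obtain ⟨γ, J, t₀, h, hγ⟩ := hG.horizon.ruled _ ((hG.graph u hu).mpr hg)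
  exact ⟨_, γ, J, t₀, h, hγ, rfl⟩

/-- Tangent vectors of generators are one-sided tangents of curves in the upper sheet. -/
lemma exists_curve {k : R4} (hk : k ∈ genVecs S H e u) : ∃ (c : ℝ → R4) (t : ℝ), c t = u ∧
    HasDerivAt c k t ∧ ∀ᶠ s in 𝓝[>] t, OnGraph (c s) := by
  obtain ⟨γ, J, t₀, hg, hγ, rfl⟩ := hk
  have hs : γ t₀ ∈ e.source := by rw [hγ]; exact e.map_target (hG.target hu)
  have hd := hasDerivAt_generator hG.atlas hg hg.mem hs
  have heq : e (γ t₀) = u := by rw [hγ]; exact e.right_inv (hG.target hu)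
  refine ⟨fun s => e (γ s), t₀, heq, hd, ?_⟩
  have h1 : ∀ᶠ s in 𝓝 t₀, e (γ s) ∈ Metric.ball (0 : R4) r :=
    hd.continuousAt.eventually_mem (Metric.isOpen_ball.mem_nhds (by simpa only [heq] using hu))
  have h2 : ∀ᶠ s in 𝓝 t₀, γ s ∈ e.source :=
    (IsGenerator_mdifferentiableAt hg hg.mem).continuousAt.eventually_mem
      (e.open_source.mem_nhds hs)
  filter_upwards [nhdsWithin_le_nhds h1, nhdsWithin_le_nhds h2,
    nhdsWithin_le_nhds (hg.isOpen.mem_nhds hg.mem), self_mem_nhdsWithin] with s a1 a2 a3 a4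
  refine (hG.graph _ a1).mp ?_
  rw [e.left_inv a2]
  exact hg.subset s a3 (le_of_lt a4)

/-- The tangent hyperplanes of the upper sheet contain no timelike vectors. -/
lemma nonneg_of_pair_eq_zero {w a q : ℝ} (h : q < 2 * a ^ 2 ∨ a = 0 ∧ q = 0)
    (hus : u = sheet w a q) {d : R4} (hd : pair (conormal a) d = 0) : 0 ≤ gForm S e u d d := by
  have hq : q ≤ 2 * a ^ 2 := by
    rcases h with h | ⟨rfl, rfl⟩
    · exact h.le
    · simp
  set x := 4 * a ^ 3 - 2 * q * a with hx
  -- A straight line in `(w, x, y)` lifted to the graph is a curve in the horizon, and the formula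
  -- for `dZ` shows that its velocity is `d`.
  set f : ℝ → R4 := fun t => pt (w + t * d 0) (x + t * d 1) (q + t * d 2)
    (maxGen (x + t * d 1, q + t * d 2)) with hf
  have lin : ∀ b k : ℝ, HasDerivAt (fun t : ℝ => b + t * k) k 0 := fun b k => by
    simpa using ((hasDerivAt_id (0 : ℝ)).mul_const k).const_add b
  have hM : HasFDerivAt maxGen (a • ContinuousLinearMap.fst ℝ ℝ ℝ
      + a ^ 2 • ContinuousLinearMap.snd ℝ ℝ ℝ) (x + 0 * d 1, q + 0 * d 2) := by
    have := maxGen_hasFDerivAt h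
    simpa using this
  have h3 : HasDerivAt (fun t : ℝ => maxGen (x + t * d 1, q + t * d 2)) (d 3) 0 := by
    refine (hM.comp_hasDerivAt (0 : ℝ) ((lin x (d 1)).prodMk (lin q (d 2)))).congr_deriv ?_
    rw [pair_conormal] at hd
    simp; linarith
  have hfd : HasDerivWithinAt f d (Ioi 0) 0 := by
    have := hasDerivWithinAt_pt (lin w (d 0)).hasDerivWithinAt (lin x (d 1)).hasDerivWithinAt
      (lin q (d 2)).hasDerivWithinAt (h3.hasDerivWithinAt (s := Ioi 0))
    rwa [pt_eta] at this
  have hf0 : f 0 = u := by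
    rw [hus, hf]
    simp only [zero_mul, add_zero, sheet, hx, maxGen_critical hq]
  have hgr : ∀ t, OnGraph (f t) := fun t => rfl
  have hb : f 0 ∈ Metric.ball (0 : R4) r := by rw [hf0]; exact hu
  rw [← hf0]
  refine tangent_nonneg hG.atlas hG.horizon.achronal (hG.target hb) hfd
    ((hG.graph _ hb).mpr (hgr 0)) ?_
  filter_upwards [hfd.continuousWithinAt.eventually_mem (Metric.isOpen_ball.mem_nhds hb)] with s hs
  exact (hG.graph _ hs).mpr (hgr s)

/-- The velocity of a generator is a null vector in a hyperplane without timelike vectors, hence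
orthogonal to that hyperplane, hence proportional to its raised conormal. -/
lemma genVecs_eq_smul {w a q : ℝ} (h : q < 2 * a ^ 2 ∨ a = 0 ∧ q = 0)
    (hus : u = sheet w a q) {k : R4} (hk : k ∈ genVecs S H e u) :
    ∃ μ : ℝ, μ ≠ 0 ∧ k = μ • sharp S e u (conormal a) := by
  obtain ⟨c, t, hct, hcd, hev⟩ := hG.exists_curve hu hk
  have hk0 := pair_conormal_eq_zero h (hct.trans hus) hcd.hasDerivWithinAt hev
  have horth : ∀ d, pair (conormal a) d = 0 → gForm S e u k d = 0 := fun d hd =>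
    IsLorentz.orthogonal_of_nonneg (ν := pairLin (conormal a)) (gForm_symm S u)
      (fun c hc => hG.nonneg_of_pair_eq_zero hu h hus hc) (hG.genVecs_null hu hk).1 hk0 hd
  have heq : k = gForm S e u k (stdVec 3) • sharp S e u (conormal a) := by
    refine eq_sharp_of_forall S hG.atlas (hG.target hu) fun d => ?_
    -- Subtracting a multiple of `∂/∂z` moves `d` into the hyperplane annihilated by the conormal,
    -- whose `z` component is `1`.
    have h1 := horth (d + (-(pair (conormal a) d)) • stdVec 3) (by
      rw [pair_add, pair_smul, pair_conormal a (stdVec 3)]; simp)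
    simp only [map_add, map_smul, smul_eq_mul] at h1
    linarith
  refine ⟨_, fun h0 => hG.genVecs_ne_zero hu hk ?_, heq⟩
  rw [heq, h0, zero_smul]

/-- Some generator passes through the point, and its null velocity is a nonzero multiple of the
raised conormal. -/
lemma null_of_regular {w a q : ℝ} (h : q < 2 * a ^ 2 ∨ a = 0 ∧ q = 0)
    (hus : u = sheet w a q) : pair (conormal a) (sharp S e u (conormal a)) = 0 := by
  have hq : q ≤ 2 * a ^ 2 := by
    rcases h with h | ⟨rfl, rfl⟩
    · exact h.le
    · simp
  obtain ⟨k, hk⟩ := hG.genVecs_nonempty hu (hus ▸ onGraph_sheet hq)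
  obtain ⟨μ, hμ, rfl⟩ := hG.genVecs_eq_smul hu h hus hk
  have h1 := (hG.genVecs_null hu hk).1
  simp only [map_smul, LinearMap.smul_apply, smul_eq_mul, gForm_sharp S hG.atlas (hG.target hu)] at h1
  simpa [hμ] using h1

/-- The conormals of the upper sheet are null. -/
lemma null_conormal {w a q : ℝ} (hq : q ≤ 2 * a ^ 2) (hus : u = sheet w a q) :
    pair (conormal a) (sharp S e u (conormal a)) = 0 := by
  rcases hq.lt_or_eq with h | h
  · exact hG.null_of_regular hu (Or.inl h) hus
  -- At the crease, `a` is kept and `q'` increases to `2a²`: nullity holds at these regular points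
  -- and passes to the limit.
  · have hc : Continuous fun q' : ℝ => sheet w a q' :=
      continuous_pt continuous_const (by fun_prop) (by fun_prop) (by fun_prop)
    have ht : Tendsto (fun q' : ℝ => sheet w a q') (𝓝[<] q) (𝓝 u) := by
      rw [hus]; exact (hc.tendsto q).mono_left nhdsWithin_le_nhds
    have h1 := tendsto_sharp S hG.atlas (hG.target hu) ht (tendsto_const_nhds (x := conormal a))
    have h2 : Tendsto (fun q' : ℝ => pair (conormal a) (sharp S e (sheet w a q') (conormal a)))
        (𝓝[<] q) (𝓝 (pair (conormal a) (sharp S e u (conormal a)))) :=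
      tendsto_pair tendsto_const_nhds h1
    refine tendsto_nhds_unique h2 (tendsto_const_nhds.congr' ?_)
    filter_upwards [ht.eventually_mem (Metric.isOpen_ball.mem_nhds hu), self_mem_nhdsWithin]
      with q' hb hq'
    exact (hG.null_of_regular hb (Or.inl (lt_of_lt_of_eq hq' h)) rfl).symm

omit hu in
/-- Distinct conormals give non-proportional vectors. -/
lemma sharp_ne_smul (hu : u ∈ e.target) {a b : ℝ} (hab : a ≠ b) (μ : ℝ) :
    sharp S e u (conormal a) ≠ μ • sharp S e u (conormal b) := by
  intro h
  have key : ∀ d, pair (conormal a) d = μ * pair (conormal b) d := fun d => by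
    have := congrArg (fun v => gForm S e u v d) h
    simp only [map_smul, LinearMap.smul_apply, smul_eq_mul, gForm_sharp S hG.atlas hu] at this
    exact this
  have h3 := key (stdVec 3)
  have h1 := key (stdVec 1)
  simp [pair_conormal] at h3 h1
  rw [← h3] at h1
  exact hab (by linarith)

omit hu in
lemma sharp_ne_zero (hu : u ∈ e.target) (a : ℝ) : sharp S e u (conormal a) ≠ 0 := by
  intro h
  have := gForm_sharp S hG.atlas hu (conormal a) (stdVec 3)
  rw [h, pair_conormal] at this
  simp at this

/-- A null vector annihilated by a null conormal is a multiple of the raised conormal. -/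
lemma eq_smul_sharp {w a q : ℝ} (hq : q ≤ 2 * a ^ 2) (hus : u = sheet w a q) {k : R4}
    (hk : gForm S e u k k = 0) (hp : pair (conormal a) k = 0) :
    ∃ μ : ℝ, k = μ • sharp S e u (conormal a) := by
  have ht := hG.target hu
  refine (isLorentz_gForm S hG.atlas ht).eq_smul_of_null hk ?_ ?_ (hG.sharp_ne_zero ht a)
  · rw [gForm_sharp S hG.atlas ht]; exact hG.null_conormal hu hq hus
  · rw [gForm_symm, gForm_sharp S hG.atlas ht]; exact hp

omit hu in
-- The pairings with the time orientation are metric products with the raised conormals, so equal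
-- signs mean equal time orientation. Non-proportional null vectors of equal time orientation have
-- negative product.
lemma pair_neg_of_future_neg (hu : u ∈ Metric.ball (0 : R4) r) {w a b q : ℝ} (hq : q ≤ 2 * a ^ 2)
    (hus : u = sheet w a q) (hq' : q ≤ 2 * b ^ 2)
    (hus' : u = sheet w b q) (hab : a ≠ b)
    (hs : 0 < pair (conormal a) (futureCoord S e u) * pair (conormal b) (futureCoord S e u)) :
    pair (conormal a) (sharp S e u (conormal b)) < 0 := by
  have ht := hG.target hu
  have hL := isLorentz_gForm S hG.atlas ht
  have n1 := hG.null_conormal hu hq hus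
  have n2 := hG.null_conormal hu hq' hus'
  have hT := futureCoord_timelike S hG.atlas ht
  rw [← gForm_sharp S hG.atlas ht] at n1 n2 ⊢
  rw [← gForm_sharp S hG.atlas ht (conormal a), ← gForm_sharp S hG.atlas ht (conormal b),
    gForm_symm S u (sharp S e u (conormal a)), gForm_symm S u (sharp S e u (conormal b))] at hs
  rcases pos_and_pos_or_neg_and_neg_of_mul_pos hs with ⟨h1, h2⟩ | ⟨h1, h2⟩
  · have := hL.neg_of_future_null (T := -futureCoord S e u) (by simpa using hT) n1 n2
      (by simpa using h1) (by simpa using h2) (hG.sharp_ne_smul ht hab)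
    exact this
  · exact hL.neg_of_future_null hT n1 n2 h1 h2 (hG.sharp_ne_smul ht hab)

end HorizonGraph

lemma mem_ball_of_tendsto {ι : Type*} {l : Filter ι} {f : ι → R4} {u : R4}
    (h : Tendsto f l (𝓝 u)) (hu : u ∈ Metric.ball (0 : R4) r) :
    ∀ᶠ i in l, f i ∈ Metric.ball (0 : R4) r :=
  h.eventually_mem (Metric.isOpen_ball.mem_nhds hu)

namespace HorizonGraph

lemma tendsto_pair_future (hG : HorizonGraph S H e r) :
    Tendsto (fun s : R4 × ℝ => pair (conormal s.2) (futureCoord S e s.1)) (𝓝 (0, 0))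
      (𝓝 (futureCoord S e 0 3)) := by
  have h0 : (0 : R4) ∈ e.target := hG.target (Metric.mem_ball_self hG.pos)
  have h1 : Tendsto (fun s : R4 × ℝ => futureCoord S e s.1) (𝓝 (0, 0)) (𝓝 (futureCoord S e 0)) :=
    (((continuousOn_futureCoord S hG.atlas).continuousAt (e.open_target.mem_nhds h0)).tendsto).comp
      (continuous_fst.tendsto ((0 : R4), (0 : ℝ)))
  have h2 : Tendsto (fun s : R4 × ℝ => conormal s.2) (𝓝 (0, 0)) (𝓝 (conormal 0)) :=
    (continuous_conormal.tendsto 0).comp (continuous_snd.tendsto ((0 : R4), (0 : ℝ)))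
  have h3 := tendsto_pair h2 h1
  have h4 : pair (conormal 0) (futureCoord S e 0) = futureCoord S e 0 3 := by
    rw [conormal_zero, pair_stdVec]
  rw [h4] at h3
  exact h3

lemma zero_eq_sheet : (0 : R4) = sheet 0 0 0 := by
  apply R4.ext <;> simp [sheet]

/-- The future of the horizon is the side `z > Z`. -/
lemma futureCoord_pos (hG : HorizonGraph S H e r) : 0 < futureCoord S e 0 3 := by
  have hb0 : (0 : R4) ∈ Metric.ball (0 : R4) r := Metric.mem_ball_self hG.pos
  have hne : futureCoord S e 0 3 ≠ 0 := by
    intro h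
    have h1 := hG.nonneg_of_pair_eq_zero hb0 (w := 0) (a := 0) (q := 0) (Or.inr ⟨rfl, rfl⟩)
      zero_eq_sheet (d := futureCoord S e 0) (by rw [conormal_zero, pair_stdVec, h])
    exact absurd (futureCoord_timelike S hG.atlas (hG.target hb0)) (not_lt.mpr h1)
  -- If the future were below the sheet, a generator at a crease point near the origin would be a
  -- positive multiple of one raised conormal and pair negatively with the other conormal. It would
  -- drop below the sheet, against `pair_conormal_nonneg`.
  by_contra hnp
  have hneg : futureCoord S e 0 3 < 0 := lt_of_le_of_ne (not_lt.mp hnp) hne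
  have hT := hG.tendsto_pair_future
  have hsc : Tendsto (fun a : ℝ => sheet 0 a (2 * a ^ 2)) (𝓝[>] 0) (𝓝 0) := by
    have : Continuous fun a : ℝ => sheet 0 a (2 * a ^ 2) :=
      continuous_pt continuous_const (by fun_prop) (by fun_prop) (by fun_prop)
    have h := this.tendsto 0
    simp only [ne_eq, OfNat.ofNat_ne_zero, not_false_eq_true, zero_pow, mul_zero,
      ← zero_eq_sheet] at h
    exact h.mono_left nhdsWithin_le_nhds
  have hid : Tendsto (fun a : ℝ => a) (𝓝[>] 0) (𝓝 0) := tendsto_id.mono_left nhdsWithin_le_nhds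
  have t1 := hT.comp (hsc.prodMk_nhds hid)
  have t2 := hT.comp (hsc.prodMk_nhds (by simpa using hid.neg : Tendsto (fun a : ℝ => -a) (𝓝[>] 0) (𝓝 0)))
  obtain ⟨a, h1, h2, h3, h4⟩ := ((t1.eventually (gt_mem_nhds hneg)).and
    ((t2.eventually (gt_mem_nhds hneg)).and ((mem_ball_of_tendsto hsc hb0).and
      self_mem_nhdsWithin))).exists
  have ha : a ≠ 0 := (show (0 : ℝ) < a from h4).ne'
  simp only [Function.comp] at h1 h2
  set u := sheet 0 a (2 * a ^ 2) with hu
  have hus' : u = sheet 0 (-a) (2 * a ^ 2) := (sheet_crease_neg 0 a).symm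
  have hq' : 2 * a ^ 2 ≤ 2 * (-a) ^ 2 := by rw [neg_sq]
  obtain ⟨k, hk⟩ := hG.genVecs_nonempty h3 (onGraph_sheet le_rfl)
  obtain ⟨c, t, hct, hcd, hev⟩ := hG.exists_curve h3 hk
  obtain ⟨hk1, hk2⟩ := hG.genVecs_null h3 hk
  have hane : a ≠ -a := fun h => ha (by linarith)
  have key : ∀ b b' : ℝ, 2 * a ^ 2 ≤ 2 * b ^ 2 → 2 * a ^ 2 ≤ 2 * b' ^ 2 → u = sheet 0 b (2 * a ^ 2) →
      u = sheet 0 b' (2 * a ^ 2) → b' ≠ b → pair (conormal b) (futureCoord S e u) < 0 →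
      pair (conormal b') (futureCoord S e u) < 0 → pair (conormal b) k = 0 → False := by
    intro b b' hb hb' hub hub' hbb f1 f2 hz
    obtain ⟨μ, hμ⟩ := hG.eq_smul_sharp h3 hb hub hk1 hz
    have hμ0 : 0 < μ := by
      rw [hμ, map_smul, smul_eq_mul, gForm_symm, gForm_sharp S hG.atlas (hG.target h3)] at hk2
      by_contra hn
      exact absurd hk2 (not_lt.mpr (mul_nonneg_of_nonpos_of_nonpos (not_lt.mp hn) f1.le))
    have h5 := hG.pair_neg_of_future_neg h3 hb' hub' hb hub hbb (mul_pos_of_neg_of_neg f2 f1)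
    have h6 := pair_conormal_nonneg (hct.trans hub') hcd.hasDerivWithinAt hev
    rw [hμ, pair_smul] at h6
    exact absurd h6 (not_le.mpr (mul_neg_of_pos_of_neg hμ0 h5))
  rcases pair_conormal_crease ha hct hcd.hasDerivWithinAt hev with h | h
  · exact key a (-a) le_rfl hq' rfl hus' hane.symm h1 h2 h
  · exact key (-a) a hq' le_rfl hus' rfl hane h2 h1 h

end HorizonGraph

variable (S H e r) in
/-- A ball in which the horizon is the upper sheet, and the future is its upper side. -/
structure OrientedGraph : Prop extends HorizonGraph S H e r where
  future_pos : ∀ v ∈ Metric.ball (0 : R4) r, ∀ b, |b| = |argmaxGen (v 1, v 2)| →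
    0 < pair (conormal b) (futureCoord S e v)

/-- Positivity at the origin persists nearby because the maximizer is continuous there with value
`0`. Both `±A` are included, since both conormals matter at the crease. -/
lemma HorizonGraph.exists_orientedGraph (hG : HorizonGraph S H e r) :
    ∃ r' > 0, OrientedGraph S H e r' := by
  have hT := hG.tendsto_pair_future.eventually (lt_mem_nhds hG.futureCoord_pos)
  obtain ⟨ρ, hρ, hb⟩ := Metric.eventually_nhds_iff_ball.mp hT
  rw [← ball_prod_same] at hb
  have hA : Tendsto (fun v : R4 => argmaxGen (v 1, v 2)) (𝓝 0) (𝓝 0) := by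
    have h1 := tendsto_argmaxGen (a := 0) (y := 0) (Or.inr ⟨rfl, rfl⟩)
    have h2 : Tendsto (fun v : R4 => (v 1, v 2)) (𝓝 0) (𝓝 (0, 0)) :=
      ((continuous_coord 1).prodMk (continuous_coord 2)).tendsto 0
    simp only [ne_eq, OfNat.ofNat_ne_zero, not_false_eq_true, zero_pow, mul_zero, sub_zero] at h1
    exact h1.comp h2
  obtain ⟨ρ', hρ', hb'⟩ := Metric.eventually_nhds_iff_ball.mp
    (hA.eventually_mem (Metric.ball_mem_nhds 0 hρ))
  refine ⟨min r (min ρ ρ'), lt_min hG.pos (lt_min hρ hρ'),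
    hG.mono (lt_min hG.pos (lt_min hρ hρ')) (min_le_left _ _), fun v hv b hbA => ?_⟩
  refine hb (v, b) ⟨Metric.ball_subset_ball ((min_le_right _ _).trans (min_le_left _ _)) hv, ?_⟩
  have := hb' v (Metric.ball_subset_ball ((min_le_right _ _).trans (min_le_right _ _)) hv)
  simp only [Metric.mem_ball, dist_zero_right, Real.norm_eq_abs] at this ⊢
  rwa [hbA]

namespace OrientedGraph

variable (hG : OrientedGraph S H e r) {u : R4} (hu : u ∈ Metric.ball (0 : R4) r)
include hG hu

lemma neg_of_eq_smul {k : R4} {b μ : ℝ} (hb : |b| = |argmaxGen (u 1, u 2)|)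
    (hk : gForm S e u (futureCoord S e u) k < 0) (h : k = μ • sharp S e u (conormal b)) :
    μ < 0 := by
  rw [h, map_smul, smul_eq_mul, gForm_symm, gForm_sharp S hG.atlas (hG.target hu)] at hk
  have := hG.future_pos u hu b hb
  by_contra hn
  exact absurd hk (not_lt.mpr (mul_nonneg (not_lt.mp hn) this.le))

/-- The tangent vectors of generators at points where the upper sheet is differentiable. -/
lemma genVecs_regular (hg : OnGraph u) (hoff : (u 1, u 2) ∈ offCrease) {k : R4}
    (hk : k ∈ genVecs S H e u) :
    ∃ μ : ℝ, 0 < μ ∧ k = -(μ • sharp S e u (conormal (argmaxGen (u 1, u 2)))) := by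
  obtain ⟨μ, hμ, h⟩ := hG.genVecs_eq_smul hu (argmaxGen_of_offCrease hoff) hg.eq_sheet hk
  have := hG.neg_of_eq_smul hu rfl (hG.genVecs_null hu hk).2 h
  exact ⟨-μ, by linarith, by rw [h]; simp⟩

end OrientedGraph

/-- The points of the upper sheet over the crease. -/
lemma OnGraph.crease_sheet {u : R4} (hg : OnGraph u) (hoff : (u 1, u 2) ∉ offCrease) :
    u 2 = 2 * argmaxGen (u 1, u 2) ^ 2 ∧ argmaxGen (u 1, u 2) ≠ 0 ∧
      u = sheet (u 0) (argmaxGen (u 1, u 2)) (2 * argmaxGen (u 1, u 2) ^ 2) := by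
  have h1 := argmaxGen_critical (u 1, u 2)
  have h2 := le_two_argmaxGen_sq (u 1, u 2)
  simp only [offCrease, mem_ofPred_eq, not_not] at hoff
  simp only at h1 h2
  have hA : argmaxGen (u 1, u 2) ≠ 0 := by
    intro h
    rw [h] at h2
    linarith [hoff.2]
  have h3 : u 2 = 2 * argmaxGen (u 1, u 2) ^ 2 := by
    rw [hoff.1] at h1 hA ⊢
    have h4 : argmaxGen (0, u 2) * (2 * argmaxGen (0, u 2) ^ 2 - u 2) = 0 := by linarith
    have := (mul_eq_zero.mp h4).resolve_left hA
    linarith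
  refine ⟨h3, hA, ?_⟩
  rw [← h3]
  exact hg.eq_sheet

namespace OrientedGraph

variable (hG : OrientedGraph S H e r) {u : R4} (hu : u ∈ Metric.ball (0 : R4) r)
include hG hu

/-- The two raised conormals at the crease are transverse. -/
lemma pair_crease_neg (hg : OnGraph u) (hoff : (u 1, u 2) ∉ offCrease) {b : ℝ}
    (hb : |b| = |argmaxGen (u 1, u 2)|) :
    pair (conormal (-b)) (sharp S e u (conormal b)) < 0 := by
  obtain ⟨h2, hA, hs⟩ := hg.crease_sheet hoff
  set A := argmaxGen (u 1, u 2)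
  have hb2 : b ^ 2 = A ^ 2 := (sq_eq_sq_iff_abs_eq_abs _ _).mpr hb
  have hb0 : b ≠ 0 := by
    intro h; rw [h] at hb2
    exact hA (by simpa using hb2.symm)
  have hsb : u = sheet (u 0) b (2 * A ^ 2) := by
    rcases abs_eq_abs.mp hb with h | h
    · rw [h]; exact hs
    · rw [h, sheet_crease_neg]; exact hs
  have hsb' : u = sheet (u 0) (-b) (2 * A ^ 2) := by
    rw [← hb2, sheet_crease_neg, hb2]; exact hsb
  refine hG.toHorizonGraph.pair_neg_of_future_neg hu (by rw [neg_sq, hb2]) hsb' (by rw [hb2]) hsb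
    (fun h => hb0 (by linarith)) (mul_pos (hG.future_pos u hu _ (by rwa [abs_neg]))
      (hG.future_pos u hu _ hb))

/-- The tangent vectors of generators at an arbitrary point of the upper sheet. -/
lemma genVecs_form (hg : OnGraph u) {k : R4} (hk : k ∈ genVecs S H e u) :
    ∃ b μ : ℝ, |b| = |argmaxGen (u 1, u 2)| ∧ 0 < μ ∧ k = -(μ • sharp S e u (conormal b)) := by
  by_cases hoff : (u 1, u 2) ∈ offCrease
  · obtain ⟨μ, hμ, h⟩ := hG.genVecs_regular hu hg hoff hk
    exact ⟨_, μ, rfl, hμ, h⟩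
  · obtain ⟨h2, hA, hs⟩ := hg.crease_sheet hoff
    set A := argmaxGen (u 1, u 2) with hAdef
    obtain ⟨c, t, hct, hcd, hev⟩ := hG.exists_curve hu hk
    obtain ⟨hk1, hk2⟩ := hG.genVecs_null hu hk
    have fin : ∀ b : ℝ, |b| = |A| → u = sheet (u 0) b (2 * A ^ 2) → pair (conormal b) k = 0 →
        ∃ b μ : ℝ, |b| = |A| ∧ 0 < μ ∧ k = -(μ • sharp S e u (conormal b)) := by
      intro b hb hsb h0
      have hb2 : b ^ 2 = A ^ 2 := (sq_eq_sq_iff_abs_eq_abs _ _).mpr hb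
      obtain ⟨μ, hμ⟩ := hG.eq_smul_sharp hu (by rw [hb2]) hsb hk1 h0
      have := hG.neg_of_eq_smul hu hb hk2 hμ
      exact ⟨b, -μ, hb, by linarith, by rw [hμ]; simp⟩
    rcases pair_conormal_crease hA (hct.trans hs) hcd.hasDerivWithinAt hev with h | h
    · exact fin A rfl hs h
    · exact fin (-A) (abs_neg A) (by rw [sheet_crease_neg]; exact hs) h

end OrientedGraph

end Caustic
end

noncomputable section
namespace Caustic

set_option linter.unusedSectionVars false

/-! ### The inverse metric on the `A₃` line -/

variable {M : Type*} [TopologicalSpace M] [ChartedSpace R4 M] [IsManifold (𝓡 4) ∞ M]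
variable {S : Spacetime M} {H : Set M} {e : OpenPartialHomeomorph M R4} {p : M} {r : ℝ}

lemma sharp_conormal_apply (v : R4) (a : ℝ) (i : Fin 4) :
    sharp S e v (conormal a) i = S.gUp e v i 3 - a * S.gUp e v i 1 - a ^ 2 * S.gUp e v i 2 := by
  rw [sharp_apply, Fin.sum_univ_four]
  simp [conormal]; ring

/-- The null condition for the conormal written as a polynomial in `a` with components of the
inverse metric as coefficients; by `HorizonGraph.null_conormal` it vanishes on the upper sheet. -/
lemma pair_sharp_conormal (v : R4) (a : ℝ) :
    pair (conormal a) (sharp S e v (conormal a)) = S.gUp e v 3 3 - 2 * a * S.gUp e v 1 3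
      + a ^ 2 * (S.gUp e v 1 1 - 2 * S.gUp e v 2 3) + 2 * a ^ 3 * S.gUp e v 1 2
      + a ^ 4 * S.gUp e v 2 2 := by
  simp only [pair_conormal, sharp_conormal_apply]
  rw [gUp_symm S v 3 1, gUp_symm S v 3 2, gUp_symm S v 2 1]
  ring

/-- Letting `a → 0` kills the constant term; division by `a` and repetition kill the other two. -/
lemma coeff_eq_zero_of_isBigO {c₀ c₁ c₂ : ℝ}
    (h : (fun a : ℝ => c₀ + c₁ * a + c₂ * a ^ 2) =O[𝓝[>] 0] fun a => a ^ 3) :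
    c₀ = 0 ∧ c₁ = 0 ∧ c₂ = 0 := by
  have lim : ∀ f : ℝ → ℝ, Continuous f → Tendsto f (𝓝[>] 0) (𝓝 (f 0)) := fun f hf =>
    (hf.tendsto 0).mono_left nhdsWithin_le_nhds
  have limpow : ∀ n : ℕ, n ≠ 0 → Tendsto (fun a : ℝ => a ^ n) (𝓝[>] 0) (𝓝 0) := fun n hn => by
    have := lim (fun a : ℝ => a ^ n) (by fun_prop)
    rwa [zero_pow hn] at this
  have hdiv : ∀ {f : ℝ → ℝ} {n : ℕ}, (fun a => f a * a) =O[𝓝[>] 0] (fun a : ℝ => a ^ (n + 1)) →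
      f =O[𝓝[>] 0] fun a => a ^ n := by
    intro f n hf
    have := hf.mul (Asymptotics.isBigO_refl (fun a : ℝ => a⁻¹) (𝓝[>] 0))
    refine this.congr' ?_ ?_
    · filter_upwards [self_mem_nhdsWithin] with a ha
      have : a ≠ 0 := (show (0 : ℝ) < a from ha).ne'
      field_simp
    · filter_upwards [self_mem_nhdsWithin] with a ha
      have : a ≠ 0 := (show (0 : ℝ) < a from ha).ne'
      field_simp; ring
  have h0 : c₀ = 0 := by
    have t1 := h.trans_tendsto (limpow 3 (by simp))
    have t2 := lim (fun a : ℝ => c₀ + c₁ * a + c₂ * a ^ 2) (by fun_prop)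
    have := tendsto_nhds_unique t2 t1
    simpa using this
  subst h0
  have h' := hdiv (f := fun a => c₁ + c₂ * a) (n := 2) (h.congr_left fun a => by ring)
  have h1 : c₁ = 0 := by
    have t1 := h'.trans_tendsto (limpow 2 (by simp))
    have t2 := lim (fun a : ℝ => c₁ + c₂ * a) (by fun_prop)
    have := tendsto_nhds_unique t2 t1
    simpa using this
  subst h1
  have h'' := hdiv (f := fun _ => c₂) (n := 1) (h'.congr_left fun a => by ring)
  refine ⟨rfl, rfl, ?_⟩
  have t1 := h''.trans_tendsto (limpow 1 (by simp))
  exact tendsto_nhds_unique tendsto_const_nhds t1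

lemma linePoint_eq_sheet (w : ℝ) : linePoint w = sheet w 0 0 := by
  rw [linePoint_eq]; simp [sheet]

lemma differentiableAt_gUp (he : e ∈ IsManifold.maximalAtlas (𝓡 4) ∞ M) {u : R4} (hu : u ∈ e.target)
    (i j : Fin 4) : DifferentiableAt ℝ (fun v => S.gUp e v i j) u :=
  ((contDiffOn_gUp S he i j).contDiffAt (e.open_target.mem_nhds hu)).differentiableAt (by simp)

lemma continuousAt_gUp (he : e ∈ IsManifold.maximalAtlas (𝓡 4) ∞ M) {u : R4} (hu : u ∈ e.target)
    (i j : Fin 4) : ContinuousAt (fun v => S.gUp e v i j) u :=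
  (differentiableAt_gUp he hu i j).continuousAt

namespace HorizonGraph

variable (hG : HorizonGraph S H e r) {w : ℝ} (hw : linePoint w ∈ Metric.ball (0 : R4) r)
include hG hw

/-- On the curve `(w, 4a³, 0, 3a⁴)` the conormal has slope `a`, but the point is only `O(a³)` away
from the line. So the inverse metric may be frozen at the line with an error `O(a³)`, and the null
condition forces the coefficients of `1`, `a`, `a²` to vanish. -/
lemma gUp_line : S.gUp e (linePoint w) 3 3 = 0 ∧ S.gUp e (linePoint w) 1 3 = 0 ∧
    S.gUp e (linePoint w) 2 3 = (1 / 2) * S.gUp e (linePoint w) 1 1 := by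
  set u := linePoint w with hu
  have hc : Continuous fun a : ℝ => sheet w a 0 :=
    continuous_pt continuous_const (by fun_prop) (by fun_prop) (by fun_prop)
  have ht : Tendsto (fun a : ℝ => sheet w a 0) (𝓝[>] 0) (𝓝 u) := by
    rw [hu, linePoint_eq_sheet]; exact (hc.tendsto 0).mono_left nhdsWithin_le_nhds
  have hdist : (fun a : ℝ => sheet w a 0 - u) =O[𝓝[>] 0] fun a => a ^ 3 := by
    have h1 : (fun a : ℝ => sheet w a 0 - u) = fun a => a ^ 3 • pt 0 4 0 (3 * a) := by
      funext a
      apply R4.ext <;> simp [sheet, hu, linePoint_eq] <;> ring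
    rw [h1]
    have h2 : (fun a : ℝ => pt 0 4 0 (3 * a)) =O[𝓝[>] 0] fun _ => (1 : ℝ) := by
      have : Continuous fun a : ℝ => pt 0 4 0 (3 * a) :=
        continuous_pt continuous_const continuous_const continuous_const (by fun_prop)
      exact ((this.tendsto 0).mono_left nhdsWithin_le_nhds).isBigO_one ℝ
    simpa using (Asymptotics.isBigO_refl (fun a : ℝ => a ^ 3) (𝓝[>] 0)).smul h2
  have hO : ∀ i j, (fun a : ℝ => S.gUp e (sheet w a 0) i j - S.gUp e u i j) =O[𝓝[>] 0]
      fun a => a ^ 3 := fun i j =>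
    (((differentiableAt_gUp hG.atlas (hG.target hw) i j).hasFDerivAt.isBigO_sub).comp_tendsto ht).trans
      hdist
  have hB : ∀ i j, (fun a : ℝ => S.gUp e (sheet w a 0) i j) =O[𝓝[>] 0] fun _ => (1 : ℝ) :=
    fun i j => ((continuousAt_gUp hG.atlas (hG.target hw) i j).tendsto.comp ht).isBigO_one ℝ
  have hpow : ∀ f : ℝ → ℝ, Continuous f → f =O[𝓝[>] 0] fun _ => (1 : ℝ) := fun f hf =>
    ((hf.tendsto 0).mono_left nhdsWithin_le_nhds).isBigO_one ℝ
  have hmul : ∀ {f g : ℝ → ℝ}, f =O[𝓝[>] 0] (fun _ => (1 : ℝ)) → g =O[𝓝[>] 0] (fun a : ℝ => a ^ 3) →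
      (fun a => f a * g a) =O[𝓝[>] 0] fun a : ℝ => a ^ 3 := fun hf hg => by
    simpa using hf.mul hg
  have hz : ∀ᶠ a in 𝓝[>] (0 : ℝ), S.gUp e (sheet w a 0) 3 3 - 2 * a * S.gUp e (sheet w a 0) 1 3
      + a ^ 2 * (S.gUp e (sheet w a 0) 1 1 - 2 * S.gUp e (sheet w a 0) 2 3)
      + 2 * a ^ 3 * S.gUp e (sheet w a 0) 1 2 + a ^ 4 * S.gUp e (sheet w a 0) 2 2 = 0 := by
    filter_upwards [mem_ball_of_tendsto ht hw] with a ha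
    rw [← pair_sharp_conormal]
    exact hG.null_conormal ha (by positivity) rfl
  have hsum : (fun a : ℝ => (S.gUp e u 3 3 - S.gUp e (sheet w a 0) 3 3)
      + (-2 * a) * (S.gUp e u 1 3 - S.gUp e (sheet w a 0) 1 3)
      + a ^ 2 * (S.gUp e u 1 1 - S.gUp e (sheet w a 0) 1 1)
      + (-2 * a ^ 2) * (S.gUp e u 2 3 - S.gUp e (sheet w a 0) 2 3)
      + (-2 * S.gUp e (sheet w a 0) 1 2) * a ^ 3
      + (-a * S.gUp e (sheet w a 0) 2 2) * a ^ 3) =O[𝓝[>] 0] fun a => a ^ 3 := by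
    have hO' : ∀ i j, (fun a : ℝ => S.gUp e u i j - S.gUp e (sheet w a 0) i j) =O[𝓝[>] 0]
      fun a => a ^ 3 := fun i j => (hO i j).neg_left.congr_left fun a => by simp
    refine (((((hO' 3 3).add (hmul (hpow _ (by fun_prop)) (hO' 1 3))).add
      (hmul (hpow _ (by fun_prop)) (hO' 1 1))).add (hmul (hpow _ (by fun_prop)) (hO' 2 3))).add
      (hmul ((hB 1 2).const_mul_left (-2)) (Asymptotics.isBigO_refl _ _))).add
      (hmul ?_ (Asymptotics.isBigO_refl _ _))
    simpa using (hpow (fun a => -a) (by fun_prop)).mul (hB 2 2)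
  obtain ⟨h1, h2, h3⟩ := coeff_eq_zero_of_isBigO (c₀ := S.gUp e u 3 3) (c₁ := -2 * S.gUp e u 1 3)
    (c₂ := S.gUp e u 1 1 - 2 * S.gUp e u 2 3) (hsum.congr' (by
      filter_upwards [hz] with a ha
      linear_combination (-1 : ℝ) * ha) EventuallyEq.rfl)
  exact ⟨h1, by linarith, by linarith⟩

omit hw in
/-- A vector orthogonal to a null vector, and not proportional to it, is spacelike. -/
lemma pos_of_orthogonal_null {u : R4} (hu : u ∈ e.target) {n d : R4} (hn0 : n ≠ 0)
    (hn : gForm S e u n n = 0) (hnd : gForm S e u n d = 0) (hne : ∀ μ : ℝ, d ≠ μ • n) :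
    0 < gForm S e u d d := by
  have hL := isLorentz_gForm S hG.atlas hu
  obtain ⟨T, hT⟩ := hL.exists_timelike
  have hTn := hL.ne_zero_of_causal hT hn0 hn.le
  have h := hL.pos_of_orthogonal hT (c := d - (gForm S e u T d / gForm S e u T n) • n) (by
    simp only [map_sub, map_smul, smul_eq_mul]; field_simp; ring)
    (fun h => hne _ (sub_eq_zero.mp h))
  simp only [map_sub, map_smul, LinearMap.sub_apply, LinearMap.smul_apply, smul_eq_mul,
    gForm_symm S u d n, hn, hnd] at h
  simpa using h

lemma gForm_dz_null : gForm S e (linePoint w) (sharp S e (linePoint w) (stdVec 3))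
    (sharp S e (linePoint w) (stdVec 3)) = 0 := by
  rw [gForm_sharp S hG.atlas (hG.target hw), pair_stdVec, ← gUp_eq_sharp]
  exact (hG.gUp_line hw).1

/-- The raised `dx` is orthogonal to the null raised `dz`, because `g^{xz} = 0`, and is not
proportional to it. Hence it is spacelike, so `g^{xx} > 0`, and `g^{yz}` is half of this. -/
lemma gUp_pos : 0 < S.gUp e (linePoint w) 2 3 := by
  have ht := hG.target hw
  obtain ⟨h33, h13, h23⟩ := hG.gUp_line hw
  have h := hG.pos_of_orthogonal_null ht (n := sharp S e (linePoint w) (stdVec 3))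
    (d := sharp S e (linePoint w) (stdVec 1))
    (by have := hG.sharp_ne_zero ht 0; rwa [conormal_zero] at this) (hG.gForm_dz_null hw)
    (by rw [gForm_sharp S hG.atlas ht, pair_stdVec, ← gUp_eq_sharp, gUp_symm, h13]) (by
      intro μ h
      have key : ∀ d, pair (stdVec 1) d = μ * pair (stdVec 3) d := fun d => by
        have := congrArg (fun v => gForm S e (linePoint w) v d) h
        simp only [map_smul, LinearMap.smul_apply, smul_eq_mul, gForm_sharp S hG.atlas ht] at this
        exact this
      have := key (stdVec 1)
      simp [pair_stdVec] at this)
  rw [gForm_sharp S hG.atlas ht, pair_stdVec, ← gUp_eq_sharp] at h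
  rw [h23]; linarith

/-- Coordinate vectors tangent to the horizon at the `A₃` line are spacelike, except `∂/∂y`. -/
lemma gDown_pos {i : Fin 4} (h3 : i ≠ 3) (h2 : i ≠ 2) : 0 < S.gDown e (linePoint w) i i := by
  have ht := hG.target hw
  refine hG.pos_of_orthogonal_null ht (n := sharp S e (linePoint w) (stdVec 3)) (d := stdVec i)
    (by have := hG.sharp_ne_zero ht 0; rwa [conormal_zero] at this) (hG.gForm_dz_null hw)
    (by rw [gForm_sharp S hG.atlas ht, pair_stdVec]; simp [h3.symm]) (fun μ h => ?_)
  have e2 := congrArg (fun v : R4 => v 2) h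
  simp only [stdVec_apply, if_neg h2.symm, PiLp.smul_apply, smul_eq_mul, ← gUp_eq_sharp] at e2
  have hμ : μ = 0 := (mul_eq_zero.mp e2.symm).resolve_right (hG.gUp_pos hw).ne'
  have e3 := congrArg (fun v : R4 => v i) h
  simp [hμ] at e3

end HorizonGraph

lemma OnGraph.linePoint (w : ℝ) : OnGraph (linePoint w) := by
  rw [linePoint_eq_sheet]; exact onGraph_sheet (by simp)

lemma linePoint_offCrease (w : ℝ) : ((linePoint w) 1, (linePoint w) 2) ∈ offCrease := by
  simp [offCrease, linePoint_eq]

lemma argmaxGen_zero : argmaxGen (0, 0) = 0 := by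
  simpa using argmaxGen_critical_eq (a := 0) (y := 0) (Or.inr ⟨rfl, rfl⟩)

lemma argmaxGen_linePoint (w : ℝ) : argmaxGen ((linePoint w) 1, (linePoint w) 2) = 0 :=
  argmaxGen_zero

/-! ### Past endpoints -/

lemma contDiffAt_chart (he : e ∈ IsManifold.maximalAtlas (𝓡 4) ∞ M) {γ : ℝ → M} {t : ℝ}
    {n : WithTop ℕ∞} (hn : n ≤ ∞)
    (hγ : ContMDiffAt 𝓘(ℝ, ℝ) (𝓡 4) n γ t) (ht : γ t ∈ e.source) :
    ContDiffAt ℝ n (fun s => e (γ s)) t := by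
  rw [← contMDiffAt_iff_contDiffAt]
  exact (((contMDiffOn_of_mem_maximalAtlas he).contMDiffAt
    (e.open_source.mem_nhds ht)).of_le hn).comp t hγ

lemma IsGenerator_contMDiffAt {γ : ℝ → M} {J : Set ℝ} {t₀ t : ℝ} (hg : S.IsGenerator H γ J t₀)
    (ht : t ∈ J) : ContMDiffAt 𝓘(ℝ, ℝ) (𝓡 4) 2 γ t :=
  hg.geodesic.1.contMDiffAt (hg.isOpen.mem_nhds ht)

namespace OrientedGraph

set_option maxHeartbeats 1000000 in
/-- A generator through a point of the `A₃` line cannot be extended to the past in the horizon. -/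
lemma not_extendible_line (hG : OrientedGraph S H e r) {w : ℝ}
    (hw : linePoint w ∈ Metric.ball (0 : R4) r) {γ : ℝ → M} {J : Set ℝ} {t₀ : ℝ}
    (hg : S.IsGenerator H γ J t₀) (hγ : γ t₀ = e.symm (linePoint w)) :
    ¬ ∃ t ∈ J, t < t₀ ∧ ∀ s ∈ Icc t t₀, γ s ∈ H := by
  -- With `s = t₀ - t`: since `y` decreases strictly along the generator at `t₀`, a past extension
  -- has `y` at least a constant times `s`. The `x` component of the velocity and `g^{xz}` both
  -- vanish at `t₀`, hence are `O(s)`, and the form of the velocity gives `|b| = O(s)` for the sheet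
  -- parameter `b`. Then `y ≤ 2b² = O(s²)`, a contradiction for small `s`.
  rintro ⟨t₁, ht₁J, ht₁, hpast⟩
  set u := linePoint w with hu
  have htu := hG.target hw
  have hs : γ t₀ ∈ e.source := by rw [hγ]; exact e.map_target htu
  set c : ℝ → R4 := fun s => e (γ s) with hc
  have hct : c t₀ = u := by simp only [hc]; rw [hγ]; exact e.right_inv htu
  have hC2 : ContDiffAt ℝ 2 c t₀ :=
    contDiffAt_chart hG.atlas ENat.LEInfty.out (IsGenerator_contMDiffAt hg hg.mem) hs
  have hDd : DifferentiableAt ℝ (deriv c) t₀ := by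
    have h1 : ContDiffAt ℝ 1 (deriv c) t₀ := by
      have := hC2.fderiv_right (m := 1) (by norm_num)
      have h2 : deriv c = fun t => fderiv ℝ c t 1 := by
        funext t; exact (fderiv_apply_one_eq_deriv).symm
      rw [h2]
      exact this.clm_apply contDiffAt_const
    exact h1.differentiableAt (by simp)
  have hder0 : deriv c t₀ = chartD e (γ t₀) (velocity γ t₀) :=
    (hasDerivAt_generator hG.atlas hg hg.mem hs).deriv
  obtain ⟨h33, h13, h23⟩ := hG.gUp_line hw
  rw [← hu] at h33 h13 h23
  set G := S.gUp e u 2 3 with hGdef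
  have hGpos : 0 < G := hG.gUp_pos hw
  have h11 : S.gUp e u 1 1 = 2 * G := by linarith
  -- the velocity at the endpoint
  have hk : deriv c t₀ ∈ genVecs S H e u := ⟨γ, J, t₀, hg, hγ, hder0.symm⟩
  obtain ⟨μ₀, hμ₀, hk0⟩ := hG.genVecs_regular hw (OnGraph.linePoint w) (linePoint_offCrease w) hk
  rw [argmaxGen_linePoint] at hk0
  have hk1 : deriv c t₀ 1 = 0 := by
    rw [hk0]; simp [sharp_conormal_apply, h13]
  have hk2 : deriv c t₀ 2 < 0 := by
    rw [hk0]; simp only [PiLp.neg_apply, PiLp.smul_apply, sharp_conormal_apply, smul_eq_mul]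
    simp only [zero_mul, sub_zero, ne_eq, OfNat.ofNat_ne_zero, not_false_eq_true, zero_pow,
      ← hGdef, neg_neg_iff_pos]
    positivity
  set k2 := deriv c t₀ 2 with hk2def
  -- estimates near the endpoint
  have hccont : ContinuousAt c t₀ := hC2.continuousAt
  have lc : Tendsto c (𝓝[<] t₀) (𝓝 u) := by
    rw [← hct]; exact hccont.tendsto.mono_left nhdsWithin_le_nhds
  have hDcoord : ∀ i, HasDerivAt (fun t => deriv c t i) (deriv (deriv c) t₀ i) t₀ := fun i =>
    hasDerivAt_coord hDd.hasDerivAt i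
  obtain ⟨C1, hC1⟩ := (hDcoord 1).isBigO_sub.bound
  have hcd : HasDerivAt c (deriv c t₀) t₀ := (hC2.differentiableAt (by simp)).hasDerivAt
  have hg13 : DifferentiableAt ℝ (fun t => S.gUp e (c t) 1 3) t₀ :=
    DifferentiableAt.comp t₀ (g := fun v => S.gUp e v 1 3) (f := c)
      (by rw [hct]; exact differentiableAt_gUp hG.atlas htu 1 3) hcd.differentiableAt
  obtain ⟨C2, hC2'⟩ := hg13.hasDerivAt.isBigO_sub.bound
  have E3 : ∀ᶠ t in 𝓝[<] t₀, deriv c t 2 < k2 / 2 :=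
    ((hDcoord 2).continuousAt.tendsto.mono_left nhdsWithin_le_nhds).eventually
      (gt_mem_nhds (by linarith))
  have E4 : ∀ᶠ t in 𝓝[<] t₀, -k2 / 2 * (t₀ - t) ≤ c t 2 := by
    have h1 := (hasDerivAt_coord hcd 2).tendsto_slope.mono_left
      (nhdsWithin_mono t₀ (fun x (hx : x ∈ Iio t₀) => ne_of_lt hx))
    filter_upwards [h1.eventually (gt_mem_nhds (show k2 < k2 / 2 by linarith)), self_mem_nhdsWithin]
      with t ht htt
    have htt : t < t₀ := htt
    have hc2 : c t₀ 2 = 0 := by rw [hct, hu]; rfl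
    rw [slope_def_field, hc2, div_lt_iff_of_neg (by linarith)] at ht
    linarith
  have lb : Tendsto (fun t => |argmaxGen (c t 1, c t 2)|) (𝓝[<] t₀) (𝓝 0) := by
    have h1 : Tendsto (fun t => (c t 1, c t 2)) (𝓝[<] t₀) (𝓝 (0, 0)) := by
      have := (((continuous_coord 1).prodMk (continuous_coord 2)).tendsto u).comp lc
      exact this
    have h2 := tendsto_argmaxGen (a := 0) (y := 0) (Or.inr ⟨rfl, rfl⟩)
    simp only [ne_eq, OfNat.ofNat_ne_zero, not_false_eq_true, zero_pow, mul_zero, sub_zero] at h2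
    simpa using (h2.comp h1).abs
  have lg : ∀ i j, Tendsto (fun t => S.gUp e (c t) i j) (𝓝[<] t₀) (𝓝 (S.gUp e u i j)) :=
    fun i j => (continuousAt_gUp hG.atlas htu i j).tendsto.comp lc
  have E5 : ∀ᶠ t in 𝓝[<] t₀,
      G < S.gUp e (c t) 1 1 - |argmaxGen (c t 1, c t 2)| * |S.gUp e (c t) 1 2| := by
    have := (lg 1 1).sub (lb.mul (lg 1 2).abs)
    refine this.eventually (lt_mem_nhds ?_)
    rw [h11, zero_mul, sub_zero]; linarith
  have E6 : ∀ᶠ t in 𝓝[<] t₀, S.gUp e (c t) 2 3 + |argmaxGen (c t 1, c t 2)| * |S.gUp e (c t) 1 2|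
      + |argmaxGen (c t 1, c t 2)| ^ 2 * |S.gUp e (c t) 2 2| < 2 * G := by
    have := ((lg 2 3).add (lb.mul (lg 1 2).abs)).add ((lb.pow 2).mul (lg 2 2).abs)
    refine this.eventually (gt_mem_nhds ?_)
    simp only [zero_mul, add_zero, ne_eq, OfNat.ofNat_ne_zero, not_false_eq_true, zero_pow]
    rw [← hGdef]; linarith
  -- `m` is a lower bound for the factor `μ` of the velocity: `-dy/dt` exceeds `-k2/2`, and the
  -- bracket multiplying `μ` is at most `2G`. The constant `C` below is the one in `|b| ≤ C s`.
  set m := -k2 / (4 * G) with hm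
  have hm0 : 0 < m := div_pos (by linarith) (by linarith)
  set C := (|C1| / m + |C2|) / G with hC
  have E7 : ∀ᶠ t in 𝓝[<] t₀, 2 * C ^ 2 * (t₀ - t) < -k2 / 2 := by
    have h1 : Continuous fun t : ℝ => 2 * C ^ 2 * (t₀ - t) := by fun_prop
    refine ((h1.tendsto t₀).mono_left nhdsWithin_le_nhds).eventually (gt_mem_nhds ?_)
    rw [sub_self, mul_zero]; linarith
  have EJ : ∀ᶠ t in 𝓝[<] t₀, t ∈ J := nhdsWithin_le_nhds (hg.isOpen.mem_nhds hg.mem)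
  have Es : ∀ᶠ t in 𝓝[<] t₀, γ t ∈ e.source := nhdsWithin_le_nhds
    ((IsGenerator_mdifferentiableAt hg hg.mem).continuousAt.eventually_mem
      (e.open_source.mem_nhds hs))
  have E1 : ∀ᶠ t in 𝓝[<] t₀, ‖deriv c t 1 - deriv c t₀ 1‖ ≤ C1 * ‖t - t₀‖ := nhdsWithin_le_nhds hC1
  have E2 : ∀ᶠ t in 𝓝[<] t₀, ‖S.gUp e (c t) 1 3 - S.gUp e (c t₀) 1 3‖ ≤ C2 * ‖t - t₀‖ :=
    nhdsWithin_le_nhds hC2'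
  have E8 : ∀ᶠ t in 𝓝[<] t₀, t < t₀ := self_mem_nhdsWithin
  obtain ⟨t, ht1, ht2, ht3, ht4, ht5, ht6, ht7, htJ, hts, htb, htlt, htt1⟩ :=
    (E1.and (E2.and (E3.and (E4.and (E5.and (E6.and (E7.and
      (EJ.and (Es.and ((mem_ball_of_tendsto lc hw).and (E8.and
      (Ioo_mem_nhdsLT ht₁)))))))))))).exists
  have htlt : t < t₀ := htlt
  have hsub : ∀ s ∈ J, t ≤ s → γ s ∈ H := by
    intro s hsJ hts
    rcases le_or_gt s t₀ with h | h
    · exact hpast s ⟨htt1.1.le.trans hts, h⟩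
    · exact hg.subset s hsJ h.le
  have hsymm : e.symm (c t) = γ t := e.left_inv hts
  have hgr : OnGraph (c t) := (hG.graph _ htb).mp (by rw [hsymm]; exact hsub t htJ le_rfl)
  have hDt : deriv c t ∈ genVecs S H e (c t) :=
    ⟨γ, J, t, IsGenerator_later hg htJ hsub, hsymm.symm,
      (hasDerivAt_generator hG.atlas hg htJ hts).deriv.symm⟩
  obtain ⟨b, μ, hb, hμ, hD⟩ := hG.genVecs_form htb hgr hDt
  have hD1 := congrArg (fun v : R4 => v 1) hD
  have hD2 := congrArg (fun v : R4 => v 2) hD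
  simp only [PiLp.neg_apply, PiLp.smul_apply, sharp_conormal_apply, smul_eq_mul] at hD1 hD2
  rw [gUp_symm S (c t) 2 1] at hD2
  rw [← hb] at ht5 ht6
  simp only [hk1, hct, h13, sub_zero, Real.norm_eq_abs] at ht1 ht2
  rw [abs_sub_comm, abs_of_pos (sub_pos.mpr htlt)] at ht1 ht2
  set s := t₀ - t with hsdef
  have hs0 : 0 < s := sub_pos.mpr htlt
  -- lower bound for `μ`
  have hμm : m ≤ μ := by
    have e1 : S.gUp e (c t) 2 3 - b * S.gUp e (c t) 1 2 - b ^ 2 * S.gUp e (c t) 2 2 ≤ 2 * G := by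
      have a1 := neg_abs_le (b * S.gUp e (c t) 1 2)
      have a2 := neg_abs_le (b ^ 2 * S.gUp e (c t) 2 2)
      rw [abs_mul] at a1 a2
      rw [abs_of_nonneg (sq_nonneg b), ← sq_abs b] at a2
      rw [← sq_abs b]
      linarith
    have e2 := mul_le_mul_of_nonneg_left e1 hμ.le
    rw [hm, div_le_iff₀ (by positivity)]
    linarith
  -- upper bound for `b`
  have hbs : |b| ≤ C * s := by
    -- The `x` component of the velocity, solved for `b`. The coefficient of `b` is at least `G` by
    -- `ht5`, and both terms on the right are `O(s)`.
    have e1 : b * (S.gUp e (c t) 1 1 + b * S.gUp e (c t) 1 2)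
        = deriv c t 1 / μ + S.gUp e (c t) 1 3 := by
      rw [hD1]; field_simp; ring
    have e2 : |b| * G ≤ |b| * |S.gUp e (c t) 1 1 + b * S.gUp e (c t) 1 2| := by
      refine mul_le_mul_of_nonneg_left ?_ (abs_nonneg b)
      have a1 := neg_abs_le (b * S.gUp e (c t) 1 2)
      rw [abs_mul] at a1
      exact le_trans (by linarith) (le_abs_self _)
    rw [← abs_mul, e1] at e2
    have e3 := abs_add_le (deriv c t 1 / μ) (S.gUp e (c t) 1 3)
    have e4 : |deriv c t 1 / μ| ≤ |C1| * s / m := by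
      rw [abs_div, abs_of_pos hμ]
      have : |deriv c t 1| ≤ |C1| * s := ht1.trans (by gcongr; exact le_abs_self _)
      gcongr
    have e5 : |S.gUp e (c t) 1 3| ≤ |C2| * s := ht2.trans (by gcongr; exact le_abs_self _)
    rw [hC, div_mul_eq_mul_div, le_div_iff₀ hGpos]
    calc |b| * G ≤ |C1| * s / m + |C2| * s := by linarith
      _ = (|C1| / m + |C2|) * s := by ring
  have hy := le_two_argmaxGen_sq (c t 1, c t 2)
  simp only at hy
  rw [← sq_abs, ← hb] at hy
  have hb2 : |b| ^ 2 ≤ (C * s) ^ 2 := by gcongr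
  have e1 := mul_lt_mul_of_pos_right ht7 hs0
  nlinarith

/-- A generator through a point of the crease cannot be extended to the past in the horizon. -/
lemma not_extendible_crease (hG : OrientedGraph S H e r) {u : R4}
    (hu : u ∈ Metric.ball (0 : R4) r) (hgr : OnGraph u) (hoff : (u 1, u 2) ∉ offCrease)
    {γ : ℝ → M} {J : Set ℝ} {t₀ : ℝ}
    (hg : S.IsGenerator H γ J t₀) (hγ : γ t₀ = e.symm u) :
    ¬ ∃ t ∈ J, t < t₀ ∧ ∀ s ∈ Icc t t₀, γ s ∈ H := by
  rintro ⟨t₁, ht₁J, ht₁, hpast⟩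
  have htu := hG.target hu
  have hs : γ t₀ ∈ e.source := by rw [hγ]; exact e.map_target htu
  set c : ℝ → R4 := fun s => e (γ s) with hc
  have hct : c t₀ = u := by simp only [hc]; rw [hγ]; exact e.right_inv htu
  have hd := hasDerivAt_generator hG.atlas hg hg.mem hs
  set k := chartD e (γ t₀) (velocity γ t₀) with hk
  have hkg : k ∈ genVecs S H e u := ⟨γ, J, t₀, hg, hγ, rfl⟩
  obtain ⟨b, μ, hb, hμ, hkb⟩ := hG.genVecs_form hu hgr hkg
  obtain ⟨h2, hA, hsh⟩ := hgr.crease_sheet hoff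
  have hsb' : u = sheet (u 0) (-b) (2 * argmaxGen (u 1, u 2) ^ 2) := by
    rcases abs_eq_abs.mp hb with h | h
    · rw [h, sheet_crease_neg]; exact hsh
    · rw [h, neg_neg]; exact hsh
  -- The generator along one conormal rises strictly above the tangent hyperplane of the other.
  -- Followed backwards it falls below that supporting hyperplane, hence out of the sheet.
  have hpos : 0 < pair (conormal (-b)) k := by
    rw [hkb, pair_neg, pair_smul]
    have := hG.pair_crease_neg hu hgr hoff hb
    have := mul_neg_of_pos_of_neg hμ this
    linarith
  -- the reversed curve
  have hrev : HasDerivAt (fun s => c (-s)) (-k) (-t₀) := by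
    have h1 : HasDerivAt c k (- -t₀) := by rw [neg_neg]; exact hd
    exact (h1.scomp (-t₀) (hasDerivAt_neg (-t₀))).congr_deriv (by simp)
  have hev : ∀ᶠ s in 𝓝[>] (-t₀), OnGraph (c (-s)) := by
    have hneg : Tendsto (fun s : ℝ => -s) (𝓝[>] (-t₀)) (𝓝[<] t₀) := by
      have := tendsto_neg_nhdsGT (a := -t₀)
      rwa [neg_neg] at this
    refine hneg.eventually (p := fun s => OnGraph (c s)) ?_
    have h1 : ∀ᶠ s in 𝓝 t₀, c s ∈ Metric.ball (0 : R4) r :=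
      mem_ball_of_tendsto (hct ▸ hd.continuousAt.tendsto) hu
    have h2 : ∀ᶠ s in 𝓝 t₀, γ s ∈ e.source :=
      (IsGenerator_mdifferentiableAt hg hg.mem).continuousAt.eventually_mem
        (e.open_source.mem_nhds hs)
    filter_upwards [nhdsWithin_le_nhds h1, nhdsWithin_le_nhds h2, Ioo_mem_nhdsLT ht₁] with s a1 a2 a3
    refine (hG.graph _ a1).mp ?_
    rw [show e.symm (c s) = γ s from e.left_inv a2]
    exact hpast s ⟨a3.1.le, a3.2.le⟩
  have := pair_conormal_nonneg (c := fun s => c (-s)) (t := -t₀) (k := -k)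
    (by simp only [neg_neg]; rw [hct]; exact hsb') hrev.hasDerivWithinAt hev
  rw [pair_neg] at this
  linarith

end OrientedGraph

end Caustic
end

noncomputable section
namespace Caustic

set_option linter.unusedSectionVars false

/-! ### The geodesic equation -/

variable {M : Type*} [TopologicalSpace M] [ChartedSpace R4 M] [IsManifold (𝓡 4) ∞ M]
variable (S : Spacetime M) {e e' : OpenPartialHomeomorph M R4}

/-- The derivative of the metric in the direction `ξ`. -/
def dForm (e : OpenPartialHomeomorph M R4) (u ξ c d : R4) : ℝ :=
  ∑ i, ∑ j, fderiv ℝ (fun v => S.gDown e v i j) u ξ * c i * d j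

/-- The Christoffel symbols of the first kind, applied twice to a velocity. -/
def elForm (e : OpenPartialHomeomorph M R4) (u c ξ : R4) : ℝ :=
  dForm S e u c c ξ - (1 / 2) * dForm S e u ξ c c

/-- The coordinate acceleration of a geodesic. -/
def accel (e : OpenPartialHomeomorph M R4) (u c : R4) : R4 :=
  WithLp.toLp 2 fun k => -∑ i, ∑ j, S.christoffel e u k i j * c i * c j

lemma dForm_eq_sum (u ξ c d : R4) : dForm S e u ξ c d =
    ∑ l, (∑ i, ∑ j, fderiv ℝ (fun v => S.gDown e v i j) u (stdVec l) * c i * d j) * ξ l := by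
  unfold dForm
  have h : ∀ i j, fderiv ℝ (fun v => S.gDown e v i j) u ξ
      = ∑ l, fderiv ℝ (fun v => S.gDown e v i j) u (stdVec l) * ξ l := fun i j => by
    conv_lhs => rw [sum_smul_stdVec ξ]
    simp only [map_sum, map_smul, smul_eq_mul, mul_comm]
  simp only [h, Finset.sum_mul]
  rw [Finset.sum_congr rfl fun i _ => Finset.sum_comm, Finset.sum_comm]
  exact Finset.sum_congr rfl fun l _ => Finset.sum_congr rfl fun i _ =>
    Finset.sum_congr rfl fun j _ => by ring

lemma dForm_stdVec (u ξ c : R4) (l : Fin 4) :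
    dForm S e u ξ c (stdVec l) = ∑ i, fderiv ℝ (fun v => S.gDown e v i l) u ξ * c i := by
  simp [dForm]

lemma elForm_eq_sum (u c ξ : R4) : elForm S e u c ξ = ∑ l, elForm S e u c (stdVec l) * ξ l := by
  have h1 : dForm S e u c c ξ = ∑ l, dForm S e u c c (stdVec l) * ξ l := by
    simp only [dForm_stdVec, Finset.sum_mul]
    exact Finset.sum_comm
  unfold elForm
  rw [h1, dForm_eq_sum S u ξ, Finset.mul_sum, ← Finset.sum_sub_distrib]
  exact Finset.sum_congr rfl fun l _ => by simp only [dForm]; ring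

/-- Contracted with the symmetric `c c`, two of the three terms in the Christoffel symbols coincide.
What remains is the raised Euler–Lagrange covector. -/
lemma accel_eq (u c : R4) :
    accel S e u c = -sharp S e u (WithLp.toLp 2 fun l => elForm S e u c (stdVec l)) := by
  ext k
  simp only [accel, PiLp.neg_apply, sharp_apply, Spacetime.christoffel]
  rw [neg_inj]
  simp only [Finset.mul_sum, Finset.sum_mul]
  rw [Finset.sum_congr rfl fun i _ => Finset.sum_comm, Finset.sum_comm]
  refine Finset.sum_congr rfl fun l _ => ?_
  have h1 : ∑ i, ∑ j, fderiv ℝ (fun v => S.gDown e v j l) u (stdVec i) * c i * c j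
      = dForm S e u c c (stdVec l) := by
    rw [dForm_eq_sum]
    refine Finset.sum_congr rfl fun i _ => ?_
    simp [Finset.sum_mul]
    exact Finset.sum_congr rfl fun j _ => by ring
  have h2 : ∑ i, ∑ j, fderiv ℝ (fun v => S.gDown e v i l) u (stdVec j) * c i * c j
      = dForm S e u c c (stdVec l) := by
    rw [← h1, Finset.sum_comm]
    exact Finset.sum_congr rfl fun j _ => Finset.sum_congr rfl fun i _ => by ring
  have h3 : elForm S e u c (stdVec l) = ∑ i, ∑ j, (1 / 2) *
      (fderiv ℝ (fun v => S.gDown e v j l) u (stdVec i)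
      + fderiv ℝ (fun v => S.gDown e v i l) u (stdVec j)
      - fderiv ℝ (fun v => S.gDown e v i j) u (stdVec l)) * c i * c j := by
    have : ∀ i j, (1 / 2) * (fderiv ℝ (fun v => S.gDown e v j l) u (stdVec i)
      + fderiv ℝ (fun v => S.gDown e v i l) u (stdVec j)
      - fderiv ℝ (fun v => S.gDown e v i j) u (stdVec l)) * c i * c j
      = (1 / 2) * (fderiv ℝ (fun v => S.gDown e v j l) u (stdVec i) * c i * c j)
      + (1 / 2) * (fderiv ℝ (fun v => S.gDown e v i l) u (stdVec j) * c i * c j)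
      - (1 / 2) * (fderiv ℝ (fun v => S.gDown e v i j) u (stdVec l) * c i * c j) := fun i j => by ring
    simp only [this, Finset.sum_sub_distrib, Finset.sum_add_distrib, ← Finset.mul_sum, h1, h2]
    simp only [elForm, dForm]; ring
  simp only [h3, Finset.mul_sum]
  exact Finset.sum_congr rfl fun i _ => Finset.sum_congr rfl fun j _ => by ring

/-- Lowering the index gives the geodesic equation tested against all `ξ`. This form contains no
inverse metric and transforms simply under a change of chart. -/
lemma eq_accel_iff (he : e ∈ IsManifold.maximalAtlas (𝓡 4) ∞ M) {u : R4} (hu : u ∈ e.target)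
    (b c : R4) : b = accel S e u c ↔ ∀ ξ, gForm S e u b ξ + elForm S e u c ξ = 0 := by
  have h : ∀ ξ, gForm S e u (b - accel S e u c) ξ = gForm S e u b ξ + elForm S e u c ξ := fun ξ => by
    rw [accel_eq, sub_neg_eq_add, map_add, LinearMap.add_apply, gForm_sharp S he hu,
      elForm_eq_sum S u c ξ, pair]
  constructor
  · rintro rfl ξ
    rw [← h, sub_self]; simp
  · intro hz
    exact sub_eq_zero.mp ((isLorentz_gForm S he hu).eq_zero_of_forall fun d => (h d).trans (hz d))

/-- The product rule for the metric along a curve. -/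
lemma hasDerivAt_gForm (he : e ∈ IsManifold.maximalAtlas (𝓡 4) ∞ M) {V A B : ℝ → R4}
    {V' A' B' : R4} {t : ℝ} (hVt : V t ∈ e.target) (hV : HasDerivAt V V' t)
    (hA : HasDerivAt A A' t) (hB : HasDerivAt B B' t) :
    HasDerivAt (fun s => gForm S e (V s) (A s) (B s))
      (dForm S e (V t) V' (A t) (B t) + gForm S e (V t) A' (B t) + gForm S e (V t) (A t) B') t := by
  simp only [gForm_eq_sum, dForm, ← Finset.sum_add_distrib]
  refine HasDerivAt.fun_sum fun i _ => HasDerivAt.fun_sum fun j _ => ?_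
  have hg : DifferentiableAt ℝ (fun v => S.gDown e v i j) (V t) :=
    ((contDiffOn_gDown S he i j).contDiffAt (e.open_target.mem_nhds hVt)).differentiableAt (by simp)
  have h1 := hg.hasFDerivAt.comp_hasDerivAt t hV
  refine ((h1.mul (hasDerivAt_coord hA i)).mul (hasDerivAt_coord hB j)).congr_deriv ?_
  simp only [Function.comp, Pi.mul_apply]
  ring

/-! ### Independence of the chart -/

lemma contDiffAt_transition (he : e ∈ IsManifold.maximalAtlas (𝓡 4) ∞ M)
    (he' : e' ∈ IsManifold.maximalAtlas (𝓡 4) ∞ M) {u : R4} (hu : u ∈ e.target)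
    (hu' : e.symm u ∈ e'.source) : ContDiffAt ℝ ∞ (fun v => e' (e.symm v)) u := by
  rw [← contMDiffAt_iff_contDiffAt]
  exact ((contMDiffOn_of_mem_maximalAtlas he').contMDiffAt (e'.open_source.mem_nhds hu')).comp u
    ((contMDiffOn_symm_of_mem_maximalAtlas he).contMDiffAt (e.open_target.mem_nhds hu))

lemma chartD_coordTangent_transition (he : e ∈ IsManifold.maximalAtlas (𝓡 4) ∞ M)
    (he' : e' ∈ IsManifold.maximalAtlas (𝓡 4) ∞ M) {u : R4} (hu : u ∈ e.target)
    (hu' : e.symm u ∈ e'.source) (c : R4) :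
    chartD e' (e.symm u) (coordTangent e u c) = fderiv ℝ (fun v => e' (e.symm v)) u c := by
  have h1 := (mdifferentiable_of_mem_maximalAtlas he').mdifferentiableAt hu'
  have h2 := (mdifferentiable_of_mem_maximalAtlas he).mdifferentiableAt_symm hu
  have := mfderiv_comp u h1 h2
  rw [mfderiv_eq_fderiv] at this
  exact (DFunLike.congr_fun this c).symm

lemma gForm_transition (he : e ∈ IsManifold.maximalAtlas (𝓡 4) ∞ M)
    (he' : e' ∈ IsManifold.maximalAtlas (𝓡 4) ∞ M) {u : R4} (hu : u ∈ e.target)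
    (hu' : e.symm u ∈ e'.source) (c d : R4) : gForm S e u c d =
      gForm S e' (e' (e.symm u)) (fderiv ℝ (fun v => e' (e.symm v)) u c)
        (fderiv ℝ (fun v => e' (e.symm v)) u d) := by
  rw [gForm_apply, metric_eq_gForm S he' hu', chartD_coordTangent_transition he he' hu hu',
    chartD_coordTangent_transition he he' hu hu']

lemma fderiv_transition_surjective (he : e ∈ IsManifold.maximalAtlas (𝓡 4) ∞ M)
    (he' : e' ∈ IsManifold.maximalAtlas (𝓡 4) ∞ M) {u : R4} (hu : u ∈ e.target)
    (hu' : e.symm u ∈ e'.source) :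
    Function.Surjective (fderiv ℝ (fun v => e' (e.symm v)) u) := by
  have hinj : Function.Injective (fderiv ℝ (fun v => e' (e.symm v)) u : R4 →ₗ[ℝ] R4) := by
    intro c d h
    rw [ContinuousLinearMap.coe_coe,
      ← chartD_coordTangent_transition he he' hu hu',
      ← chartD_coordTangent_transition he he' hu hu'] at h
    have := congrArg (chartD e (e.symm u)) (chartD_injective he' hu' h)
    rwa [chartD_coordTangent he hu, chartD_coordTangent he hu] at this
  exact LinearMap.injective_iff_surjective.mp hinj

/-- The geodesic equation in two charts. -/
lemma elForm_transition (he : e ∈ IsManifold.maximalAtlas (𝓡 4) ∞ M)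
    (he' : e' ∈ IsManifold.maximalAtlas (𝓡 4) ∞ M) {u : R4} (hu : u ∈ e.target)
    (hu' : e.symm u ∈ e'.source) (b c ξ : R4) : gForm S e u b ξ + elForm S e u c ξ =
      gForm S e' (e' (e.symm u)) (fderiv ℝ (fun v => e' (e.symm v)) u b
          + fderiv ℝ (fderiv ℝ (fun v => e' (e.symm v))) u c c)
        (fderiv ℝ (fun v => e' (e.symm v)) u ξ)
      + elForm S e' (e' (e.symm u)) (fderiv ℝ (fun v => e' (e.symm v)) u c)
          (fderiv ℝ (fun v => e' (e.symm v)) u ξ) := by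
  set ψ : R4 → R4 := fun v => e' (e.symm v) with hψ
  have hψu := contDiffAt_transition he he' hu hu'
  rw [← hψ] at hψu
  have hψ1 : HasFDerivAt ψ (fderiv ℝ ψ u) u := (hψu.differentiableAt (by simp)).hasFDerivAt
  have hψ2 : HasFDerivAt (fderiv ℝ ψ) (fderiv ℝ (fderiv ℝ ψ) u) u :=
    ((hψu.fderiv_right (m := 1)
      (by rw [one_add_one_eq_two]; exact ENat.LEInfty.out)).differentiableAt (by simp)).hasFDerivAt
  have hsym : ∀ a d, fderiv ℝ (fderiv ℝ ψ) u a d = fderiv ℝ (fderiv ℝ ψ) u d a :=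
    fun a d => (hψu.isSymmSndFDerivAt (by
      rw [minSmoothness_of_isRCLikeNormedField]; exact ENat.LEInfty.out)) a d
  have hnear : ∀ᶠ v in 𝓝 u, v ∈ e.target ∧ e.symm v ∈ e'.source :=
    (e.open_target.eventually_mem hu).and
      ((e.continuousAt_symm hu).eventually_mem (e'.open_source.mem_nhds hu'))
  -- The transformation law of the metric, differentiated at `u` in the direction `η`. In `elForm`
  -- the terms with second derivatives of the transition map then cancel by symmetry, except for the
  -- one that belongs to the acceleration.
  have key : ∀ η c d : R4, dForm S e u η c d =
      dForm S e' (ψ u) (fderiv ℝ ψ u η) (fderiv ℝ ψ u c) (fderiv ℝ ψ u d)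
        + gForm S e' (ψ u) (fderiv ℝ (fderiv ℝ ψ) u η c) (fderiv ℝ ψ u d)
        + gForm S e' (ψ u) (fderiv ℝ ψ u c) (fderiv ℝ (fderiv ℝ ψ) u η d) := by
    intro η c d
    have hl : HasDerivAt (fun s : ℝ => u + s • η) η 0 := by
      have := ((hasDerivAt_id (0 : ℝ)).smul_const η).const_add u
      exact this.congr_deriv (by simp)
    have hu0 : u + (0 : ℝ) • η = u := by simp
    have h1 := hasDerivAt_gForm S he (V := fun s : ℝ => u + s • η) (t := 0) (by rw [hu0]; exact hu) hl
      (hasDerivAt_const (0 : ℝ) c) (hasDerivAt_const (0 : ℝ) d)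
    have hA : ∀ a, HasDerivAt (fun s : ℝ => fderiv ℝ ψ (u + s • η) a)
        (fderiv ℝ (fderiv ℝ ψ) u η a) 0 := fun a => by
      have := (hu0.symm ▸ hψ2 : HasFDerivAt (fderiv ℝ ψ) (fderiv ℝ (fderiv ℝ ψ) u)
        (u + (0 : ℝ) • η)).comp_hasDerivAt (0 : ℝ) hl
      exact (this.clm_apply (hasDerivAt_const (0 : ℝ) a)).congr_deriv (by simp)
    have hV : HasDerivAt (fun s : ℝ => ψ (u + s • η)) (fderiv ℝ ψ u η) 0 := by
      have h : HasFDerivAt ψ (fderiv ℝ ψ u) (u + (0 : ℝ) • η) := by rw [hu0]; exact hψ1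
      exact h.comp_hasDerivAt (0 : ℝ) hl
    have h2 := hasDerivAt_gForm S he' (t := 0)
      (by simp only [hu0]; exact e'.map_source hu') hV (hA c) (hA d)
    have heq : (fun s : ℝ => gForm S e (u + s • η) c d) =ᶠ[𝓝 0] fun s =>
        gForm S e' (ψ (u + s • η)) (fderiv ℝ ψ (u + s • η) c) (fderiv ℝ ψ (u + s • η) d) := by
      have hc : Tendsto (fun s : ℝ => u + s • η) (𝓝 0) (𝓝 u) := by
        have := hl.continuousAt.tendsto
        rwa [hu0] at this
      filter_upwards [hc.eventually hnear] with s hs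
      exact gForm_transition S he he' hs.1 hs.2 c d
    have := h1.unique (h2.congr_of_eventuallyEq heq)
    simpa [hu0] using this
  rw [gForm_transition S he he' hu hu' b ξ, elForm, elForm, key, key, map_add, LinearMap.add_apply,
    hsym ξ c, gForm_symm S (ψ u) (fderiv ℝ ψ u c) (fderiv ℝ (fderiv ℝ ψ) u c ξ)]
  ring

/-! ### Geodesics in a chart -/

lemma contDiffAt_deriv {c : ℝ → R4} {t : ℝ} (hc : ContDiffAt ℝ 2 c t) :
    ContDiffAt ℝ 1 (deriv c) t := by
  have h2 : deriv c = fun t => fderiv ℝ c t 1 := by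
    funext t; exact (fderiv_apply_one_eq_deriv).symm
  rw [h2]
  exact (hc.fderiv_right (m := 1) (by norm_num)).clm_apply contDiffAt_const

lemma eventually_hasDerivAt {c : ℝ → R4} {t : ℝ} (hc : ContDiffAt ℝ 2 c t) :
    ∀ᶠ s in 𝓝 t, HasDerivAt c (deriv c s) s := by
  filter_upwards [hc.eventually (by simp)] with s hs
  exact (hs.differentiableAt (by simp)).hasDerivAt

lemma hasDerivAt_deriv {c : ℝ → R4} {t : ℝ} (hc : ContDiffAt ℝ 2 c t) :
    HasDerivAt (deriv c) (deriv (deriv c) t) t :=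
  ((contDiffAt_deriv hc).differentiableAt (by simp)).hasDerivAt

lemma deriv_coord {c : ℝ → R4} {t : ℝ} (hc : ContDiffAt ℝ 2 c t) (k : Fin 4) :
    deriv (fun s => c s k) t = deriv c t k :=
  (hasDerivAt_coord (eventually_hasDerivAt hc).self_of_nhds k).deriv

lemma deriv_deriv_coord {c : ℝ → R4} {t : ℝ} (hc : ContDiffAt ℝ 2 c t) (k : Fin 4) :
    deriv (deriv fun s => c s k) t = deriv (deriv c) t k := by
  have h : (deriv fun s => c s k) =ᶠ[𝓝 t] fun s => deriv c s k := by
    filter_upwards [hc.eventually (by simp)] with s hs using deriv_coord hs k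
  rw [h.deriv_eq]
  exact (hasDerivAt_coord (hasDerivAt_deriv hc) k).deriv

lemma christoffel_eq_iff {c : ℝ → R4} {t : ℝ} (hc : ContDiffAt ℝ 2 c t) :
    (∀ k, deriv (deriv fun s => c s k) t + ∑ i, ∑ j, S.christoffel e (c t) k i j
      * deriv (fun s => c s i) t * deriv (fun s => c s j) t = 0) ↔
      deriv (deriv c) t = accel S e (c t) (deriv c t) := by
  simp only [deriv_deriv_coord hc, deriv_coord hc]
  constructor
  · intro h
    ext k
    exact eq_neg_of_add_eq_zero_left (h k)
  · intro h k
    rw [h, accel]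
    exact neg_add_cancel _

/-- The chain rule adds a second-derivative term to the acceleration, which is precisely the term in
`elForm_transition`. So the geodesic equation has to be checked in a single chart only. -/
lemma accel_transition (he : e ∈ IsManifold.maximalAtlas (𝓡 4) ∞ M)
    (he' : e' ∈ IsManifold.maximalAtlas (𝓡 4) ∞ M) {c : ℝ → R4} {t : ℝ}
    (hc : ContDiffAt ℝ 2 c t) (ht : c t ∈ e.target) (ht' : e.symm (c t) ∈ e'.source)
    (h : deriv (deriv c) t = accel S e (c t) (deriv c t)) :
    deriv (deriv fun s => e' (e.symm (c s))) t
      = accel S e' (e' (e.symm (c t))) (deriv (fun s => e' (e.symm (c s))) t) := by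
  set ψ : R4 → R4 := fun v => e' (e.symm v) with hψ
  have hψu : ContDiffAt ℝ ∞ ψ (c t) := contDiffAt_transition he he' ht ht'
  have hψ2 : HasFDerivAt (fderiv ℝ ψ) (fderiv ℝ (fderiv ℝ ψ) (c t)) (c t) :=
    ((hψu.fderiv_right (m := 1)
      (by rw [one_add_one_eq_two]; exact ENat.LEInfty.out)).differentiableAt (by simp)).hasFDerivAt
  have hcd := (eventually_hasDerivAt hc).self_of_nhds
  have hev : (deriv fun s => ψ (c s)) =ᶠ[𝓝 t] fun s => fderiv ℝ ψ (c s) (deriv c s) := by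
    have h1 : ∀ᶠ v in 𝓝 (c t), DifferentiableAt ℝ ψ v :=
      ((hψu.of_le (m := 1) ENat.LEInfty.out).eventually (by simp)).mono
        fun v hv => hv.differentiableAt (by simp)
    filter_upwards [eventually_hasDerivAt hc, hcd.continuousAt.tendsto.eventually h1] with s hs hs'
    exact (hs'.hasFDerivAt.comp_hasDerivAt s hs).deriv
  have hd : HasDerivAt (fun s => fderiv ℝ ψ (c s) (deriv c s))
      (fderiv ℝ ψ (c t) (deriv (deriv c) t) + fderiv ℝ (fderiv ℝ ψ) (c t) (deriv c t) (deriv c t)) t :=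
    ((hψ2.comp_hasDerivAt t hcd).clm_apply (hasDerivAt_deriv hc)).congr_deriv (by
      simp [add_comm])
  change deriv (deriv fun s => ψ (c s)) t = accel S e' (ψ (c t)) (deriv (fun s => ψ (c s)) t)
  rw [hev.deriv_eq, hd.deriv, hev.self_of_nhds, eq_accel_iff S he' (e'.map_source ht')]
  intro ξ'
  obtain ⟨ξ, rfl⟩ := fderiv_transition_surjective he he' ht ht' ξ'
  rw [← elForm_transition S he he' ht ht']
  exact (eq_accel_iff S he ht _ _).mp h ξ

/-- The geodesic equation as a first order system. -/
def geoField (e : OpenPartialHomeomorph M R4) (s : R4 × R4) : R4 × R4 := (s.2, accel S e s.1 s.2)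

lemma contDiffAt_accel (he : e ∈ IsManifold.maximalAtlas (𝓡 4) ∞ M) {s : R4 × R4}
    (hs : s.1 ∈ e.target) : ContDiffAt ℝ 1 (fun s : R4 × R4 => accel S e s.1 s.2) s := by
  have hcoord : ∀ i, ContDiffAt ℝ 1 (fun s : R4 × R4 => s.2 i) s := fun i =>
    ((EuclideanSpace.proj i : R4 →L[ℝ] ℝ).contDiff.comp contDiff_snd).contDiffAt
  have hD : ∀ i j l, ContDiffAt ℝ 1
      (fun s : R4 × R4 => fderiv ℝ (fun v => S.gDown e v i j) s.1 (stdVec l)) s := fun i j l => by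
    have h1 : ContDiffAt ℝ 1 (fderiv ℝ fun v => S.gDown e v i j) s.1 :=
      ((contDiffOn_gDown S he i j).contDiffAt (e.open_target.mem_nhds hs)).fderiv_right
        (by rw [one_add_one_eq_two]; exact ENat.LEInfty.out)
    exact (h1.comp s contDiffAt_fst).clm_apply contDiffAt_const
  have hU : ∀ i j, ContDiffAt ℝ 1 (fun s : R4 × R4 => S.gUp e s.1 i j) s := fun i j =>
    (((contDiffOn_gUp S he i j).contDiffAt (e.open_target.mem_nhds hs)).of_le
      ENat.LEInfty.out).comp s contDiffAt_fst
  rw [contDiffAt_piLp]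
  intro k
  simp only [accel, Spacetime.christoffel]
  refine (ContDiffAt.sum fun i _ => ContDiffAt.sum fun j _ => ?_).neg
  exact ((contDiffAt_const.mul (ContDiffAt.sum fun l _ =>
    (hU k l).mul (((hD j l i).add (hD i l j)).sub (hD i j l)))).mul (hcoord i)).mul (hcoord j)

lemma contDiffAt_geoField (he : e ∈ IsManifold.maximalAtlas (𝓡 4) ∞ M) {s : R4 × R4}
    (hs : s.1 ∈ e.target) : ContDiffAt ℝ 1 (geoField S e) s :=
  contDiffAt_snd.prodMk (contDiffAt_accel S he hs)

variable {S}

/-- Regularity is bootstrapped: the acceleration is continuous along the solution, so `d` is `C¹`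
and `c` is `C²`. The other charts are covered by `accel_transition`. -/
lemma isGeodesicOn_of_chart (he : e ∈ IsManifold.maximalAtlas (𝓡 4) ∞ M) {c d : ℝ → R4} {J : Set ℝ}
    (hJ : IsOpen J) (hcJ : ∀ t ∈ J, c t ∈ e.target) (hc : ∀ t ∈ J, HasDerivAt c (d t) t)
    (hd : ∀ t ∈ J, HasDerivAt d (accel S e (c t) (d t)) t) :
    S.IsGeodesicOn (fun t => e.symm (c t)) J := by
  have hderiv : ∀ t ∈ J, deriv c =ᶠ[𝓝 t] d := fun t ht => by
    filter_upwards [hJ.mem_nhds ht] with s hs using (hc s hs).deriv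
  have hd1 : ContDiffOn ℝ 1 d J := by
    rw [show (1 : WithTop ℕ∞) = 0 + 1 by simp, contDiffOn_succ_iff_deriv_of_isOpen hJ]
    refine ⟨fun t ht => (hd t ht).differentiableAt.differentiableWithinAt, by simp, ?_⟩
    rw [contDiffOn_zero]
    intro t ht
    have h1 := (contDiffAt_accel S he (s := (c t, d t)) (hcJ t ht)).continuousAt
    have h2 : ContinuousAt (fun t => (c t, d t)) t :=
      (hc t ht).continuousAt.prodMk (hd t ht).continuousAt
    have h3 : ContinuousAt (fun t => accel S e (c t) (d t)) t :=
      ContinuousAt.comp (f := fun t => (c t, d t))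
        (g := fun s : R4 × R4 => accel S e s.1 s.2) h1 h2
    refine (h3.congr ?_).continuousWithinAt
    filter_upwards [hJ.mem_nhds ht] with s hs using (hd s hs).deriv.symm
  have hc2 : ContDiffOn ℝ 2 c J := by
    rw [show (2 : WithTop ℕ∞) = 1 + 1 by norm_num, contDiffOn_succ_iff_deriv_of_isOpen hJ]
    exact ⟨fun t ht => (hc t ht).differentiableAt.differentiableWithinAt, by simp,
      hd1.congr fun t ht => (hc t ht).deriv⟩
  refine ⟨?_, fun e' he' t ht hs => ?_⟩
  · exact ((contMDiffOn_symm_of_mem_maximalAtlas he).of_le ENat.LEInfty.out).comp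
      (contMDiffOn_iff_contDiffOn.mpr hc2) hcJ
  · have hct := hc2.contDiffAt (hJ.mem_nhds ht)
    have hacc : deriv (deriv c) t = accel S e (c t) (deriv c t) := by
      rw [(hderiv t ht).deriv_eq, (hd t ht).deriv, (hc t ht).deriv]
    have h2 : ContDiffAt ℝ 2 (fun s => e' (e.symm (c s))) t :=
      ((contDiffAt_transition he he' (hcJ t ht) hs).of_le ENat.LEInfty.out).comp t hct
    exact (christoffel_eq_iff S h2).mpr (accel_transition S he he' hct (hcJ t ht) hs hacc)

lemma geodesic_chart (he : e ∈ IsManifold.maximalAtlas (𝓡 4) ∞ M) {γ : ℝ → M} {J : Set ℝ}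
    (hJ : IsOpen J) (hγ : S.IsGeodesicOn γ J) {t : ℝ} (ht : t ∈ J) (hs : γ t ∈ e.source) :
    HasDerivAt (fun s => (e (γ s), deriv (fun s => e (γ s)) s))
      (geoField S e (e (γ t), deriv (fun s => e (γ s)) t)) t := by
  have h2 : ContDiffAt ℝ 2 (fun s => e (γ s)) t :=
    contDiffAt_chart he ENat.LEInfty.out (hγ.1.contMDiffAt (hJ.mem_nhds ht)) hs
  have h3 := (christoffel_eq_iff S h2).mp (hγ.2 e he t ht hs)
  have h4 := hasDerivAt_deriv h2
  rw [h3] at h4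
  exact (eventually_hasDerivAt h2).self_of_nhds.prodMk h4

end Caustic
end

noncomputable section
namespace Caustic

set_option linter.unusedSectionVars false

/-! ### Uniqueness of geodesics -/

variable {M : Type*} [TopologicalSpace M] [ChartedSpace R4 M] [IsManifold (𝓡 4) ∞ M]
variable {S : Spacetime M} {H : Set M} {e : OpenPartialHomeomorph M R4}

lemma IsGeodesicOn_mono {γ : ℝ → M} {J J' : Set ℝ} (h : S.IsGeodesicOn γ J) (hJ : J' ⊆ J) :
    S.IsGeodesicOn γ J' :=
  ⟨h.1.mono hJ, fun e he t ht => h.2 e he t (hJ ht)⟩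

lemma IsGeodesicOn_continuousAt {γ : ℝ → M} {J : Set ℝ} (hJ : IsOpen J) (h : S.IsGeodesicOn γ J)
    {t : ℝ} (ht : t ∈ J) : ContinuousAt γ t :=
  (h.1.contMDiffAt (hJ.mem_nhds ht)).continuousAt

/-- Geodesics with the same position and velocity agree nearby. -/
lemma geodesic_germ_unique (he : e ∈ IsManifold.maximalAtlas (𝓡 4) ∞ M) {γ₁ γ₂ : ℝ → M}
    {J : Set ℝ} (hJ : IsOpen J) (h₁ : S.IsGeodesicOn γ₁ J) (h₂ : S.IsGeodesicOn γ₂ J) {t : ℝ}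
    (ht : t ∈ J) (hs : γ₁ t ∈ e.source) (heq : γ₁ t = γ₂ t)
    (hd : deriv (fun s => e (γ₁ s)) t = deriv (fun s => e (γ₂ s)) t) : γ₁ =ᶠ[𝓝 t] γ₂ := by
  have hs₂ : γ₂ t ∈ e.source := heq ▸ hs
  obtain ⟨K, N, hN, hK⟩ := (contDiffAt_geoField S he
    (s := (e (γ₁ t), deriv (fun s => e (γ₁ s)) t)) (e.map_source hs)).exists_lipschitzOnWith
  have ev : ∀ γ : ℝ → M, S.IsGeodesicOn γ J → γ t ∈ e.source →
      N ∈ 𝓝 (e (γ t), deriv (fun s => e (γ s)) t) → ∀ᶠ s in 𝓝 t,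
      HasDerivAt (fun s => (e (γ s), deriv (fun s => e (γ s)) s))
        (geoField S e (e (γ s), deriv (fun s => e (γ s)) s)) s ∧
      (e (γ s), deriv (fun s => e (γ s)) s) ∈ N := by
    intro γ hγ hγs hNγ
    filter_upwards [hJ.mem_nhds ht,
      (IsGeodesicOn_continuousAt hJ hγ ht).eventually_mem (e.open_source.mem_nhds hγs),
      (geodesic_chart he hJ hγ ht hγs).continuousAt.eventually_mem hNγ] with s a1 a2 a3
    exact ⟨geodesic_chart he hJ hγ a1 a2, a3⟩
  have h := ODE_solution_unique_of_eventually (v := fun _ => geoField S e) (s := fun _ => N)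
    (K := K) (Eventually.of_forall fun _ => hK) (ev γ₁ h₁ hs hN)
    (ev γ₂ h₂ hs₂ (by rw [← hd, ← heq]; exact hN)) (by simp only [heq, hd])
  filter_upwards [h, (IsGeodesicOn_continuousAt hJ h₁ ht).eventually_mem (e.open_source.mem_nhds hs),
    (IsGeodesicOn_continuousAt hJ h₂ ht).eventually_mem (e.open_source.mem_nhds hs₂)] with s a1 a2 a3
  exact e.injOn a2 a3 (congrArg Prod.fst a1)

/-- The set of parameters with equal germs is open. It is closed in `J`: at a limit parameter the
positions agree by the Hausdorff property and the velocities by continuity, so local uniqueness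
applies there. -/
lemma geodesic_unique [T2Space M] {γ₁ γ₂ : ℝ → M} {J : Set ℝ} (hJ : IsOpen J)
    (hJc : IsPreconnected J) (h₁ : S.IsGeodesicOn γ₁ J) (h₂ : S.IsGeodesicOn γ₂ J) {t₀ : ℝ}
    (ht₀ : t₀ ∈ J) (hgerm : γ₁ =ᶠ[𝓝 t₀] γ₂) : EqOn γ₁ γ₂ J := by
  have hsub : J ⊆ {t | γ₁ =ᶠ[𝓝 t] γ₂} := by
    refine hJc.subset_of_closure_inter_subset isOpen_setOfPred_eventually_nhds ⟨t₀, ht₀, hgerm⟩ ?_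
    rintro t ⟨htc, ht⟩
    have hf : ∃ᶠ s in 𝓝 t, γ₁ =ᶠ[𝓝 s] γ₂ := mem_closure_iff_frequently.mp htc
    have heq : γ₁ t = γ₂ t :=
      tendsto_nhds_unique_of_frequently_eq (IsGeodesicOn_continuousAt hJ h₁ ht)
        (IsGeodesicOn_continuousAt hJ h₂ ht) (hf.mono fun s hs => hs.self_of_nhds)
    set e := chartAt R4 (γ₁ t)
    have he : e ∈ IsManifold.maximalAtlas (𝓡 4) ∞ M :=
      IsManifold.chart_mem_maximalAtlas (γ₁ t)
    have hs : γ₁ t ∈ e.source := mem_chart_source R4 (γ₁ t)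
    refine geodesic_germ_unique he hJ h₁ h₂ ht hs heq ?_
    have c1 := (geodesic_chart he hJ h₁ ht hs).continuousAt.snd
    have c2 := (geodesic_chart he hJ h₂ ht (heq ▸ hs)).continuousAt.snd
    refine tendsto_nhds_unique_of_frequently_eq c1 c2 (hf.mono fun s hs => ?_)
    exact (hs.fun_comp e).deriv_eq
  exact fun t ht => (hsub ht).self_of_nhds

/-! ### Reparametrization and gluing of generators -/

lemma isFutureNull_velocity_iff (he : e ∈ IsManifold.maximalAtlas (𝓡 4) ∞ M) {γ : ℝ → M} {t : ℝ}
    (hγ : MDifferentiableAt 𝓘(ℝ, ℝ) (𝓡 4) γ t) (hs : γ t ∈ e.source) :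
    S.IsFutureNull (velocity γ t) ↔
      gForm S e (e (γ t)) (deriv (fun s => e (γ s)) t) (deriv (fun s => e (γ s)) t) = 0 ∧
      gForm S e (e (γ t)) (futureCoord S e (e (γ t))) (deriv (fun s => e (γ s)) t) < 0 := by
  rw [isFutureNull_iff S he hs, (hasDerivAt_chart he hγ hs).deriv]

lemma deriv_comp_affine (f : ℝ → ℝ) (a b t : ℝ) :
    deriv (fun s => f (a * s + b)) t = a * deriv f (a * t + b) := by
  have h1 := deriv_comp_mul_left a (fun x => f (x + b)) t
  rw [deriv_comp_add_const] at h1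
  exact h1

/-- Both terms of the geodesic equation acquire the factor `a²`. -/
lemma isGeodesicOn_affine {γ : ℝ → M} {J : Set ℝ} (h : S.IsGeodesicOn γ J) (a b : ℝ) :
    S.IsGeodesicOn (fun s => γ (a * s + b)) ((fun s => a * s + b) ⁻¹' J) := by
  refine ⟨h.1.comp (t := J) ?_ (fun t ht => ht), fun e he t ht hs k => ?_⟩
  · exact (contMDiff_iff_contDiff.mpr (by fun_prop)).contMDiffOn
  · have := h.2 e he (a * t + b) ht hs k
    have h2 : deriv (fun s => e (γ (a * s + b)) k)
        = fun s => a * deriv (fun s => e (γ s) k) (a * s + b) := by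
      funext s; exact deriv_comp_affine (fun s => e (γ s) k) a b s
    have h3 : ∀ i, deriv (fun s => e (γ (a * s + b)) i) t
        = a * deriv (fun s => e (γ s) i) (a * t + b) := fun i =>
      deriv_comp_affine (fun s => e (γ s) i) a b t
    rw [h2, deriv_const_mul_field, deriv_comp_affine]
    simp only [h3]
    have h4 : ∀ i j, S.christoffel e (e (γ (a * t + b))) k i j
        * (a * deriv (fun s => e (γ s) i) (a * t + b)) * (a * deriv (fun s => e (γ s) j) (a * t + b))
        = a ^ 2 * (S.christoffel e (e (γ (a * t + b))) k i j
        * deriv (fun s => e (γ s) i) (a * t + b) * deriv (fun s => e (γ s) j) (a * t + b)) :=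
      fun i j => by ring
    simp only [h4, ← Finset.mul_sum]
    linear_combination a ^ 2 * this

lemma deriv_chart_affine {γ : ℝ → M} (a b t : ℝ) {k : R4}
    (h : HasDerivAt (fun s => e (γ s)) k (a * t + b)) :
    HasDerivAt (fun s => e (γ (a * s + b))) (a • k) t := by
  have h1 : HasDerivAt (fun s : ℝ => a * s + b) a t := by
    simpa using ((hasDerivAt_id t).const_mul a).add_const b
  exact h.scomp t h1

/-- The shift is chosen so that the parameter `s₀` corresponds to `t₀`; positivity of `a` preserves
the time orientation and the meaning of inextendibility. -/
lemma IsGenerator_affine {γ : ℝ → M} {J : Set ℝ} {t₀ : ℝ} (hg : S.IsGenerator H γ J t₀) {a : ℝ}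
    (ha : 0 < a) (s₀ : ℝ) :
    S.IsGenerator H (fun s => γ (a * s + (t₀ - a * s₀)))
      ((fun s => a * s + (t₀ - a * s₀)) ⁻¹' J) s₀ := by
  set b := t₀ - a * s₀ with hb
  have hcont : Continuous fun s : ℝ => a * s + b := by fun_prop
  have hmono : ∀ {s t : ℝ}, s ≤ t → a * s + b ≤ a * t + b := fun h => by gcongr
  have hinv : ∀ t : ℝ, a * ((t - b) / a) + b = t := fun t => by field_simp; ring
  refine ⟨hg.isOpen.preimage hcont, ⟨fun s hs t ht x hx => ?_⟩, ?_, isGeodesicOn_affine hg.geodesic a b,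
    fun t ht => ?_, ?_, fun t ht hle => ?_⟩
  · exact hg.ordConnected.out hs ht ⟨hmono hx.1, hmono hx.2⟩
  · change a * s₀ + b ∈ J
    rw [show a * s₀ + b = t₀ by rw [hb]; ring]; exact hg.mem
  · set e := chartAt R4 (γ (a * t + b))
    have he : e ∈ IsManifold.maximalAtlas (𝓡 4) ∞ M := IsManifold.chart_mem_maximalAtlas _
    have hs : γ (a * t + b) ∈ e.source := mem_chart_source R4 _
    have hd := IsGenerator_mdifferentiableAt hg ht
    have h1 := (isFutureNull_velocity_iff he hd hs).mp (hg.null _ ht)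
    have hgeo := isGeodesicOn_affine hg.geodesic a b
    have hd' : MDifferentiableAt 𝓘(ℝ, ℝ) (𝓡 4) (fun s => γ (a * s + b)) t :=
      (hgeo.1.contMDiffAt ((hg.isOpen.preimage hcont).mem_nhds ht)).mdifferentiableAt (by simp)
    rw [isFutureNull_velocity_iff he hd' hs,
      (deriv_chart_affine a b t (hasDerivAt_chart he hd hs)).deriv, ← (hasDerivAt_chart he hd hs).deriv]
    simp only [map_smul, LinearMap.smul_apply, smul_eq_mul, h1.1, mul_zero, true_and]
    exact mul_neg_of_pos_of_neg ha h1.2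
  · rintro ⟨q, hq⟩
    refine hg.inextendible ⟨q, fun V hV => ?_⟩
    obtain ⟨s, hs, h⟩ := hq V hV
    refine ⟨a * s + b, hs, fun t ht hle => ?_⟩
    have := h ((t - b) / a) (by change a * _ + b ∈ J; rw [hinv]; exact ht) (by
      rw [le_div_iff₀ ha]; linarith)
    simpa only [hinv] using this
  · refine hg.subset _ ht ?_
    have := hmono hle
    rwa [show a * s₀ + b = t₀ by rw [hb]; ring] at this

/-- A generator with a given tangent vector may be parametrized so that it starts at any given
parameter value, and the tangent vector may be rescaled. -/
lemma exists_generator_of_genVecs (he : e ∈ IsManifold.maximalAtlas (𝓡 4) ∞ M) {u k : R4}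
    (hu : u ∈ e.target) (hk : k ∈ genVecs S H e u) {a : ℝ} (ha : 0 < a) (s₀ : ℝ) :
    ∃ γ J, S.IsGenerator H γ J s₀ ∧ γ s₀ = e.symm u ∧ HasDerivAt (fun s => e (γ s)) (a • k) s₀ := by
  obtain ⟨γ, J, t₀, hg, hγ, rfl⟩ := hk
  have hs₀ : a * s₀ + (t₀ - a * s₀) = t₀ := by ring
  have hs : γ t₀ ∈ e.source := by rw [hγ]; exact e.map_target hu
  refine ⟨_, _, IsGenerator_affine hg ha s₀, by simp only [hs₀]; exact hγ,
    deriv_chart_affine a _ s₀ ?_⟩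
  rw [hs₀]
  exact hasDerivAt_generator he hg hg.mem hs

lemma mem_genVecs_of_hasDerivAt (he : e ∈ IsManifold.maximalAtlas (𝓡 4) ∞ M) {u k : R4}
    (hu : u ∈ e.target) {γ : ℝ → M} {J : Set ℝ} {t₀ : ℝ} (hg : S.IsGenerator H γ J t₀)
    (hγ : γ t₀ = e.symm u) (hd : HasDerivAt (fun s => e (γ s)) k t₀) : k ∈ genVecs S H e u :=
  ⟨γ, J, t₀, hg, hγ, (hasDerivAt_generator he hg hg.mem (by rw [hγ]; exact e.map_target hu)).unique hd⟩

lemma smul_mem_genVecs (he : e ∈ IsManifold.maximalAtlas (𝓡 4) ∞ M) {u k : R4}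
    (hu : u ∈ e.target) (hk : k ∈ genVecs S H e u) {a : ℝ} (ha : 0 < a) :
    a • k ∈ genVecs S H e u := by
  obtain ⟨γ, J, hg, hγ, hd⟩ := exists_generator_of_genVecs he hu hk ha 0
  exact mem_genVecs_of_hasDerivAt he hu hg hγ hd

variable (S e) in
/-- A solution of the geodesic equation in the chart `e`. -/
structure IsGeodesicSolution (c d : ℝ → R4) (I : Set ℝ) : Prop where
  isOpen : IsOpen I
  ordConnected : I.OrdConnected
  target : ∀ t ∈ I, c t ∈ e.target
  hasDerivAt : ∀ t ∈ I, HasDerivAt c (d t) t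
  hasDerivAt' : ∀ t ∈ I, HasDerivAt d (accel S e (c t) (d t)) t

namespace IsGeodesicSolution

variable {c d : ℝ → R4} {I : Set ℝ}

lemma geodesic (he : e ∈ IsManifold.maximalAtlas (𝓡 4) ∞ M) (h : IsGeodesicSolution S e c d I) :
    S.IsGeodesicOn (fun t => e.symm (c t)) I :=
  isGeodesicOn_of_chart he h.isOpen h.target h.hasDerivAt h.hasDerivAt'

lemma hasDerivAt_chart (h : IsGeodesicSolution S e c d I) {t : ℝ} (ht : t ∈ I) :
    HasDerivAt (fun s => e (e.symm (c s))) (d t) t := by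
  refine (h.hasDerivAt t ht).congr_of_eventuallyEq ?_
  filter_upwards [h.isOpen.mem_nhds ht] with s hs using e.right_inv (h.target s hs)

/-- A generator agrees with the solution with the same initial data. -/
lemma germ_eq (he : e ∈ IsManifold.maximalAtlas (𝓡 4) ∞ M) (h : IsGeodesicSolution S e c d I)
    {γ : ℝ → M} {J : Set ℝ} {t₀ t : ℝ} (hg : S.IsGenerator H γ J t₀) (ht : t ∈ I) (htJ : t ∈ J)
    (hγ : γ t = e.symm (c t)) (hd : HasDerivAt (fun s => e (γ s)) (d t) t) :
    γ =ᶠ[𝓝 t] fun s => e.symm (c s) :=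
  geodesic_germ_unique he (hg.isOpen.inter h.isOpen)
    (IsGeodesicOn_mono hg.geodesic inter_subset_left)
    (IsGeodesicOn_mono (h.geodesic he) inter_subset_right) ⟨htJ, ht⟩
    (by rw [hγ]; exact e.map_target (h.target t ht)) hγ
    (by rw [hd.deriv, (h.hasDerivAt_chart ht).deriv])

/-- A solution stays on the horizon if its initial data belong to a generator. -/
lemma mem_horizon [T2Space M] (he : e ∈ IsManifold.maximalAtlas (𝓡 4) ∞ M)
    (h : IsGeodesicSolution S e c d I) {t₀ : ℝ} (ht₀ : t₀ ∈ I) (hk : d t₀ ∈ genVecs S H e (c t₀)) {t : ℝ}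
    (ht : t ∈ I) (hle : t₀ ≤ t) : e.symm (c t) ∈ H := by
  obtain ⟨γ, J, hg, hγ, hd⟩ := exists_generator_of_genVecs he (h.target t₀ ht₀) hk one_pos t₀
  rw [one_smul] at hd
  have hEq : EqOn γ (fun s => e.symm (c s)) (J ∩ I) :=
    geodesic_unique (hg.isOpen.inter h.isOpen)
      (hg.ordConnected.inter h.ordConnected).isPreconnected
      (IsGeodesicOn_mono hg.geodesic inter_subset_left)
      (IsGeodesicOn_mono (h.geodesic he) inter_subset_right) ⟨hg.mem, ht₀⟩
      (h.germ_eq he hg ht₀ hg.mem hγ hd)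
  by_cases htJ : t ∈ J
  · have := hEq ⟨htJ, ht⟩
    simp only at this
    rw [← this]
    exact hg.subset t htJ hle
  -- Otherwise the parameters of the generator end at some `T ≤ t` inside the domain of the
  -- solution. The generator then converges to the position of the solution at `T`, contrary to
  -- inextendibility.
  · exfalso
    have hlt : ∀ s ∈ J, s < t := fun s hs => by
      by_contra hn
      exact htJ (hg.ordConnected.out hg.mem hs ⟨hle, not_lt.mp hn⟩)
    have hbdd : BddAbove J := ⟨t, fun s hs => (hlt s hs).le⟩
    have hne : J.Nonempty := ⟨t₀, hg.mem⟩
    set T := sSup J with hT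
    have hTI : T ∈ I := h.ordConnected.out ht₀ ht
      ⟨le_csSup hbdd hg.mem, csSup_le hne fun s hs => (hlt s hs).le⟩
    have hTc : ContinuousAt (fun s => e.symm (c s)) T :=
      IsGeodesicOn_continuousAt h.isOpen (h.geodesic he) hTI
    refine hg.inextendible ⟨e.symm (c T), fun V hV => ?_⟩
    obtain ⟨δ, hδ, hb⟩ := Metric.eventually_nhds_iff_ball.mp (hTc.eventually_mem hV)
    obtain ⟨s, hs, hsT⟩ := exists_lt_of_lt_csSup hne (show T - δ < sSup J by linarith)
    refine ⟨max s t₀, by rcases max_choice s t₀ with h | h <;> rw [h]; exacts [hs, hg.mem],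
      fun x hx hxs => ?_⟩
    have hxT : x ≤ T := le_csSup hbdd hx
    have hxI : x ∈ I := h.ordConnected.out ht₀ hTI ⟨(le_max_right _ _).trans hxs, hxT⟩
    rw [hEq ⟨hx, hxI⟩]
    refine hb x ?_
    rw [Real.ball_eq_Ioo]
    exact ⟨by linarith [(le_max_left s t₀).trans hxs], by linarith⟩

/-- A null solution in the horizon that ends up on a generator is itself part of a generator. -/
lemma mem_genVecs (he : e ∈ IsManifold.maximalAtlas (𝓡 4) ∞ M)
    (h : IsGeodesicSolution S e c d I) {t₀ t₁ : ℝ} (ht₀ : t₀ ∈ I) (ht₁ : t₁ ∈ I) (hlt : t₀ < t₁)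
    (hnull : ∀ t ∈ I, gForm S e (c t) (d t) (d t) = 0)
    (hfut : ∀ t ∈ I, gForm S e (c t) (futureCoord S e (c t)) (d t) < 0)
    (hH : ∀ t ∈ Icc t₀ t₁, e.symm (c t) ∈ H) (hk : d t₁ ∈ genVecs S H e (c t₁)) :
    d t₀ ∈ genVecs S H e (c t₀) := by
  obtain ⟨γ, J, hg, hγ, hd⟩ := exists_generator_of_genVecs he (h.target t₁ ht₁) hk one_pos t₁
  rw [one_smul] at hd
  have hgerm := h.germ_eq he hg ht₁ hg.mem hγ hd
  set σ : ℝ → M := fun s => e.symm (c s) with hσ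
  -- Concatenation of the solution up to `t₁` with the generator afterwards. The germs agree at
  -- `t₁`, so near every parameter `ζ` is one of the two geodesics and inherits all local
  -- properties; inextendibility comes from the generator.
  set ζ : ℝ → M := fun s => if s ≤ t₁ then σ s else γ s with hζ
  set L : Set ℝ := (I ∩ Iic t₁) ∪ (J ∩ Ici t₁) with hL
  have hζσ : ∀ t < t₁, ζ =ᶠ[𝓝 t] σ := fun t ht => by
    filter_upwards [gt_mem_nhds ht] with s hs
    simp [hζ, (show s < t₁ from hs).le]
  have hζγ : ∀ t ≥ t₁, ζ =ᶠ[𝓝 t] γ := fun t ht => by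
    rcases eq_or_lt_of_le ht with rfl | ht
    · filter_upwards [hgerm] with s hs
      by_cases hst : s ≤ t₁
      · simp [hζ, hst, hs]
      · simp [hζ, hst]
    · filter_upwards [lt_mem_nhds ht] with s hs
      simp [hζ, (show t₁ < s from hs)]
  have hopen : IsOpen L := by
    rw [isOpen_iff_mem_nhds]
    rintro t ht
    rcases lt_trichotomy t t₁ with hlt | rfl | hlt
    · have : t ∈ I := by
        rcases ht with ht | ht
        · exact ht.1
        · exact absurd ht.2 (not_le.mpr hlt)
      filter_upwards [h.isOpen.mem_nhds this, gt_mem_nhds hlt] with s hs hs'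
      exact Or.inl ⟨hs, le_of_lt hs'⟩
    · filter_upwards [h.isOpen.mem_nhds ht₁, hg.isOpen.mem_nhds hg.mem] with s hs hs'
      rcases le_total s t with hle | hle
      · exact Or.inl ⟨hs, hle⟩
      · exact Or.inr ⟨hs', hle⟩
    · have : t ∈ J := by
        rcases ht with ht | ht
        · exact absurd ht.2 (not_le.mpr hlt)
        · exact ht.1
      filter_upwards [hg.isOpen.mem_nhds this, lt_mem_nhds hlt] with s hs hs'
      exact Or.inr ⟨hs, le_of_lt hs'⟩
  have hord : L.OrdConnected := by
    refine ⟨fun a ha b hb s hs => ?_⟩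
    rcases le_total s t₁ with hle | hle
    · refine Or.inl ⟨?_, hle⟩
      rcases ha with ha | ha
      · exact h.ordConnected.out ha.1 ht₁ ⟨hs.1, hle⟩
      · rw [le_antisymm hle (le_trans ha.2 hs.1)]; exact ht₁
    · refine Or.inr ⟨?_, hle⟩
      rcases hb with hb | hb
      · rw [le_antisymm (le_trans hs.2 hb.2) hle]; exact hg.mem
      · exact hg.ordConnected.out hg.mem hb.1 ⟨hle, hs.2⟩
  have hloc : ∀ t ∈ L, ∃ (η : ℝ → M) (K : Set ℝ), IsOpen K ∧ t ∈ K ∧ S.IsGeodesicOn η K ∧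
      ζ =ᶠ[𝓝 t] η ∧ S.IsFutureNull (velocity η t) := by
    intro t ht
    rcases lt_or_ge t t₁ with hlt | hge
    · have htI : t ∈ I := by
        rcases ht with ht | ht
        · exact ht.1
        · exact absurd ht.2 (not_le.mpr hlt)
      refine ⟨σ, I, h.isOpen, htI, h.geodesic he, hζσ t hlt, ?_⟩
      have hs : σ t ∈ e.source := e.map_target (h.target t htI)
      rw [isFutureNull_velocity_iff he (((h.geodesic he).1.contMDiffAt
        (h.isOpen.mem_nhds htI)).mdifferentiableAt (by simp)) hs]
      have h1 : deriv (fun s => e (σ s)) t = d t := (h.hasDerivAt_chart htI).deriv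
      have h2 : e (σ t) = c t := e.right_inv (h.target t htI)
      rw [h1, h2]
      exact ⟨hnull t htI, hfut t htI⟩
    · have htJ : t ∈ J := by
        rcases ht with ht | ht
        · rw [le_antisymm ht.2 hge]; exact hg.mem
        · exact ht.1
      exact ⟨γ, J, hg.isOpen, htJ, hg.geodesic, hζγ t hge, hg.null t htJ⟩
  have hsm : ContMDiffOn 𝓘(ℝ, ℝ) (𝓡 4) 2 ζ L := fun t ht => by
    obtain ⟨η, K, hK, htK, hη, heq, -⟩ := hloc t ht
    exact ((hη.1.contMDiffAt (hK.mem_nhds htK)).congr_of_eventuallyEq heq).contMDiffWithinAt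
  have hgen : S.IsGenerator H ζ L t₀ := by
    refine ⟨hopen, hord, Or.inl ⟨ht₀, hlt.le⟩, ⟨hsm, fun e' he' t ht hs k => ?_⟩, fun t ht => ?_, ?_,
      fun t ht hle => ?_⟩
    · obtain ⟨η, K, hK, htK, hη, heq, -⟩ := hloc t ht
      have hη' := hη.2 e' he' t htK (heq.self_of_nhds ▸ hs) k
      have hk : ∀ i, (fun s => e' (ζ s) i) =ᶠ[𝓝 t] fun s => e' (η s) i := fun i =>
        heq.fun_comp fun x => e' x i
      rw [(hk k).deriv.deriv_eq, heq.self_of_nhds]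
      simp only [(hk _).deriv_eq]
      exact hη'
    · obtain ⟨η, K, hK, htK, hη, heq, hn⟩ := hloc t ht
      set e' := chartAt R4 (ζ t)
      have he' : e' ∈ IsManifold.maximalAtlas (𝓡 4) ∞ M := IsManifold.chart_mem_maximalAtlas _
      have hs : ζ t ∈ e'.source := mem_chart_source R4 _
      have hs' : η t ∈ e'.source := heq.self_of_nhds ▸ hs
      have h1 := (isFutureNull_velocity_iff he' ((hη.1.contMDiffAt
        (hK.mem_nhds htK)).mdifferentiableAt (by simp)) hs').mp hn
      rw [isFutureNull_velocity_iff he' ((hsm.contMDiffAt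
        (hopen.mem_nhds ht)).mdifferentiableAt (by simp)) hs,
        (show (fun s => e' (ζ s)) =ᶠ[𝓝 t] fun s => e' (η s) from heq.fun_comp e').deriv_eq,
        heq.self_of_nhds]
      exact h1
    · rintro ⟨q, hq⟩
      refine hg.inextendible ⟨q, fun V hV => ?_⟩
      obtain ⟨s, hs, hV⟩ := hq V hV
      obtain ⟨s', hs', hs't⟩ : ∃ s' ∈ J, t₁ < s' := by
        obtain ⟨δ, hδ, hb⟩ := Metric.isOpen_iff.mp hg.isOpen t₁ hg.mem
        refine ⟨t₁ + δ / 2, hb ?_, by linarith⟩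
        rw [Real.ball_eq_Ioo]; constructor <;> linarith
      have hmax : max s s' ∈ J := by
        rcases le_total s s' with h | h
        · rw [max_eq_right h]; exact hs'
        · rw [max_eq_left h]
          rcases hs with hs | hs
          · exact absurd (hs't.trans_le h) (not_lt.mpr hs.2)
          · exact hs.1
      refine ⟨max s s', hmax, fun t ht hle => ?_⟩
      have htt : t₁ < t := hs't.trans_le ((le_max_right _ _).trans hle)
      have := hV t (Or.inr ⟨ht, htt.le⟩) ((le_max_left _ _).trans hle)
      simpa [hζ, not_le.mpr htt] using this
    · by_cases htt : t ≤ t₁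
      · simp only [hζ, htt, if_true]; exact hH t ⟨hle, htt⟩
      · simp only [hζ, htt, if_false]
        rw [not_le] at htt
        rcases ht with ht | ht
        · exact absurd ht.2 (not_le.mpr htt)
        · exact hg.subset t ht.1 htt.le
  refine mem_genVecs_of_hasDerivAt he (h.target t₀ ht₀) hgen (hζσ t₀ hlt).self_of_nhds ?_
  exact (h.hasDerivAt_chart ht₀).congr_of_eventuallyEq ((hζσ t₀ hlt).fun_comp e)

lemma mono (h : IsGeodesicSolution S e c d I) {I' : Set ℝ} (hsub : I' ⊆ I) (ho : IsOpen I')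
    (hc : I'.OrdConnected) : IsGeodesicSolution S e c d I' :=
  ⟨ho, hc, fun t ht => h.target t (hsub ht), fun t ht => h.hasDerivAt t (hsub ht),
    fun t ht => h.hasDerivAt' t (hsub ht)⟩

/-- The derivative of the square of the velocity is twice the covariant geodesic equation tested
against the velocity itself. -/
lemma gForm_const (he : e ∈ IsManifold.maximalAtlas (𝓡 4) ∞ M) (h : IsGeodesicSolution S e c d I)
    {t t' : ℝ} (ht : t ∈ I) (ht' : t' ∈ I) :
    gForm S e (c t) (d t) (d t) = gForm S e (c t') (d t') (d t') := by
  have hder : ∀ s ∈ I, HasDerivAt (fun s => gForm S e (c s) (d s) (d s)) 0 s := fun s hs => by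
    refine (hasDerivAt_gForm S he (h.target s hs) (h.hasDerivAt s hs) (h.hasDerivAt' s hs)
      (h.hasDerivAt' s hs)).congr_deriv ?_
    have := (eq_accel_iff S he (h.target s hs) (accel S e (c s) (d s)) (d s)).mp rfl (d s)
    rw [gForm_symm S (c s) (d s)]
    rw [elForm] at this
    linarith
  exact h.isOpen.is_const_of_deriv_eq_zero h.ordConnected.isPreconnected
    (fun s hs => (hder s hs).differentiableAt.differentiableWithinAt)
    (fun s hs => (hder s hs).deriv) ht ht'

/-- A solution that starts future-directed is future-directed for some time. -/
lemma exists_future (he : e ∈ IsManifold.maximalAtlas (𝓡 4) ∞ M) (h : IsGeodesicSolution S e c d I)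
    {t₀ : ℝ} (ht₀ : t₀ ∈ I) (hf : gForm S e (c t₀) (futureCoord S e (c t₀)) (d t₀) < 0) :
    ∃ ε > 0, Ioo (t₀ - ε) (t₀ + ε) ⊆ I ∧ ∀ t ∈ Ioo (t₀ - ε) (t₀ + ε),
      gForm S e (c t) (futureCoord S e (c t)) (d t) < 0 := by
  have hc := (h.hasDerivAt t₀ ht₀).continuousAt
  have hF : Tendsto (fun t => futureCoord S e (c t)) (𝓝 t₀) (𝓝 (futureCoord S e (c t₀))) :=
    (((continuousOn_futureCoord S he).continuousAt
      (e.open_target.mem_nhds (h.target t₀ ht₀))).tendsto).comp hc.tendsto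
  have ht := tendsto_gForm S he (h.target t₀ ht₀) hc.tendsto hF
    (h.hasDerivAt' t₀ ht₀).continuousAt.tendsto
  obtain ⟨ε, hε, hb⟩ := Metric.eventually_nhds_iff_ball.mp
    ((ht.eventually (gt_mem_nhds hf)).and (h.isOpen.eventually_mem ht₀))
  rw [Real.ball_eq_Ioo] at hb
  exact ⟨ε, hε, fun t ht => (hb t ht).2, fun t ht => (hb t ht).1⟩

end IsGeodesicSolution

end Caustic
end

noncomputable section
namespace Caustic

set_option linter.unusedSectionVars false

/-! ### The two generators at the crease -/

variable {M : Type*} [TopologicalSpace M] [ChartedSpace R4 M] [IsManifold (𝓡 4) ∞ M]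
variable {S : Spacetime M} {H : Set M} {e : OpenPartialHomeomorph M R4} {r : ℝ}

/-- The local geodesic flow. -/
lemma exists_geodesic_flow (he : e ∈ IsManifold.maximalAtlas (𝓡 4) ∞ M) {x₀ : R4 × R4}
    (hx₀ : x₀.1 ∈ e.target) : ∃ ρ > 0, ∃ ε > 0, ∃ α : (R4 × R4) × ℝ → R4 × R4,
      (∀ x ∈ Metric.closedBall x₀ ρ, α (x, 0) = x ∧ ∀ t ∈ Ioo (-ε) ε, (α (x, t)).1 ∈ e.target ∧
        HasDerivAt (fun s => α (x, s)) (geoField S e (α (x, t))) t) ∧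
      ContinuousOn α (Metric.closedBall x₀ ρ ×ˢ Icc (-ε) ε) := by
  obtain ⟨ε, hε, a, ρ, L, K, hρ, hpl⟩ :=
    IsPicardLindelof.of_contDiffAt_one (contDiffAt_geoField S he hx₀)
  obtain ⟨α, h1, h2⟩ := (hpl 0).exists_forall_mem_closedBall_eq_hasDerivWithinAt_continuousOn
  simp only [zero_sub, zero_add] at h1 h2
  have hx₀ρ : x₀ ∈ Metric.closedBall x₀ (ρ : ℝ) := Metric.mem_closedBall_self hρ.le
  have hnhds : Metric.closedBall x₀ (ρ : ℝ) ×ˢ Icc (-ε) ε ∈ 𝓝 (x₀, (0 : ℝ)) :=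
    prod_mem_nhds (Metric.closedBall_mem_nhds x₀ hρ) (Icc_mem_nhds (by linarith) hε)
  have hcont : ContinuousAt α (x₀, 0) := h2.continuousAt hnhds
  have hev : ∀ᶠ s in 𝓝 (x₀, (0 : ℝ)), (α s).1 ∈ e.target :=
    hcont.fst.eventually_mem (e.open_target.mem_nhds (by rw [(h1 x₀ hx₀ρ).1]; exact hx₀))
  -- Initial data and times are restricted further so that the positions remain in the target of the
  -- chart.
  obtain ⟨δ, hδ, hb⟩ := Metric.eventually_nhds_iff_ball.mp hev
  rw [← ball_prod_same] at hb
  have hsub : Metric.closedBall x₀ (min ρ (δ / 2)) ⊆ Metric.closedBall x₀ (ρ : ℝ) :=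
    Metric.closedBall_subset_closedBall (min_le_left _ _)
  have hρ' : (0 : ℝ) < ρ := hρ
  refine ⟨min ρ (δ / 2), by positivity, min ε δ, by positivity, α, fun x hx => ⟨(h1 x (hsub hx)).1,
    fun t ht => ⟨hb (x, t) ⟨?_, ?_⟩, ?_⟩⟩, h2.mono (prod_mono hsub ?_)⟩
  · exact (Metric.mem_closedBall.mp hx).trans_lt ((min_le_right _ _).trans_lt (by linarith))
  · rw [Real.ball_eq_Ioo]
    have := min_le_right ε δ
    exact ⟨by linarith [ht.1], by linarith [ht.2]⟩
  · have := min_le_left ε δ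
    have ht' : t ∈ Ioo (-ε) ε := ⟨by linarith [ht.1], by linarith [ht.2]⟩
    exact ((h1 x (hsub hx)).2 t (Ioo_subset_Icc_self ht')).hasDerivAt (Icc_mem_nhds ht'.1 ht'.2)
  · have := min_le_left ε δ
    exact Icc_subset_Icc (by linarith) this

lemma isGeodesicSolution_of_flow {φ : ℝ → R4 × R4} {ε : ℝ}
    (hφ : ∀ t ∈ Ioo (-ε) ε, (φ t).1 ∈ e.target ∧ HasDerivAt φ (geoField S e (φ t)) t) :
    IsGeodesicSolution S e (fun t => (φ t).1) (fun t => (φ t).2) (Ioo (-ε) ε) :=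
  ⟨isOpen_Ioo, ordConnected_Ioo, fun t ht => (hφ t ht).1, fun t ht => (hφ t ht).2.fst,
    fun t ht => (hφ t ht).2.snd⟩

namespace OrientedGraph

/-- At regular points the generator is unique up to rescaling. -/
lemma neg_sharp_mem_genVecs (hG : OrientedGraph S H e r) {u : R4} (hu : u ∈ Metric.ball (0 : R4) r)
    (hg : OnGraph u) (hoff : (u 1, u 2) ∈ offCrease) {μ : ℝ} (hμ : 0 < μ) :
    -(μ • sharp S e u (conormal (argmaxGen (u 1, u 2)))) ∈ genVecs S H e u := by
  obtain ⟨k, hk⟩ := hG.genVecs_nonempty hu hg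
  obtain ⟨ν, hν, rfl⟩ := hG.genVecs_regular hu hg hoff hk
  have := smul_mem_genVecs hG.atlas (hG.target hu) hk (a := μ / ν) (by positivity)
  rwa [smul_neg, smul_smul, div_mul_cancel₀ _ hν.ne'] at this

/-- Both raised conormals at the crease are tangent to generators. -/
lemma neg_sharp_mem_genVecs_crease [T2Space M] (hG : OrientedGraph S H e r) {w b : ℝ} (hb0 : b ≠ 0)
    (hu : sheet w b (2 * b ^ 2) ∈ Metric.ball (0 : R4) r) :
    -sharp S e (sheet w b (2 * b ^ 2)) (conormal b) ∈
      genVecs S H e (sheet w b (2 * b ^ 2)) := by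
  set u := sheet w b (2 * b ^ 2) with hudef
  have htu := hG.target hu
  have hgr : OnGraph u := onGraph_sheet le_rfl
  have hu1 : u 1 = 0 := by simp only [hudef, sheet, pt_one]; ring
  have hu2 : u 2 = 2 * b ^ 2 := rfl
  have hoff : (u 1, u 2) ∉ offCrease := by
    simp only [offCrease, mem_ofPred_eq, not_not, hu1, hu2, true_and]; positivity
  have hbA : |b| = |argmaxGen (u 1, u 2)| := by
    have := (hgr.crease_sheet hoff).1
    rw [hu2] at this
    rw [← sq_eq_sq_iff_abs_eq_abs, hu2]; linarith
  set k := -sharp S e u (conormal b) with hk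
  have hknull : gForm S e u k k = 0 := by
    simp only [hk, map_neg, LinearMap.neg_apply, neg_neg]
    rw [gForm_sharp S hG.atlas htu]
    exact hG.null_conormal hu le_rfl rfl
  have hkfut : gForm S e u (futureCoord S e u) k < 0 := by
    rw [hk, map_neg, gForm_symm, gForm_sharp S hG.atlas htu, neg_neg_iff_pos]
    exact hG.future_pos u hu b hbA
  -- If the `x` component vanished, the conormals for `b` and `-b` would pair equally with the
  -- vector, but one pairing is zero and the other is not. So the geodesic leaves `x = 0` and
  -- reaches regular points of the sheet.
  have hk1 : k 1 ≠ 0 := by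
    have h1 := hG.pair_crease_neg hu hgr hoff hbA
    have h2 := hG.null_conormal hu le_rfl (rfl : u = sheet w b (2 * b ^ 2))
    rw [pair_conormal] at h1 h2
    intro h
    have h3 : sharp S e u (conormal b) 1 = 0 := by simpa [hk] using h
    rw [h3] at h1 h2
    rw [neg_sq] at h1
    linarith
  obtain ⟨ρ, hρ, ε, hε, α, hα, hαc⟩ := exists_geodesic_flow (S := S) hG.atlas (x₀ := (u, k)) htu
  have hx₀ : (u, k) ∈ Metric.closedBall (u, k) ρ := Metric.mem_closedBall_self hρ.le
  have hsol := isGeodesicSolution_of_flow (hα _ hx₀).2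
  have h0 : (0 : ℝ) ∈ Ioo (-ε) ε := ⟨by linarith, hε⟩
  have hα0 := (hα _ hx₀).1
  have hcont_q : Continuous fun q : ℝ => sheet w b q :=
    continuous_pt continuous_const (by fun_prop) (by fun_prop) (by fun_prop)
  -- The crease is approached through regular points with the same parameter `b`, where the
  -- direction of the generator is known to be the raised conormal.
  have ht : Tendsto (fun q : ℝ => sheet w b q) (𝓝[<] (2 * b ^ 2)) (𝓝 u) :=
    (hcont_q.tendsto _).mono_left nhdsWithin_le_nhds
  have htk : Tendsto (fun q : ℝ => -sharp S e (sheet w b q) (conormal b)) (𝓝[<] (2 * b ^ 2)) (𝓝 k) :=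
    (tendsto_sharp S hG.atlas htu ht tendsto_const_nhds).neg
  have htuk := ht.prodMk_nhds htk
  -- the limit of the generators lies in the horizon
  have hH : ∀ t ∈ Ioo (-ε) ε, 0 ≤ t → e.symm (α ((u, k), t)).1 ∈ H := by
    intro t htI ht0
    have hlim : Tendsto (fun q : ℝ => e.symm (α ((sheet w b q, -sharp S e (sheet w b q) (conormal b)), t)).1)
        (𝓝[<] (2 * b ^ 2)) (𝓝 (e.symm (α ((u, k), t)).1)) := by
      have h1 : ContinuousAt α ((u, k), t) := hαc.continuousAt
        (prod_mem_nhds (Metric.closedBall_mem_nhds _ hρ) (Icc_mem_nhds htI.1 htI.2))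
      have h2 := h1.tendsto.comp (htuk.prodMk_nhds (tendsto_const_nhds (x := t)))
      exact (e.continuousAt_symm ((hα _ hx₀).2 t htI).1).tendsto.comp
        ((continuous_fst.tendsto _).comp h2)
    refine hG.horizon.isClosed.mem_of_tendsto hlim ?_
    filter_upwards [mem_ball_of_tendsto ht hu, htuk.eventually_mem (Metric.closedBall_mem_nhds _ hρ),
      self_mem_nhdsWithin] with q hq1 hq2 hq3
    have hq3 : q < 2 * b ^ 2 := hq3
    have hs := isGeodesicSolution_of_flow (hα _ hq2).2
    have hoffq : ((sheet w b q) 1, (sheet w b q) 2) ∈ offCrease := by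
      simp only [offCrease, mem_ofPred_eq, sheet, pt_one, pt_two, not_and_or]
      left
      have : 4 * b ^ 3 - 2 * q * b = 2 * b * (2 * b ^ 2 - q) := by ring
      rw [this]
      exact mul_ne_zero (by simpa using hb0) (by linarith)
    have hAq : argmaxGen ((sheet w b q) 1, (sheet w b q) 2) = b :=
      argmaxGen_critical_eq (Or.inl hq3)
    have hkq := hG.neg_sharp_mem_genVecs hq1 (onGraph_sheet hq3.le) hoffq one_pos
    rw [hAq, one_smul] at hkq
    refine hs.mem_horizon hG.atlas h0 ?_ htI ht0
    rw [(hα _ hq2).1]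
    exact hkq
  obtain ⟨δ, hδ, hδI, hδf⟩ := hsol.exists_future hG.atlas h0 (by rw [hα0]; exact hkfut)
  simp only [zero_sub, zero_add] at hδI hδf
  have hsol' := hsol.mono hδI isOpen_Ioo ordConnected_Ioo
  set c : ℝ → R4 := fun t => (α ((u, k), t)).1 with hc
  set d : ℝ → R4 := fun t => (α ((u, k), t)).2 with hd
  have hc0 : c 0 = u := by simp only [hc, hα0]
  have hd0 : d 0 = k := by simp only [hd, hα0]
  have hδ0 : (0 : ℝ) ∈ Ioo (-δ) δ := ⟨by linarith, hδ⟩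
  have hnull : ∀ t ∈ Ioo (-δ) δ, gForm S e (c t) (d t) (d t) = 0 := fun t ht => by
    rw [hsol'.gForm_const hG.atlas ht hδ0, hc0, hd0]; exact hknull
  have hcd0 : HasDerivAt c k 0 := by
    have := hsol'.hasDerivAt 0 hδ0
    rwa [hd0] at this
  -- a slightly later regular point
  have hx : ∀ᶠ t in 𝓝[>] (0 : ℝ), c t 1 ≠ 0 := by
    have h1 := (hasDerivAt_coord hcd0 1).eventually_ne (c := (0 : ℝ)) hk1
    exact h1.filter_mono (nhdsWithin_mono _ fun t (ht : 0 < t) => ne_of_gt ht)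
  have hball : ∀ᶠ t in 𝓝[>] (0 : ℝ), c t ∈ Metric.ball (0 : R4) r :=
    nhdsWithin_le_nhds (mem_ball_of_tendsto (hc0 ▸ hcd0.continuousAt.tendsto) hu)
  obtain ⟨t₁, hx1, hb1, ht1⟩ := (hx.and (hball.and (Ioo_mem_nhdsGT hδ))).exists
  have ht1I : t₁ ∈ Ioo (-δ) δ := ⟨by linarith [ht1.1], ht1.2⟩
  have hHt : ∀ t ∈ Ioo (-δ) δ, 0 ≤ t → e.symm (c t) ∈ H := fun t ht h => hH t (hδI ht) h
  have hg1 : OnGraph (c t₁) := (hG.graph _ hb1).mp (hHt t₁ ht1I ht1.1.le)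
  have hoff1 : (c t₁ 1, c t₁ 2) ∈ offCrease := fun h => hx1 h.1
  have hcd1 := hsol'.hasDerivAt t₁ ht1I
  have hp1 : pair (conormal (argmaxGen (c t₁ 1, c t₁ 2))) (d t₁) = 0 := by
    refine pair_conormal_eq_zero (argmaxGen_of_offCrease hoff1) hg1.eq_sheet hcd1.hasDerivWithinAt ?_
    filter_upwards [nhdsWithin_le_nhds (mem_ball_of_tendsto hcd1.continuousAt.tendsto hb1),
      Ioo_mem_nhdsGT ht1.2] with t a1 a2
    exact (hG.graph _ a1).mp (hHt t ⟨by linarith [a2.1, ht1.1], a2.2⟩ (by linarith [a2.1, ht1.1]))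
  obtain ⟨μ, hμ⟩ := hG.eq_smul_sharp hb1 (le_two_argmaxGen_sq _) hg1.eq_sheet (hnull t₁ ht1I) hp1
  have hμ0 := hG.neg_of_eq_smul hb1 rfl (hδf t₁ ht1I) hμ
  -- At the regular point `c t₁` the limit geodesic is tangent to a true generator. Gluing the two
  -- supplies the inextendibility that the limit inside the chart does not give.
  have hgen1 : d t₁ ∈ genVecs S H e (c t₁) := by
    have := hG.neg_sharp_mem_genVecs hb1 hg1 hoff1 (μ := -μ) (by linarith)
    rwa [neg_smul, neg_neg, ← hμ] at this
  have := hsol'.mem_genVecs hG.atlas hδ0 ht1I ht1.1 hnull hδf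
    (fun t ht => hHt t ⟨by linarith [ht.1], ht.2.trans_lt ht1.2⟩ ht.1) hgen1
  rwa [hc0, hd0] at this

end OrientedGraph

end Caustic
end

noncomputable section
namespace Caustic

set_option linter.unusedSectionVars false

/-! ### The number of generators -/

variable {M : Type*} [TopologicalSpace M] [ChartedSpace R4 M] [IsManifold (𝓡 4) ∞ M]
variable {S : Spacetime M} {H : Set M} {e : OpenPartialHomeomorph M R4} {r : ℝ}

lemma coordTangent_ne_zero (he : e ∈ IsManifold.maximalAtlas (𝓡 4) ∞ M) {u k : R4}
    (hu : u ∈ e.target) (hk : k ≠ 0) : coordTangent e u k ≠ 0 := fun h => hk (by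
  rw [← chartD_coordTangent he hu k, h, map_zero])

lemma coordTangent_smul (u k : R4) (a : ℝ) :
    coordTangent e u (a • k) = a • coordTangent e u k := (coordD e u).map_smul a k

lemma mem_generatorVectors_coordTangent (he : e ∈ IsManifold.maximalAtlas (𝓡 4) ∞ M) {u : R4}
    (hu : u ∈ e.target) (k : R4) :
    coordTangent e u k ∈ S.generatorVectors H (e.symm u) ↔ k ∈ genVecs S H e u := by
  rw [mem_generatorVectors_iff he hu, chartD_coordTangent he hu]

/-- The directions of the generators in terms of the components of their tangent vectors. -/
lemma numGenerators_eq (he : e ∈ IsManifold.maximalAtlas (𝓡 4) ∞ M) {u : R4}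
    (hu : u ∈ e.target) {ι : Type*} (k : ι → R4) (hk0 : ∀ i, k i ≠ 0)
    (hk : ∀ i, k i ∈ genVecs S H e u)
    (hall : ∀ d ∈ genVecs S H e u, ∃ i, ∃ μ : ℝ, 0 < μ ∧ d = μ • k i) :
    S.numGenerators H (e.symm u) = Set.encard (Set.range fun i =>
      rayOfNeZero ℝ (coordTangent e u (k i)) (coordTangent_ne_zero he hu (hk0 i))) := by
  unfold Spacetime.numGenerators
  congr 1
  ext ρ
  constructor
  · rintro ⟨v, hv0, hv, rfl⟩
    obtain ⟨i, μ, hμ, h⟩ := hall _ ((mem_generatorVectors_iff he hu v).mp hv)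
    refine ⟨i, ?_⟩
    have hv' : v = μ • coordTangent e u (k i) := by
      rw [← coordTangent_smul, ← h, coordTangent_chartD he hu]
    rw [ray_eq_iff, hv']
    exact SameRay.sameRay_nonneg_smul_right _ hμ.le
  · rintro ⟨i, rfl⟩
    exact ⟨_, _, (mem_generatorVectors_coordTangent he hu _).mpr (hk i), rfl⟩

lemma numGenerators_eq_one (he : e ∈ IsManifold.maximalAtlas (𝓡 4) ∞ M) {u k : R4}
    (hu : u ∈ e.target) (hk0 : k ≠ 0) (hk : k ∈ genVecs S H e u)
    (hall : ∀ d ∈ genVecs S H e u, ∃ μ : ℝ, 0 < μ ∧ d = μ • k) :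
    S.numGenerators H (e.symm u) = 1 := by
  rw [numGenerators_eq he hu (fun _ : Unit => k) (fun _ => hk0) (fun _ => hk)
    (fun d hd => ⟨(), hall d hd⟩), Set.range_const, Set.encard_singleton]

lemma numGenerators_eq_two (he : e ∈ IsManifold.maximalAtlas (𝓡 4) ∞ M) {u : R4}
    (hu : u ∈ e.target) {k l : R4} (hk0 : k ≠ 0) (hl0 : l ≠ 0) (hk : k ∈ genVecs S H e u)
    (hl : l ∈ genVecs S H e u) (hne : ∀ μ : ℝ, l ≠ μ • k)
    (hall : ∀ d ∈ genVecs S H e u, ∃ μ : ℝ, 0 < μ ∧ (d = μ • k ∨ d = μ • l)) :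
    S.numGenerators H (e.symm u) = 2 := by
  rw [numGenerators_eq he hu (fun b : Bool => cond b k l) (by rintro (_ | _) <;> assumption)
    (by rintro (_ | _) <;> assumption) (fun d hd => by
      obtain ⟨μ, hμ, h | h⟩ := hall d hd
      exacts [⟨true, μ, hμ, h⟩, ⟨false, μ, hμ, h⟩]), Bool.range_eq, Set.encard_pair]
  simp only [cond_true, cond_false, ne_eq, ray_eq_iff]
  intro h
  obtain ⟨μ, -, h⟩ := h.symm.exists_pos_left (coordTangent_ne_zero he hu hk0)
    (coordTangent_ne_zero he hu hl0)
  apply hne μ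
  rw [← coordTangent_smul] at h
  have := congrArg (chartD e (e.symm u)) h
  rwa [chartD_coordTangent he hu, chartD_coordTangent he hu, eq_comm] at this

namespace OrientedGraph

variable (hG : OrientedGraph S H e r) {u : R4} (hu : u ∈ Metric.ball (0 : R4) r)
include hG hu

lemma numGenerators_regular (hg : OnGraph u) (hoff : (u 1, u 2) ∈ offCrease) :
    S.numGenerators H (e.symm u) = 1 := by
  refine numGenerators_eq_one hG.atlas (hG.target hu)
    (k := -sharp S e u (conormal (argmaxGen (u 1, u 2))))
    (neg_ne_zero.mpr (hG.sharp_ne_zero (hG.target hu) _)) ?_ fun d hd => ?_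
  · have := hG.neg_sharp_mem_genVecs hu hg hoff one_pos
    rwa [one_smul] at this
  · obtain ⟨μ, hμ, h⟩ := hG.genVecs_regular hu hg hoff hd
    exact ⟨μ, hμ, by rw [h, smul_neg]⟩

lemma numGenerators_crease [T2Space M] (hg : OnGraph u) (hoff : (u 1, u 2) ∉ offCrease) :
    S.numGenerators H (e.symm u) = 2 := by
  obtain ⟨h2, hA, hs⟩ := hg.crease_sheet hoff
  set A := argmaxGen (u 1, u 2) with hAdef
  have ht := hG.target hu
  have hmem : ∀ b : ℝ, b ≠ 0 → u = sheet (u 0) b (2 * b ^ 2) →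
      -sharp S e u (conormal b) ∈ genVecs S H e u := fun b hb hub => by
    have := hG.neg_sharp_mem_genVecs_crease hb (w := u 0) (hub ▸ hu)
    rwa [← hub] at this
  refine numGenerators_eq_two hG.atlas ht (k := -sharp S e u (conormal A))
    (l := -sharp S e u (conormal (-A))) (neg_ne_zero.mpr (hG.sharp_ne_zero ht _))
    (neg_ne_zero.mpr (hG.sharp_ne_zero ht _)) (hmem A hA hs)
    (hmem (-A) (neg_ne_zero.mpr hA) (by rw [neg_sq, sheet_crease_neg]; exact hs)) (fun μ h => ?_)
    fun d hd => ?_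
  · refine hG.sharp_ne_smul ht (a := -A) (b := A) (fun h => hA (by linarith)) μ ?_
    rw [smul_neg, neg_inj] at h
    exact h
  · obtain ⟨b, μ, hb, hμ, h⟩ := hG.genVecs_form hu hg hd
    refine ⟨μ, hμ, ?_⟩
    rcases abs_eq_abs.mp hb with h' | h'
    · left; rw [h, h', smul_neg]
    · right; rw [h, h', smul_neg]

lemma mem_endpoints_of (hg : OnGraph u) (hne : ∀ γ J t₀, S.IsGenerator H γ J t₀ →
    γ t₀ = e.symm u → ¬ ∃ t ∈ J, t < t₀ ∧ ∀ s ∈ Icc t t₀, γ s ∈ H) : e.symm u ∈ S.endpoints H := by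
  obtain ⟨γ, J, t₀, h, hγ⟩ := hG.horizon.ruled _ ((hG.graph u hu).mpr hg)
  exact ⟨γ, J, t₀, h, hγ, hne γ J t₀ h hγ⟩

/-- The crease set. -/
lemma mem_creaseSet_iff [T2Space M] :
    e.symm u ∈ S.creaseSet H ↔ OnGraph u ∧ (u 1, u 2) ∉ offCrease := by
  constructor
  · rintro ⟨⟨γ, J, t₀, hg, hγ, -⟩, hN⟩
    have hgr : OnGraph u := (hG.graph u hu).mp (hγ ▸ hg.subset t₀ hg.mem le_rfl)
    refine ⟨hgr, fun hoff => ?_⟩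
    rw [hG.numGenerators_regular hu hgr hoff] at hN
    exact lt_irrefl _ hN
  · rintro ⟨hg, hoff⟩
    refine ⟨hG.mem_endpoints_of hu hg fun γ J t₀ h hγ => hG.not_extendible_crease hu hg hoff h hγ, ?_⟩
    rw [hG.numGenerators_crease hu hg hoff]
    norm_num

end OrientedGraph

lemma onGraph_crease_iff (v : R4) : OnGraph v ∧ (v 1, v 2) ∉ offCrease ↔
    ∃ w y : ℝ, 0 < y ∧ v = creaseParam (w, y) := by
  simp only [offCrease, mem_ofPred_eq, not_not, OnGraph]
  constructor
  · rintro ⟨h3, h1, h2⟩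
    refine ⟨v 0, v 2, h2, ?_⟩
    rw [h1, maxGen_zero_nonneg h2.le] at h3
    exact R4.ext rfl h1 rfl h3
  · rintro ⟨w, y, hy, rfl⟩
    exact ⟨(maxGen_zero_nonneg hy.le).symm, rfl, hy⟩

/-! ### The tangent planes of the crease -/

lemma contDiff_creaseParam : ContDiff ℝ ∞ creaseParam := by
  rw [contDiff_iff_contDiffAt]
  intro s
  exact contDiffAt_pt contDiffAt_fst contDiffAt_const contDiffAt_snd
    ((contDiffAt_snd.pow 2).div_const 4)

/-- The second spanning vector of the tangent plane of the crease. -/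
def creaseVec (y : ℝ) : R4 := pt 0 0 1 (y / 2)

lemma creasePlane_fderiv_apply (s d : ℝ × ℝ) :
    fderiv ℝ creaseParam s d = d.1 • stdVec 0 + d.2 • creaseVec s.2 := by
  have hd : HasDerivAt (fun t : ℝ => creaseParam (s + t • d)) (fderiv ℝ creaseParam s d) 0 := by
    have h1 : HasFDerivAt creaseParam (fderiv ℝ creaseParam s) (s + (0 : ℝ) • d) := by
      rw [zero_smul, add_zero]
      exact (contDiff_creaseParam.differentiable (by simp) s).hasFDerivAt
    have h2 : HasDerivAt (fun t : ℝ => s + t • d) d 0 := by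
      exact (((hasDerivAt_id (0 : ℝ)).smul_const d).const_add s).congr_deriv (by simp)
    exact h1.comp_hasDerivAt (0 : ℝ) h2
  have lin : ∀ a b : ℝ, HasDerivAt (fun t : ℝ => a + t * b) b 0 := fun a b => by
    simpa using ((hasDerivAt_id (0 : ℝ)).mul_const b).const_add a
  have h3 : HasDerivAt (fun t : ℝ => (s.2 + t * d.2) ^ 2 / 4) (s.2 * d.2 / 2) 0 := by
    refine (((lin s.2 d.2).pow 2).div_const 4).congr_deriv ?_
    simp; ring
  have h4 := hasDerivWithinAt_pt (lin s.1 d.1).hasDerivWithinAt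
    (hasDerivAt_const (0 : ℝ) (0 : ℝ)).hasDerivWithinAt (lin s.2 d.2).hasDerivWithinAt
    (h3.hasDerivWithinAt (s := univ))
  rw [hasDerivWithinAt_univ] at h4
  have := hd.unique h4
  rw [this]
  apply R4.ext <;> simp [creaseVec]
  ring

lemma mem_creasePlane_iff (s : ℝ × ℝ) (c : R4) :
    c ∈ creasePlane s ↔ ∃ a b : ℝ, c = a • stdVec 0 + b • creaseVec s.2 := by
  constructor
  · rintro ⟨d, rfl⟩
    exact ⟨d.1, d.2, creasePlane_fderiv_apply s d⟩
  · rintro ⟨a, b, rfl⟩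
    exact ⟨(a, b), creasePlane_fderiv_apply s (a, b)⟩

lemma finrank_creasePlane (s : ℝ × ℝ) : Module.finrank ℝ (creasePlane s) = 2 := by
  rw [creasePlane, LinearMap.finrank_range_of_inj, Module.finrank_prod, Module.finrank_self]
  intro d d' h
  rw [ContinuousLinearMap.coe_coe, creasePlane_fderiv_apply, creasePlane_fderiv_apply] at h
  have h0 := congrArg (fun v : R4 => v 0) h
  have h2 := congrArg (fun v : R4 => v 2) h
  simp [creaseVec] at h0 h2
  exact Prod.ext h0 h2

/-- The plane at `y = 0` is spanned by `∂/∂w` and `∂/∂y`, and `l` is a combination of these with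
nonzero `∂/∂y` part. This covers both `l = ∂/∂y` and `l = (dz)^a`. -/
lemma creasePlane_zero_eq_span (w : ℝ) {l : R4} (h1 : l 1 = 0) (h2 : l 2 ≠ 0) (h3 : l 3 = 0) :
    creasePlane (w, 0) = Submodule.span ℝ {stdVec 0, l} := by
  ext c
  rw [mem_creasePlane_iff, Submodule.mem_span_pair]
  constructor
  · rintro ⟨a, b, rfl⟩
    refine ⟨a - b / l 2 * l 0, b / l 2, ?_⟩
    apply R4.ext <;> simp [creaseVec, h1, h3]
    field_simp
  · rintro ⟨a, b, rfl⟩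
    refine ⟨a + b * l 0, b * l 2, ?_⟩
    apply R4.ext <;> simp [creaseVec, h1, h3]

/-- The orthogonal projection onto the tangent plane of the crease. -/
def creaseProj (y : ℝ) : R4 →L[ℝ] R4 :=
  (innerSL ℝ (stdVec 0)).smulRight (stdVec 0)
    + (1 + y ^ 2 / 4)⁻¹ • (innerSL ℝ (creaseVec y)).smulRight (creaseVec y)

lemma inner_eq_pair (c d : R4) : inner ℝ c d = pair c d := by
  simp only [PiLp.inner_apply, pair, RCLike.inner_apply, conj_trivial]
  exact Finset.sum_congr rfl fun i _ => mul_comm _ _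

/-- The two spanning vectors are orthogonal, with squared lengths `1` and `1 + y²/4`. The explicit
formula reduces convergence of the planes to continuity in `y`. -/
lemma starProjection_creasePlane (s : ℝ × ℝ) : (creasePlane s).starProjection = creaseProj s.2 := by
  have hpos : (1 + s.2 ^ 2 / 4 : ℝ) ≠ 0 := by positivity
  ext1 v
  symm
  have hv : creaseProj s.2 v = (v 0) • stdVec 0
      + ((1 + s.2 ^ 2 / 4)⁻¹ * (v 2 + s.2 / 2 * v 3)) • creaseVec s.2 := by
    simp [creaseProj, inner_eq_pair, pair_eq, creaseVec, smul_smul]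
  rw [hv]
  symm
  refine Submodule.eq_starProjection_of_mem_of_inner_eq_zero
    ((mem_creasePlane_iff _ _).mpr ⟨_, _, rfl⟩) fun c hc => ?_
  obtain ⟨a, b, rfl⟩ := (mem_creasePlane_iff _ _).mp hc
  simp [inner_eq_pair, pair_eq, creaseVec]
  field_simp
  ring

lemma continuous_creaseProj : Continuous creaseProj := by
  have hcv : Continuous creaseVec :=
    continuous_pt continuous_const continuous_const continuous_const (by fun_prop)
  have h1 : Continuous fun y : ℝ => (innerSL ℝ (creaseVec y)).smulRight (creaseVec y) := by
    have h2 : Continuous fun y : ℝ =>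
        ContinuousLinearMap.smulRightL ℝ R4 R4 (innerSL ℝ (creaseVec y)) (creaseVec y) :=
      ((ContinuousLinearMap.smulRightL ℝ R4 R4).continuous.comp
        ((innerSL ℝ).continuous.comp hcv)).clm_apply hcv
    exact h2
  have h3 : Continuous fun y : ℝ => (1 + y ^ 2 / 4)⁻¹ :=
    Continuous.inv₀ (by fun_prop) fun y => by positivity
  exact continuous_const.add (h3.smul h1)

/-- The geometry along the `A₃` line. -/
theorem OrientedGraph.a3LineGeometry (hG : OrientedGraph S H e r) {w : ℝ}
    (hw : linePoint w ∈ Metric.ball (0 : R4) r) : A3LineGeometry S H e (linePoint w) := by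
  have ht := hG.target hw
  have hgr := OnGraph.linePoint w
  have hoff := linePoint_offCrease w
  obtain ⟨h33, h13, h23⟩ := hG.gUp_line hw
  have hpos := hG.gUp_pos hw
  have hdz : sharp S e (linePoint w) (conormal 0) = S.dzUp e (linePoint w) := by
    rw [conormal_zero, dzUp_eq_sharp]
  have hmem : ∀ μ : ℝ, 0 < μ → -(μ • S.dzUp e (linePoint w)) ∈ genVecs S H e (linePoint w) := by
    intro μ hμ
    have := hG.neg_sharp_mem_genVecs hw hgr hoff hμ
    rwa [argmaxGen_linePoint, hdz] at this
  have hmem1 : -S.dzUp e (linePoint w) ∈ genVecs S H e (linePoint w) := by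
    have := hmem 1 one_pos
    rwa [one_smul] at this
  have hplane : creasePlane ((linePoint w) 0, 0)
      = Submodule.span ℝ {stdVec 0, S.dzUp e (linePoint w)} :=
    creasePlane_zero_eq_span _ h13 hpos.ne' h33
  have htan : ∀ c ∈ creasePlane ((linePoint w) 0, 0), c 3 = 0 := fun c hc => by
    obtain ⟨a, b, rfl⟩ := (mem_creasePlane_iff _ _).mp hc
    simp [creaseVec]
  refine ⟨hG.mem_endpoints_of hw hgr fun γ J t₀ h hγ => hG.not_extendible_line hw h hγ,
    hG.numGenerators_regular hw hgr hoff, ?_, ?_, h33, h13, h23, hpos,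
    hG.gDown_pos hw (by decide) (by decide), hG.gDown_pos hw (by decide) (by decide), ?_,
    creasePlane_zero_eq_span _ (by simp) (by simp) (by simp), hplane, ?_, htan⟩
  · ext v
    constructor
    · intro hv
      obtain ⟨μ, hμ, h⟩ := hG.genVecs_regular hw hgr hoff ((mem_generatorVectors_iff hG.atlas ht v).mp hv)
      rw [argmaxGen_linePoint, hdz] at h
      exact ⟨μ, hμ, by rw [← h, coordTangent_chartD hG.atlas ht]⟩
    · rintro ⟨μ, hμ, rfl⟩
      exact (mem_generatorVectors_coordTangent hG.atlas ht _).mpr (hmem μ hμ)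
  · rw [isFutureNull_iff S hG.atlas (e.map_target ht), chartD_coordTangent hG.atlas ht,
      e.right_inv ht]
    exact hG.genVecs_null hw hmem1
  · simp only [starProjection_creasePlane]
    exact ((continuous_creaseProj.comp continuous_snd).tendsto ((linePoint w) 0, (0 : ℝ))).mono_left
      nhdsWithin_le_nhds
  · refine ⟨S.dzUp e (linePoint w), ?_, fun h => ?_, fun d hd => ?_⟩
    · rw [hplane]; exact Submodule.subset_span (by simp)
    · exact hpos.ne' (congrArg (fun v : R4 => v 2) h)
    · rw [← gForm_apply, dzUp_eq_sharp, gForm_sharp S hG.atlas ht, pair_stdVec]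
      exact htan d hd

end Caustic
end

noncomputable section
namespace Caustic

set_option linter.unusedSectionVars false

/-! ### The `A₃` points -/

variable {M : Type*} [TopologicalSpace M] [ChartedSpace R4 M] [IsManifold (𝓡 4) ∞ M]
variable {S : Spacetime M} {H : Set M} {e e' : OpenPartialHomeomorph M R4} {p : M} {r : ℝ}

lemma trans_mem_maximalAtlas (he : e ∈ IsManifold.maximalAtlas (𝓡 4) ∞ M)
    {φ : OpenPartialHomeomorph R4 R4} (h : ContDiffOn ℝ ∞ φ φ.source)
    (h' : ContDiffOn ℝ ∞ φ.symm φ.target) :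
    e.trans φ ∈ IsManifold.maximalAtlas (𝓡 4) ∞ M := by
  refine OpenPartialHomeomorph.mem_maximalAtlas_of_contMDiffOn _ ?_ ?_
  · exact (contMDiffOn_iff_contDiffOn.mpr h).comp
      ((contMDiffOn_of_mem_maximalAtlas he).mono fun x hx => by
        rw [OpenPartialHomeomorph.trans_source] at hx; exact hx.1) fun x hx => by
        rw [OpenPartialHomeomorph.trans_source] at hx; exact hx.2
  · exact (contMDiffOn_symm_of_mem_maximalAtlas he).comp
      ((contMDiffOn_iff_contDiffOn.mpr h').mono fun x hx => by
        rw [OpenPartialHomeomorph.trans_target] at hx; exact hx.1) fun x hx => by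
        rw [OpenPartialHomeomorph.trans_target] at hx; exact hx.2

/-- The points of the line `x = y = z = 0` are `A₃` points. -/
lemma isA3Chart_translate (he : S.IsA3Chart H p e) {w : ℝ} (hw : linePoint w ∈ e.target)
    (hH : e.symm (linePoint w) ∈ H) :
    S.IsA3Chart H (e.symm (linePoint w))
      (e.trans (Homeomorph.addRight (-linePoint w)).toOpenPartialHomeomorph) := by
  have hφ : ∀ u : R4, (Homeomorph.addRight (-linePoint w)).toOpenPartialHomeomorph u
      = u + -linePoint w := fun u => rfl
  have hφ' : ∀ u : R4, (Homeomorph.addRight (-linePoint w)).toOpenPartialHomeomorph.symm u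
      = u + linePoint w := fun u => by
    change u + -(-linePoint w) = _
    rw [neg_neg]
  refine ⟨trans_mem_maximalAtlas he.mem_atlas ?_ ?_, hH, ?_, ?_, fun v hv => ?_⟩
  · exact (contDiff_id.add contDiff_const).contDiffOn
  · exact (contDiff_id.add contDiff_const).contDiffOn
  · simp [e.map_target hw]
  · simp only [OpenPartialHomeomorph.coe_trans, Function.comp, hφ, e.right_inv hw, add_neg_cancel]
  · have hv' : v + linePoint w ∈ e.target := by
      rw [OpenPartialHomeomorph.trans_target] at hv
      have := hv.2
      rwa [mem_preimage, hφ'] at this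
    have h := he.wavefront _ hv'
    simp only [OpenPartialHomeomorph.coe_trans_symm, Function.comp, hφ']
    rw [h]
    simp [linePoint_eq]

lemma exists_orientedGraph (hH : S.IsFutureHorizon H) (he : S.IsA3Chart H p e) :
    ∃ r > 0, OrientedGraph S H e r := by
  obtain ⟨r, hr, ht, hg⟩ := exists_horizon_graph hH he
  exact HorizonGraph.exists_orientedGraph ⟨hH, he.mem_atlas, hr, ht, hg⟩

/-- The derivative changes by at most a multiple of `‖u‖` on the ball of radius `‖u‖`, and the mean
value inequality contributes the second factor `‖u‖`. -/
lemma abs_sub_fderiv_le {F : R4 → ℝ} (hF : ContDiffAt ℝ 2 F 0) :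
    ∃ C : ℝ, ∀ᶠ u in 𝓝 (0 : R4), |F u - F 0 - fderiv ℝ F 0 u| ≤ C * ‖u‖ ^ 2 := by
  have h1 : DifferentiableAt ℝ (fderiv ℝ F) 0 :=
    (hF.fderiv_right (m := 1) (by norm_num)).differentiableAt (by simp)
  obtain ⟨C, hC⟩ := h1.hasFDerivAt.isBigO_sub.bound
  have h2 : ∀ᶠ u in 𝓝 (0 : R4), DifferentiableAt ℝ F u :=
    (hF.eventually (by simp)).mono fun u hu => hu.differentiableAt (by simp)
  obtain ⟨δ, hδ, hb⟩ := Metric.eventually_nhds_iff_ball.mp (hC.and h2)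
  refine ⟨|C|, ?_⟩
  filter_upwards [Metric.ball_mem_nhds (0 : R4) hδ] with u hu
  have hsub : ∀ x ∈ Metric.closedBall (0 : R4) ‖u‖, x ∈ Metric.ball (0 : R4) δ := fun x hx => by
    rw [mem_ball_zero_iff] at hu ⊢
    rw [mem_closedBall_zero_iff] at hx
    exact hx.trans_lt hu
  have := Convex.norm_image_sub_le_of_norm_fderiv_le' (𝕜 := ℝ) (f := F) (φ := fderiv ℝ F 0)
    (C := |C| * ‖u‖) (s := Metric.closedBall (0 : R4) ‖u‖) (x := 0) (y := u)
    (fun x hx => (hb x (hsub x hx)).2) (fun x hx => by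
      have h3 := (hb x (hsub x hx)).1
      rw [mem_closedBall_zero_iff] at hx
      rw [sub_zero] at h3
      exact h3.trans (mul_le_mul (le_abs_self C) hx (norm_nonneg _) (abs_nonneg _)))
    (convex_closedBall _ _) (by simp) (by simp)
  rw [sub_zero, Real.norm_eq_abs] at this
  linarith [this, sq (‖u‖), mul_assoc |C| ‖u‖ ‖u‖]

/-- The upper sheet of the swallowtail is not contained in a smooth hypersurface near the origin. -/
lemma fderiv_eq_zero_of_onGraph {F : R4 → ℝ} (hF : ContDiffAt ℝ 2 F 0)
    (h0 : ∀ᶠ u in 𝓝 (0 : R4), OnGraph u → F u = 0) : fderiv ℝ F 0 = 0 := by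
  have hF0 : F 0 = 0 := h0.self_of_nhds maxGen_zero.symm
  have hFd : HasFDerivAt F (fderiv ℝ F 0) 0 := (hF.differentiableAt (by simp)).hasFDerivAt
  have hM : HasFDerivAt maxGen (0 : ℝ × ℝ →L[ℝ] ℝ) (0, 0) := by
    have := maxGen_hasFDerivAt (a := 0) (y := 0) (Or.inr ⟨rfl, rfl⟩)
    simpa using this
  -- The tangent hyperplane of the sheet at the origin is `z = 0`: each such vector is the velocity
  -- of a curve in the sheet, along which `F` vanishes.
  have htan : ∀ d0 d1 d2 : ℝ, fderiv ℝ F 0 (pt d0 d1 d2 0) = 0 := by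
    intro d0 d1 d2
    have lin : ∀ k : ℝ, HasDerivAt (fun t : ℝ => t * k) k 0 := fun k => by
      simpa using (hasDerivAt_id (0 : ℝ)).mul_const k
    have h3 : HasDerivAt (fun t : ℝ => maxGen (t * d1, t * d2)) 0 0 := by
      have hM' : HasFDerivAt maxGen (0 : ℝ × ℝ →L[ℝ] ℝ) ((0 : ℝ) * d1, (0 : ℝ) * d2) := by
        rw [zero_mul, zero_mul]; exact hM
      exact hM'.comp_hasDerivAt (0 : ℝ) ((lin d1).prodMk (lin d2))
    have hg := hasDerivWithinAt_pt (lin d0).hasDerivWithinAt (lin d1).hasDerivWithinAt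
      (lin d2).hasDerivWithinAt (h3.hasDerivWithinAt (s := univ))
    rw [hasDerivWithinAt_univ] at hg
    set g : ℝ → R4 := fun t => pt (t * d0) (t * d1) (t * d2) (maxGen (t * d1, t * d2)) with hgdef
    have hg0 : g 0 = 0 := by simp [hgdef, maxGen_zero, pt_zero_eq]
    have hFd' : HasFDerivAt F (fderiv ℝ F 0) (g 0) := by rw [hg0]; exact hFd
    have h4 := hFd'.comp_hasDerivAt (0 : ℝ) hg
    have h5 : F ∘ g =ᶠ[𝓝 0] fun _ => 0 := by
      have := hg.continuousAt.tendsto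
      rw [hg0] at this
      filter_upwards [this.eventually h0] with t ht
      exact ht rfl
    exact (h4.congr_of_eventuallyEq h5.symm).unique (hasDerivAt_const (0 : ℝ) (0 : ℝ))
  -- On the points `(0, 4a³, 0, 3a⁴)` the linear part of `F` is `3a⁴` times this derivative, while
  -- the quadratic remainder is `O(a⁶)`.
  have h3 : fderiv ℝ F 0 (stdVec 3) = 0 := by
    obtain ⟨C, hC⟩ := abs_sub_fderiv_le hF
    have hc : Continuous fun a : ℝ => sheet 0 a 0 :=
      continuous_pt continuous_const (by fun_prop) (by fun_prop) (by fun_prop)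
    have hs : Tendsto (fun a : ℝ => sheet 0 a 0) (𝓝[>] 0) (𝓝 0) := by
      have := hc.tendsto 0
      rw [← HorizonGraph.zero_eq_sheet] at this
      exact this.mono_left nhdsWithin_le_nhds
    have hN : Continuous fun a : ℝ => C / 3 * a ^ 2 * ‖pt 0 4 0 (3 * a)‖ ^ 2 := by
      have : Continuous fun a : ℝ => pt 0 4 0 (3 * a) :=
        continuous_pt continuous_const continuous_const continuous_const (by fun_prop)
      fun_prop
    have hlim : Tendsto (fun a : ℝ => C / 3 * a ^ 2 * ‖pt 0 4 0 (3 * a)‖ ^ 2) (𝓝[>] 0) (𝓝 0) := by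
      have := hN.tendsto 0
      simp only [ne_eq, OfNat.ofNat_ne_zero, not_false_eq_true, zero_pow, mul_zero, zero_mul] at this
      exact this.mono_left nhdsWithin_le_nhds
    have hle : |fderiv ℝ F 0 (stdVec 3)| ≤ 0 := by
      refine ge_of_tendsto hlim ?_
      filter_upwards [hs.eventually hC, hs.eventually h0, self_mem_nhdsWithin] with a h1 h2 ha
      have ha : 0 < a := ha
      have hL : fderiv ℝ F 0 (sheet 0 a 0) = 3 * a ^ 4 * fderiv ℝ F 0 (stdVec 3) := by
        have : sheet 0 a 0 = pt 0 (4 * a ^ 3) 0 0 + (3 * a ^ 4) • stdVec 3 := by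
          apply R4.ext <;> simp [sheet]
        rw [this, map_add, htan, map_smul, zero_add, smul_eq_mul]
      have hn : ‖sheet 0 a 0‖ ^ 2 = a ^ 6 * ‖pt 0 4 0 (3 * a)‖ ^ 2 := by
        have : sheet 0 a 0 = a ^ 3 • pt 0 4 0 (3 * a) := by
          apply R4.ext <;> simp [sheet] <;> ring
        rw [this, norm_smul, mul_pow, Real.norm_eq_abs, sq_abs]; ring
      rw [h2 (onGraph_sheet (by positivity)), hF0, hL, hn, sub_self, zero_sub, abs_neg, abs_mul,
        abs_of_pos (by positivity)] at h1
      have h4 : (0 : ℝ) < 3 * a ^ 4 := by positivity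
      refine le_of_mul_le_mul_left (h1.trans_eq ?_) h4
      ring
    exact abs_nonpos_iff.mp hle
  ext1 d
  have hd : d = pt (d 0) (d 1) (d 2) 0 + d 3 • stdVec 3 := by
    apply R4.ext <;> simp
  rw [hd, map_add, htan, map_smul, h3]
  simp

/-- Points where the upper sheet is smooth are not `A₃` points. -/
lemma HorizonGraph.not_isA3Chart_of_smooth (hG : HorizonGraph S H e r) {v : R4}
    (hv : v ∈ Metric.ball (0 : R4) r) (hs : ¬ (v 1 = 0 ∧ 0 ≤ v 2)) :
    ¬ S.IsA3Chart H (e.symm v) e' := by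
  intro he'
  have htv := hG.target hv
  obtain ⟨r', hr', hrt', hg'⟩ := exists_horizon_graph hG.horizon he'
  have h0' : (0 : R4) ∈ e'.target := zero_mem_target he'
  have hsymm0 : e'.symm 0 = e.symm v := symm_zero he'
  have hs0 : e'.symm 0 ∈ e.source := by rw [hsymm0]; exact e.map_target htv
  set ψ : R4 → R4 := fun u => e (e'.symm u) with hψ
  have hψ0 : ψ 0 = v := by simp only [hψ, hsymm0]; exact e.right_inv htv
  have hψd : ContDiffAt ℝ ∞ ψ 0 := contDiffAt_transition he'.mem_atlas hG.atlas h0' hs0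
  -- Near `v` this is a smooth function with the horizon as zero set and `∂f/∂z = 1`. Read in a
  -- canonical chart at the same point it would vanish on a swallowtail sheet, so its derivative
  -- would be zero by `fderiv_eq_zero_of_onGraph`.
  set f : R4 → ℝ := fun u => u 3 - maxGen (u 1, u 2) with hf
  have hcoord : ∀ i, ContDiffAt ℝ ∞ (fun u : R4 => u i) v := fun i =>
    (EuclideanSpace.proj i : R4 →L[ℝ] ℝ).contDiff.contDiffAt
  have hfd : ContDiffAt ℝ ∞ f v := (hcoord 3).sub
    (ContDiffAt.comp v (g := maxGen) (f := fun u : R4 => (u 1, u 2)) (maxGen_contDiffAt hs)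
      ((hcoord 1).prodMk (hcoord 2)))
  have hfψ : ContDiffAt ℝ ∞ (fun u => f (ψ u)) 0 :=
    ContDiffAt.comp (0 : R4) (g := f) (by rw [hψ0]; exact hfd) hψd
  have hev : ∀ᶠ u in 𝓝 (0 : R4), OnGraph u → f (ψ u) = 0 := by
    have hψt : Tendsto ψ (𝓝 0) (𝓝 v) := by
      have := hψd.continuousAt.tendsto
      rwa [hψ0] at this
    filter_upwards [Metric.ball_mem_nhds (0 : R4) hr', mem_ball_of_tendsto hψt hv,
      (e'.continuousAt_symm h0').eventually_mem (e.open_source.mem_nhds hs0)] with u a1 a2 a3 hu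
    have h1 : e'.symm u ∈ H := (hg' u a1).mpr hu
    have h2 : e.symm (ψ u) = e'.symm u := e.left_inv a3
    rw [← h2] at h1
    have h3 : OnGraph (ψ u) := (hG.graph _ a2).mp h1
    simp only [hf]
    rw [h3]; ring
  have hz := fderiv_eq_zero_of_onGraph (hfψ.of_le ENat.LEInfty.out) hev
  have hfd' : HasFDerivAt f (fderiv ℝ f v) (ψ 0) := by
    rw [hψ0]; exact (hfd.differentiableAt (by simp)).hasFDerivAt
  have hchain := (hfd'.comp (0 : R4) (hψd.differentiableAt (by simp)).hasFDerivAt).fderiv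
  obtain ⟨d, hd⟩ := fderiv_transition_surjective he'.mem_atlas hG.atlas h0' hs0 (stdVec 3)
  have h1 : fderiv ℝ f v (stdVec 3) = 0 := by
    have := DFunLike.congr_fun (hchain.symm.trans hz) d
    rw [ContinuousLinearMap.comp_apply] at this
    rw [← hd]
    exact this
  have hl : HasDerivAt (fun t : ℝ => f (v + t • stdVec 3)) (fderiv ℝ f v (stdVec 3)) 0 := by
    have h2 : HasDerivAt (fun t : ℝ => v + t • stdVec 3) (stdVec 3) 0 :=
      (((hasDerivAt_id (0 : ℝ)).smul_const (stdVec 3)).const_add v).congr_deriv (by simp)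
    have h3 : HasFDerivAt f (fderiv ℝ f v) (v + (0 : ℝ) • stdVec 3) := by
      rw [zero_smul, add_zero]; exact (hfd.differentiableAt (by simp)).hasFDerivAt
    exact h3.comp_hasDerivAt (0 : ℝ) h2
  have hl' : HasDerivAt (fun t : ℝ => f (v + t • stdVec 3)) 1 0 := by
    have : (fun t : ℝ => f (v + t • stdVec 3)) = fun t => f v + t := by
      funext t; simp [hf]; ring
    rw [this]
    exact (hasDerivAt_id (0 : ℝ)).const_add (f v)
  have := hl.unique hl'
  rw [h1] at this
  norm_num at this

/-- The local structure of the horizon at an `A₃` point. -/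
theorem OrientedGraph.a3LocalStructure [T2Space M] (hG : OrientedGraph S H e r)
    (he : S.IsA3Chart H p e) : A3LocalStructure S H e r where
  ball_subset := hG.target
  horizon v hv := by
    rw [hG.graph v hv, OnGraph, eq_maxGen_iff]
    constructor
    · rintro ⟨a, h1, h2, h3⟩
      exact ⟨a, v 2, h1, h2, rfl, h3⟩
    · rintro ⟨a, q, h1, h2, rfl, h3⟩
      exact ⟨a, h1, h2, h3⟩
  graph := ⟨maxGen, isSwallowtailGraph_maxGen, hG.graph⟩
  a3 v hv := by
    constructor
    · rintro ⟨e', he'⟩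
      have hg : OnGraph v := (hG.graph v hv).mp he'.mem_horizon
      by_cases hs : v 1 = 0 ∧ 0 ≤ v 2
      · rcases hs.2.eq_or_lt with h2 | h2
        · refine ⟨v 0, R4.ext rfl hs.1 h2.symm ?_⟩
          rw [OnGraph, hs.1, ← h2, maxGen_zero] at hg
          exact hg
        -- A crease point has two generators, whereas the centre of any canonical chart has one.
        · exfalso
          obtain ⟨r', hr', hG'⟩ := exists_orientedGraph hG.horizon he'
          have h0 : linePoint 0 = 0 := by rw [linePoint_eq, pt_zero_eq]
          have h1 := (hG'.a3LineGeometry (w := 0) (by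
            rw [h0]; exact Metric.mem_ball_self hr')).one_generator
          rw [h0, symm_zero he', hG.numGenerators_crease hv hg (fun h => h ⟨hs.1, h2⟩)] at h1
          norm_num at h1
      · exact absurd he' (hG.not_isA3Chart_of_smooth hv hs)
    · rintro ⟨w, rfl⟩
      exact ⟨_, isA3Chart_translate he (hG.target hv)
        ((hG.graph _ hv).mpr (OnGraph.linePoint w))⟩
  crease v hv := (hG.mem_creaseSet_iff hv).trans (onGraph_crease_iff v)
  two_generators v hv h := by
    obtain ⟨hg, hoff⟩ := (hG.mem_creaseSet_iff hv).mp h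
    exact hG.numGenerators_crease hv hg hoff
  crease_immersed := ⟨contDiff_creaseParam, finrank_creasePlane⟩
  line _ hw := hG.a3LineGeometry hw

end Caustic
end

noncomputable section
namespace Caustic

set_option linter.unusedSectionVars false

/-! ### Nondegenerate minima of functions of one variable -/

/-- The inverse of a function that increases from the value `0` at `0`. -/
lemma exists_right_branch {g : ℝ → ℝ} {ε b : ℝ} (hε : 0 < ε) (hc : ContinuousOn g (Icc 0 ε))
    (hm : StrictMonoOn g (Icc 0 ε)) (hg0 : g 0 = 0)
    (hb : Tendsto (fun w => g w / w ^ 2) (𝓝[>] 0) (𝓝 b)) (hb0 : 0 < b) :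
    ∃ W : ℝ → ℝ, (∀ t ∈ Ioo 0 (g ε), W t ∈ Ioo 0 ε ∧ g (W t) = t) ∧
      StrictMonoOn W (Ioo 0 (g ε)) ∧ Tendsto W (𝓝[>] 0) (𝓝 0) ∧
      Tendsto (fun t => W t / √t) (𝓝[>] 0) (𝓝 (1 / √b)) := by
  have h0 : (0 : ℝ) ∈ Icc 0 ε := ⟨le_rfl, hε.le⟩
  have h1 : ε ∈ Icc 0 ε := ⟨hε.le, le_rfl⟩
  have hgε : 0 < g ε := by rw [← hg0]; exact hm h0 h1 hε
  have hex : ∀ t, ∃ w, t ∈ Ioo 0 (g ε) → w ∈ Ioo 0 ε ∧ g w = t := by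
    intro t
    by_cases ht : t ∈ Ioo 0 (g ε)
    · obtain ⟨w, hw, h⟩ := intermediate_value_Ioo hε.le hc (by rw [hg0]; exact ht)
      exact ⟨w, fun _ => ⟨hw, h⟩⟩
    · exact ⟨0, fun h => absurd h ht⟩
  choose W hW using hex
  have hI : ∀ t ∈ Ioo 0 (g ε), W t ∈ Icc 0 ε := fun t ht => Ioo_subset_Icc_self (hW t ht).1
  have hmono : StrictMonoOn W (Ioo 0 (g ε)) := fun t ht t' ht' h => by
    rw [← hm.lt_iff_lt (hI t ht) (hI t' ht'), (hW t ht).2, (hW t' ht').2]; exact h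
  have hlim : Tendsto W (𝓝[>] 0) (𝓝[>] 0) := by
    rw [tendsto_nhdsWithin_iff]
    constructor
    · rw [Metric.tendsto_nhds]
      intro κ hκ
      have hκ' : min κ ε ∈ Icc 0 ε := ⟨by positivity, min_le_right _ _⟩
      have hgκ : 0 < g (min κ ε) := by rw [← hg0]; exact hm h0 hκ' (by positivity)
      filter_upwards [Ioo_mem_nhdsGT hgκ] with t ht
      have htε : t ∈ Ioo 0 (g ε) := ⟨ht.1, ht.2.trans_le (hm.monotoneOn hκ' h1 (min_le_right _ _))⟩
      have h2 : W t < min κ ε := by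
        rw [← hm.lt_iff_lt (hI t htε) hκ', (hW t htε).2]; exact ht.2
      rw [Real.dist_eq, sub_zero, abs_of_pos (hW t htε).1.1]
      exact h2.trans_le (min_le_left _ _)
    · filter_upwards [Ioo_mem_nhdsGT hgε] with t ht using (hW t ht).1.1
  refine ⟨W, hW, hmono, hlim.mono_right nhdsWithin_le_nhds, ?_⟩
  -- Since `g (W t) = t`, this quotient equals `W t / √t`.
  have h2 : Tendsto (fun t => 1 / √(g (W t) / W t ^ 2)) (𝓝[>] 0) (𝓝 (1 / √b)) :=
    tendsto_const_nhds.div ((Real.continuous_sqrt.tendsto b).comp (hb.comp hlim))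
      (Real.sqrt_pos.mpr hb0).ne'
  refine h2.congr' ?_
  filter_upwards [Ioo_mem_nhdsGT hgε] with t ht
  have h3 := (hW t ht).1.1
  rw [(hW t ht).2, Real.sqrt_div' _ (sq_nonneg _), Real.sqrt_sq h3.le, one_div_div]

/-- The two branches of the inverse of `g` near a minimum at `0` with `g(w) = b w² + …`. -/
structure IsQuadraticWell (g : ℝ → ℝ) (b ε δ : ℝ) (wm wp : ℝ → ℝ) : Prop where
  zero : g 0 = 0
  pos : ∀ w ∈ Ioo (-ε) ε, w ≠ 0 → 0 < g w
  mem : ∀ t ∈ Ioo 0 δ, wm t ∈ Ioo (-ε) 0 ∧ wp t ∈ Ioo 0 ε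
  eq_iff : ∀ t ∈ Ioo 0 δ, ∀ w ∈ Ioo (-ε) ε, g w = t ↔ w = wm t ∨ w = wp t
  lt_iff : ∀ t ∈ Ioo 0 δ, ∀ w ∈ Ioo (-ε) ε, g w < t ↔ w ∈ Ioo (wm t) (wp t)
  anti : StrictAntiOn wm (Ioo 0 δ)
  mono : StrictMonoOn wp (Ioo 0 δ)
  tendsto_left : Tendsto wm (𝓝[>] 0) (𝓝 0)
  tendsto_right : Tendsto wp (𝓝[>] 0) (𝓝 0)
  rate_left : Tendsto (fun t => wm t / √t) (𝓝[>] 0) (𝓝 (-(1 / √b)))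
  rate_right : Tendsto (fun t => wp t / √t) (𝓝[>] 0) (𝓝 (1 / √b))

lemma IsQuadraticWell.restrict {g : ℝ → ℝ} {b ε δ δ' : ℝ} {wm wp : ℝ → ℝ}
    (h : IsQuadraticWell g b ε δ wm wp) (hle : δ' ≤ δ) : IsQuadraticWell g b ε δ' wm wp := by
  have hsub : Ioo 0 δ' ⊆ Ioo 0 δ := Ioo_subset_Ioo_right hle
  exact ⟨h.zero, h.pos, fun t ht => h.mem t (hsub ht), fun t ht => h.eq_iff t (hsub ht),
    fun t ht => h.lt_iff t (hsub ht), h.anti.mono hsub, h.mono.mono hsub, h.tendsto_left,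
    h.tendsto_right, h.rate_left, h.rate_right⟩

/-- The behaviour of a function near a critical point with positive second derivative. -/
lemma second_order_min {g : ℝ → ℝ} {b : ℝ} (hg : ContDiffAt ℝ 2 g 0) (hg0 : g 0 = 0)
    (hd0 : deriv g 0 = 0) (hb : deriv (deriv g) 0 = 2 * b) (hb0 : 0 < b) :
    (∀ᶠ ε in 𝓝[>] (0 : ℝ), ContinuousOn g (Icc (-ε) ε) ∧ StrictMonoOn g (Icc 0 ε) ∧
      StrictAntiOn g (Icc (-ε) 0)) ∧ Tendsto (fun w => g w / w ^ 2) (𝓝[≠] 0) (𝓝 b) := by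
  have hdiff : ∀ᶠ w in 𝓝 (0 : ℝ), DifferentiableAt ℝ g w :=
    (hg.eventually (by simp)).mono fun w hw => hw.differentiableAt (by simp)
  have h2 : deriv g = fun t => fderiv ℝ g t 1 := by
    funext t; exact (fderiv_apply_one_eq_deriv).symm
  have hdd : HasDerivAt (deriv g) (2 * b) 0 := by
    rw [← hb, hasDerivAt_deriv_iff, h2]
    exact ((hg.fderiv_right (m := 1) (by norm_num)).clm_apply contDiffAt_const).differentiableAt
      (by simp)
  have hslope : Tendsto (fun w => deriv g w / w) (𝓝[≠] 0) (𝓝 (2 * b)) := by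
    refine hdd.tendsto_slope.congr fun w => ?_
    rw [slope_def_field, hd0, sub_zero, sub_zero]
  constructor
  · have hev : ∀ᶠ w in 𝓝 (0 : ℝ), w ≠ 0 → 0 < deriv g w / w :=
      eventually_nhdsWithin_iff.mp (hslope.eventually (lt_mem_nhds (by linarith)))
    obtain ⟨ε₀, hε₀, hball⟩ := Metric.eventually_nhds_iff_ball.mp (hdiff.and hev)
    rw [Real.ball_eq_Ioo, zero_sub, zero_add] at hball
    filter_upwards [Ioo_mem_nhdsGT hε₀] with ε hε
    have hc : ContinuousOn g (Icc (-ε) ε) := fun w hw =>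
      (hball w ⟨by linarith [hw.1, hε.2], by linarith [hw.2, hε.2]⟩).1.continuousAt.continuousWithinAt
    refine ⟨hc, strictMonoOn_of_deriv_pos (convex_Icc _ _)
      (hc.mono (Icc_subset_Icc_left (by linarith [hε.1]))) fun w hw => ?_,
      strictAntiOn_of_deriv_neg (convex_Icc _ _)
      (hc.mono (Icc_subset_Icc_right (by linarith [hε.1]))) fun w hw => ?_⟩
    · rw [interior_Icc] at hw
      have := (hball w ⟨by linarith [hw.1, hε.1], by linarith [hw.2, hε.2]⟩).2 hw.1.ne'
      exact (div_pos_iff_of_pos_right hw.1).mp this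
    · rw [interior_Icc] at hw
      have := (hball w ⟨by linarith [hw.1, hε.2], by linarith [hw.2, hε.1, hε.2]⟩).2 hw.2.ne
      rcases div_pos_iff.mp this with h | h
      · linarith [h.2, hw.2]
      · exact h.1
  -- One application of l'Hôpital's rule: `g'(w) / (2w)` tends to half of the second derivative
  -- `2b`.
  · refine deriv.lhopital_zero_nhdsNE (hdiff.filter_mono nhdsWithin_le_nhds) ?_ ?_ ?_ ?_
    · filter_upwards [self_mem_nhdsWithin] with w hw
      have hw : w ≠ 0 := hw
      simp [hw]
    · have := hg.continuousAt.tendsto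
      rw [hg0] at this
      exact this.mono_left nhdsWithin_le_nhds
    · have : Tendsto (fun w : ℝ => w ^ 2) (𝓝 0) (𝓝 (0 ^ 2)) := (continuous_pow 2).tendsto 0
      rw [zero_pow two_ne_zero] at this
      exact this.mono_left nhdsWithin_le_nhds
    · have h3 : Tendsto (fun w => deriv g w / w / 2) (𝓝[≠] 0) (𝓝 (2 * b / 2)) := hslope.div_const 2
      rw [mul_div_cancel_left₀ _ two_ne_zero] at h3
      refine h3.congr fun w => ?_
      rw [div_div, mul_comm w 2]
      simp

/-- The derivative has the sign of `w`, so `g` decreases and then increases. The right branch is the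
inverse of `g`, the left one comes from `w ↦ g(-w)`, and `δ` is the smaller of the two boundary
values. -/
lemma exists_isQuadraticWell {g : ℝ → ℝ} {b : ℝ} (hg : ContDiffAt ℝ 2 g 0) (hg0 : g 0 = 0)
    (hd0 : deriv g 0 = 0) (hb : deriv (deriv g) 0 = 2 * b) (hb0 : 0 < b) :
    ∀ᶠ ε in 𝓝[>] (0 : ℝ), ∃ δ > 0, ∃ wm wp, IsQuadraticWell g b ε δ wm wp := by
  obtain ⟨hev, hlim⟩ := second_order_min hg hg0 hd0 hb hb0
  filter_upwards [hev, self_mem_nhdsWithin] with ε ⟨hc, hmono, hanti⟩ hε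
  have hε : 0 < ε := hε
  have h0p : (0 : ℝ) ∈ Icc 0 ε := ⟨le_rfl, hε.le⟩
  have h0m : (0 : ℝ) ∈ Icc (-ε) 0 := ⟨by linarith, le_rfl⟩
  obtain ⟨W, hW, hWm, hWl, hWr⟩ := exists_right_branch hε
    (hc.mono (Icc_subset_Icc_left (by linarith))) hmono hg0
    (hlim.mono_left (nhdsWithin_mono _ fun w (hw : 0 < w) => hw.ne')) hb0
  have hmem : ∀ w ∈ Icc 0 ε, -w ∈ Icc (-ε) 0 := fun w hw => ⟨by linarith [hw.2], by linarith [hw.1]⟩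
  have hneg : Tendsto (fun w : ℝ => -w) (𝓝[>] 0) (𝓝[≠] 0) := by
    have := tendsto_neg_nhdsGT (a := (0 : ℝ))
    rw [neg_zero] at this
    exact this.mono_right (nhdsWithin_mono _ fun w (hw : w < 0) => hw.ne)
  obtain ⟨V, hV, hVm, hVl, hVr⟩ := exists_right_branch (g := fun w => g (-w)) hε
    (hc.comp continuousOn_neg fun w hw => ⟨by linarith [hw.2], by linarith [hw.1]⟩)
    (fun w hw w' hw' h => hanti (hmem w' hw') (hmem w hw) (by linarith)) (by simpa using hg0)
    ((hlim.comp hneg).congr fun w => by simp) hb0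
  have hgp : 0 < g ε := by rw [← hg0]; exact hmono h0p ⟨hε.le, le_rfl⟩ hε
  have hgm : 0 < g (-ε) := by rw [← hg0]; exact hanti ⟨le_rfl, by linarith⟩ h0m (by linarith)
  have sub1 : ∀ t ∈ Ioo 0 (min (g ε) (g (-ε))), t ∈ Ioo 0 (g ε) := fun t ht =>
    ⟨ht.1, ht.2.trans_le (min_le_left _ _)⟩
  have sub2 : ∀ t ∈ Ioo 0 (min (g ε) (g (-ε))), t ∈ Ioo 0 (g (-ε)) := fun t ht =>
    ⟨ht.1, ht.2.trans_le (min_le_right _ _)⟩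
  refine ⟨min (g ε) (g (-ε)), lt_min hgp hgm, fun t => -V t, W, hg0, fun w hw hw0 => ?_,
    fun t ht => ?_, fun t ht w hw => ?_, fun t ht w hw => ?_, fun t ht t' ht' h => ?_,
    fun t ht t' ht' h => hWm (sub1 t ht) (sub1 t' ht') h, by simpa using hVl.neg, hWl, ?_, hWr⟩
  · rw [← hg0]
    rcases lt_or_gt_of_ne hw0 with h | h
    · exact hanti ⟨hw.1.le, h.le⟩ h0m h
    · exact hmono h0p ⟨h.le, hw.2.le⟩ h
  · have h1 := (hV t (sub2 t ht)).1
    exact ⟨⟨by linarith [h1.2], by linarith [h1.1]⟩, (hW t (sub1 t ht)).1⟩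
  · obtain ⟨h1, h2⟩ := hV t (sub2 t ht)
    obtain ⟨h3, h4⟩ := hW t (sub1 t ht)
    constructor
    · intro h
      rcases le_or_gt w 0 with hw0 | hw0
      · left
        exact hanti.injOn ⟨hw.1.le, hw0⟩ (hmem _ (Ioo_subset_Icc_self h1)) (h.trans h2.symm)
      · right
        exact hmono.injOn ⟨hw0.le, hw.2.le⟩ (Ioo_subset_Icc_self h3) (h.trans h4.symm)
    · rintro (rfl | rfl)
      exacts [h2, h4]
  · obtain ⟨h1, h2⟩ := hV t (sub2 t ht)
    obtain ⟨h3, h4⟩ := hW t (sub1 t ht)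
    rcases le_or_gt w 0 with hw0 | hw0
    · have h5 : g w < g (-V t) ↔ -V t < w :=
        StrictAntiOn.lt_iff_gt hanti ⟨hw.1.le, hw0⟩ (hmem _ (Ioo_subset_Icc_self h1))
      rw [h2] at h5
      rw [h5]
      exact ⟨fun h => ⟨h, by linarith [h3.1]⟩, fun h => h.1⟩
    · have h5 : g w < g (W t) ↔ w < W t := StrictMonoOn.lt_iff_lt hmono ⟨hw0.le, hw.2.le⟩ (Ioo_subset_Icc_self h3)
      rw [h4] at h5
      rw [h5]
      exact ⟨fun h => ⟨by linarith [h1.1], h⟩, fun h => h.2⟩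
  · have := hVm (sub2 t ht) (sub2 t' ht') h
    exact neg_lt_neg this
  · exact hVr.neg.congr fun t => by rw [neg_div]

end Caustic
end

noncomputable section
namespace Caustic

set_option linter.unusedSectionVars false

/-! ### Local diffeomorphisms and implicit functions -/

lemma exists_equiv_of_injective {E : Type*} [NormedAddCommGroup E] [NormedSpace ℝ E]
    [FiniteDimensional ℝ E] (L : E →L[ℝ] E) (hL : Function.Injective L) :
    ∃ L' : E ≃L[ℝ] E, (L' : E →L[ℝ] E) = L :=
  ⟨(LinearEquiv.ofInjectiveEndo (L : E →ₗ[ℝ] E) hL).toContinuousLinearEquiv, by ext; rfl⟩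

/-- The derivative is invertible in a whole neighbourhood, so after shrinking the source the inverse
is smooth at every point of the target, not only at the image of `x`. This is what a change of chart
requires. -/
lemma exists_local_diffeo {E : Type*} [NormedAddCommGroup E] [NormedSpace ℝ E]
    [FiniteDimensional ℝ E] {Φ : E → E} {x : E}
    (h : ∀ᶠ y in 𝓝 x, ContDiffAt ℝ ∞ Φ y ∧ Function.Injective (fderiv ℝ Φ y)) :
    ∃ φ : OpenPartialHomeomorph E E, x ∈ φ.source ∧ (∀ y, φ y = Φ y) ∧
      ContDiffOn ℝ ∞ φ φ.source ∧ ContDiffOn ℝ ∞ φ.symm φ.target := by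
  have : CompleteSpace E := FiniteDimensional.complete ℝ E
  obtain ⟨N, hN, hNo, hxN⟩ := eventually_nhds_iff.mp h
  have hder : ∀ y ∈ N, ∃ L' : E ≃L[ℝ] E, HasFDerivAt Φ (L' : E →L[ℝ] E) y := fun y hy => by
    obtain ⟨L', hL'⟩ := exists_equiv_of_injective _ (hN y hy).2
    exact ⟨L', by rw [hL']; exact ((hN y hy).1.differentiableAt (by simp)).hasFDerivAt⟩
  obtain ⟨L', hL'⟩ := hder x hxN
  set φ₀ := (hN x hxN).1.toOpenPartialHomeomorph Φ hL' (by simp) with hφ₀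
  set φ := φ₀.restrOpen N hNo with hφ
  have hcoe : ∀ y, φ y = Φ y := fun y => rfl
  have hfun : (φ : E → E) = Φ := rfl
  have hsrc : φ.source = φ₀.source ∩ N := rfl
  refine ⟨φ, ?_, hcoe, fun y hy => ?_, fun y hy => ?_⟩
  · rw [hsrc]
    exact ⟨(hN x hxN).1.mem_toOpenPartialHomeomorph_source hL' (by simp), hxN⟩
  · rw [hfun]
    exact (hN y (hsrc ▸ hy).2).1.contDiffWithinAt
  · have hy' : φ.symm y ∈ N := by
      have := φ.map_target hy
      rw [hsrc] at this
      exact this.2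
    obtain ⟨L₁, hL₁⟩ := hder _ hy'
    exact (φ.contDiffAt_symm hy (by rw [hfun]; exact hL₁)
      (by rw [hfun]; exact (hN _ hy').1)).contDiffWithinAt

/-- The implicit function theorem for a function of two variables that decreases in the
second one. -/
lemma exists_implicit {F : ℝ × ℝ → ℝ} (hF : ∀ᶠ s in 𝓝 (0, 0), ContDiffAt ℝ ∞ F s)
    (hF0 : F (0, 0) = 0) (hy : fderiv ℝ F (0, 0) (0, 1) < 0) :
    ∃ Y : ℝ → ℝ → ℝ, ∀ᶠ η in 𝓝[>] (0 : ℝ), ∀ᶠ κ in 𝓝[>] (0 : ℝ),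
      ContDiffOn ℝ ∞ (fun s : ℝ × ℝ => Y s.1 s.2) (Ioo (-κ) κ ×ˢ Ioo (-κ) κ) ∧
      ∀ t ∈ Ioo (-κ) κ, ∀ w ∈ Ioo (-κ) κ, Y t w ∈ Ioo (-η) η ∧
        (∀ y ∈ Ioo (-η) η, F (w, y) = t ↔ y = Y t w) ∧ (0 < Y t w ↔ t < F (w, 0)) := by
  have hneg : ∀ᶠ s in 𝓝 ((0 : ℝ), (0 : ℝ)), fderiv ℝ F s (0, 1) < 0 := by
    have h1 : ContinuousAt (fderiv ℝ F) (0, 0) :=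
      (hF.self_of_nhds.fderiv_right (m := 0) (by simp)).continuousAt
    exact (h1.clm_apply continuousAt_const).eventually (gt_mem_nhds hy)
  -- This map exchanges the coordinates `(w, y)` for `(t, w)` with `t = F(w, y)`; the solution `Y`
  -- is the second component of its inverse.
  set Φ : ℝ × ℝ → ℝ × ℝ := fun s => (F s, s.1) with hΦ
  have hΦd : ∀ s, ContDiffAt ℝ ∞ F s → fderiv ℝ F s (0, 1) < 0 →
      ContDiffAt ℝ ∞ Φ s ∧ Function.Injective (fderiv ℝ Φ s) := by
    intro s h1 h2
    refine ⟨h1.prodMk contDiffAt_fst, ?_⟩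
    have h3 : fderiv ℝ Φ s = (fderiv ℝ F s).prod (ContinuousLinearMap.fst ℝ ℝ ℝ) :=
      ((h1.differentiableAt (by simp)).hasFDerivAt.prodMk hasFDerivAt_fst).fderiv
    rw [h3, injective_iff_map_eq_zero]
    rintro ⟨a, b⟩ hab
    have e2 : a = 0 := congrArg Prod.snd hab
    have e1 : fderiv ℝ F s (a, b) = 0 := congrArg Prod.fst hab
    subst e2
    have e3 : ((0 : ℝ), b) = b • ((0 : ℝ), (1 : ℝ)) := by simp
    rw [e3, map_smul, smul_eq_mul] at e1
    have := (mul_eq_zero.mp e1).resolve_right h2.ne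
    rw [this]; rfl
  obtain ⟨φ, hφ0, hφ, -, hφs⟩ := exists_local_diffeo (Φ := Φ) (x := (0, 0))
    ((hF.and hneg).mono fun s hs => hΦd s hs.1 hs.2)
  have hφ00 : φ (0, 0) = (0, 0) := by rw [hφ, hΦ]; simp only [hF0]
  have hsymm0 : φ.symm (0, 0) = (0, 0) := by rw [← hφ00, φ.left_inv hφ0, hφ00]
  have h0t : ((0 : ℝ), (0 : ℝ)) ∈ φ.target := by rw [← hφ00]; exact φ.map_source hφ0
  refine ⟨fun t w => (φ.symm (t, w)).2, ?_⟩
  obtain ⟨η₀, hη₀, hbox⟩ := Metric.eventually_nhds_iff_ball.mp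
    ((hF.and hneg).and (φ.open_source.eventually_mem hφ0))
  have hboxm : ∀ a b : ℝ, a ∈ Ioo (-η₀) η₀ → b ∈ Ioo (-η₀) η₀ →
      (a, b) ∈ Metric.ball ((0 : ℝ), (0 : ℝ)) η₀ := fun a b ha hb => by
    rw [← ball_prod_same, Real.ball_eq_Ioo, zero_sub, zero_add]; exact ⟨ha, hb⟩
  filter_upwards [Ioo_mem_nhdsGT hη₀] with η hη
  have hcs := (φ.continuousAt_symm h0t)
  have hev : ∀ᶠ s in 𝓝 ((0 : ℝ), (0 : ℝ)), φ.symm s ∈ Metric.ball ((0 : ℝ), (0 : ℝ)) η ∧ s ∈ φ.target :=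
    (hcs.eventually_mem (by rw [hsymm0]; exact Metric.ball_mem_nhds _ hη.1)).and
      (φ.open_target.eventually_mem h0t)
  obtain ⟨κ₀, hκ₀, hb⟩ := Metric.eventually_nhds_iff_ball.mp hev
  filter_upwards [Ioo_mem_nhdsGT (lt_min hκ₀ hη.1)] with κ hκ
  have hκ1 : κ < κ₀ := hκ.2.trans_le (min_le_left _ _)
  have hκ2 : κ < η := hκ.2.trans_le (min_le_right _ _)
  have hin : ∀ t ∈ Ioo (-κ) κ, ∀ w ∈ Ioo (-κ) κ, (t, w) ∈ Metric.ball ((0 : ℝ), (0 : ℝ)) κ₀ := by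
    intro t ht w hw
    rw [← ball_prod_same, Real.ball_eq_Ioo, zero_sub, zero_add]
    exact ⟨⟨by linarith [ht.1], by linarith [ht.2]⟩, ⟨by linarith [hw.1], by linarith [hw.2]⟩⟩
  refine ⟨(contDiff_snd.comp_contDiffOn hφs).mono fun s hs => (hb s (hin _ hs.1 _ hs.2)).2,
    fun t ht w hw => ?_⟩
  obtain ⟨h1, h2⟩ := hb _ (hin t ht w hw)
  have h3 := φ.right_inv h2
  rw [hφ, hΦ] at h3
  have h4 : (φ.symm (t, w)).1 = w := congrArg Prod.snd h3
  have h5 : F (φ.symm (t, w)) = t := congrArg Prod.fst h3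
  rw [← ball_prod_same, Real.ball_eq_Ioo, zero_sub, zero_add] at h1
  set y₀ := (φ.symm (t, w)).2 with hy₀
  have h6 : φ.symm (t, w) = (w, y₀) := Prod.ext h4 rfl
  rw [h6] at h5
  have hwη : w ∈ Ioo (-η₀) η₀ := ⟨by linarith [hw.1, hη.2], by linarith [hw.2, hη.2]⟩
  have hyη : ∀ y ∈ Ioo (-η) η, y ∈ Ioo (-η₀) η₀ := fun y hy =>
    ⟨by linarith [hy.1, hη.2], by linarith [hy.2, hη.2]⟩
  refine ⟨h1.2, fun y hy => ⟨fun h => ?_, fun h => by rw [h]; exact h5⟩, ?_⟩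
  · have h7 := φ.left_inv (hbox _ (hboxm w y hwη (hyη y hy))).2
    rw [hφ, hΦ] at h7
    simp only [h] at h7
    rw [hy₀, h7]
  · have hder : ∀ y ∈ Ioo (-η) η, HasDerivAt (fun y => F (w, y)) (fderiv ℝ F (w, y) (0, 1)) y := by
      intro y hy
      have hFd := ((hbox _ (hboxm w y hwη (hyη y hy))).1.1.differentiableAt (by simp)).hasFDerivAt
      exact hFd.comp_hasDerivAt y ((hasDerivAt_const y w).prodMk (hasDerivAt_id y))
    -- `F` decreases in `y` and has the value `t` at `Y t w`, so `Y t w` is positive exactly when `t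
    -- < F(w, 0)`.
    have hanti : StrictAntiOn (fun y => F (w, y)) (Ioo (-η) η) := by
      refine strictAntiOn_of_deriv_neg (convex_Ioo _ _)
        (fun y hy => (hder y hy).continuousAt.continuousWithinAt) fun y hy => ?_
      rw [interior_Ioo] at hy
      rw [(hder y hy).deriv]
      exact (hbox _ (hboxm w y hwη (hyη y hy))).1.2
    have := hanti.lt_iff_gt (a := y₀) (b := 0) h1.2 ⟨by linarith [hη.1], hη.1⟩
    simp only [h5] at this
    exact this.symm

end Caustic
end

noncomputable section
namespace Caustic

set_option linter.unusedSectionVars false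

/-! ### Time functions -/

variable {M : Type*} [TopologicalSpace M] [ChartedSpace R4 M] [IsManifold (𝓡 4) ∞ M]
variable {S : Spacetime M} {H : Set M} {e : OpenPartialHomeomorph M R4} {p : M} {r : ℝ} {τ : M → ℝ}

lemma contDiffAt_coordFun (hτ : S.IsTimeFunction τ) (he : e ∈ IsManifold.maximalAtlas (𝓡 4) ∞ M)
    {u : R4} (hu : u ∈ e.target) : ContDiffAt ℝ ∞ (fun v => τ (e.symm v)) u := by
  have h := hτ.1.comp_contMDiffOn (contMDiffOn_symm_of_mem_maximalAtlas he)
  exact (contMDiffOn_iff_contDiffOn.mp h).contDiffAt (e.open_target.mem_nhds hu)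

/-- A time function increases along future-directed null vectors. -/
lemma fderiv_pos_of_future_null (hτ : S.IsTimeFunction τ)
    (he : e ∈ IsManifold.maximalAtlas (𝓡 4) ∞ M) {u k : R4} (hu : u ∈ e.target)
    (hk : S.IsFutureNull (coordTangent e u k)) : 0 < fderiv ℝ (fun v => τ (e.symm v)) u k := by
  obtain ⟨n, hn, hn1, hn2⟩ := hτ.2 (e.symm u)
  have hL : IsLorentz (S.metric (e.symm u)) := ⟨S.symm _, S.lorentzian _⟩
  have h1 := hL.neg_of_future_causal (S.future_timelike _) hn1 hn2 hk.1.le hk.2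
  rw [map_neg, LinearMap.neg_apply, hn] at h1
  have h2 : mfderiv (𝓡 4) 𝓘(ℝ, ℝ) (τ ∘ e.symm) u
      = (mfderiv (𝓡 4) 𝓘(ℝ, ℝ) τ (e.symm u)).comp (mfderiv (𝓡 4) (𝓡 4) e.symm u) :=
    mfderiv_comp u (hτ.1.mdifferentiableAt (by simp))
      ((mdifferentiable_of_mem_maximalAtlas he).mdifferentiableAt_symm hu)
  rw [mfderiv_eq_fderiv] at h2
  have h3 : fderiv ℝ (fun v => τ (e.symm v)) u k
      = mfderiv (𝓡 4) 𝓘(ℝ, ℝ) τ (e.symm u) (coordTangent e u k) := DFunLike.congr_fun h2 k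
  rw [h3]
  exact neg_neg_iff_pos.mp h1

lemma creaseParam_zero_right (w : ℝ) : creaseParam (w, 0) = linePoint w := by
  rw [creaseParam_eq, linePoint_eq]; norm_num

lemma creaseParam_zero : creaseParam (0, 0) = 0 := by
  rw [creaseParam_zero_right, linePoint_eq, pt_zero_eq]

lemma hasDerivAt_coordFun_line (hτ : S.IsTimeFunction τ)
    (he : e ∈ IsManifold.maximalAtlas (𝓡 4) ∞ M) {w : ℝ} (hw : linePoint w ∈ e.target) :
    HasDerivAt (fun w => τ (e.symm (linePoint w)))
      (fderiv ℝ (fun v => τ (e.symm v)) (linePoint w) (stdVec 0)) w := by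
  have h1 : HasDerivAt linePoint (stdVec 0) w := by
    have : linePoint = fun w : ℝ => w • stdVec 0 := by
      funext w; apply R4.ext <;> simp [linePoint_eq]
    rw [this]
    exact ((hasDerivAt_id w).smul_const (stdVec 0)).congr_deriv (one_smul _ _)
  exact ((contDiffAt_coordFun hτ he hw).differentiableAt (by simp)).hasFDerivAt.comp_hasDerivAt w h1

/-- If a time function has nonzero derivative along the `A₃` line then it can be taken as the
coordinate along this line. -/
theorem exists_adapted_chart (he : S.IsA3Chart H p e) (hτ : S.IsTimeFunction τ) (hp : τ p = 0)
    (hd : deriv (fun w => τ (e.symm (linePoint w))) 0 ≠ 0) :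
    ∃ e' : OpenPartialHomeomorph M R4, S.IsA3Chart H p e' ∧ ∀ v ∈ e'.target, τ (e'.symm v) = v 0 := by
  set f : R4 → ℝ := fun v => τ (e.symm v) with hf
  have h0 := zero_mem_target he
  have hl0 : linePoint 0 = 0 := pt_zero_eq
  rw [(hasDerivAt_coordFun_line hτ he.mem_atlas (by rw [hl0]; exact h0)).deriv, hl0] at hd
  have hfd : ∀ v ∈ e.target, ContDiffAt ℝ ∞ f v := fun v hv => contDiffAt_coordFun hτ he.mem_atlas hv
  have hcoord : ∀ (i : Fin 4) (v : R4), ContDiffAt ℝ ∞ (fun u : R4 => u i) v := fun i v =>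
    (EuclideanSpace.proj i : R4 →L[ℝ] ℝ).contDiff.contDiffAt
  -- Only the coordinate `w` is replaced, by the time function. The equation of the wavefront does
  -- not contain `w`, so the chart remains canonical.
  set Φ : R4 → R4 := fun v => pt (f v) (v 1) (v 2) (v 3) with hΦ
  have hev : ∀ᶠ v in 𝓝 (0 : R4), ContDiffAt ℝ ∞ Φ v ∧ Function.Injective (fderiv ℝ Φ v) := by
    have hc : ContinuousAt (fderiv ℝ f) 0 := ((hfd 0 h0).fderiv_right (m := 0) (by simp)).continuousAt
    filter_upwards [e.open_target.mem_nhds h0,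
      (hc.clm_apply (continuousAt_const (y := stdVec 0))).eventually_ne hd] with v hv hne
    have hΦd : ContDiffAt ℝ ∞ Φ v := contDiffAt_pt (hfd v hv) (hcoord 1 v) (hcoord 2 v) (hcoord 3 v)
    refine ⟨hΦd, (injective_iff_map_eq_zero _).mpr fun d hd0 => ?_⟩
    have hΦf := (hΦd.differentiableAt (by simp)).hasFDerivAt
    have hcomp : ∀ (i : Fin 4) {L : R4 →L[ℝ] ℝ}, HasFDerivAt (fun u => Φ u i) L v → L d = 0 := by
      intro i L hL
      have h1 : HasFDerivAt (fun u => Φ u i)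
          ((EuclideanSpace.proj i : R4 →L[ℝ] ℝ).comp (fderiv ℝ Φ v)) v :=
        (EuclideanSpace.proj i : R4 →L[ℝ] ℝ).hasFDerivAt.comp v hΦf
      rw [hL.unique h1, ContinuousLinearMap.comp_apply, hd0, map_zero]
    have d1 : d 1 = 0 := hcomp 1 (EuclideanSpace.proj 1 : R4 →L[ℝ] ℝ).hasFDerivAt
    have d2 : d 2 = 0 := hcomp 2 (EuclideanSpace.proj 2 : R4 →L[ℝ] ℝ).hasFDerivAt
    have d3 : d 3 = 0 := hcomp 3 (EuclideanSpace.proj 3 : R4 →L[ℝ] ℝ).hasFDerivAt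
    have d0 : fderiv ℝ f v d = 0 := hcomp 0 ((hfd v hv).differentiableAt (by simp)).hasFDerivAt
    have hd' : d = d 0 • stdVec 0 := by apply R4.ext <;> simp [d1, d2, d3]
    rw [hd', map_smul, smul_eq_mul] at d0
    have h00 := (mul_eq_zero.mp d0).resolve_right hne
    rw [hd', h00, zero_smul]
  obtain ⟨φ, hφ0, hφ, hφ1, hφ2⟩ := exists_local_diffeo hev
  have htgt : ∀ v ∈ (e.trans φ).target, v ∈ φ.target ∧ φ.symm v ∈ e.target := fun v hv => by
    rw [OpenPartialHomeomorph.trans_target] at hv; exact hv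
  have hinv : ∀ v ∈ (e.trans φ).target, Φ (φ.symm v) = v := fun v hv => by
    rw [← hφ, φ.right_inv (htgt v hv).1]
  refine ⟨e.trans φ, ⟨trans_mem_maximalAtlas he.mem_atlas hφ1 hφ2, he.mem_horizon, ?_, ?_,
    fun v hv => ?_⟩, fun v hv => ?_⟩
  · rw [OpenPartialHomeomorph.trans_source]
    exact ⟨he.mem_source, by rw [mem_preimage, he.map_zero]; exact hφ0⟩
  · simp only [OpenPartialHomeomorph.coe_trans, Function.comp, he.map_zero, hφ, hΦ, hf,
      symm_zero he, hp]
    exact pt_zero_eq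
  · have h1 := he.wavefront _ (htgt v hv).2
    have h2 := hinv v hv
    rw [OpenPartialHomeomorph.coe_trans_symm, Function.comp, h1]
    obtain ⟨-, c1, c2, c3⟩ := R4.ext_iff.mp h2
    rw [← c1, ← c2, ← c3]
    rfl
  · have h2 := hinv v hv
    exact congrArg (fun u : R4 => u 0) h2

/-- A time function that is stationary along the `A₃` line decreases along the crease. -/
lemma fderiv_stdVec_two_neg (hA : A3LocalStructure S H e r) (hr : 0 < r)
    (he : e ∈ IsManifold.maximalAtlas (𝓡 4) ∞ M) (hτ : S.IsTimeFunction τ)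
    (hd : deriv (fun w => τ (e.symm (linePoint w))) 0 = 0) :
    fderiv ℝ (fun v => τ (e.symm v)) 0 (stdVec 2) < 0 := by
  have hl0 : linePoint 0 = 0 := pt_zero_eq
  have hb : linePoint 0 ∈ Metric.ball (0 : R4) r := by rw [hl0]; exact Metric.mem_ball_self hr
  have hL := hA.line 0 hb
  rw [(hasDerivAt_coordFun_line hτ he (hA.ball_subset hb)).deriv] at hd
  have h1 := fderiv_pos_of_future_null hτ he (hA.ball_subset hb) hL.future_null
  -- As `g^{zz} = g^{xz} = 0`, the future null direction has only `w` and `y` components. The time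
  -- function increases along it and is stationary in `w`, and the `y` component `-g^{yz}` is
  -- negative.
  have h2 : -S.dzUp e (linePoint 0) = (-S.gUp e (linePoint 0) 0 3) • stdVec 0
      + (-S.gUp e (linePoint 0) 2 3) • stdVec 2 := by
    apply R4.ext <;> simp [Spacetime.dzUp, hL.gzz, hL.gxz]
  rw [h2, map_add, map_smul, map_smul, hd, smul_zero, zero_add, smul_eq_mul, hl0] at h1
  have h3 := hL.gyz_pos
  rw [hl0] at h3
  nlinarith

lemma contDiffAt_coordFun_crease (hτ : S.IsTimeFunction τ)
    (he : e ∈ IsManifold.maximalAtlas (𝓡 4) ∞ M) {s : ℝ × ℝ} (hs : creaseParam s ∈ e.target) :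
    ContDiffAt ℝ ∞ (fun s => τ (e.symm (creaseParam s))) s :=
  (contDiffAt_coordFun hτ he hs).comp s contDiff_creaseParam.contDiffAt

/-- The height `y²/4` contributes nothing to first order at the origin, and the derivative along the
line vanishes by assumption. -/
lemma fderiv_coordFun_crease (hτ : S.IsTimeFunction τ) (he : S.IsA3Chart H p e)
    (hd : deriv (fun w => τ (e.symm (linePoint w))) 0 = 0) (d : ℝ × ℝ) :
    fderiv ℝ (fun s => τ (e.symm (creaseParam s))) (0, 0) d
      = d.2 * fderiv ℝ (fun v => τ (e.symm v)) 0 (stdVec 2) := by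
  have h0 := zero_mem_target he
  have hl0 : linePoint 0 = 0 := pt_zero_eq
  rw [(hasDerivAt_coordFun_line hτ he.mem_atlas (by rw [hl0]; exact h0)).deriv, hl0] at hd
  have h1 : HasFDerivAt (fun v => τ (e.symm v)) (fderiv ℝ (fun v => τ (e.symm v)) 0)
      (creaseParam (0, 0)) := by
    rw [creaseParam_zero]
    exact ((contDiffAt_coordFun hτ he.mem_atlas h0).differentiableAt (by simp)).hasFDerivAt
  have h2 := (h1.comp (0, 0)
    (contDiff_creaseParam.contDiffAt.differentiableAt (by simp)).hasFDerivAt).fderiv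
  have h3 : creaseVec 0 = stdVec 2 := by apply R4.ext <;> simp [creaseVec]
  have h4 := DFunLike.congr_fun h2 d
  rw [ContinuousLinearMap.comp_apply, creasePlane_fderiv_apply, map_add, map_smul, map_smul, hd,
    h3, smul_zero, zero_add, smul_eq_mul] at h4
  exact h4

/-- Near a point where a time function is stationary along the `A₃` line the crease, away from
this line, is in the past. -/
theorem neg_on_crease (hA : A3LocalStructure S H e r) (hr : 0 < r) (he : S.IsA3Chart H p e)
    (hτ : S.IsTimeFunction τ) (hp : τ p = 0)
    (hd : deriv (fun w => τ (e.symm (linePoint w))) 0 = 0) {K : ℝ} (hK : 0 < K) :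
    ∃ ρ > 0, ∀ v ∈ Metric.ball (0 : R4) ρ,
      e.symm v ∈ S.creaseSet H → |v 0| ≤ K * v 2 → τ (e.symm v) < 0 := by
  have hneg := fderiv_stdVec_two_neg hA hr he.mem_atlas hτ hd
  set m := fderiv ℝ (fun v => τ (e.symm v)) 0 (stdVec 2) with hm
  have hF := ((contDiffAt_coordFun_crease hτ he.mem_atlas (s := (0, 0))
    (by rw [creaseParam_zero]; exact zero_mem_target he)).differentiableAt (by simp)).hasFDerivAt
  -- In the sector `|w| ≤ K y` the norm of `(w, y)` is at most `(K + 1) y`. With this constant the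
  -- first-order error is at most half of the main term `m y`.
  have hc : 0 < -m / (2 * (K + 1)) := div_pos (by linarith) (by linarith)
  obtain ⟨ρ, hρ, hb⟩ := Metric.eventually_nhds_iff_ball.mp (hF.isLittleO.def hc)
  refine ⟨min ρ r, lt_min hρ hr, fun v hv hcr hle => ?_⟩
  have hvr := Metric.ball_subset_ball (min_le_right ρ r) hv
  obtain ⟨w, y, hy, rfl⟩ := (hA.crease v hvr).mp hcr
  have hw : |w| ≤ K * y := hle
  have h1 : ((w, y) : ℝ × ℝ) ∈ Metric.ball (0, 0) ρ := by
    have hv' := mem_ball_zero_iff.mp hv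
    have c0 : |w| < ρ := ((abs_coord_le (creaseParam (w, y)) 0).trans_lt hv').trans_le (min_le_left _ _)
    have c2 : |y| < ρ := ((abs_coord_le (creaseParam (w, y)) 2).trans_lt hv').trans_le (min_le_left _ _)
    rw [← ball_prod_same]
    exact ⟨by rwa [mem_ball_zero_iff], by rwa [mem_ball_zero_iff]⟩
  have h2 := hb _ h1
  rw [creaseParam_zero, symm_zero he, hp, sub_zero, Prod.mk_sub_mk, sub_zero, sub_zero,
    fderiv_coordFun_crease hτ he hd, ← hm] at h2
  have h3 : ‖((w, y) : ℝ × ℝ)‖ ≤ (K + 1) * y := by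
    rw [Prod.norm_def]
    refine max_le ?_ ?_
    · rw [Real.norm_eq_abs]; nlinarith
    · rw [Real.norm_eq_abs, abs_of_pos hy]; nlinarith
  have h4 : -m / (2 * (K + 1)) * ‖((w, y) : ℝ × ℝ)‖ ≤ -m / 2 * y := by
    refine (mul_le_mul_of_nonneg_left h3 hc.le).trans_eq ?_
    field_simp
  have h5 := (abs_le.mp (h2.trans h4)).2
  simp only at h5
  nlinarith

end Caustic
end

noncomputable section
namespace Caustic

set_option linter.unusedSectionVars false

/-! ### Perestroikas -/

variable {M : Type*} [TopologicalSpace M] [ChartedSpace R4 M] [IsManifold (𝓡 4) ∞ M]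
variable {S : Spacetime M} {H : Set M} {e : OpenPartialHomeomorph M R4} {p : M} {r : ℝ} {τ : M → ℝ}

/-- A rectangular neighbourhood of the origin. -/
def box (ε η R : ℝ) : Set R4 := {v | |v 0| < ε ∧ |v 1| < R ∧ |v 2| < η ∧ |v 3| < R}

lemma isOpen_box (ε η R : ℝ) : IsOpen (box ε η R) := by
  have h : ∀ (i : Fin 4) (c : ℝ), IsOpen {v : R4 | |v i| < c} := fun i c =>
    isOpen_lt (continuous_coord i).abs continuous_const
  exact (h 0 ε).inter ((h 1 R).inter ((h 2 η).inter (h 3 R)))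

lemma box_subset_cube {ε η R : ℝ} (hε : ε ≤ R) (hη : η ≤ R) : box ε η R ⊆ cube R := by
  rintro v ⟨h0, h1, h2, h3⟩
  rw [← pt_eta v]
  exact pt_mem_cube (h0.trans_le hε) h1 (h2.trans_le hη) h3

/-- For `|y| < η ≤ R ≤ 1` the height `y²/4` is automatically less than `R`, so only `w` and `y` are
constrained. -/
lemma creaseParam_mem_box {ε η R w y : ℝ} (hR : 0 < R) (hR1 : R ≤ 1) (hη : η ≤ R) :
    creaseParam (w, y) ∈ box ε η R ↔ w ∈ Ioo (-ε) ε ∧ y ∈ Ioo (-η) η := by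
  rw [creaseParam_eq, mem_Ioo, mem_Ioo, ← abs_lt, ← abs_lt]
  constructor
  · rintro ⟨h0, -, h2, -⟩
    exact ⟨h0, h2⟩
  · rintro ⟨h0, h2⟩
    refine ⟨h0, by simpa using hR, h2, ?_⟩
    have h3 : |y| ^ 2 ≤ |y| * 1 := by
      rw [sq]; exact mul_le_mul_of_nonneg_left (by linarith) (abs_nonneg y)
    rw [pt_three, abs_of_nonneg (by positivity), ← sq_abs y]
    linarith [abs_nonneg y]

/-- `Y` solves `τ = t` on the crease, extended to negative values of `y`, in a box. -/
structure IsCreaseSolution (e : OpenPartialHomeomorph M R4) (τ : M → ℝ) (Y : ℝ → ℝ → ℝ)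
    (ε η δ : ℝ) : Prop where
  mem : ∀ t ∈ Ioo (-δ) δ, ∀ w ∈ Ioo (-ε) ε, Y t w ∈ Ioo (-η) η
  eq_iff : ∀ t ∈ Ioo (-δ) δ, ∀ w ∈ Ioo (-ε) ε, ∀ y ∈ Ioo (-η) η,
    τ (e.symm (creaseParam (w, y))) = t ↔ y = Y t w
  pos_iff : ∀ t ∈ Ioo (-δ) δ, ∀ w ∈ Ioo (-ε) ε, 0 < Y t w ↔ t < τ (e.symm (linePoint w))

namespace IsCreaseSolution

variable {Y : ℝ → ℝ → ℝ} {ε η δ R : ℝ} (hY : IsCreaseSolution e τ Y ε η δ)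
include hY

lemma eq_zero (hη : 0 < η) {t w : ℝ} (ht : t ∈ Ioo (-δ) δ) (hw : w ∈ Ioo (-ε) ε)
    (h : τ (e.symm (linePoint w)) = t) : Y t w = 0 :=
  ((hY.eq_iff t ht w hw 0 ⟨by linarith, hη⟩).mp (by rw [creaseParam_zero_right]; exact h)).symm

/-- The slice is decided by the time function on the line: the value `t` at `w` means an `A₃` point,
and a value above `t` means a crease point over `w`, at `y = Y t w > 0`. -/
lemma sliceIs (hA : A3LocalStructure S H e r) (hR : 0 < R) (hR1 : R ≤ 1) (hη : η ≤ R) (hη0 : 0 < η)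
    (hbox : box ε η R ⊆ Metric.ball 0 r) {t : ℝ} (ht : t ∈ Ioo (-δ) δ) {A C : Set ℝ}
    (hAt : ∀ w, w ∈ A ↔ w ∈ Ioo (-ε) ε ∧ τ (e.symm (linePoint w)) = t)
    (hCt : ∀ w, w ∈ C ↔ w ∈ Ioo (-ε) ε ∧ t < τ (e.symm (linePoint w))) :
    SliceIs S H e τ (box ε η R) Y t A C := by
  have hm : ∀ w y, creaseParam (w, y) ∈ box ε η R ↔ w ∈ Ioo (-ε) ε ∧ y ∈ Ioo (-η) η :=
    fun w y => creaseParam_mem_box hR hR1 hη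
  have h0η : (0 : ℝ) ∈ Ioo (-η) η := ⟨by linarith, hη0⟩
  have hl : ∀ w, linePoint w ∈ box ε η R ↔ w ∈ Ioo (-ε) ε := fun w => by
    rw [← creaseParam_zero_right, hm]; exact ⟨fun h => h.1, fun h => ⟨h, h0η⟩⟩
  constructor
  · ext v
    constructor
    · rintro ⟨hv, ha, hvt⟩
      obtain ⟨w, rfl⟩ := (hA.a3 v (hbox hv)).mp ha
      exact ⟨w, (hAt w).mpr ⟨(hl w).mp hv, hvt⟩, rfl⟩
    · rintro ⟨w, hw, rfl⟩
      obtain ⟨h1, h2⟩ := (hAt w).mp hw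
      have h3 := (hl w).mpr h1
      exact ⟨h3, (hA.a3 _ (hbox h3)).mpr ⟨w, rfl⟩, h2⟩
  · ext v
    constructor
    · rintro ⟨hv, ha, hvt⟩
      obtain ⟨w, y, hy, rfl⟩ := (hA.crease v (hbox hv)).mp ha
      obtain ⟨h1, h2⟩ := (hm w y).mp hv
      have h3 := (hY.eq_iff t ht w h1 y h2).mp hvt
      exact ⟨w, (hCt w).mpr ⟨h1, (hY.pos_iff t ht w h1).mp (h3 ▸ hy)⟩, by simp only [h3]⟩
    · rintro ⟨w, hw, rfl⟩
      obtain ⟨h1, h2⟩ := (hCt w).mp hw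
      have h3 := hY.mem t ht w h1
      have h4 := (hm w (Y t w)).mpr ⟨h1, h3⟩
      exact ⟨h4, (hA.crease _ (hbox h4)).mpr ⟨w, Y t w, (hY.pos_iff t ht w h1).mpr h2, rfl⟩,
        (hY.eq_iff t ht w h1 _ h3).mpr rfl⟩

/-- On the line `τ` has a strict minimum at `w = 0`. Below the minimal value every `w` carries
crease; above it the crease disappears over the sublevel interval between the two branches. -/
lemma a3Nucleation (hA : A3LocalStructure S H e r) (hR : 0 < R) (hR1 : R ≤ 1) (hη : η ≤ R)
    (hη0 : 0 < η) (hbox : box ε η R ⊆ Metric.ball 0 r) (hε : 0 < ε) (hδ : 0 < δ) {b : ℝ}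
    {wm wp : ℝ → ℝ} (hw : IsQuadraticWell (fun w => τ (e.symm (linePoint w))) b ε δ wm wp) :
    A3Nucleation S H e τ b (box ε η R) ε δ Y wm wp := by
  have h0ε : (0 : ℝ) ∈ Ioo (-ε) ε := ⟨by linarith, hε⟩
  have h0δ : (0 : ℝ) ∈ Ioo (-δ) δ := ⟨by linarith, hδ⟩
  have hz : τ (e.symm (linePoint 0)) = 0 := hw.zero
  have hnn : ∀ w ∈ Ioo (-ε) ε, 0 ≤ τ (e.symm (linePoint w)) := fun w hwε => by
    by_cases h : w = 0
    · rw [h, hz]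
    · exact (hw.pos w hwε h).le
  have hmδ : ∀ t ∈ Ioo (-δ) 0, t ∈ Ioo (-δ) δ := fun t ht => ⟨ht.1, ht.2.trans hδ⟩
  have hpδ : ∀ t ∈ Ioo 0 δ, t ∈ Ioo (-δ) δ := fun t ht => ⟨by linarith [ht.1], ht.2⟩
  have hpos0 : ∀ w ∈ Ioo (-ε) ε, 0 < τ (e.symm (linePoint w)) ↔ w ≠ 0 := fun w hwε =>
    ⟨fun h h0 => by rw [h0, hz] at h; exact lt_irrefl _ h, hw.pos w hwε⟩
  refine ⟨fun t ht => ⟨fun w hwε => ?_, ?_⟩, ⟨fun w hwε h => ?_, ?_, ?_⟩, fun t ht => ?_,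
    ⟨hw.anti, hw.mono⟩, hw.rate_left, hw.rate_right⟩
  · exact (hY.pos_iff t (hmδ t ht) w hwε).mpr (ht.2.trans_le (hnn w hwε))
  · refine hY.sliceIs hA hR hR1 hη hη0 hbox (hmδ t ht) (fun w => ?_) fun w => ?_
    · refine ⟨fun h => h.elim, fun h => ?_⟩
      linarith [hnn w h.1, h.2, ht.2]
    · exact ⟨fun h => ⟨h, ht.2.trans_le (hnn w h)⟩, fun h => h.1⟩
  · exact (hY.pos_iff 0 h0δ w hwε).mpr (hw.pos w hwε h)
  · exact hY.eq_zero hη0 h0δ h0ε hz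
  · refine hY.sliceIs hA hR hR1 hη hη0 hbox h0δ (fun w => ?_) fun w => ?_
    · constructor
      · rintro rfl; exact ⟨h0ε, hz⟩
      · rintro ⟨h1, h2⟩
        by_contra h
        exact (hw.pos w h1 h).ne' h2
    · constructor
      · rintro (h | h)
        · have h' : w ∈ Ioo (-ε) ε := ⟨h.1, h.2.trans hε⟩
          exact ⟨h', (hpos0 w h').mpr h.2.ne⟩
        · have h' : w ∈ Ioo (-ε) ε := ⟨by linarith [h.1], h.2⟩
          exact ⟨h', (hpos0 w h').mpr h.1.ne'⟩
      · rintro ⟨h1, h2⟩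
        rcases lt_or_gt_of_ne ((hpos0 w h1).mp h2) with h | h
        · exact Or.inl ⟨h1.1, h⟩
        · exact Or.inr ⟨h, h1.2⟩
  · obtain ⟨h1, h2⟩ := hw.mem t ht
    have h1' : wm t ∈ Ioo (-ε) ε := ⟨h1.1, h1.2.trans hε⟩
    have h2' : wp t ∈ Ioo (-ε) ε := ⟨by linarith [h2.1], h2.2⟩
    have e1 := (hw.eq_iff t ht _ h1').mpr (Or.inl rfl)
    have e2 := (hw.eq_iff t ht _ h2').mpr (Or.inr rfl)
    have hC : ∀ w, w ∈ Ioo (-ε) (wm t) ∪ Ioo (wp t) ε ↔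
        w ∈ Ioo (-ε) ε ∧ t < τ (e.symm (linePoint w)) := by
      intro w
      constructor
      · intro h
        have h' : w ∈ Ioo (-ε) ε := by
          rcases h with h | h
          · exact ⟨h.1, h.2.trans h1'.2⟩
          · exact ⟨h2'.1.trans h.1, h.2⟩
        refine ⟨h', lt_of_le_of_ne (not_lt.mp fun hlt => ?_) fun heq => ?_⟩
        · have h3 := (hw.lt_iff t ht w h').mp hlt
          rcases h with h | h
          · exact lt_asymm h.2 h3.1
          · exact lt_asymm h.1 h3.2
        · rcases (hw.eq_iff t ht w h').mp heq.symm with h3 | h3 <;> rcases h with h | h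
          · exact h.2.ne h3
          · linarith [h.1, h1.2, h2.1]
          · linarith [h.2, h1.2, h2.1]
          · exact h.1.ne' h3
      · rintro ⟨h', hlt⟩
        by_contra h
        simp only [mem_union, mem_Ioo, not_or, not_and, not_lt] at h
        have h3 := h.1 h'.1
        have h4 : w ≤ wp t := not_lt.mp fun h5 => (h.2 h5).not_gt h'.2
        rcases h3.eq_or_lt with h5 | h5
        · rw [← h5] at hlt; exact hlt.ne e1.symm
        rcases h4.eq_or_lt with h6 | h6
        · rw [h6] at hlt; exact hlt.ne e2.symm
        exact lt_asymm hlt ((hw.lt_iff t ht w h').mpr ⟨h5, h6⟩)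
    refine ⟨h1, h2, fun w hwC => ?_, hY.eq_zero hη0 (hpδ t ht) h1' e1,
      hY.eq_zero hη0 (hpδ t ht) h2' e2,
      hY.sliceIs hA hR hR1 hη hη0 hbox (hpδ t ht) (fun w => ?_) hC⟩
    · obtain ⟨h3, h4⟩ := (hC w).mp hwC
      exact (hY.pos_iff t (hpδ t ht) w h3).mpr h4
    · constructor
      · rintro (rfl | rfl)
        exacts [⟨h1', e1⟩, ⟨h2', e2⟩]
      · rintro ⟨h3, h4⟩
        exact (hw.eq_iff t ht w h3).mp h4

/-- Here `-τ` has the well, and the crease at time `t` lies over its sublevel interval at the level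
`-t`. This interval shrinks to `0`, and continuity of `Y` makes the crease shrink to the point. -/
lemma creaseShrinks (hA : A3LocalStructure S H e r) (hR : 0 < R) (hR1 : R ≤ 1) (hη : η ≤ R)
    (hη0 : 0 < η) (hbox : box ε η R ⊆ Metric.ball 0 r) (hε : 0 < ε) (hδ : 0 < δ) {b : ℝ}
    (hc : ContinuousAt (fun s : ℝ × ℝ => Y s.1 s.2) (0, 0)) {wm wp : ℝ → ℝ}
    (hw : IsQuadraticWell (fun w => -τ (e.symm (linePoint w))) (-b) ε δ wm wp) :
    CreaseShrinks S H e τ b (box ε η R) ε δ Y (fun t => wm (-t)) (fun t => wp (-t)) := by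
  have h0ε : (0 : ℝ) ∈ Ioo (-ε) ε := ⟨by linarith, hε⟩
  have h0δ : (0 : ℝ) ∈ Ioo (-δ) δ := ⟨by linarith, hδ⟩
  have hz : τ (e.symm (linePoint 0)) = 0 := neg_eq_zero.mp hw.zero
  have hneg : ∀ w ∈ Ioo (-ε) ε, w ≠ 0 → τ (e.symm (linePoint w)) < 0 := fun w hwε h =>
    neg_pos.mp (hw.pos w hwε h)
  have hnn : ∀ w ∈ Ioo (-ε) ε, τ (e.symm (linePoint w)) ≤ 0 := fun w hwε => by
    by_cases h : w = 0
    · rw [h, hz]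
    · exact (hneg w hwε h).le
  have hmδ : ∀ t ∈ Ioo (-δ) 0, t ∈ Ioo (-δ) δ := fun t ht => ⟨ht.1, ht.2.trans hδ⟩
  have hpδ : ∀ t ∈ Ioo 0 δ, t ∈ Ioo (-δ) δ := fun t ht => ⟨by linarith [ht.1], ht.2⟩
  have hnt : ∀ t ∈ Ioo (-δ) 0, -t ∈ Ioo 0 δ := fun t ht => ⟨by linarith [ht.2], by linarith [ht.1]⟩
  have heq : ∀ t ∈ Ioo (-δ) 0, ∀ w ∈ Ioo (-ε) ε,
      τ (e.symm (linePoint w)) = t ↔ w = wm (-t) ∨ w = wp (-t) := fun t ht w hwε => by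
    rw [← hw.eq_iff _ (hnt t ht) w hwε, neg_inj]
  have hlt : ∀ t ∈ Ioo (-δ) 0, ∀ w ∈ Ioo (-ε) ε,
      t < τ (e.symm (linePoint w)) ↔ w ∈ Ioo (wm (-t)) (wp (-t)) := fun t ht w hwε => by
    rw [← hw.lt_iff _ (hnt t ht) w hwε, neg_lt_neg_iff]
  have hntend : Tendsto (fun t : ℝ => -t) (𝓝[<] 0) (𝓝[>] 0) := by
    have := tendsto_neg_nhdsLT (a := (0 : ℝ))
    rwa [neg_zero] at this
  have hC : ∀ t ∈ Ioo (-δ) 0, ∀ w, w ∈ Ioo (wm (-t)) (wp (-t)) ↔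
      w ∈ Ioo (-ε) ε ∧ t < τ (e.symm (linePoint w)) := fun t ht w => by
    obtain ⟨h1, h2⟩ := hw.mem _ (hnt t ht)
    constructor
    · intro h
      have h' : w ∈ Ioo (-ε) ε := ⟨h1.1.trans h.1, h.2.trans h2.2⟩
      exact ⟨h', (hlt t ht w h').mpr h⟩
    · rintro ⟨h', h⟩
      exact (hlt t ht w h').mp h
  have hslice : ∀ t ∈ Ioo (-δ) 0, SliceIs S H e τ (box ε η R) Y t {wm (-t), wp (-t)}
      (Ioo (wm (-t)) (wp (-t))) := fun t ht => by
    obtain ⟨h1, h2⟩ := hw.mem _ (hnt t ht)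
    have h1' : wm (-t) ∈ Ioo (-ε) ε := ⟨h1.1, h1.2.trans hε⟩
    have h2' : wp (-t) ∈ Ioo (-ε) ε := ⟨by linarith [h2.1], h2.2⟩
    refine hY.sliceIs hA hR hR1 hη hη0 hbox (hmδ t ht) (fun w => ?_) (hC t ht)
    constructor
    · rintro (rfl | rfl)
      exacts [⟨h1', (heq t ht _ h1').mpr (Or.inl rfl)⟩, ⟨h2', (heq t ht _ h2').mpr (Or.inr rfl)⟩]
    · rintro ⟨h3, h4⟩
      exact (heq t ht w h3).mp h4
  refine ⟨fun t ht => ?_, ?_, fun t ht => ?_, ⟨fun t ht t' ht' h => ?_, fun t ht t' ht' h => ?_⟩,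
    fun V hV => ?_, hw.rate_left.comp hntend, hw.rate_right.comp hntend⟩
  · obtain ⟨h1, h2⟩ := hw.mem _ (hnt t ht)
    have h1' : wm (-t) ∈ Ioo (-ε) ε := ⟨h1.1, h1.2.trans hε⟩
    have h2' : wp (-t) ∈ Ioo (-ε) ε := ⟨by linarith [h2.1], h2.2⟩
    refine ⟨h1, h2, fun w hwC => ?_,
      hY.eq_zero hη0 (hmδ t ht) h1' ((heq t ht _ h1').mpr (Or.inl rfl)),
      hY.eq_zero hη0 (hmδ t ht) h2' ((heq t ht _ h2').mpr (Or.inr rfl)), hslice t ht⟩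
    obtain ⟨h3, h4⟩ := (hC t ht w).mp hwC
    exact (hY.pos_iff t (hmδ t ht) w h3).mpr h4
  · refine hY.sliceIs hA hR hR1 hη hη0 hbox h0δ (fun w => ?_) fun w => ?_
    · constructor
      · rintro rfl; exact ⟨h0ε, hz⟩
      · rintro ⟨h1, h2⟩
        by_contra h
        exact (hneg w h1 h).ne h2
    · exact ⟨fun h => h.elim, fun h => absurd h.2 (hnn w h.1).not_gt⟩
  · refine hY.sliceIs hA hR hR1 hη hη0 hbox (hpδ t ht) (fun w => ?_) fun w => ?_
    · refine ⟨fun h => h.elim, fun h => ?_⟩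
      linarith [hnn w h.1, h.2, ht.1]
    · exact ⟨fun h => h.elim, fun h => absurd (ht.1.trans h.2) (hnn w h.1).not_gt⟩
  · exact hw.anti (hnt t' ht') (hnt t ht) (neg_lt_neg h)
  · exact hw.mono (hnt t' ht') (hnt t ht) (neg_lt_neg h)
  · have hY0 : Y 0 0 = 0 := hY.eq_zero hη0 h0δ h0ε hz
    have hcw : ContinuousAt (fun s : ℝ × ℝ => creaseParam (s.2, Y s.1 s.2)) (0, 0) :=
      ContinuousAt.comp (g := creaseParam) contDiff_creaseParam.continuous.continuousAt
        (continuousAt_snd.prodMk hc)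
    have hev : ∀ᶠ s : ℝ × ℝ in 𝓝 (0, 0), creaseParam (s.2, Y s.1 s.2) ∈ V :=
      hcw.eventually_mem (by simp only [hY0, creaseParam_zero]; exact hV)
    obtain ⟨κ, hκ, hball⟩ := Metric.eventually_nhds_iff_ball.mp hev
    filter_upwards [(hw.tendsto_left.comp hntend).eventually (lt_mem_nhds (neg_lt_zero.mpr hκ)),
      (hw.tendsto_right.comp hntend).eventually (gt_mem_nhds hκ),
      Ioo_mem_nhdsLT (neg_lt_zero.mpr (lt_min hκ hδ))] with t h1 h2 h3
    have ht : t ∈ Ioo (-δ) 0 := ⟨by linarith [h3.1, min_le_right κ δ], h3.2⟩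
    rw [(hslice t ht).2]
    rintro v ⟨w, hwC, rfl⟩
    refine hball (t, w) ?_
    rw [← ball_prod_same, Real.ball_eq_Ioo, zero_sub, zero_add]
    simp only [Function.comp] at h1 h2
    exact ⟨⟨by linarith [h3.1, min_le_left κ δ], by linarith [h3.2]⟩,
      ⟨h1.trans hwC.1, hwC.2.trans h2⟩⟩

end IsCreaseSolution

lemma exists_pos_of_eventually {P : ℝ → Prop} (h : ∀ᶠ x in 𝓝[>] (0 : ℝ), P x) {R : ℝ} (hR : 0 < R) :
    ∃ x > 0, x < R ∧ P x := by
  obtain ⟨x, hx, hP⟩ := (Filter.Eventually.and (Ioo_mem_nhdsGT hR) h).exists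
  exact ⟨x, hx.1, hx.2, hP⟩

/-- The two types of perestroika. -/
theorem perestroikaDichotomy (hA : A3LocalStructure S H e r) (hr : 0 < r) (he : S.IsA3Chart H p e)
    (hτ : S.IsTimeFunction τ) (hp : τ p = 0)
    (hd : deriv (fun w => τ (e.symm (linePoint w))) 0 = 0) {b : ℝ}
    (hb : b = iteratedDeriv 2 (fun w => τ (e.symm (linePoint w))) 0 / 2) (hb0 : b ≠ 0) :
    PerestroikaDichotomy S H e τ b := by
  intro ρ hρ
  set h : ℝ → ℝ := fun w => τ (e.symm (linePoint w)) with hh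
  have h0t := zero_mem_target he
  have hcont : Tendsto creaseParam (𝓝 (0, 0)) (𝓝 0) := by
    have := contDiff_creaseParam.continuous.tendsto (0, 0)
    rwa [creaseParam_zero] at this
  have hF : ∀ᶠ s in 𝓝 ((0 : ℝ), (0 : ℝ)), ContDiffAt ℝ ∞ (fun s => τ (e.symm (creaseParam s))) s :=
    (hcont.eventually (e.open_target.mem_nhds h0t)).mono fun s hs =>
      contDiffAt_coordFun_crease hτ he.mem_atlas hs
  have hF0 : τ (e.symm (creaseParam (0, 0))) = 0 := by rw [creaseParam_zero, symm_zero he, hp]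
  have hFy : fderiv ℝ (fun s => τ (e.symm (creaseParam s))) (0, 0) (0, 1) < 0 := by
    rw [fderiv_coordFun_crease hτ he hd, one_mul]
    exact fderiv_stdVec_two_neg hA hr he.mem_atlas hτ hd
  have hh2 : ContDiffAt ℝ 2 h 0 := by
    have h1 : ContDiffAt ℝ ∞ (fun w : ℝ => τ (e.symm (creaseParam (w, 0)))) 0 :=
      ContDiffAt.comp (0 : ℝ) (g := fun s => τ (e.symm (creaseParam s))) (f := fun w : ℝ => (w, (0 : ℝ)))
        hF.self_of_nhds (contDiffAt_id.prodMk contDiffAt_const)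
    simp only [creaseParam_zero_right] at h1
    exact h1.of_le ENat.LEInfty.out
  have hhz : h 0 = 0 := by rw [creaseParam_zero_right] at hF0; exact hF0
  have hdd : deriv (deriv h) 0 = 2 * b := by
    rw [iteratedDeriv_succ, iteratedDeriv_one] at hb
    rw [hb]; ring
  obtain ⟨Y, hY⟩ := exists_implicit hF hF0 hFy
  -- Order of the choices: `R` fits the box into both balls; `η < R` bounds `y`; `κ` bounds `t` and
  -- `w` so that `Y` stays in `(-η, η)`; finally `ε` is taken below `R` and `κ`, and `δ` below `κ`
  -- and the depth of the well.
  set R : ℝ := min (min ρ r) 1 / 2 with hRdef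
  have hR : 0 < R := by positivity
  have hR1 : R ≤ 1 := by linarith [min_le_right (min ρ r) 1]
  have hRρ : 2 * R ≤ ρ := by
    have := (min_le_left (min ρ r) 1).trans (min_le_left ρ r); linarith
  have hRr : 2 * R ≤ r := by
    have := (min_le_left (min ρ r) 1).trans (min_le_right ρ r); linarith
  obtain ⟨η, hη0, hηR, hη⟩ := exists_pos_of_eventually hY hR
  obtain ⟨κ, hκ0, -, hYd, hκ⟩ := exists_pos_of_eventually hη one_pos
  have hsol : ∀ ε ≤ κ, ∀ δ ≤ κ, IsCreaseSolution e τ Y ε η δ := by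
    intro ε hε δ hδ
    have hi : ∀ c ≤ κ, Ioo (-c) c ⊆ Ioo (-κ) κ := fun c hc => Ioo_subset_Ioo (neg_le_neg hc) hc
    refine ⟨fun t ht w hw => (hκ t (hi δ hδ ht) w (hi ε hε hw)).1,
      fun t ht w hw => (hκ t (hi δ hδ ht) w (hi ε hε hw)).2.1, fun t ht w hw => ?_⟩
    rw [← creaseParam_zero_right]
    exact (hκ t (hi δ hδ ht) w (hi ε hε hw)).2.2
  have hYc : ContinuousAt (fun s : ℝ × ℝ => Y s.1 s.2) (0, 0) :=
    hYd.continuousOn.continuousAt (prod_mem_nhds (Ioo_mem_nhds (by linarith) hκ0)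
      (Ioo_mem_nhds (by linarith) hκ0))
  have hfin : ∀ {ε : ℝ}, 0 < ε → ε ≤ R → IsOpen (box ε η R) ∧ (0 : R4) ∈ box ε η R ∧
      box ε η R ⊆ e.target ∩ Metric.ball 0 ρ ∧ box ε η R ⊆ Metric.ball 0 r := by
    intro ε hε hεR
    have hsub := (box_subset_cube hεR hηR.le).trans (cube_subset_ball hR)
    have hsubr := hsub.trans (Metric.ball_subset_ball hRr)
    refine ⟨isOpen_box _ _ _, ?_, fun v hv => ⟨hA.ball_subset (hsubr hv),
      Metric.ball_subset_ball hRρ (hsub hv)⟩, hsubr⟩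
    rw [← creaseParam_zero, creaseParam_mem_box hR hR1 hηR.le]
    exact ⟨⟨by linarith, hε⟩, ⟨by linarith, hη0⟩⟩
  have hYd' : ∀ {ε δ : ℝ}, ε ≤ κ → δ ≤ κ →
      ContDiffOn ℝ ∞ (fun s : ℝ × ℝ => Y s.1 s.2) (Ioo (-δ) δ ×ˢ Ioo (-ε) ε) := fun hε hδ =>
    hYd.mono (prod_mono (Ioo_subset_Ioo (neg_le_neg hδ) hδ) (Ioo_subset_Ioo (neg_le_neg hε) hε))
  rcases lt_or_gt_of_ne hb0 with hneg | hpos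
  · have hdn : deriv (fun w => -h w) = fun w => -deriv h w := by funext w; exact deriv.fun_neg
    obtain ⟨ε, hε0, hεlt, δ', hδ', wm, wp, hw⟩ := exists_pos_of_eventually
      (exists_isQuadraticWell (g := fun w => -h w) (b := -b) hh2.neg (by simp [hhz])
        (by rw [hdn]; simp [hd]) (by rw [hdn, deriv.fun_neg, hdd]; ring) (by linarith))
      (lt_min hR hκ0)
    have hεR := hεlt.le.trans (min_le_left _ _)
    have hεκ := hεlt.le.trans (min_le_right _ _)
    obtain ⟨h1, h2, h3, h4⟩ := hfin hε0 hεR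
    have hδκ : min κ δ' ≤ κ := min_le_left _ _
    exact ⟨_, h1, h2, h3, ε, min κ δ', Y, _, _, hε0, lt_min hκ0 hδ', hYd' hεκ hδκ,
      Or.inl ⟨hneg, (hsol ε hεκ _ hδκ).creaseShrinks hA hR hR1 hηR.le hη0 h4 hε0 (lt_min hκ0 hδ')
        hYc (hw.restrict (min_le_right _ _))⟩⟩
  · obtain ⟨ε, hε0, hεlt, δ', hδ', wm, wp, hw⟩ := exists_pos_of_eventually
      (exists_isQuadraticWell hh2 hhz hd hdd hpos) (lt_min hR hκ0)
    have hεR := hεlt.le.trans (min_le_left _ _)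
    have hεκ := hεlt.le.trans (min_le_right _ _)
    obtain ⟨h1, h2, h3, h4⟩ := hfin hε0 hεR
    have hδκ : min κ δ' ≤ κ := min_le_left _ _
    exact ⟨_, h1, h2, h3, ε, min κ δ', Y, _, _, hε0, lt_min hκ0 hδ', hYd' hεκ hδκ,
      Or.inr ⟨hpos, (hsol ε hεκ _ hδκ).a3Nucleation hA hR hR1 hηR.le hη0 h4 hε0 (lt_min hκ0 hδ')
        (hw.restrict (min_le_right _ _))⟩⟩

end Caustic
end

/-! ### The main theorem -/

theorem mainTheorem6 {M : Type*} [TopologicalSpace M] [T2Space M] [SecondCountableTopology M]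
    [ChartedSpace R4 M] [IsManifold (𝓡 4) ∞ M] (S : Spacetime M) (H : Set M)
    (hH : S.IsFutureHorizon H) (p : M) (e : OpenPartialHomeomorph M R4)
    (he : S.IsA3Chart H p e) :
    (∃ r > 0, A3LocalStructure S H e r) ∧
    (∀ τ : M → ℝ, S.IsTimeFunction τ → τ p = 0 →
      -- the surface `τ = 0` is transverse to the `A₃` line
      (deriv (fun w => τ (e.symm (linePoint w))) 0 ≠ 0 →
        ∃ e' : OpenPartialHomeomorph M R4, S.IsA3Chart H p e' ∧
          ∀ v ∈ e'.target, τ (e'.symm v) = v 0) ∧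
      -- the surface `τ = 0` is tangent to the `A₃` line
      (deriv (fun w => τ (e.symm (linePoint w))) 0 = 0 →
        fderiv ℝ (fun v => τ (e.symm v)) 0 (stdVec 2) < 0 ∧
        (∀ K > 0, ∃ ρ > 0, ∀ v ∈ Metric.ball (0 : R4) ρ,
          e.symm v ∈ S.creaseSet H → |v 0| ≤ K * v 2 → τ (e.symm v) < 0) ∧
        ∀ b : ℝ, b = iteratedDeriv 2 (fun w => τ (e.symm (linePoint w))) 0 / 2 → b ≠ 0 →
          PerestroikaDichotomy S H e τ b)) := by
  obtain ⟨r, hr, hG⟩ := exists_orientedGraph hH he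
  have hA := hG.a3LocalStructure he
  exact ⟨⟨r, hr, hA⟩, fun τ hτ hp => ⟨exists_adapted_chart he hτ hp, fun hd =>
    ⟨fderiv_stdVec_two_neg hA hr he.mem_atlas hτ hd, fun K hK => neg_on_crease hA hr he hτ hp hd hK,
      fun b hb hb0 => perestroikaDichotomy hA hr he hτ hp hd hb hb0⟩⟩⟩
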